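/- Let $\mathfrak g$ be a finite-dimensional simple complex Lie algebra of rank $r$ with Chevalley generators $e_i,f_i,\check\alpha_i$, simple roots $\alpha_i$ numbered by $i=1,\dots,r$ in an arbitrary order, and Cartan matrix $a_{ij}=\langle\alpha_j,\check\alpha_i\rangle$. Let $G$ be the simply connected group with Lie algebra $\mathfrak g$, $H$ its maximal torus, $N_\pm$ and $B_\pm=HN_\pm$ the unipotent and Borel subgroups defined by the $e_i$ (for $+$) and the $f_i$ (for $-$), $s_i=e^{e_i}e^{-f_i}e^{e_i}$ the lifts of the simple reflections, and $c=s_1\cdots s_r$. Products $\prod_i$ of group elements are taken in the order $i=1,\dots,r$. For an algebraic group $K$ write $K(u)=K(\mathbb C(u))$. Let $\hbar\in\mathbb C^\times$ be not a root of unity, let $\Lambda_1,\dots,\Lambda_r\in\mathbb C[u]$ be nonzero, and let $Z=\prod_i\zeta_i^{\check\alpha_i}\in H$, $\zeta_i\in\mathbb C^\times$, be such that $\alpha(Z)\notin\hbar^{\mathbb Z}$ for every root $\alpha$ of $\mathfrak g$. A Miura $(G,\hbar)$-oper on $\mathbb P^1$ is a $G$-bundle with a meromorphic $\hbar$-connection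 and generically defined reductions to $B_-$ and $B_+$. In a trivialization over an open dense subset it is given by $A(u)\in G(u)$ and cosets $a(u)B_-(u)$, $b(u)B_+(u)$ such that $a(\hbar u)^{-1}A(u)a(u)\in B_-(u)\,c\,B_-(u)$ and $b(\hbar u)^{-1}A(u)b(u)\in B_+(u)$. Such opers are considered up to change of trivialization $g(u)\in G(u)$, which sends $A(u)$ to $g(\hbar u)A(u)g(u)^{-1}$ and $a,b$ to $ga,gb$. The oper has regular singularities determined by $\{\Lambda_i\}$ if the representative $a$ of its coset can be chosen with $a(\hbar u)^{-1}A(u)a(u)\in N_-(u)\prod_i(\Lambda_i(u)^{\check\alpha_i}s_i)N_-(u)$. It is $Z$-twisted if the representative $b$ of its coset can be chosen with $A(u)=b(\hbar u)Zb(u)^{-1}$. Two polynomials have $\hbar$-distinct roots if no root of the first and root of the second lie in the same orbit of multiplication by $\hbar^{\mathbb Z}$. Consider a $Z$-twisted Miura $(G,\hbar)$-oper with regular singularities determined by $\{\Lambda_i\}$, in a trivialization in which its reductions are $B_-(u)$, $B_+(u)$ and $$A(u)=\prod_i g_i(u)^{\check\alpha_i}e^{\frac{\Lambda_i(u)}{g_i(u)}e_i}=v(\hbar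 u)Zv(u)^{-1},\qquad v(u)\in\prod_i P_i(u)^{\check\alpha_i}\prod_i e^{-\frac{Q^i_-(u)}{Q^i_+(u)}e_i}\,[N_+(u),N_+(u)],$$ where $g_i\in\mathbb C(u)^\times$, and $Q^i_+$, $Q^i_-$ are relatively prime polynomials with $Q^i_+$ monic. The oper is called nondegenerate if $v$ can be chosen so that the $P_i$ are polynomials, $P_i$ and $P_j$ have $\hbar$-distinct roots whenever $i\ne j$ and $a_{ij}\neq0$, and $P_i=Q^i_+$ for all $i$. The $QQ$-system is the system of equations $$\widetilde\xi_iQ^i_-(u)Q^i_+(\hbar u)-\xi_iQ^i_-(\hbar u)Q^i_+(u)=\Lambda_i(u)\prod_{j>i}Q^j_+(\hbar u)^{-a_{ji}}\prod_{j<i}Q^j_+(u)^{-a_{ji}},\qquad i=1,\dots,r,$$ with $\widetilde\xi_i=\zeta_i\prod_{j>i}\zeta_j^{a_{ji}}$ and $\xi_i=\zeta_i^{-1}\prod_{j<i}\zeta_j^{-a_{ji}}$. A polynomial solution $\{Q^i_+,Q^i_-\}$ is called nondegenerate if, for all $i$, $Q^i_+$ is monic and relatively prime to $Q^i_-$, and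 $Q^i_+$, $Q^j_+$ have $\hbar$-distinct roots whenever $i\neq j$ and $a_{ij}\ne0$. Theorem. (1) There is a bijection between the set of nondegenerate polynomial solutions of the $QQ$-system and the set of (isomorphism classes of) nondegenerate $Z$-twisted Miura $(G,\hbar)$-opers on $\mathbb P^1$ with regular singularities determined by $\{\Lambda_i\}$. It sends $\{Q^i_\pm\}$ to the class of the oper with reductions $B_-(u)$, $B_+(u)$ and connection $A(u)=\prod_i g_i(u)^{\check\alpha_i}e^{\frac{\Lambda_i(u)}{g_i(u)}e_i}$, $g_i(u)=\zeta_i\frac{Q^i_+(\hbar u)}{Q^i_+(u)}$, and this connection equals $v(\hbar u)Zv(u)^{-1}$ for some $v(u)\in\prod_iQ^i_+(u)^{\check\alpha_i}\prod_ie^{-\frac{Q^i_-(u)}{Q^i_+(u)}e_i}[N_+(u),N_+(u)]$. (2) The condition $P_i=Q^i_+$ in the definition of nondegeneracy is automatic for generic roots: let a $Z$-twisted Miura $(G,\hbar)$-oper with regular singularities determined by $\{\Lambda_i\}$ have, in a trivialization as above, $A(u)=v(\hbar u)Zv(u)^{-1}$ with $v$ of the form above and nonzero polynomials $P_i$ such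 that $P_i$, $P_j$ have $\hbar$-distinct roots whenever $i\ne j$ and $a_{ij}\neq0$. If, for every $i$, the roots of $P_i$ are nonzero, simple, in pairwise distinct $\hbar^{\mathbb Z}$-orbits, and $\hbar$-distinct from the roots of $\Lambda_i$, then the oper is nondegenerate. -/

import Mathlib

open Polynomial

noncomputable section

namespace HOper

/-! ### Chevalley generators and fundamental representations -/

/-- A system of Chevalley generators `e i, f i, h i` (`h i` is the simple coroot) of a Lie algebra,
with Cartan matrix `cartan i j = ⟨α_j, α̌_i⟩`, so that `⁅h i, e j⁆ = cartan i j • e j`. The numbering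
of the simple roots by `Fin r` is arbitrary; its order is the order of the simple reflections in
the Coxeter element `c = w_1 ⋯ w_r`. -/
structure ChevalleySystem (r : ℕ) (𝔤 : Type*) [LieRing 𝔤] [LieAlgebra ℂ 𝔤] where
  e : Fin r → 𝔤
  f : Fin r → 𝔤
  h : Fin r → 𝔤
  cartan : Matrix (Fin r) (Fin r) ℤ
  cartan_diag : ∀ i, cartan i i = 2
  cartan_offDiag : ∀ i j, i ≠ j → cartan i j ≤ 0
  lie_h_h : ∀ i j, ⁅h i, h j⁆ = 0
  lie_h_e : ∀ i j, ⁅h i, e j⁆ = (cartan i j : ℂ) • e j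
  lie_h_f : ∀ i j, ⁅h i, f j⁆ = -(cartan i j : ℂ) • f j
  lie_e_f : ∀ i j, ⁅e i, f j⁆ = if i = j then h i else 0
  linearIndependent_h : LinearIndependent ℂ h
  generates : LieSubalgebra.lieSpan ℂ 𝔤 (Set.range e ∪ Set.range f) = ⊤

/-- The fundamental representations `V_1, …, V_r`, written in matrices: `V_i` is an irreducible
finite-dimensional representation with a highest weight vector `ν i` of weight `ω_i`. -/
structure FundamentalReps {r : ℕ} {𝔤 : Type*} [LieRing 𝔤] [LieAlgebra ℂ 𝔤]
    (S : ChevalleySystem r 𝔤) where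
  dim : Fin r → ℕ
  ρ : ∀ i, 𝔤 →ₗ[ℂ] Matrix (Fin (dim i)) (Fin (dim i)) ℂ
  ρ_lie : ∀ i x y, ρ i ⁅x, y⁆ = ρ i x * ρ i y - ρ i y * ρ i x
  ν : ∀ i, Fin (dim i) → ℂ
  ν_ne_zero : ∀ i, ν i ≠ 0
  e_ν : ∀ i j, (ρ i (S.e j)).mulVec (ν i) = 0
  h_ν : ∀ i j, (ρ i (S.h j)).mulVec (ν i) = if i = j then ν i else 0
  irreducible : ∀ i, ∀ W : Submodule ℂ (Fin (dim i) → ℂ),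
    (∀ x : 𝔤, ∀ w ∈ W, (ρ i x).mulVec w ∈ W) → W = ⊥ ∨ W = ⊤

/-- In characteristic zero, `[H, E] = c E` with `c ≠ 0` forces the matrix `E` to be nilpotent. -/
theorem isNilpotent_of_lie_eq_smul {n : ℕ} (H E : Matrix (Fin n) (Fin n) ℂ) (c : ℂ) (hc : c ≠ 0)
    (hE : H * E - E * H = c • E) : IsNilpotent E := by
  by_contra hnil
  have hpow : ∀ k : ℕ, E ^ k ≠ 0 := fun k hk => hnil ⟨k, hk⟩
  have hlie : ∀ k : ℕ, H * E ^ k - E ^ k * H = ((k : ℂ) * c) • E ^ k := by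
    intro k
    induction k with
    | zero => simp
    | succ k ih =>
      have : H * E ^ (k + 1) - E ^ (k + 1) * H
          = (H * E ^ k - E ^ k * H) * E + E ^ k * (H * E - E * H) := by
        rw [pow_succ]; noncomm_ring
      rw [this, ih, hE, smul_mul_assoc, mul_smul_comm, ← pow_succ, ← add_smul]
      congr 1
      push_cast
      ring
  let T : Module.End ℂ (Matrix (Fin n) (Fin n) ℂ) := LinearMap.mulLeft ℂ H - LinearMap.mulRight ℂ H
  have hev : ∀ k : ℕ, T.HasEigenvalue ((k : ℂ) * c) := fun k =>
    Module.End.hasEigenvalue_of_hasEigenvector (x := E ^ k)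
      ⟨Module.End.mem_eigenspace_iff.mpr (by simpa [T] using hlie k), hpow k⟩
  have hfin : Set.Finite {μ | T.HasEigenvalue μ} := Module.End.finite_hasEigenvalue T
  have hinj : Function.Injective (fun k : ℕ => (k : ℂ) * c) := by
    intro a b hab
    exact Nat.cast_injective (mul_right_cancel₀ hc hab)
  exact Set.infinite_range_of_injective hinj (hfin.subset (by rintro _ ⟨k, rfl⟩; exact hev k))

/-- The field `ℂ(u)` of rational functions on the projective line. -/
abbrev K : Type := RatFunc ℂ

/-- The automorphism `p(u) ↦ p(ħ u)` of `ℂ[u]`. -/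
def polyShift (ħ : ℂˣ) : ℂ[X] →+* ℂ[X] := Polynomial.compRingHom (C (ħ : ℂ) * X)

theorem polyShift_injective (ħ : ℂˣ) : Function.Injective (polyShift ħ) := by
  refine (injective_iff_map_eq_zero _).mpr fun p hp => ?_
  exact (comp_C_mul_X_eq_zero_iff (mem_nonZeroDivisors_of_ne_zero ħ.ne_zero)).mp hp

/-- The automorphism `a(u) ↦ a(ħ u)` of `ℂ(u)`. -/
def shift (ħ : ℂˣ) : K →+* K :=
  RatFunc.mapRingHom (polyShift ħ) (by
    intro p hp
    rw [Submonoid.mem_comap, mem_nonZeroDivisors_iff_ne_zero]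
    exact (map_ne_zero_iff _ (polyShift_injective ħ)).mpr (nonZeroDivisors.ne_zero hp))

/-- `exp (t E)` as an invertible matrix over `ℂ(u)`, for a nilpotent complex matrix `E`. -/
def expGL {n : ℕ} (E : Matrix (Fin n) (Fin n) ℂ) (hE : IsNilpotent E) (t : K) :
    Matrix.GeneralLinearGroup (Fin n) K where
  val := IsNilpotent.exp (t • E.map (algebraMap ℂ K))
  inv := IsNilpotent.exp (-(t • E.map (algebraMap ℂ K)))
  val_inv := IsNilpotent.exp_mul_exp_neg_self
    ((hE.map (algebraMap ℂ K).mapMatrix).smul t)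
  inv_val := IsNilpotent.exp_neg_mul_exp_self
    ((hE.map (algebraMap ℂ K).mapMatrix).smul t)

theorem shift_algebraMap (ħ : ℂˣ) (c : ℂ) : shift ħ (algebraMap ℂ K c) = algebraMap ℂ K c := by
  have h : algebraMap ℂ K c = algebraMap ℂ[X] K (C c) := by
    rw [IsScalarTower.algebraMap_apply ℂ ℂ[X] K]; rfl
  rw [h, shift, RatFunc.coe_mapRingHom_eq_coe_map, RatFunc.map_apply]
  simp [polyShift]

theorem map_shift_expGL (ħ : ℂˣ) {n : ℕ} (E : Matrix (Fin n) (Fin n) ℂ) (hE : IsNilpotent E)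
    (t : K) :
    Matrix.GeneralLinearGroup.map (shift ħ) (expGL E hE t) = expGL E hE (shift ħ t) := by
  apply Units.ext
  change (shift ħ).mapMatrix (IsNilpotent.exp (t • E.map (algebraMap ℂ K))) = _
  have hn : IsNilpotent (t • E.map (algebraMap ℂ K)) :=
    (hE.map (algebraMap ℂ K).mapMatrix).smul t
  rw [IsNilpotent.map_exp hn (shift ħ).mapMatrix]
  change _ = IsNilpotent.exp (shift ħ t • E.map (algebraMap ℂ K))
  congr 1
  ext a b
  change shift ħ (t * algebraMap ℂ K (E a b)) = shift ħ t * algebraMap ℂ K (E a b)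
  rw [map_mul, shift_algebraMap]

section Group

variable {r : ℕ} {𝔤 : Type*} [LieRing 𝔤] [LieAlgebra ℂ 𝔤] {S : ChevalleySystem r 𝔤}

theorem isNilpotent_e (V : FundamentalReps S) (i j : Fin r) : IsNilpotent (V.ρ i (S.e j)) :=
  isNilpotent_of_lie_eq_smul (V.ρ i (S.h j)) _ 2 two_ne_zero (by
    rw [← V.ρ_lie, S.lie_h_e, S.cartan_diag, map_smul]; norm_num)

theorem isNilpotent_f (V : FundamentalReps S) (i j : Fin r) : IsNilpotent (V.ρ i (S.f j)) :=
  isNilpotent_of_lie_eq_smul (V.ρ i (S.h j)) _ (-2) (by norm_num) (by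
    rw [← V.ρ_lie, S.lie_h_f, S.cartan_diag, map_smul]; norm_num)

/-! ### The simply connected group `G(u) = G(ℂ(u))` -/

/-- The product of the groups `GL(V_i)(ℂ(u))`, in which `G(u)` lives. -/
abbrev Ambient (V : FundamentalReps S) : Type :=
  ∀ i : Fin r, Matrix.GeneralLinearGroup (Fin (V.dim i)) K

/-- `exp (t e_j)` acting on all fundamental representations. -/
def ambE (V : FundamentalReps S) (j : Fin r) (t : K) : Ambient V :=
  fun i => expGL (V.ρ i (S.e j)) (isNilpotent_e V i j) t

/-- `exp (t f_j)` acting on all fundamental representations. -/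
def ambF (V : FundamentalReps S) (j : Fin r) (t : K) : Ambient V :=
  fun i => expGL (V.ρ i (S.f j)) (isNilpotent_f V i j) t

/-- The `ℂ(u)`-points of the simply connected group with Lie algebra `𝔤`, in the construction of
Chevalley: the group generated by the root subgroups in a faithful representation whose weights
span the whole weight lattice, here the direct sum of the fundamental representations. -/
def groupPoints (V : FundamentalReps S) : Subgroup (Ambient V) :=
  Subgroup.closure ({g | ∃ j t, g = ambE V j t} ∪ {g | ∃ j t, g = ambF V j t})

/-- The group `G(u)`. -/
abbrev G (V : FundamentalReps S) : Type := groupPoints V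

/-- `exp (t e_j)` in `G(u)`. -/
def xE (V : FundamentalReps S) (j : Fin r) (t : K) : G V :=
  ⟨ambE V j t, Subgroup.subset_closure (Or.inl ⟨j, t, rfl⟩)⟩

/-- `exp (t f_j)` in `G(u)`. -/
def xF (V : FundamentalReps S) (j : Fin r) (t : K) : G V :=
  ⟨ambF V j t, Subgroup.subset_closure (Or.inr ⟨j, t, rfl⟩)⟩

/-- `w_j(t) = exp (t e_j) exp (-t⁻¹ f_j) exp (t e_j)`, for `t ≠ 0`; in `SL(2)` this is the matrix
with rows `(0, t)` and `(-t⁻¹, 0)`. -/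
def weylElt (V : FundamentalReps S) (j : Fin r) (t : K) : G V :=
  xE V j t * xF V j (-t⁻¹) * xE V j t

/-- The lift `s_j` of the simple reflection `w_j` to `G`. -/
def simpleLift (V : FundamentalReps S) (j : Fin r) : G V := weylElt V j 1

/-- The element `t ^ α̌_j` of the maximal torus, for `t ≠ 0`: the value at `t` of the cocharacter
`α̌_j`; in `SL(2)` this is `diag(t, t⁻¹)`. -/
def cochar (V : FundamentalReps S) (j : Fin r) (t : K) : G V :=
  weylElt V j t * (weylElt V j 1)⁻¹

/-- The product `∏_j a_j` in the order `j = 1, …, r`. -/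
def oprod {M : Type*} [Monoid M] (a : Fin r → M) : M := (List.ofFn a).prod

/-- `H(u)`. -/
def torus (V : FundamentalReps S) : Subgroup (G V) :=
  Subgroup.closure {g | ∃ j, ∃ t : K, t ≠ 0 ∧ g = cochar V j t}

/-- `N_+(u)`. -/
def Nplus (V : FundamentalReps S) : Subgroup (G V) := Subgroup.closure {g | ∃ j t, g = xE V j t}

/-- `N_-(u)`. -/
def Nminus (V : FundamentalReps S) : Subgroup (G V) := Subgroup.closure {g | ∃ j t, g = xF V j t}

/-- `B_+(u)`. -/
def Bplus (V : FundamentalReps S) : Subgroup (G V) := torus V ⊔ Nplus V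

/-- `B_-(u)`. -/
def Bminus (V : FundamentalReps S) : Subgroup (G V) := torus V ⊔ Nminus V

/-- `g(u) ↦ g(ħ u)` on the ambient group. -/
def ambShift (ħ : ℂˣ) (V : FundamentalReps S) : Ambient V →* Ambient V :=
  MonoidHom.pi fun i => (Matrix.GeneralLinearGroup.map (shift ħ)).comp (Pi.evalMonoidHom _ i)

theorem ambShift_mem (ħ : ℂˣ) (V : FundamentalReps S) {g : Ambient V} (hg : g ∈ groupPoints V) :
    ambShift ħ V g ∈ groupPoints V := by
  have h : groupPoints V ≤ (groupPoints V).comap (ambShift ħ V) := by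
    refine (Subgroup.closure_le _).mpr ?_
    rintro _ (⟨j, t, rfl⟩ | ⟨j, t, rfl⟩)
    · exact Subgroup.subset_closure
        (Or.inl ⟨j, shift ħ t, funext fun i => map_shift_expGL ħ _ _ t⟩)
    · exact Subgroup.subset_closure
        (Or.inr ⟨j, shift ħ t, funext fun i => map_shift_expGL ħ _ _ t⟩)
  exact h hg

/-- `g(u) ↦ g(ħ u)` on `G(u)`. -/
def gShift (ħ : ℂˣ) (V : FundamentalReps S) : G V →* G V where
  toFun g := ⟨ambShift ħ V g, ambShift_mem ħ V g.2⟩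
  map_one' := Subtype.ext (map_one _)
  map_mul' _ _ := Subtype.ext (map_mul _ _ _)

/-! ### Miura opers -/

/-- A Miura `(G, ħ)`-oper on the projective line, in a trivialization of the `G`-bundle over a
Zariski open dense subset: the connection `A(u) ∈ G(u)`, the reductions to `B_-` and to `B_+`,
given at the generic point by cosets `a B_-(u)` and `b B_+(u)`; in a trivialization induced from
the reduction to `B_-` the connection takes values in the Bruhat cell `B_- c B_-` of the Coxeter
element, and the reduction to `B_+` is preserved by the connection. -/
structure MiuraOper (ħ : ℂˣ) (V : FundamentalReps S) where
  conn : G V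
  redMinus : G V ⧸ Bminus V
  redPlus : G V ⧸ Bplus V
  oper : ∃ a : G V, (a : G V ⧸ Bminus V) = redMinus ∧ ∃ b ∈ Bminus V, ∃ b' ∈ Bminus V,
    (gShift ħ V a)⁻¹ * conn * a = b * oprod (simpleLift V) * b'
  preserved : ∃ b : G V, (b : G V ⧸ Bplus V) = redPlus ∧
    (gShift ħ V b)⁻¹ * conn * b ∈ Bplus V

/-- Change of the trivialization by `g(u) ∈ G(u)`: `A(u) ↦ g(ħ u) A(u) g(u)⁻¹`, the reductions
being transported by `g`. -/
def GaugeEquiv {ħ : ℂˣ} {V : FundamentalReps S} (x y : MiuraOper ħ V) : Prop :=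
  ∃ g : G V, y.conn = gShift ħ V g * x.conn * g⁻¹ ∧ y.redMinus = g • x.redMinus ∧
    y.redPlus = g • x.redPlus

instance gaugeSetoid (ħ : ℂˣ) (V : FundamentalReps S) : Setoid (MiuraOper ħ V) where
  r := GaugeEquiv
  iseqv :=
    { refl := fun x => ⟨1, by simp, by simp, by simp⟩
      symm := by
        rintro x y ⟨g, h1, h2, h3⟩
        exact ⟨g⁻¹, by rw [h1, map_inv]; group, by rw [h2, inv_smul_smul],
          by rw [h3, inv_smul_smul]⟩
      trans := by
        rintro x y z ⟨g, h1, h2, h3⟩ ⟨g', h1', h2', h3'⟩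
        exact ⟨g' * g, by rw [h1', h1, map_mul]; group, by rw [h2', h2, mul_smul],
          by rw [h3', h3, mul_smul]⟩ }

/-- Miura `(G, ħ)`-opers up to isomorphism, i.e. up to change of trivialization. -/
abbrev MiuraOperClass (ħ : ℂˣ) (V : FundamentalReps S) : Type := Quotient (gaugeSetoid ħ V)

/-- The polynomial `p`, as an element of `ℂ(u)`. -/
abbrev toK (p : ℂ[X]) : K := algebraMap ℂ[X] K p

/-- The constant `c`, as an element of `ℂ(u)`. -/
abbrev constK (c : ℂ) : K := algebraMap ℂ K c

/-- The oper has regular singularities determined by the polynomials `Λ_i`: in a trivialization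
induced from the reduction to `B_-`, the connection is `n'(u) ∏_i (Λ_i(u)^α̌_i s_i) n(u)`. -/
def HasRegularSingularities {ħ : ℂˣ} {V : FundamentalReps S} (Λ : Fin r → ℂ[X])
    (x : MiuraOper ħ V) : Prop :=
  ∃ a : G V, (a : G V ⧸ Bminus V) = x.redMinus ∧ ∃ n' ∈ Nminus V, ∃ n ∈ Nminus V,
    (gShift ħ V a)⁻¹ * x.conn * a
      = n' * oprod (fun i => cochar V i (toK (Λ i)) * simpleLift V i) * n

/-- The constant element `Z = ∏_i ζ_i^α̌_i` of the maximal torus. -/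
def twist (V : FundamentalReps S) (ζ : Fin r → ℂˣ) : G V :=
  oprod fun i => cochar V i (constK (ζ i))

/-- The Miura oper is `Z`-twisted: in some trivialization induced from the reduction to `B_+`, the
connection is the constant `Z`. -/
def IsTwisted {ħ : ℂˣ} {V : FundamentalReps S} (ζ : Fin r → ℂˣ) (x : MiuraOper ħ V) : Prop :=
  ∃ b : G V, (b : G V ⧸ Bplus V) = x.redPlus ∧ x.conn = gShift ħ V b * twist V ζ * b⁻¹

/-- `∏_i g_i(u)^α̌_i exp ((Λ_i(u) / g_i(u)) e_i)`. -/
def normalForm (V : FundamentalReps S) (Λ : Fin r → ℂ[X]) (g : Fin r → K) : G V :=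
  oprod fun i => cochar V i (g i) * xE V i (toK (Λ i) / g i)

/-- The class of the Miura oper is represented by `∏_i g_i^α̌_i exp ((Λ_i / g_i) e_i)`, with the
standard reductions `B_-` and `B_+`, and this connection equals `v(ħ u) Z v(u)⁻¹` where
`v = ∏_i P_i^α̌_i ∏_i exp (-(Q₋^i / Q₊^i) e_i) ⋯`, the dots standing for an element of
`[N_+(u), N_+(u)]`. -/
def HasTwistedForm {ħ : ℂˣ} {V : FundamentalReps S} (Λ : Fin r → ℂ[X]) (ζ : Fin r → ℂˣ)
    (x : MiuraOper ħ V) (P Qp Qm : Fin r → ℂ[X]) : Prop :=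
  (∀ i, P i ≠ 0) ∧ (∀ i, Qp i ≠ 0) ∧
  ∃ y : MiuraOper ħ V, GaugeEquiv x y ∧
    y.redMinus = ((1 : G V) : G V ⧸ Bminus V) ∧ y.redPlus = ((1 : G V) : G V ⧸ Bplus V) ∧
    (∃ g : Fin r → K, (∀ i, g i ≠ 0) ∧ y.conn = normalForm V Λ g) ∧
    ∃ m ∈ ⁅Nplus V, Nplus V⁆, ∃ v : G V,
      v = oprod (fun i => cochar V i (toK (P i))) *
          oprod (fun i => xE V i (-(toK (Qm i) / toK (Qp i)))) * m ∧
      y.conn = gShift ħ V v * twist V ζ * v⁻¹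

/-- No root of `p` and root of `q` lie in the same orbit of multiplication by `ħ`. -/
def HbarDistinct (ħ : ℂˣ) (p q : ℂ[X]) : Prop :=
  ∀ a b : ℂ, p.IsRoot a → q.IsRoot b → ∀ k : ℤ, b ≠ ((ħ ^ k : ℂˣ) : ℂ) * a

/-- `P_i` and `P_j` have `ħ`-distinct roots for neighboring nodes `i ≠ j` of the Dynkin diagram. -/
def NeighborsDistinct (S : ChevalleySystem r 𝔤) (ħ : ℂˣ) (P : Fin r → ℂ[X]) : Prop :=
  ∀ i j, i ≠ j → S.cartan i j ≠ 0 → HbarDistinct ħ (P i) (P j)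

/-- Nondegeneracy of a `Z`-twisted Miura oper with regular singularities: the `P_i` are polynomials
whose roots are `ħ`-distinct for neighboring nodes, and `P_i = Q₊^i`, where `Q₊^i` is the monic
denominator of the reduced fraction `Q₋^i / Q₊^i`. -/
def IsNondegenerate {ħ : ℂˣ} {V : FundamentalReps S} (Λ : Fin r → ℂ[X]) (ζ : Fin r → ℂˣ)
    (x : MiuraOper ħ V) : Prop :=
  ∃ P Qp Qm : Fin r → ℂ[X], HasTwistedForm Λ ζ x P Qp Qm ∧
    (∀ i, (Qp i).Monic) ∧ (∀ i, IsCoprime (Qp i) (Qm i)) ∧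
    NeighborsDistinct S ħ P ∧ ∀ i, P i = Qp i

/-- The classes of nondegenerate `Z`-twisted Miura `(G, ħ)`-opers with regular singularities
determined by `Λ`. -/
def nondegenerateOpers (ħ : ℂˣ) (V : FundamentalReps S) (Λ : Fin r → ℂ[X]) (ζ : Fin r → ℂˣ) :
    Set (MiuraOperClass ħ V) :=
  {c | ∃ x : MiuraOper ħ V, Quotient.mk _ x = c ∧ HasRegularSingularities Λ x ∧
    IsTwisted ζ x ∧ IsNondegenerate Λ ζ x}

/-- `P_i` has nonzero, simple roots, pairwise `ħ`-distinct and `ħ`-distinct from those of `Λ_i`. -/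
def GenericRoots (ħ : ℂˣ) (Λ P : Fin r → ℂ[X]) : Prop :=
  ∀ i, (P i).eval 0 ≠ 0 ∧ (P i).roots.Nodup ∧ HbarDistinct ħ (P i) (Λ i) ∧
    ∀ a b : ℂ, (P i).IsRoot a → (P i).IsRoot b → a ≠ b → ∀ k : ℤ, b ≠ ((ħ ^ k : ℂˣ) : ℂ) * a

/-! ### The `QQ`-system -/

/-- `ξ̃_i = ζ_i ∏_{j > i} ζ_j ^ a_{ji}`. -/
def xiTilde (S : ChevalleySystem r 𝔤) (ζ : Fin r → ℂˣ) (i : Fin r) : ℂˣ :=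
  ζ i * ∏ j with i < j, ζ j ^ S.cartan j i

/-- `ξ_i = ζ_i⁻¹ ∏_{j < i} ζ_j ^ (-a_{ji})`. -/
def xi (S : ChevalleySystem r 𝔤) (ζ : Fin r → ℂˣ) (i : Fin r) : ℂˣ :=
  (ζ i)⁻¹ * ∏ j with j < i, ζ j ^ (-S.cartan j i)

/-- The `QQ`-system. -/
def IsQQSolution (S : ChevalleySystem r 𝔤) (ħ : ℂˣ) (Λ : Fin r → ℂ[X]) (ζ : Fin r → ℂˣ)
    (Qp Qm : Fin r → ℂ[X]) : Prop :=
  ∀ i, C (xiTilde S ζ i : ℂ) * Qm i * polyShift ħ (Qp i)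
      - C (xi S ζ i : ℂ) * polyShift ħ (Qm i) * Qp i
    = Λ i * (∏ j with i < j, polyShift ħ (Qp j) ^ (-S.cartan j i).toNat)
        * ∏ j with j < i, Qp j ^ (-S.cartan j i).toNat

/-- The nondegenerate polynomial solutions `(Q₊, Q₋)` of the `QQ`-system: `Q₊^i` is monic and
relatively prime to `Q₋^i`, and the roots of `Q₊^i, Q₊^j` are `ħ`-distinct for neighboring nodes
`i, j`. -/
def nondegenerateSolutions (S : ChevalleySystem r 𝔤) (ħ : ℂˣ) (Λ : Fin r → ℂ[X])
    (ζ : Fin r → ℂˣ) : Set ((Fin r → ℂ[X]) × (Fin r → ℂ[X])) :=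
  {Q | IsQQSolution S ħ Λ ζ Q.1 Q.2 ∧ (∀ i, (Q.1 i).Monic) ∧
    (∀ i, IsCoprime (Q.1 i) (Q.2 i)) ∧ NeighborsDistinct S ħ Q.1}

/-- `c = (⟨α, α̌_i⟩)_i` for a root `α` of `𝔤`. -/
def IsRoot (S : ChevalleySystem r 𝔤) (c : Fin r → ℤ) : Prop :=
  c ≠ 0 ∧ ∃ x : 𝔤, x ≠ 0 ∧ ∀ i, ⁅S.h i, x⁆ = (c i : ℂ) • x

/-- Genericity of the twist: `α(Z) = ∏_i ζ_i ^ ⟨α, α̌_i⟩` is not a power of `ħ`, for every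
root `α`. -/
def GenericTwist (S : ChevalleySystem r 𝔤) (ħ : ℂˣ) (ζ : Fin r → ℂˣ) : Prop :=
  ∀ c : Fin r → ℤ, IsRoot S c → ∀ k : ℤ, ∏ i, ζ i ^ c i ≠ ħ ^ k

end Group

end HOper

end

/-! Write `τ(g) = Z⁻¹ g(ħu) Z`. In the equation `A = v(ħu) Z v⁻¹` the action on the highest weight
vectors forces `g_i = ζ_i P_i(ħu) / P_i(u)`. Removing the factor `∏ P_i^α̌_i`
(`normalForm_eq_qqTerm`) leaves an equation in `N_+(u)`, namely `∏ exp (s_i e_i) = τ(n) n⁻¹`, where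
`s_i` is `qqTerm`. Modulo `[N_+, N_+]` it says `f_i - α_i(Z)⁻¹ f_i(ħu) = s_i` for `f_i = Q₋^i /
Q₊^i`, and for `P = Q₊` this is the `QQ`-system (`qq_iff`). Hence an oper gives a solution
(`eq_of_normalForm_eq`).

Conversely, a solution determines `n` modulo `[N_+, N_+]`, and the rest of `n` is built degree by
degree along the height filtration (`exists_gauge`). In each degree the obstruction is a family of
scalar equations `α(Z)⁻¹ f(ħu) - f(u) = s(u)`, one for each root vector of a basis. Because `α(Z)`
is not a power of `ħ`, Laurent polynomials are never an obstruction, and partial fractions reduce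
solvability in `ℂ(u)` to solvability modulo functions regular on each orbit in `ℂ^×`
(`exists_diffOp_eq`).

The local problem is where nondegeneracy enters (`local_regular`). Near a given orbit, gauge by `exp
(-f_i e_i)` only for those `i` for which `Q₊^i` has a root on the orbit. These nodes are pairwise
not adjacent, so their `e_i` commute. For every other node `j`, the Serre relation `(ad e_i)^(1 -
a_ij) e_j = 0` bounds the poles created by conjugating `e_j`, and the factor of exponent `-a_ij`
coming from `Q₊^i` in `s_j` cancels them exactly. The connection becomes regular on the orbit, and
`exists_regU_mul` compares this local gauge with the global one constructed so far, which yields the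
local solutions of the scalar equations.

For injectivity, an isomorphism of two opers in normal form with standard reductions lies in `B_+ ∩
B_- = H` (`eq_tor_of_mem_inf`). Since the `Λ_i` are the same on both sides, its torus coordinates
satisfy multiplicative relations which exclude zeros and poles in `ℂ^×`. Invertibility of the Cartan
matrix makes their degrees vanish, so they are constants. Then the `Q₊^i` agree, and the `Q₋^i`
agree because the homogeneous scalar equation has only the zero solution.

That the normal form is an oper with the prescribed singularities follows from `exp (t e) = exp (t⁻¹
f) w(t) exp (t⁻¹ f)` and from a rearrangement of factors of `N_-` through the Coxeter element
(`exists_Nminus_mul`). For generic roots, the scalar equation locates all poles of `f_i`: its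
denominator is `P_i` up to a constant (`denom_eq_of_generic`), and rescaling gives a solution of the
`QQ`-system with the same connection. -/

noncomputable section

namespace HOper

set_option linter.unusedSectionVars false

/-! ### Conjugation by exponentials of nilpotent elements -/

section Conj

variable {A : Type*} [Ring A] [Algebra ℚ A]

/-- The commutator map `w ↦ z w - w z`. -/
def adQ (z : A) : Module.End ℚ A := LinearMap.mulLeft ℚ z - LinearMap.mulRight ℚ z

@[simp] theorem adQ_apply (z w : A) : adQ z w = z * w - w * z := rfl

theorem commute_mulLeft_neg_mulRight (z : A) :
    Commute (LinearMap.mulLeft ℚ z) (-LinearMap.mulRight ℚ z) := by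
  have h : Commute (LinearMap.mulLeft ℚ z) (LinearMap.mulRight ℚ z) := by
    ext w
    simp [mul_assoc]
  exact h.neg_right

theorem mulRight_pow_apply (z w : A) (k : ℕ) : ((LinearMap.mulRight ℚ z) ^ k) w = w * z ^ k := by
  induction k generalizing w with
  | zero => simp
  | succ k ih => rw [pow_succ, Module.End.mul_apply, ih, LinearMap.mulRight_apply, mul_assoc,
      ← pow_succ']

theorem isNilpotent_mulRight {z : A} (hz : IsNilpotent z) :
    IsNilpotent (LinearMap.mulRight ℚ z) := by
  obtain ⟨k, hk⟩ := hz
  exact ⟨k, by ext w; rw [mulRight_pow_apply, hk]; simp⟩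

theorem mulLeft_pow_apply (z w : A) (k : ℕ) : ((LinearMap.mulLeft ℚ z) ^ k) w = z ^ k * w := by
  induction k generalizing w with
  | zero => simp
  | succ k ih => rw [pow_succ, Module.End.mul_apply, ih, LinearMap.mulLeft_apply, pow_succ,
      mul_assoc]

theorem isNilpotent_mulLeft {z : A} (hz : IsNilpotent z) :
    IsNilpotent (LinearMap.mulLeft ℚ z) := by
  obtain ⟨k, hk⟩ := hz
  exact ⟨k, by ext w; rw [mulLeft_pow_apply, hk]; simp⟩

theorem isNilpotent_adQ {z : A} (hz : IsNilpotent z) : IsNilpotent (adQ z) := by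
  rw [adQ, sub_eq_add_neg]
  exact (commute_mulLeft_neg_mulRight z).isNilpotent_add (isNilpotent_mulLeft hz)
    (isNilpotent_mulRight hz).neg

theorem exp_adQ_apply {z : A} (hz : IsNilpotent z) (w : A) :
    IsNilpotent.exp (adQ z) w = IsNilpotent.exp z * w * IsNilpotent.exp (-z) := by
  have h1 : IsNilpotent.exp (adQ z) = IsNilpotent.exp (LinearMap.mulLeft ℚ z) *
      IsNilpotent.exp (-LinearMap.mulRight ℚ z) := by
    rw [adQ, sub_eq_add_neg]
    exact IsNilpotent.exp_add_of_commute (commute_mulLeft_neg_mulRight z) (isNilpotent_mulLeft hz)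
      (isNilpotent_mulRight hz).neg
  have h2 : ∀ w, IsNilpotent.exp (LinearMap.mulLeft ℚ z) w = IsNilpotent.exp z * w := by
    intro w
    obtain ⟨k, hk⟩ := hz
    have hk' : (LinearMap.mulLeft ℚ z) ^ k = 0 := by
      ext w; rw [mulLeft_pow_apply, hk]; simp
    rw [IsNilpotent.exp_eq_sum hk, IsNilpotent.exp_eq_sum hk', LinearMap.sum_apply, Finset.sum_mul]
    refine Finset.sum_congr rfl fun i _ => ?_
    rw [LinearMap.smul_apply, mulLeft_pow_apply, smul_mul_assoc]
  have h3 : ∀ w, IsNilpotent.exp (-LinearMap.mulRight ℚ z) w = w * IsNilpotent.exp (-z) := by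
    intro w
    obtain ⟨k, hk⟩ := hz
    have e : -LinearMap.mulRight ℚ z = LinearMap.mulRight ℚ (-z) := by ext w; simp
    have hkn : (-z) ^ k = 0 := by rw [neg_pow, hk, mul_zero]
    have hk' : (LinearMap.mulRight ℚ (-z)) ^ k = 0 := by
      ext w; rw [mulRight_pow_apply, hkn]; simp
    rw [e, IsNilpotent.exp_eq_sum hkn, IsNilpotent.exp_eq_sum hk', LinearMap.sum_apply,
      Finset.mul_sum]
    refine Finset.sum_congr rfl fun i _ => ?_
    rw [LinearMap.smul_apply, mulRight_pow_apply, mul_smul_comm]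
  rw [h1, Module.End.mul_apply, h2, h3, mul_assoc]

/-- If `(ad z)^k w = 0`, conjugation of `w` by `exp z` is a finite sum. -/
theorem exp_conj_eq_sum {z : A} (hz : IsNilpotent z) {w : A} {k : ℕ} (hk : ((adQ z) ^ k) w = 0) :
    IsNilpotent.exp z * w * IsNilpotent.exp (-z) =
      ∑ i ∈ Finset.range k, (i.factorial : ℚ)⁻¹ • ((adQ z) ^ i) w := by
  rw [← exp_adQ_apply hz]
  exact IsNilpotent.exp_smul_eq_sum (a := adQ z) (m := w) hk (isNilpotent_adQ hz)

/-- Conjugation by `exp z` is `exp (ad z)`, and every term of that series after the zeroth lies in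
`M`. -/
theorem exp_conj_sub_mem {z : A} (hz : IsNilpotent z) (M : Submodule ℚ A)
    (hM : ∀ m ∈ M, z * m - m * z ∈ M) {w : A} (hw : z * w - w * z ∈ M) :
    IsNilpotent.exp z * w * IsNilpotent.exp (-z) - w ∈ M := by
  obtain ⟨k, hk⟩ := isNilpotent_adQ hz
  -- The exponent `k + 1` ensures that the truncated series has a zeroth term to split off, even
  -- when `k = 0`.
  have hk' : ((adQ z) ^ (k + 1)) w = 0 := by rw [pow_succ', hk]; simp
  have hpow : ∀ i : ℕ, ((adQ z) ^ (i + 1)) w ∈ M := by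
    intro i
    induction i with
    | zero => simpa using hw
    | succ i ih => rw [pow_succ', Module.End.mul_apply]; exact hM _ ih
  rw [exp_conj_eq_sum hz hk', Finset.sum_range_succ']
  simp only [pow_zero, Module.End.one_apply, Nat.factorial_zero, Nat.cast_one, inv_one, one_smul,
    add_sub_cancel_right]
  exact Submodule.sum_mem _ fun i _ => M.smul_mem _ (hpow i)

theorem conj_exp {z w : A} (hz : IsNilpotent z) (hw : IsNilpotent w) :
    IsNilpotent.exp z * IsNilpotent.exp w * IsNilpotent.exp (-z) =
      IsNilpotent.exp (IsNilpotent.exp z * w * IsNilpotent.exp (-z)) := by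
  let u : Aˣ := ⟨IsNilpotent.exp z, IsNilpotent.exp (-z), IsNilpotent.exp_mul_exp_neg_self hz,
    IsNilpotent.exp_neg_mul_exp_self hz⟩
  exact IsNilpotent.exp_smul (ConjAct.toConjAct u) hw |>.symm

end Conj

/-- `exp z` as a unit. -/
def expU {A : Type*} [Ring A] [Module ℚ A] (z : A) (hz : IsNilpotent z) : Aˣ where
  val := IsNilpotent.exp z
  inv := IsNilpotent.exp (-z)
  val_inv := IsNilpotent.exp_mul_exp_neg_self hz
  inv_val := IsNilpotent.exp_neg_mul_exp_self hz

section ExpUnit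

variable {A : Type*} [Ring A] [Algebra ℚ A]

theorem expU_neg {z : A} (hz : IsNilpotent z) : expU (-z) hz.neg = (expU z hz)⁻¹ := Units.ext rfl

theorem expU_congr {z w : A} (h : z = w) (hz : IsNilpotent z) (hw : IsNilpotent w) :
    expU z hz = expU w hw := by
  subst h; rfl

theorem conj_expU {z w : A} (hz : IsNilpotent z) (hw : IsNilpotent w)
    (hn : IsNilpotent (IsNilpotent.exp z * w * IsNilpotent.exp (-z))) :
    expU z hz * expU w hw * (expU z hz)⁻¹ =
      expU (IsNilpotent.exp z * w * IsNilpotent.exp (-z)) hn := by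
  ext
  exact conj_exp hz hw

theorem isNilpotent_conj {z w : A} (hz : IsNilpotent z) (hw : IsNilpotent w) :
    IsNilpotent (IsNilpotent.exp z * w * IsNilpotent.exp (-z)) := by
  obtain ⟨k, hk⟩ := hw
  refine ⟨k, ?_⟩
  have : ∀ k : ℕ, (IsNilpotent.exp z * w * IsNilpotent.exp (-z)) ^ k =
      IsNilpotent.exp z * w ^ k * IsNilpotent.exp (-z) := by
    intro k
    induction k with
    | zero => simp [IsNilpotent.exp_mul_exp_neg_self hz]
    | succ k ih =>
      rw [pow_succ, ih, mul_assoc _ (IsNilpotent.exp (-z)), ← mul_assoc (IsNilpotent.exp (-z)),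
        ← mul_assoc (IsNilpotent.exp (-z)), IsNilpotent.exp_neg_mul_exp_self hz, one_mul, pow_succ]
      simp only [mul_assoc]
  rw [this, hk, mul_zero, zero_mul]

end ExpUnit

/-! ### Exponentials of monomials and their logarithmic derivatives -/

section Derivative

variable {A : Type*} [Ring A] [Algebra ℚ A]

theorem isNilpotent_monomial {A : Type*} [Ring A] {c : A} (hc : IsNilpotent c) (n : ℕ) :
    IsNilpotent (monomial n c) := by
  obtain ⟨k, hk⟩ := hc
  exact ⟨k, by rw [monomial_pow, hk, monomial_zero_right]⟩

/-- Only powers of the single element `c` occur as coefficients, so the exponential series can be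
differentiated as in the commutative case. -/
theorem derivative_exp_monomial {c : A} (hc : IsNilpotent c) (n : ℕ) :
    derivative (IsNilpotent.exp (monomial (n + 1) c : A[X])) =
      monomial n ((n + 1 : ℕ) * c) * IsNilpotent.exp (monomial (n + 1) c : A[X]) := by
  obtain ⟨k, hk⟩ := hc
  have hk1 : (monomial (n + 1) c : A[X]) ^ k = 0 := by
    rw [monomial_pow, hk, monomial_zero_right]
  have hk2 : (monomial (n + 1) c : A[X]) ^ (k + 1) = 0 := by rw [pow_succ, hk1, zero_mul]
  conv_lhs => rw [IsNilpotent.exp_eq_sum hk2]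
  conv_rhs => rw [IsNilpotent.exp_eq_sum hk1]
  rw [Finset.sum_range_succ', derivative_add, derivative_sum, Finset.mul_sum]
  simp only [pow_zero, Nat.factorial_zero, Nat.cast_one, inv_one, one_smul, derivative_one,
    add_zero]
  refine Finset.sum_congr rfl fun i _ => ?_
  rw [derivative_smul, monomial_pow, derivative_monomial, monomial_pow, mul_smul_comm,
    monomial_mul_monomial]
  have e : (n + 1) * (i + 1) - 1 = n + (n + 1) * i := by
    rw [Nat.mul_succ]; omega
  rw [e, pow_succ']
  have h1 : (c * c ^ i * (((n + 1) * (i + 1) : ℕ) : A)) =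
      ((i + 1 : ℕ) : ℚ) • (((n + 1 : ℕ) : A) * c * c ^ i) := by
    rw [(Nat.cast_commute ((n + 1) * (i + 1)) (c * c ^ i)).eq.symm, Nat.cast_smul_eq_nsmul,
      nsmul_eq_mul]
    push_cast
    rw [← Nat.cast_succ, ← Nat.cast_succ, (Nat.cast_commute (n.succ) ((i.succ : ℕ) : A)).eq]
    simp only [mul_assoc]
  rw [h1, ← smul_monomial, smul_smul]
  congr 1
  rw [Nat.factorial_succ]
  push_cast
  have : (i.factorial : ℚ) ≠ 0 := by positivity
  have : (i + 1 : ℚ) ≠ 0 := by positivity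
  field_simp

/-- Evaluation of a polynomial with noncommuting coefficients at `1`. -/
def evalOne : A[X] →+* A := eval₂RingHom' (RingHom.id A) 1 fun _ => Commute.one_right _

theorem evalOne_monomial {A : Type*} [Ring A] (n : ℕ) (c : A) : evalOne (monomial n c) = c := by
  simp [evalOne, eval₂RingHom']

theorem evalOne_exp_monomial {c : A} (hc : IsNilpotent c) (n : ℕ) :
    evalOne (IsNilpotent.exp (monomial n c : A[X])) = IsNilpotent.exp c := by
  rw [IsNilpotent.map_exp (isNilpotent_monomial hc n), evalOne_monomial]

theorem coeff_zero_exp_monomial {c : A} (hc : IsNilpotent c) (n : ℕ) :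
    (IsNilpotent.exp (monomial (n + 1) c : A[X])).coeff 0 = 1 := by
  let f : A[X] →+* A := constantCoeff
  have : f (IsNilpotent.exp (monomial (n + 1) c : A[X])) = 1 := by
    rw [IsNilpotent.map_exp (isNilpotent_monomial hc _)]
    have : f (monomial (n + 1) c) = 0 := by simp [f, coeff_monomial]
    rw [this, IsNilpotent.exp_zero]
  simpa [f] using this

end Derivative

/-! ### Unipotent groups attached to a filtered nilpotent Lie ring -/

/-- A decreasing filtration by a nilpotent Lie ring of nilpotent elements of an algebra. -/
structure LieFiltration (A : Type*) [Ring A] [Algebra ℚ A] where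
  F : ℕ → Submodule ℚ A
  anti : ∀ {a b}, a ≤ b → F b ≤ F a
  lie : ∀ {a b x y}, x ∈ F a → y ∈ F b → x * y - y * x ∈ F (a + b)
  nil : ∀ {x}, x ∈ F 1 → IsNilpotent x
  bot : ∃ l, F l = ⊥

namespace LieFiltration

variable {A : Type*} [Ring A] [Algebra ℚ A] (𝓕 : LieFiltration A)

theorem nil' {l : ℕ} (hl : 1 ≤ l) {x : A} (hx : x ∈ 𝓕.F l) : IsNilpotent x :=
  𝓕.nil (𝓕.anti hl hx)

/-- The group generated by the exponentials of elements of `F l`. -/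
def E (l : ℕ) : Subgroup Aˣ := Subgroup.closure {u | ∃ z ∈ 𝓕.F l, IsNilpotent z ∧
  (u : A) = IsNilpotent.exp z}

theorem E_anti {a b : ℕ} (h : a ≤ b) : 𝓕.E b ≤ 𝓕.E a :=
  Subgroup.closure_mono fun _ ⟨z, hz, hn, hu⟩ => ⟨z, 𝓕.anti h hz, hn, hu⟩

theorem expU_mem {l : ℕ} {z : A} (hz : z ∈ 𝓕.F l) (hn : IsNilpotent z) : expU z hn ∈ 𝓕.E l :=
  Subgroup.subset_closure ⟨z, hz, hn, rfl⟩

/-- Polynomials with coefficients in `F l`. -/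
def FX (l : ℕ) : Submodule ℚ A[X] where
  carrier := {p | ∀ k, p.coeff k ∈ 𝓕.F l}
  add_mem' hp hq k := by rw [coeff_add]; exact Submodule.add_mem _ (hp k) (hq k)
  zero_mem' k := by simp
  smul_mem' c p hp k := by rw [coeff_smul]; exact Submodule.smul_mem _ _ (hp k)

theorem FX_lie {a b : ℕ} {p q : A[X]} (hp : p ∈ 𝓕.FX a) (hq : q ∈ 𝓕.FX b) :
    p * q - q * p ∈ 𝓕.FX (a + b) := by
  intro k
  rw [coeff_sub, coeff_mul, coeff_mul, ← Finset.Nat.sum_antidiagonal_swap, ← Finset.sum_sub_distrib]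
  refine Submodule.sum_mem _ fun x _ => ?_
  have := 𝓕.lie (hp x.2) (hq x.1)
  simpa using this

theorem FX_anti {a b : ℕ} (h : a ≤ b) : 𝓕.FX b ≤ 𝓕.FX a := fun _ hp k => 𝓕.anti h (hp k)

theorem monomial_mem_FX {l : ℕ} {c : A} (hc : c ∈ 𝓕.F l) (n : ℕ) : monomial n c ∈ 𝓕.FX l := by
  intro k
  rw [coeff_monomial]
  split_ifs
  · exact hc
  · exact Submodule.zero_mem _

theorem conj_sub_mem {a b : ℕ} {z w : A} (hn : IsNilpotent z) (hz : z ∈ 𝓕.F a) (hw : w ∈ 𝓕.F b) :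
    IsNilpotent.exp z * w * IsNilpotent.exp (-z) - w ∈ 𝓕.F (a + b) :=
  exp_conj_sub_mem hn _ (fun m hm => 𝓕.anti (by omega) (𝓕.lie hz hm)) (𝓕.lie hz hw)

theorem conj_mem {a b : ℕ} {z w : A} (hn : IsNilpotent z) (hz : z ∈ 𝓕.F a) (hw : w ∈ 𝓕.F b) :
    IsNilpotent.exp z * w * IsNilpotent.exp (-z) ∈ 𝓕.F b := by
  have := Submodule.add_mem _ (𝓕.anti (by omega) (𝓕.conj_sub_mem hn hz hw) :
    IsNilpotent.exp z * w * IsNilpotent.exp (-z) - w ∈ 𝓕.F b) hw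
  simpa using this

theorem FX_conj_sub_mem {a b : ℕ} {z w : A[X]} (hn : IsNilpotent z) (hz : z ∈ 𝓕.FX a)
    (hw : w ∈ 𝓕.FX b) :
    IsNilpotent.exp z * w * IsNilpotent.exp (-z) - w ∈ 𝓕.FX (a + b) :=
  exp_conj_sub_mem hn _ (fun m hm => 𝓕.FX_anti (by omega) (𝓕.FX_lie hz hm)) (𝓕.FX_lie hz hw)

/-- The value at `1` of a solution of `g' = y g`, `g(0) = 1`, where `y` is a polynomial with
coefficients in `F l`. -/
theorem evalOne_mem {l : ℕ} (hl : 1 ≤ l) (g y : A[X]) (hy : y ∈ 𝓕.FX l)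
    (hg : derivative g = y * g) (hg0 : g.coeff 0 = 1) : ∃ u ∈ 𝓕.E l, (u : A) = evalOne g := by
  obtain ⟨L, hL⟩ := 𝓕.bot
  obtain ⟨d, hd⟩ : ∃ d, L ≤ l + d := ⟨L, by omega⟩
  induction d generalizing l g y with
  | zero =>
    have hbot : 𝓕.F l = ⊥ := le_bot_iff.mp (hL ▸ 𝓕.anti (by omega))
    have hy0 : y = 0 := by
      ext k
      have := hy k
      rw [hbot, Submodule.mem_bot] at this
      simpa using this
    rw [hy0, zero_mul] at hg
    have : g = C 1 := by
      ext k
      rcases k with _ | k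
      · simpa using hg0
      · have h := congrArg (fun p => coeff p k) hg
        simp only [coeff_derivative, coeff_zero] at h
        rw [coeff_C, if_neg (Nat.succ_ne_zero k)]
        have h2 : ((k + 1 : ℕ) : ℚ) • g.coeff (k + 1) = 0 := by
          rw [Nat.cast_smul_eq_nsmul, nsmul_eq_mul, (Nat.cast_commute _ _).eq]
          push_cast
          exact h
        exact (smul_eq_zero.mp h2).resolve_left (by positivity)
    exact ⟨1, one_mem _, by simp [this]⟩
  | succ d ih =>
    -- An inner induction on a bound for the degrees whose coefficients are not yet known to lie in
    -- `F (l + 1)`. Once the bound is `0`, the outer induction applies one level deeper.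
    obtain ⟨n, hn⟩ : ∃ n, ∀ k, n ≤ k → y.coeff k ∈ 𝓕.F (l + 1) :=
      ⟨y.natDegree + 1, fun k hk => by
        rw [coeff_eq_zero_of_natDegree_lt (by omega)]; exact Submodule.zero_mem _⟩
    induction n generalizing g y with
    | zero =>
      obtain ⟨u, hu, hu'⟩ := ih (l := l + 1) (by omega) g y (fun k => hn k (Nat.zero_le _)) hg hg0
        (by omega)
      exact ⟨u, 𝓕.E_anti (Nat.le_succ l) hu, hu'⟩
    | succ n ihn =>
      -- Multiplying `g` on the left by `exp (c u^(n+1))` adds `-y_n u^n` to its logarithmic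
      -- derivative and otherwise changes it only modulo `F (l + l)`. This pushes the coefficient in
      -- degree `n` into `F (l + 1)`.
      set c : A := ((n + 1 : ℕ) : ℚ)⁻¹ • (-y.coeff n) with hc
      have hcF : c ∈ 𝓕.F l := Submodule.smul_mem _ _ (Submodule.neg_mem _ (hy n))
      have hcn : IsNilpotent c := 𝓕.nil' hl hcF
      have hncc : ((n + 1 : ℕ) : A) * c = -y.coeff n := by
        rw [hc, mul_smul_comm, ← nsmul_eq_mul, ← Nat.cast_smul_eq_nsmul ℚ, smul_smul,
          inv_mul_cancel₀ (by positivity), one_smul]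
      set m : A[X] := monomial (n + 1) c with hm
      have hmn : IsNilpotent m := isNilpotent_monomial hcn _
      have hmF : m ∈ 𝓕.FX l := 𝓕.monomial_mem_FX hcF _
      set Y : A[X] := monomial n (-y.coeff n) +
        IsNilpotent.exp m * y * IsNilpotent.exp (-m) with hY
      have hdiff := 𝓕.FX_conj_sub_mem hmn hmF hy
      have hYF : Y ∈ 𝓕.FX l := by
        refine Submodule.add_mem _ (𝓕.monomial_mem_FX (Submodule.neg_mem _ (hy n)) _) ?_
        have := Submodule.add_mem _ (𝓕.FX_anti (by omega : l ≤ l + l) hdiff) hy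
        simpa using this
      have hder : derivative (IsNilpotent.exp m * g) = Y * (IsNilpotent.exp m * g) := by
        rw [derivative_mul, hm, derivative_exp_monomial hcn, hncc, ← hm, hg, hY, add_mul]
        congr 1
        · rw [mul_assoc]
        · rw [mul_assoc (IsNilpotent.exp m * y), ← mul_assoc (IsNilpotent.exp (-m)),
            IsNilpotent.exp_neg_mul_exp_self hmn, one_mul, mul_assoc]
      have hcoef : ∀ k, n ≤ k → Y.coeff k ∈ 𝓕.F (l + 1) := by
        intro k hk
        have h1 : (IsNilpotent.exp m * y * IsNilpotent.exp (-m) - y).coeff k ∈ 𝓕.F (l + 1) :=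
          𝓕.anti (by omega) (hdiff k)
        have h2 : (monomial n (-y.coeff n) + y).coeff k ∈ 𝓕.F (l + 1) := by
          rcases hk.eq_or_lt with rfl | hlt
          · simp
          · rw [coeff_add, coeff_monomial, if_neg (by omega), zero_add]
            exact hn k hlt
        have := Submodule.add_mem _ h1 h2
        rw [← coeff_add] at this
        convert this using 2
        rw [hY]; abel
      obtain ⟨u, hu, hu'⟩ := ihn _ Y hYF hder (by
        rw [mul_coeff_zero, hm, coeff_zero_exp_monomial hcn, hg0, one_mul]) hcoef
      refine ⟨(expU c hcn)⁻¹ * u, mul_mem (inv_mem (𝓕.expU_mem hcF hcn)) hu, ?_⟩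
      rw [Units.val_mul, hu', map_mul, hm, evalOne_exp_monomial hcn, ← mul_assoc]
      change IsNilpotent.exp (-c) * _ * _ = _
      rw [IsNilpotent.exp_neg_mul_exp_self hcn, one_mul]

theorem FX_conj_mem {a b : ℕ} {z w : A[X]} (hn : IsNilpotent z) (hz : z ∈ 𝓕.FX a)
    (hw : w ∈ 𝓕.FX b) : IsNilpotent.exp z * w * IsNilpotent.exp (-z) ∈ 𝓕.FX b := by
  have := Submodule.add_mem _ (𝓕.FX_anti (by omega) (𝓕.FX_conj_sub_mem hn hz hw) :
    IsNilpotent.exp z * w * IsNilpotent.exp (-z) - w ∈ 𝓕.FX b) hw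
  simpa using this

/-- This takes the place of the Baker–Campbell–Hausdorff formula. The curve `exp (ua) exp (ub) exp
(uc)` has logarithmic derivative congruent to `a + b + c`, because the conjugations involved move
`b` and `c` only by multiples of commutators that lie in `F m`. Then `evalOne_mem` applies at `u =
1`. -/
theorem expU_mul_expU_mul_expU_mem {m : ℕ} (hm : 1 ≤ m) {a b c : A} (ha : a ∈ 𝓕.F 1)
    (hb : b ∈ 𝓕.F 1) (hc : c ∈ 𝓕.F 1) (habc : a + b + c ∈ 𝓕.F m) (hab : a * b - b * a ∈ 𝓕.F m)
    (hac : a * c - c * a ∈ 𝓕.F m) (hbc : b * c - c * b ∈ 𝓕.F m) :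
    expU a (𝓕.nil ha) * expU b (𝓕.nil hb) * expU c (𝓕.nil hc) ∈ 𝓕.E m := by
  have key : ∀ {p q : A} (_ : p ∈ 𝓕.F 1) (_ : p * q - q * p ∈ 𝓕.F m),
      IsNilpotent.exp (monomial 1 p) * monomial 0 q * IsNilpotent.exp (-monomial 1 p)
        - monomial 0 q ∈ 𝓕.FX m := by
    intro p q hp hpq
    refine exp_conj_sub_mem (isNilpotent_monomial (𝓕.nil hp) 1) _ (fun y hy => 𝓕.FX_anti (by omega)
      (𝓕.FX_lie (𝓕.monomial_mem_FX hp 1) hy)) ?_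
    have := 𝓕.monomial_mem_FX hpq 1
    rwa [monomial_mul_monomial, monomial_mul_monomial, ← map_sub, add_zero]
  have hA := isNilpotent_monomial (𝓕.nil ha) 1
  have hB := isNilpotent_monomial (𝓕.nil hb) 1
  have hC := isNilpotent_monomial (𝓕.nil hc) 1
  set EA := IsNilpotent.exp (monomial 1 a) with hEA
  set EA' := IsNilpotent.exp (-monomial 1 a) with hEA'
  set EB := IsNilpotent.exp (monomial 1 b) with hEB
  set EB' := IsNilpotent.exp (-monomial 1 b) with hEB'
  set EC := IsNilpotent.exp (monomial 1 c) with hEC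
  have iA : EA' * EA = 1 := IsNilpotent.exp_neg_mul_exp_self hA
  have iB : EB' * EB = 1 := IsNilpotent.exp_neg_mul_exp_self hB
  have dA : derivative EA = monomial 0 a * EA := by
    simpa using derivative_exp_monomial (𝓕.nil ha) 0
  have dB : derivative EB = monomial 0 b * EB := by
    simpa using derivative_exp_monomial (𝓕.nil hb) 0
  have dC : derivative EC = monomial 0 c * EC := by
    simpa using derivative_exp_monomial (𝓕.nil hc) 0
  obtain ⟨u, hu, hu'⟩ := 𝓕.evalOne_mem hm (EA * EB * EC)
    (monomial 0 a + EA * monomial 0 b * EA' + EA * (EB * monomial 0 c * EB') * EA') (by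
      have h1 := key ha hab
      have h2 := key ha hac
      have h3 := 𝓕.FX_conj_mem hA (𝓕.monomial_mem_FX ha 1) (key hb hbc)
      have h4 := 𝓕.monomial_mem_FX habc 0
      rw [← hEA, ← hEA'] at h1 h2 h3
      rw [← hEB, ← hEB'] at h3
      have := add_mem (add_mem (add_mem h1 h2) h3) h4
      convert this using 1
      simp only [map_add]
      noncomm_ring) (by
      rw [derivative_mul, derivative_mul, dA, dB, dC, add_mul, add_mul, add_mul]
      congr 1
      · congr 1
        · simp only [mul_assoc]
        · rw [mul_assoc _ EA', mul_assoc EA EB EC, ← mul_assoc EA' EA, iA, one_mul]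
          simp only [mul_assoc]
      · rw [mul_assoc _ EA', mul_assoc EA EB EC, ← mul_assoc EA' EA, iA, one_mul]
        simp only [mul_assoc]
        rw [← mul_assoc EB' EB, iB, one_mul]) (by
      rw [mul_coeff_zero, mul_coeff_zero, hEA, hEB, hEC, coeff_zero_exp_monomial (𝓕.nil ha),
        coeff_zero_exp_monomial (𝓕.nil hb), coeff_zero_exp_monomial (𝓕.nil hc), one_mul, one_mul])
  convert hu
  ext
  rw [hu', map_mul, map_mul, hEA, hEB, hEC, evalOne_exp_monomial (𝓕.nil ha),
    evalOne_exp_monomial (𝓕.nil hb), evalOne_exp_monomial (𝓕.nil hc)]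
  rfl

theorem expU_add_mem {l : ℕ} (hl : 1 ≤ l) {z w : A} (hz : z ∈ 𝓕.F l) (hw : w ∈ 𝓕.F l)
    (hn : IsNilpotent (z + w)) (hnz : IsNilpotent z) (hnw : IsNilpotent w) :
    expU (z + w) hn * (expU w hnw)⁻¹ * (expU z hnz)⁻¹ ∈ 𝓕.E (l + 1) := by
  have hz1 := 𝓕.anti hl hz
  have hw1 := 𝓕.anti hl hw
  have hzw := 𝓕.anti (show l + 1 ≤ l + l by omega) (𝓕.lie hz hw)
  have := 𝓕.expU_mul_expU_mul_expU_mem (m := l + 1) (by omega) (add_mem hz1 hw1) (neg_mem hw1)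
    (neg_mem hz1) (by convert Submodule.zero_mem _ using 1; abel)
    (by convert neg_mem hzw using 1; noncomm_ring) (by convert hzw using 1; noncomm_ring)
    (by convert neg_mem hzw using 1; noncomm_ring)
  rw [← expU_neg, ← expU_neg]
  exact this

/-- `E l` is normalised by `E 1`. -/
theorem conj_E_mem {l : ℕ} {g u : Aˣ} (hg : g ∈ 𝓕.E 1) (hu : u ∈ 𝓕.E l) :
    g * u * g⁻¹ ∈ 𝓕.E l := by
  induction hg using Subgroup.closure_induction'' generalizing u with
  | one => simpa using hu
  | mul x y hx hy ihx ihy =>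
    have := ihx (ihy hu)
    simpa [mul_assoc] using this
  | mem x hx =>
    obtain ⟨z, hz, hn, hzx⟩ := hx
    have e : x = expU z hn := Units.ext hzx
    induction hu using Subgroup.closure_induction with
    | one => simp
    | mul a b _ _ ha hb => simpa [mul_assoc] using mul_mem ha hb
    | inv a _ ha => simpa [mul_assoc] using inv_mem ha
    | mem a ha =>
      obtain ⟨w, hw, hwn, hwa⟩ := ha
      have e' : a = expU w hwn := Units.ext hwa
      rw [e, e', conj_expU hn hwn (isNilpotent_conj hn hwn)]
      exact 𝓕.expU_mem (𝓕.conj_mem hn hz hw) _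
  | inv_mem x hx =>
    obtain ⟨z, hz, hn, hzx⟩ := hx
    have e : x⁻¹ = expU (-z) hn.neg := by rw [expU_neg hn]; congr 1; exact Units.ext hzx
    induction hu using Subgroup.closure_induction with
    | one => simp
    | mul a b _ _ ha hb => simpa [mul_assoc] using mul_mem ha hb
    | inv a _ ha => simpa [mul_assoc] using inv_mem ha
    | mem a ha =>
      obtain ⟨w, hw, hwn, hwa⟩ := ha
      have e' : a = expU w hwn := Units.ext hwa
      rw [e, e', conj_expU hn.neg hwn (isNilpotent_conj hn.neg hwn)]
      exact 𝓕.expU_mem (𝓕.conj_mem hn.neg (neg_mem hz) hw) _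

/-- Group commutators of exponentials are exponentials of Lie brackets to leading order. Indeed `exp
z exp w exp (-z)` is the exponential of `w' = exp (ad z) w`, which agrees with `w + [z, w]` up to
terms containing at least two brackets with `z`. -/
theorem expU_commutator_mem {a b : ℕ} (ha : 1 ≤ a) (hb : 1 ≤ b) {z w : A} (hz : z ∈ 𝓕.F a)
    (hw : w ∈ 𝓕.F b) (hnz : IsNilpotent z) (hnw : IsNilpotent w)
    (hn : IsNilpotent (z * w - w * z)) :
    expU z hnz * expU w hnw * (expU z hnz)⁻¹ * (expU w hnw)⁻¹ * (expU
      (z * w - w * z) hn)⁻¹ ∈ 𝓕.E (a + b + 1) := by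
  rw [conj_expU hnz hnw (isNilpotent_conj hnz hnw)]
  set w' := IsNilpotent.exp z * w * IsNilpotent.exp (-z) with hw'
  have hw'F : w' ∈ 𝓕.F b := 𝓕.conj_mem hnz hz hw
  have hd : w' - w ∈ 𝓕.F (a + b) := 𝓕.conj_sub_mem hnz hz hw
  have hzw : z * w - w * z ∈ 𝓕.F (a + b) := 𝓕.lie hz hw
  have hr : w' + -w + -(z * w - w * z) ∈ 𝓕.F (a + b + 1) := by
    obtain ⟨k, hk⟩ := isNilpotent_adQ hnz
    -- Two extra terms, since both `w` and `[z, w]` are split off the series.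
    have hk' : ((adQ z) ^ (k + 2)) w = 0 := by rw [pow_add, hk]; simp
    have hpow : ∀ i : ℕ, ((adQ z) ^ (i + 2)) w ∈ 𝓕.F (a + b + 1) := by
      intro i
      induction i with
      | zero =>
        rw [zero_add, pow_two, Module.End.mul_apply]
        exact 𝓕.anti (by omega) (𝓕.lie hz hzw)
      | succ i ih =>
        rw [add_right_comm, pow_succ', Module.End.mul_apply]
        exact 𝓕.anti (by omega) (𝓕.lie hz ih)
    rw [hw', exp_conj_eq_sum hnz hk', Finset.sum_range_succ', Finset.sum_range_succ']
    have e : ∀ s : A, s + ((Nat.factorial (0 + 1) : ℚ)⁻¹ • (adQ z ^ (0 + 1)) w) +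
        ((Nat.factorial 0 : ℚ)⁻¹ • (adQ z ^ 0) w) + -w + -(z * w - w * z) = s := by
      intro s; simp; abel
    rw [e]
    exact Submodule.sum_mem _ fun i _ => Submodule.smul_mem _ _ (hpow i)
  rw [← expU_neg, ← expU_neg]
  refine 𝓕.expU_mul_expU_mul_expU_mem (m := a + b + 1) (by omega) (𝓕.anti hb hw'F)
    (neg_mem (𝓕.anti hb hw)) (neg_mem (𝓕.anti (by omega) hzw)) hr ?_ ?_ ?_
  · have := 𝓕.anti (show a + b + 1 ≤ a + b + b by omega) (𝓕.lie hd hw)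
    convert neg_mem this using 1
    noncomm_ring
  · have := 𝓕.anti (show a + b + 1 ≤ b + (a + b) by omega) (𝓕.lie hw'F hzw)
    convert neg_mem this using 1
    noncomm_ring
  · have := 𝓕.anti (show a + b + 1 ≤ b + (a + b) by omega) (𝓕.lie hw hzw)
    convert this using 1
    noncomm_ring

/-- Modulo `E (l + 1)`, the elements of `E l` are exponentials of elements of `F l`. -/
theorem exists_expU_mul {l : ℕ} (hl : 1 ≤ l) {u : Aˣ} (hu : u ∈ 𝓕.E l) :
    ∃ z, ∃ hz : z ∈ 𝓕.F l, ∃ e ∈ 𝓕.E (l + 1), u = e * expU z (𝓕.nil' hl hz) := by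
  induction hu using Subgroup.closure_induction with
  | one => exact ⟨0, zero_mem _, 1, one_mem _, by ext; simp [expU]⟩
  | mem a ha =>
    obtain ⟨w, hw, hwn, hwa⟩ := ha
    exact ⟨w, hw, 1, one_mem _, by ext; simp [expU, hwa]⟩
  | mul a b _ _ iha ihb =>
    obtain ⟨z, hz, e, he, rfl⟩ := iha
    obtain ⟨w, hw, f, hf, rfl⟩ := ihb
    have hnz := 𝓕.nil' hl hz
    have hnw := 𝓕.nil' hl hw
    have hs := add_mem hz hw
    have h1 := 𝓕.expU_add_mem hl hz hw (𝓕.nil' hl hs) hnz hnw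
    have h2 := 𝓕.conj_E_mem (𝓕.E_anti hl (𝓕.expU_mem hz hnz)) hf
    refine ⟨z + w, hs, _, mul_mem (mul_mem he h2) (inv_mem h1), ?_⟩
    group
  | inv a _ iha =>
    obtain ⟨z, hz, e, he, rfl⟩ := iha
    have hnz := 𝓕.nil' hl hz
    have h2 := 𝓕.conj_E_mem (𝓕.E_anti hl (𝓕.expU_mem (neg_mem hz) hnz.neg)) (inv_mem he)
    refine ⟨-z, neg_mem hz, _, h2, ?_⟩
    have : expU (-z) (𝓕.nil' hl (neg_mem hz)) = (expU z hnz)⁻¹ := expU_neg hnz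
    rw [this]
    group

/-- The groups `E l` form a central filtration of `E 1`. Modulo `E (l + 1)` the element `u` is one
exponential, and for an exponential `g` the claim follows from `expU_commutator_mem`. The normality
of the groups `E l` handles products. -/
theorem commutator_E_mem {l : ℕ} (hl : 1 ≤ l) {g u : Aˣ} (hg : g ∈ 𝓕.E 1) (hu : u ∈ 𝓕.E l) :
    g * u * g⁻¹ * u⁻¹ ∈ 𝓕.E (l + 1) := by
  have hE : 𝓕.E (l + 1) ≤ 𝓕.E 1 := 𝓕.E_anti (by omega)
  have hE' : 𝓕.E l ≤ 𝓕.E 1 := 𝓕.E_anti hl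
  have hexp : ∀ z ∈ 𝓕.F 1, ∀ hn : IsNilpotent z, expU z hn * u * (expU z hn)⁻¹ * u⁻¹ ∈ 𝓕.E
    (l + 1) := by
    intro z hz hn
    obtain ⟨w, hw, e, he, rfl⟩ := 𝓕.exists_expU_mul hl hu
    have hnw := 𝓕.nil' hl hw
    have hl' := 𝓕.lie hz hw
    have h1 := 𝓕.expU_commutator_mem le_rfl hl hz hw hn hnw (𝓕.nil' (by omega) hl')
    have h2 : expU z hn * expU w hnw * (expU z hn)⁻¹ * (expU w hnw)⁻¹ ∈ 𝓕.E (l + 1) := by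
      have h3 := mul_mem (𝓕.E_anti (by omega : l + 1 ≤ 1 + l + 1) h1)
        (𝓕.E_anti (by omega) (𝓕.expU_mem hl' (𝓕.nil' (by omega) hl')) : _ ∈ 𝓕.E (l + 1))
      simpa using h3
    have hz1 := 𝓕.expU_mem hz hn
    have h4 := 𝓕.conj_E_mem hz1 he
    have h5 := 𝓕.conj_E_mem (hE he) h2
    convert mul_mem h4 (mul_mem (inv_mem he) h5) using 1
    group
  induction hg using Subgroup.closure_induction'' with
  | one => simp
  | mul x y hx hy ihx ihy =>
    have := mul_mem (𝓕.conj_E_mem hx ihy) ihx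
    convert this using 1
    group
  | mem x hx =>
    obtain ⟨z, hz, hn, hzx⟩ := hx
    rw [show x = expU z hn from Units.ext hzx]
    exact hexp z hz hn
  | inv_mem x hx =>
    obtain ⟨z, hz, hn, hzx⟩ := hx
    rw [show x⁻¹ = expU (-z) hn.neg by rw [expU_neg hn]; congr 1; exact Units.ext hzx]
    exact hexp _ (neg_mem hz) hn.neg

theorem E_eq_bot : ∃ L, 𝓕.E L = ⊥ := by
  obtain ⟨L, hL⟩ := 𝓕.bot
  refine ⟨L, (Subgroup.closure_eq_bot_iff).mpr ?_⟩
  rintro u ⟨z, hz, hn, hu⟩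
  rw [hL, Submodule.mem_bot] at hz
  subst hz
  ext
  simpa using hu


/-- The exponential induces a surjective homomorphism from the additive group `F l / F (l + 1)` onto
`E l / E (l + 1)`. It is therefore enough to approximate the exponentials of rational multiples of
spanning elements. -/
theorem exists_inv_mul_mem {N : Subgroup Aˣ} {l : ℕ} (hl : 1 ≤ l) {S : Set A}
    (hS : S ⊆ 𝓕.F l) (hgen : 𝓕.F l ≤ Submodule.span ℚ S ⊔ 𝓕.F (l + 1))
    (hN : ∀ z ∈ S, ∀ c : ℚ, ∀ hn : IsNilpotent (c • z),
      ∃ n ∈ N, n⁻¹ * expU (c • z) hn ∈ 𝓕.E (l + 1))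
    {u : Aˣ} (hu : u ∈ 𝓕.E l) : ∃ n ∈ N, n⁻¹ * u ∈ 𝓕.E (l + 1) := by
  have hmul : ∀ {a b : Aˣ}, a ∈ 𝓕.E l → b ∈ 𝓕.E l → (∃ n ∈ N, n⁻¹ * a ∈ 𝓕.E (l + 1)) →
      (∃ n ∈ N, n⁻¹ * b ∈ 𝓕.E (l + 1)) → ∃ n ∈ N, n⁻¹ * (a * b) ∈ 𝓕.E (l + 1) := by
    rintro a b ha hb ⟨n, hn, hna⟩ ⟨m, hm, hmb⟩
    refine ⟨n * m, mul_mem hn hm, ?_⟩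
    have hm1 : m⁻¹ ∈ 𝓕.E 1 := by
      have := 𝓕.E_anti hl (mul_mem (𝓕.E_anti (Nat.le_succ l) hmb) (inv_mem hb))
      simpa using this
    have := mul_mem (𝓕.conj_E_mem hm1 hna) hmb
    convert this using 1
    group
  have hE : ∀ {a : Aˣ}, a ∈ 𝓕.E (l + 1) → ∃ n ∈ N, n⁻¹ * a ∈ 𝓕.E (l + 1) := fun ha =>
    ⟨1, one_mem _, by simpa using ha⟩
  have hadd : ∀ {z w : A} (hz : z ∈ 𝓕.F l) (hw : w ∈ 𝓕.F l),
      (∃ n ∈ N, n⁻¹ * expU z (𝓕.nil' hl hz) ∈ 𝓕.E (l + 1)) →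
      (∃ n ∈ N, n⁻¹ * expU w (𝓕.nil' hl hw) ∈ 𝓕.E (l + 1)) →
      ∃ n ∈ N, n⁻¹ * expU (z + w) (𝓕.nil' hl (add_mem hz hw)) ∈ 𝓕.E (l + 1) := by
    intro z w hz hw h1 h2
    have h3 := 𝓕.expU_add_mem hl hz hw (𝓕.nil' hl (add_mem hz hw)) (𝓕.nil' hl hz) (𝓕.nil' hl hw)
    have h4 := hmul (𝓕.E_anti (Nat.le_succ l) h3)
      (mul_mem (𝓕.expU_mem hz (𝓕.nil' hl hz)) (𝓕.expU_mem hw (𝓕.nil' hl hw))) (hE h3)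
      (hmul (𝓕.expU_mem hz (𝓕.nil' hl hz)) (𝓕.expU_mem hw (𝓕.nil' hl hw)) h1 h2)
    convert h4 using 5
    group
  have hspan : ∀ s ∈ Submodule.span ℚ S, ∃ hs : ∀ c : ℚ, c • s ∈ 𝓕.F l,
      ∀ c : ℚ, ∃ n ∈ N, n⁻¹ * expU (c • s) (𝓕.nil' hl (hs c)) ∈ 𝓕.E (l + 1) := by
    intro s hs
    induction hs using Submodule.span_induction with
    | mem z hz => exact ⟨fun c => Submodule.smul_mem _ _ (hS hz), fun c => hN z hz c _⟩
    | zero => exact ⟨fun c => by simp, fun c => ⟨1, one_mem _, by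
        convert one_mem (𝓕.E (l + 1)); ext; simp [expU]⟩⟩
    | add x y _ _ hx hy =>
      obtain ⟨hx, hx'⟩ := hx
      obtain ⟨hy, hy'⟩ := hy
      refine ⟨fun c => by rw [smul_add]; exact add_mem (hx c) (hy c), fun c => ?_⟩
      have := hadd (hx c) (hy c) (hx' c) (hy' c)
      simpa only [smul_add] using this
    | smul d x _ hx =>
      obtain ⟨hx, hx'⟩ := hx
      refine ⟨fun c => by rw [smul_smul]; exact hx _, fun c => ?_⟩
      simpa only [smul_smul] using hx' (c * d)
  obtain ⟨z, hz, e, he, rfl⟩ := 𝓕.exists_expU_mul hl hu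
  refine hmul (𝓕.E_anti (Nat.le_succ l) he) (𝓕.expU_mem hz _) (hE he) ?_
  obtain ⟨s, hs, w, hw, rfl⟩ := Submodule.mem_sup.mp (hgen hz)
  obtain ⟨hs, hs'⟩ := hspan s hs
  have h1 := hs 1
  have h2 := hs' 1
  simp only [one_smul] at h1 h2
  exact hadd h1 (𝓕.anti (Nat.le_succ l) hw) h2 (hE (𝓕.expU_mem hw _))

/-- Successive approximation by elements of `N` stops after finitely many steps, because `E L` is
trivial for some `L`. -/
theorem E_le_of_forall {N : Subgroup Aˣ} {a : ℕ} (h : ∀ l, a ≤ l → ∀ u ∈ 𝓕.E l,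
    ∃ n ∈ N, n⁻¹ * u ∈ 𝓕.E (l + 1)) : 𝓕.E a ≤ N := by
  have key : ∀ d, ∀ u ∈ 𝓕.E a, ∃ n ∈ N, n⁻¹ * u ∈ 𝓕.E (a + d) := by
    intro d u hu
    induction d with
    | zero => exact ⟨1, one_mem _, by simpa using hu⟩
    | succ d ih =>
      obtain ⟨n, hn, hnu⟩ := ih
      obtain ⟨m, hm, hmu⟩ := h _ (by omega) _ hnu
      exact ⟨n * m, mul_mem hn hm, by simpa [mul_assoc, add_assoc] using hmu⟩
  obtain ⟨L, hL⟩ := 𝓕.E_eq_bot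
  intro u hu
  obtain ⟨n, hn, hnu⟩ := key L u hu
  have := 𝓕.E_anti (show L ≤ a + L by omega) hnu
  rw [hL, Subgroup.mem_bot, inv_mul_eq_one] at this
  exact this ▸ hn

/-- If `F` is generated in degree one by a set `X`, the exponentials of the multiples of elements
of `X` generate `E 1`. -/
theorem E_one_le {X : Set A} (hX : X ⊆ 𝓕.F 1) (hgen1 : 𝓕.F 1 ≤ Submodule.span ℚ X ⊔ 𝓕.F 2)
    (hgen : ∀ l, 1 ≤ l → 𝓕.F (l + 1) ≤
      Submodule.span ℚ {y | ∃ x ∈ X, ∃ z ∈ 𝓕.F l, y = x * z - z * x} ⊔ 𝓕.F (l + 2))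
    (N : Subgroup Aˣ) (hN : ∀ x ∈ X, ∀ c : ℚ, ∀ hn : IsNilpotent (c • x), expU (c • x) hn ∈ N) :
    𝓕.E 1 ≤ N := by
  -- The approximation of all of `E 1` up to level `l` has to be carried along, since it provides
  -- the second entry of the commutators used at the next level.
  have key : ∀ l, 1 ≤ l → (∀ u ∈ 𝓕.E 1, ∃ n ∈ N, n⁻¹ * u ∈ 𝓕.E l) ∧
      ∀ u ∈ 𝓕.E l, ∃ n ∈ N, n⁻¹ * u ∈ 𝓕.E (l + 1) := by
    intro l hl
    induction l, hl using Nat.le_induction with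
    | base =>
      refine ⟨fun u hu => ⟨1, one_mem _, by simpa using hu⟩, fun u hu => ?_⟩
      exact 𝓕.exists_inv_mul_mem le_rfl hX hgen1 (fun z hz c hn => ⟨_, hN z hz c hn, by simp⟩) hu
    | succ l hl ih =>
      have hP : ∀ u ∈ 𝓕.E 1, ∃ n ∈ N, n⁻¹ * u ∈ 𝓕.E (l + 1) := by
        intro u hu
        obtain ⟨n, hn, h1⟩ := ih.1 u hu
        obtain ⟨m, hm, h2⟩ := ih.2 _ h1
        exact ⟨n * m, mul_mem hn hm, by simpa [mul_assoc] using h2⟩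
      refine ⟨hP, fun u hu => ?_⟩
      refine 𝓕.exists_inv_mul_mem (by omega) ?_ (hgen l hl) ?_ hu
      · rintro _ ⟨x, hx, z, hz, rfl⟩
        exact 𝓕.anti (by omega) (𝓕.lie (hX hx) hz)
      · rintro _ ⟨x, hx, z, hz, rfl⟩ c hn
        have hx1 := hX hx
        have hcz : c • z ∈ 𝓕.F l := Submodule.smul_mem _ _ hz
        have hnx := 𝓕.nil hx1
        have hnz := 𝓕.nil' hl hcz
        -- The element `exp (c z)` is not known to lie in `N`. Replacing it by the approximation `n`
        -- changes its commutator with `exp x` only by an element of `E (l + 2)`.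
        obtain ⟨n, hnN, hw⟩ := hP _ (𝓕.E_anti hl (𝓕.expU_mem hcz hnz))
        have hxN : expU x hnx ∈ N := by
          have := hN x hx 1 (by simpa using hnx)
          simpa only [one_smul] using this
        have he : c • (x * z - z * x) = x * (c • z) - (c • z) * x := by
          rw [mul_smul_comm, smul_mul_assoc, smul_sub]
        have hn' : IsNilpotent (x * (c • z) - (c • z) * x) := he ▸ hn
        have h1 := 𝓕.E_anti (show l + 1 + 1 ≤ 1 + l + 1 by omega)
          (𝓕.expU_commutator_mem le_rfl hl hx1 hcz hnx hnz hn')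
        rw [expU_congr he hn hn']
        have hxE := 𝓕.expU_mem hx1 hnx
        have h2 := 𝓕.commutator_E_mem (by omega) hxE hw
        have hnE : n⁻¹ ∈ 𝓕.E 1 := by
          have := mul_mem (𝓕.E_anti (by omega) hw) (inv_mem (𝓕.E_anti hl (𝓕.expU_mem hcz hnz)))
          simpa using this
        refine ⟨expU x hnx * n * (expU x hnx)⁻¹ * n⁻¹, mul_mem (mul_mem (mul_mem hxN hnN)
          (inv_mem hxN)) (inv_mem hnN), ?_⟩
        have h3 := 𝓕.conj_E_mem (inv_mem (mul_mem (mul_mem (mul_mem hxE (inv_mem hnE))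
          (inv_mem hxE)) hnE)) (inv_mem h1)
        have h4 := 𝓕.conj_E_mem (inv_mem hnE) h2
        convert mul_mem h3 h4 using 1
        group
  exact 𝓕.E_le_of_forall fun l hl u hu => (key l hl).2 u hu

/-- From level two on, the graded pieces are spanned by brackets, and the exponential of a bracket
is a group commutator up to deeper terms. -/
theorem E_two_le_commutator {X : Set A} (hX : X ⊆ 𝓕.F 1)
    (hgen : ∀ l, 1 ≤ l → 𝓕.F (l + 1) ≤
      Submodule.span ℚ {y | ∃ x ∈ X, ∃ z ∈ 𝓕.F l, y = x * z - z * x} ⊔ 𝓕.F (l + 2)) :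
    𝓕.E 2 ≤ ⁅𝓕.E 1, 𝓕.E 1⁆ := by
  refine 𝓕.E_le_of_forall fun l hl u hu => ?_
  obtain ⟨l, rfl⟩ : ∃ k, l = k + 1 := ⟨l - 1, by omega⟩
  refine 𝓕.exists_inv_mul_mem (by omega) ?_ (hgen l (by omega)) ?_ hu
  · rintro _ ⟨x, hx, z, hz, rfl⟩
    exact 𝓕.anti (by omega) (𝓕.lie (hX hx) hz)
  · rintro _ ⟨x, hx, z, hz, rfl⟩ c hn
    have hx1 := hX hx
    have hcz : c • z ∈ 𝓕.F l := Submodule.smul_mem _ _ hz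
    have hnx := 𝓕.nil hx1
    have hnz := 𝓕.nil' (by omega) hcz
    have he : c • (x * z - z * x) = x * (c • z) - (c • z) * x := by
      rw [mul_smul_comm, smul_mul_assoc, smul_sub]
    have hn' : IsNilpotent (x * (c • z) - (c • z) * x) := he ▸ hn
    have h1 := 𝓕.E_anti (show l + 1 + 1 ≤ 1 + l + 1 by omega)
      (𝓕.expU_commutator_mem le_rfl (by omega) hx1 hcz hnx hnz hn')
    have hxE := 𝓕.expU_mem hx1 hnx
    have hzE := 𝓕.E_anti (show 1 ≤ l by omega) (𝓕.expU_mem hcz hnz)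
    rw [expU_congr he hn hn']
    refine ⟨_, Subgroup.commutator_mem_commutator hxE hzE, ?_⟩
    have h3 := 𝓕.conj_E_mem (inv_mem (mul_mem (mul_mem (mul_mem hxE hzE)
      (inv_mem hxE)) (inv_mem hzE))) (inv_mem h1)
    convert h3 using 1
    rw [commutatorElement_def]
    group

end LieFiltration

/-! ### Identities in SL(2) -/

section Sl2

variable {A : Type*} [Ring A] [Algebra ℚ A]

/-- `exp X exp (-Y) exp X`. -/
def weylU (X Y : A) (hX : IsNilpotent X) (hY : IsNilpotent Y) : Aˣ :=
  expU X hX * expU (-Y) hY.neg * expU X hX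

variable {X Y H : A} (hX : IsNilpotent X) (hY : IsNilpotent Y)

/-- Conjugation by `exp z`. -/
def expConj (z w : A) : A := IsNilpotent.exp z * w * IsNilpotent.exp (-z)

theorem expConj_add (z w w' : A) : expConj z (w + w') = expConj z w + expConj z w' := by
  simp only [expConj, mul_add, add_mul]

theorem expConj_sub (z w w' : A) : expConj z (w - w') = expConj z w - expConj z w' := by
  simp only [expConj, mul_sub, sub_mul]

theorem expConj_neg (z w : A) : expConj z (-w) = -expConj z w := by
  simp only [expConj, mul_neg, neg_mul]

theorem expConj_nsmul (z w : A) (n : ℕ) : expConj z (n • w) = n • expConj z w := by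
  simp only [expConj, mul_smul_comm, smul_mul_assoc]

theorem expConj_self {z : A} (hz : IsNilpotent z) : expConj z z = z := by
  rw [expConj, exp_conj_eq_sum hz (k := 1) (by simp)]
  simp

theorem expConj_of_two {z w a : A} (hz : IsNilpotent z) (h1 : z * w - w * z = a)
    (h2 : z * a - a * z = 0) : expConj z w = w + a := by
  rw [expConj, exp_conj_eq_sum hz (k := 2) (by simp [pow_two, h1, h2])]
  simp [Finset.sum_range_succ, h1]

theorem expConj_of_three {z w a b : A} (hz : IsNilpotent z) (h1 : z * w - w * z = a)
    (h2 : z * a - a * z = 2 • b) (h3 : z * b - b * z = 0) : expConj z w = w + a + b := by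
  have e : (adQ z ^ 2) w = 2 • b := by simp [pow_two, h1, h2]
  have e3 : (adQ z ^ 3) w = 0 := by
    rw [pow_succ', Module.End.mul_apply, e, adQ_apply, mul_smul_comm, smul_mul_assoc, ← smul_sub,
      h3, smul_zero]
  rw [expConj, exp_conj_eq_sum hz (k := 3) e3]
  simp only [Finset.sum_range_succ, Finset.sum_range_zero, zero_add, Nat.factorial, e]
  simp [h1, ← Nat.cast_smul_eq_nsmul ℚ, smul_smul]

theorem weylU_conj (w : A) : (weylU X Y hX hY : A) * w * ((weylU X Y hX hY)⁻¹ : Aˣ) =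
    expConj X (expConj (-Y) (expConj X w)) := by
  simp only [weylU, mul_inv_rev, Units.val_mul, expConj, expU, Units.inv_mk, mul_assoc]

variable (hXY : X * Y - Y * X = H) (hHX : H * X - X * H = 2 • X) (hHY : H * Y - Y * H = -(2 • Y))
include hX hY hXY hHX hHY

theorem expConj_X_Y : expConj X Y = Y + H - X := by
  rw [expConj_of_three hX hXY (b := -X) (by rw [smul_neg, ← hHX]; abel) (by noncomm_ring)]
  abel

theorem expConj_X_H : expConj X H = H - 2 • X := by
  rw [expConj_of_two hX (a := -(2 • X)) (by rw [← hHX]; abel) (by noncomm_ring)]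
  abel

theorem expConj_neg_Y_X : expConj (-Y) X = X + H - Y := by
  have h : (-Y) * X - X * (-Y) = H := by rw [← hXY]; noncomm_ring
  have h' : (-Y) * H - H * (-Y) = 2 • (-Y) := by rw [smul_neg, ← hHY]; noncomm_ring
  rw [expConj_of_three hY.neg h h' (by noncomm_ring)]
  abel

theorem expConj_neg_Y_H : expConj (-Y) H = H - 2 • Y := by
  have h' : (-Y) * H - H * (-Y) = -(2 • Y) := by rw [← hHY]; noncomm_ring
  rw [expConj_of_two hY.neg h' (by noncomm_ring)]
  abel

theorem weylU_conj_X :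
    (weylU X Y hX hY : A) * X * ((weylU X Y hX hY)⁻¹ : Aˣ) = -Y := by
  rw [weylU_conj, expConj_self hX, expConj_neg_Y_X hX hY hXY hHX hHY, expConj_sub, expConj_add,
    expConj_self hX, expConj_X_H hX hY hXY hHX hHY, expConj_X_Y hX hY hXY hHX hHY]
  abel

theorem weylU_conj_H :
    (weylU X Y hX hY : A) * H * ((weylU X Y hX hY)⁻¹ : Aˣ) = -H := by
  rw [weylU_conj, expConj_X_H hX hY hXY hHX hHY, expConj_sub, expConj_nsmul,
    expConj_neg_Y_X hX hY hXY hHX hHY, expConj_neg_Y_H hX hY hXY hHX hHY]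
  have e : H - 2 • Y - 2 • (X + H - Y) = -H - 2 • X := by abel
  rw [e, expConj_sub, expConj_neg, expConj_nsmul, expConj_self hX, expConj_X_H hX hY hXY hHX hHY]
  abel

/-- The reflection `w` carries `X` to `-Y`, hence `w exp X = exp (-Y) w`. Expand `w` on the
right-hand side and cancel `exp X`. -/
theorem weylU_eq : weylU X Y hX hY = expU (-Y) hY.neg * expU X hX * expU (-Y) hY.neg := by
  set w := weylU X Y hX hY with hw
  have h : w * expU X hX * w⁻¹ = expU (-Y) hY.neg := by
    ext
    have h1 := weylU_conj_X hX hY hXY hHX hHY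
    have := IsNilpotent.exp_smul (ConjAct.toConjAct w) hX
    rw [ConjAct.units_smul_def, ConjAct.units_smul_def, ConjAct.ofConjAct_toConjAct, h1] at this
    exact this.symm
  have h2 : w * expU X hX = expU (-Y) hY.neg * w := by
    rw [← h]; group
  have h3 : w * expU X hX = expU (-Y) hY.neg * expU X hX * expU (-Y) hY.neg * expU X hX := by
    rw [h2, hw, weylU]; simp only [mul_assoc]
  exact mul_right_cancel h3

/-- The Bruhat decomposition of an upper unipotent element relative to the lower Borel subgroup. It
is the source of the oper condition for the normal form. -/
theorem expU_eq_weylU : expU X hX = expU Y hY * weylU X Y hX hY * expU Y hY := by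
  rw [weylU_eq hX hY hXY hHX hHY, expU_neg hY]
  group

end Sl2

/-! ### The action of a cocharacter on weight vectors -/

section Operators

variable {n : ℕ}

/-- `H` has finitely many eigenvalues, so Lagrange interpolation gives a polynomial with the
prescribed values at the integral ones, and this polynomial is evaluated at `H`. -/
theorem exists_operator (H : Matrix (Fin n) (Fin n) K) (φ : ℤ → K) :
    ∃ D : Matrix (Fin n) (Fin n) K, ∀ (m : ℤ) (v : Fin n → K), H.mulVec v = (m : K) • v →
      D.mulVec v = φ m • v := by
  classical
  have hfin := Module.End.finite_hasEigenvalue (Matrix.toLin' H)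
  have hfin' : {m : ℤ | Module.End.HasEigenvalue (Matrix.toLin' H) (m : K)}.Finite :=
    hfin.preimage (Int.cast_injective.injOn)
  set p := Lagrange.interpolate hfin'.toFinset (fun m : ℤ => (m : K)) φ with hp
  refine ⟨aeval H p, fun m v hv => ?_⟩
  by_cases hv0 : v = 0
  · simp [hv0]
  have hpm : p.eval (m : K) = φ m := by
    refine Lagrange.eval_interpolate_at_node φ (Int.cast_injective.injOn) ?_
    simp only [Set.Finite.mem_toFinset, Set.mem_ofPred_eq]
    exact Module.End.hasEigenvalue_of_hasEigenvector
      ⟨Module.End.mem_eigenspace_iff.mpr (by rw [Matrix.toLin'_apply]; exact hv), hv0⟩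
  rw [← hpm]
  have := Module.End.aeval_apply_of_hasEigenvector (f := Matrix.toLin' H) (p := p) (μ := (m : K))
    (x := v) ⟨Module.End.mem_eigenspace_iff.mpr (by rw [Matrix.toLin'_apply]; exact hv), hv0⟩
  rw [← this]
  have e : Matrix.toLin' (aeval H p) = aeval (Matrix.toLin' H) p :=
    (Polynomial.aeval_algHom_apply (Matrix.toLinAlgEquiv' : Matrix (Fin n)
      (Fin n) K ≃ₐ[K] _).toAlgHom H p).symm
  rw [← e, Matrix.toLin'_apply]

theorem matrix_ext_of_span {s : Set (Fin n → K)} (hs : Submodule.span K s = ⊤)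
    {P Q : Matrix (Fin n) (Fin n) K} (h : ∀ v ∈ s, P.mulVec v = Q.mulVec v) : P = Q := by
  have : Matrix.toLin' P = Matrix.toLin' Q := by
    refine LinearMap.ext_on hs fun v hv => ?_
    simpa using h v hv
  exact Matrix.toLin'.injective this

/-- Let `D` act by `t ^ ⌊m/2⌋` on vectors of weight `m`; the rounding avoids a square root of `t`.
Since `E` raises weights by `2`, conjugation by `D` multiplies `E` by `t` and `F` by `t⁻¹`, so `w(t)
= D w D⁻¹`. As `w⁻¹` negates weights, `D w D⁻¹ w⁻¹` acts on weight `m` by `t` to the power `⌊m/2⌋ -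
⌊-m/2⌋ = m`. -/
theorem cochar_aux {E F H : Matrix (Fin n) (Fin n) K} (hE : IsNilpotent E) (hF : IsNilpotent F)
    (hEF : E * F - F * E = H) (hHE : H * E - E * H = 2 • E) (hHF : H * F - F * H = -(2 • F))
    (hspan : Submodule.span K {v : Fin n → K | ∃ m : ℤ, H.mulVec v = (m : K) • v} = ⊤)
    {t : K} (ht : t ≠ 0) {v : Fin n → K} {m : ℤ} (hv : H.mulVec v = (m : K) • v) :
    (weylU (t • E) (t⁻¹ • F) (hE.smul t) (hF.smul _) * (weylU E F hE hF)⁻¹ :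
      (Matrix (Fin n) (Fin n) K)ˣ).val.mulVec v = t ^ m • v := by
  obtain ⟨D, hD⟩ := exists_operator H fun m => t ^ (m / 2)
  obtain ⟨D', hD'⟩ := exists_operator H fun m => (t ^ (m / 2))⁻¹
  have hDD' : D * D' = 1 := by
    refine matrix_ext_of_span hspan fun v ⟨m, hv⟩ => ?_
    rw [← Matrix.mulVec_mulVec, hD' m v hv, Matrix.mulVec_smul, hD m v hv, smul_smul,
      inv_mul_cancel₀ (zpow_ne_zero _ ht), one_smul, Matrix.one_mulVec]
  have hD'D : D' * D = 1 := by
    refine matrix_ext_of_span hspan fun v ⟨m, hv⟩ => ?_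
    rw [← Matrix.mulVec_mulVec, hD m v hv, Matrix.mulVec_smul, hD' m v hv, smul_smul,
      mul_inv_cancel₀ (zpow_ne_zero _ ht), one_smul, Matrix.one_mulVec]
  let d : (Matrix (Fin n) (Fin n) K)ˣ := ⟨D, D', hDD', hD'D⟩
  have hwE : ∀ (m : ℤ) (v : Fin n → K), H.mulVec v = (m : K) • v →
      H.mulVec (E.mulVec v) = ((m + 2 : ℤ) : K) • E.mulVec v := by
    intro m v hv
    have e : H * E = E * H + 2 • E := by rw [← hHE]; abel
    rw [Matrix.mulVec_mulVec, e, Matrix.add_mulVec, ← Matrix.mulVec_mulVec, hv, Matrix.mulVec_smul,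
      ← Nat.cast_smul_eq_nsmul K, Matrix.smul_mulVec, ← add_smul]
    push_cast; rfl
  have hwF : ∀ (m : ℤ) (v : Fin n → K), H.mulVec v = (m : K) • v →
      H.mulVec (F.mulVec v) = ((m - 2 : ℤ) : K) • F.mulVec v := by
    intro m v hv
    have e : H * F = F * H - 2 • F := by rw [sub_eq_add_neg, ← hHF]; abel
    rw [Matrix.mulVec_mulVec, e, Matrix.sub_mulVec, ← Matrix.mulVec_mulVec, hv, Matrix.mulVec_smul,
      ← Nat.cast_smul_eq_nsmul K, Matrix.smul_mulVec, ← sub_smul]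
    push_cast; rfl
  have hDE : D * E * D' = t • E := by
    have : D * E = t • E * D := by
      refine matrix_ext_of_span hspan fun v ⟨m, hv⟩ => ?_
      rw [← Matrix.mulVec_mulVec, hD _ _ (hwE m v hv), ← Matrix.mulVec_mulVec, hD m v hv,
        Matrix.mulVec_smul, Matrix.smul_mulVec, smul_smul]
      congr 1
      rw [show (m + 2) / 2 = m / 2 + 1 by omega, zpow_add₀ ht, zpow_one]
    rw [this, mul_assoc, hDD', mul_one]
  have hDF : D * F * D' = t⁻¹ • F := by
    have : D * F = t⁻¹ • F * D := by
      refine matrix_ext_of_span hspan fun v ⟨m, hv⟩ => ?_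
      rw [← Matrix.mulVec_mulVec, hD _ _ (hwF m v hv), ← Matrix.mulVec_mulVec, hD m v hv,
        Matrix.mulVec_smul, Matrix.smul_mulVec, smul_smul]
      congr 1
      rw [show (m - 2) / 2 = m / 2 + -1 by omega, zpow_add₀ ht, zpow_neg_one]
    rw [this, mul_assoc, hDD', mul_one]
  have hconj : ∀ (z z' : Matrix (Fin n) (Fin n) K) (hz : IsNilpotent z) (hz' : IsNilpotent z'),
      D * z * D' = z' → d * expU z hz * d⁻¹ = expU z' hz' := by
    intro z z' hz hz' h
    ext1
    have := IsNilpotent.exp_smul (ConjAct.toConjAct d) hz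
    rw [ConjAct.units_smul_def, ConjAct.units_smul_def, ConjAct.ofConjAct_toConjAct] at this
    change IsNilpotent.exp (D * z * D') = _ at this
    rw [h] at this
    exact this.symm
  have hw : d * weylU E F hE hF * d⁻¹ = weylU (t • E) (t⁻¹ • F) (hE.smul t) (hF.smul _) := by
    have h1 := hconj E _ hE (hE.smul t) hDE
    have h2 := hconj (-F) (-(t⁻¹ • F)) hF.neg (hF.smul _).neg (by rw [← hDF]; noncomm_ring)
    rw [weylU, weylU, ← h1, ← h2]
    group
  rw [← hw]
  set w := weylU E F hE hF with hwdef
  have hH := weylU_conj_H hE hF hEF hHE hHF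
  rw [← hwdef] at hH
  have hH1 : H * (w⁻¹ : (Matrix (Fin n) (Fin n) K)ˣ).val = -((w⁻¹ : (Matrix (Fin n)
    (Fin n) K)ˣ).val * H) := by
    have : w.val * H = -(H * w.val) := by
      have := congrArg (· * w.val) hH
      simpa [mul_assoc] using this
    have := congrArg (fun z => (w⁻¹ : (Matrix (Fin n) (Fin n) K)ˣ).val * z *
      (w⁻¹ : (Matrix (Fin n) (Fin n) K)ˣ).val) this
    simp only [mul_neg, neg_mul, mul_assoc, Units.mul_inv, mul_one] at this
    rw [← mul_assoc, Units.inv_mul, one_mul] at this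
    exact this
  set x := (w⁻¹ : (Matrix (Fin n) (Fin n) K)ˣ).val.mulVec v with hx
  have hxw : H.mulVec x = ((-m : ℤ) : K) • x := by
    rw [hx, Matrix.mulVec_mulVec, hH1, Matrix.neg_mulVec, ← Matrix.mulVec_mulVec, hv,
      Matrix.mulVec_smul]
    push_cast
    rw [neg_smul]
  have hwx : w.val.mulVec x = v := by
    rw [hx, Matrix.mulVec_mulVec, Units.mul_inv, Matrix.one_mulVec]
  rw [Units.val_mul, Units.val_mul, Units.val_mul, ← Matrix.mulVec_mulVec, ← hx,
    ← Matrix.mulVec_mulVec, ← Matrix.mulVec_mulVec]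
  change D.mulVec (w.val.mulVec (D'.mulVec x)) = _
  rw [hD' _ _ hxw, Matrix.mulVec_smul, hwx, Matrix.mulVec_smul, hD _ _ hv, smul_smul]
  congr 1
  rw [← zpow_neg, ← zpow_add₀ ht]
  congr 1
  omega

end Operators

/-! ### The group and the Lie algebra acting on the fundamental representations -/

section Rep

variable {r : ℕ} {𝔤 : Type*} [LieRing 𝔤] [LieAlgebra ℂ 𝔤] {S : ChevalleySystem r 𝔤}

/-- The algebra `∏_i End(V_i)(ℂ(u))`. -/
abbrev Alg (V : FundamentalReps S) : Type := ∀ i, Matrix (Fin (V.dim i)) (Fin (V.dim i)) K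

/-- The inclusion of `G(u)` into `∏_i End(V_i)(ℂ(u))`. -/
def gval (V : FundamentalReps S) : G V →* Alg V where
  toFun g i := (g.1 i).val
  map_one' := rfl
  map_mul' _ _ := rfl

theorem gval_injective (V : FundamentalReps S) : Function.Injective (gval V) := by
  intro a b h
  apply Subtype.ext
  funext i
  exact Units.ext (congrFun h i)

/-- The inclusion of `G(u)` into the units of `∏_i End(V_i)(ℂ(u))`. -/
def gU (V : FundamentalReps S) : G V →* (Alg V)ˣ := (gval V).toHomUnits

@[simp] theorem gU_val (V : FundamentalReps S) (g : G V) : (gU V g : Alg V) = gval V g := rfl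

theorem gU_injective (V : FundamentalReps S) : Function.Injective (gU V) := fun a b h =>
  gval_injective V (by rw [← gU_val, h, gU_val])

/-- The representation of `𝔤` on all fundamental representations, over `ℂ(u)`. -/
def rK (V : FundamentalReps S) : 𝔤 →ₗ[ℂ] Alg V where
  toFun x i := (V.ρ i x).map (algebraMap ℂ K)
  map_add' x y := by
    funext i
    ext a b
    simp
  map_smul' c x := by
    funext i
    ext a b
    change algebraMap ℂ K ((V.ρ i (c • x)) a b) = c • algebraMap ℂ K ((V.ρ i x) a b)
    rw [map_smul, Matrix.smul_apply, smul_eq_mul, map_mul, Algebra.smul_def]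

theorem rK_apply (V : FundamentalReps S) (x : 𝔤) (i : Fin r) :
    rK V x i = (V.ρ i x).map (algebraMap ℂ K) := rfl

theorem rK_lie (V : FundamentalReps S) (x y : 𝔤) :
    rK V ⁅x, y⁆ = rK V x * rK V y - rK V y * rK V x := by
  funext i
  rw [rK_apply, V.ρ_lie]
  have h := map_sub (algebraMap ℂ K).mapMatrix (V.ρ i x * V.ρ i y) (V.ρ i y * V.ρ i x)
  rw [map_mul, map_mul] at h
  exact h

theorem exp_apply {V : FundamentalReps S} {z : Alg V} (hz : IsNilpotent z) (i : Fin r) :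
    (IsNilpotent.exp z : Alg V) i = IsNilpotent.exp (z i) :=
  IsNilpotent.map_exp hz (Pi.evalRingHom (fun i => Matrix (Fin (V.dim i)) (Fin (V.dim i)) K) i)

theorem isNilpotent_pi {V : FundamentalReps S} {z : Alg V} (hz : ∀ i, IsNilpotent (z i)) :
    IsNilpotent z := by
  choose k hk using hz
  refine ⟨∑ i, k i, ?_⟩
  funext i
  rw [Pi.pow_apply]
  exact pow_eq_zero_of_le (Finset.single_le_sum (f := k) (fun _ _ => Nat.zero_le _)
    (Finset.mem_univ i)) (hk i)

theorem isNilpotent_rK_e (V : FundamentalReps S) (j : Fin r) : IsNilpotent (rK V (S.e j)) :=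
  isNilpotent_pi fun i => (isNilpotent_e V i j).map (algebraMap ℂ K).mapMatrix

theorem isNilpotent_rK_f (V : FundamentalReps S) (j : Fin r) : IsNilpotent (rK V (S.f j)) :=
  isNilpotent_pi fun i => (isNilpotent_f V i j).map (algebraMap ℂ K).mapMatrix

theorem gU_xE (V : FundamentalReps S) (j : Fin r) (t : K) :
    gU V (xE V j t) = expU (t • rK V (S.e j)) ((isNilpotent_rK_e V j).smul t) := by
  ext1
  funext i
  exact (exp_apply ((isNilpotent_rK_e V j).smul t) i).symm

theorem gU_xF (V : FundamentalReps S) (j : Fin r) (t : K) :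
    gU V (xF V j t) = expU (t • rK V (S.f j)) ((isNilpotent_rK_f V j).smul t) := by
  ext1
  funext i
  exact (exp_apply ((isNilpotent_rK_f V j).smul t) i).symm

theorem expU_add {A : Type*} [Ring A] [Algebra ℚ A] {z w : A} (hz : IsNilpotent z)
    (hw : IsNilpotent w) (h : Commute z w) (hn : IsNilpotent (z + w)) :
    expU (z + w) hn = expU z hz * expU w hw :=
  Units.ext (IsNilpotent.exp_add_of_commute h hz hw)

theorem xE_add (V : FundamentalReps S) (j : Fin r) (s t : K) :
    xE V j (s + t) = xE V j s * xE V j t := by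
  apply gU_injective
  rw [map_mul, gU_xE, gU_xE, gU_xE]
  exact (expU_congr (add_smul s t (rK V (S.e j))) _ (by
    rw [← add_smul]; exact (isNilpotent_rK_e V j).smul _)).trans
    (expU_add _ _ (((Commute.refl _).smul_left _).smul_right _) _)

theorem xF_add (V : FundamentalReps S) (j : Fin r) (s t : K) :
    xF V j (s + t) = xF V j s * xF V j t := by
  apply gU_injective
  rw [map_mul, gU_xF, gU_xF, gU_xF]
  exact (expU_congr (add_smul s t (rK V (S.f j))) _ (by
    rw [← add_smul]; exact (isNilpotent_rK_f V j).smul _)).trans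
    (expU_add _ _ (((Commute.refl _).smul_left _).smul_right _) _)

@[simp] theorem xE_zero (V : FundamentalReps S) (j : Fin r) : xE V j 0 = 1 := by
  have := xE_add V j 0 0
  rw [add_zero] at this
  exact left_eq_mul.mp this

@[simp] theorem xF_zero (V : FundamentalReps S) (j : Fin r) : xF V j 0 = 1 := by
  have := xF_add V j 0 0
  rw [add_zero] at this
  exact left_eq_mul.mp this

theorem xE_neg (V : FundamentalReps S) (j : Fin r) (t : K) : xE V j (-t) = (xE V j t)⁻¹ := by
  rw [eq_inv_iff_mul_eq_one, ← xE_add, neg_add_cancel, xE_zero]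

theorem xF_neg (V : FundamentalReps S) (j : Fin r) (t : K) : xF V j (-t) = (xF V j t)⁻¹ := by
  rw [eq_inv_iff_mul_eq_one, ← xF_add, neg_add_cancel, xF_zero]

theorem gU_weylElt (V : FundamentalReps S) (j : Fin r) (t : K) :
    gU V (weylElt V j t) = weylU (t • rK V (S.e j)) (t⁻¹ • rK V (S.f j))
      ((isNilpotent_rK_e V j).smul t) ((isNilpotent_rK_f V j).smul t⁻¹) := by
  rw [weylElt, map_mul, map_mul, gU_xE, gU_xF, weylU]
  congr 2
  exact expU_congr (neg_smul t⁻¹ (rK V (S.f j))) _ _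

theorem rK_e_f (V : FundamentalReps S) (j : Fin r) {t : K} (ht : t ≠ 0) :
    (t • rK V (S.e j)) * (t⁻¹ • rK V (S.f j)) - (t⁻¹ • rK V (S.f j)) * (t • rK V (S.e j)) =
      rK V (S.h j) := by
  rw [smul_mul_smul_comm, smul_mul_smul_comm, mul_inv_cancel₀ ht, inv_mul_cancel₀ ht, one_smul,
    one_smul, ← rK_lie, S.lie_e_f, if_pos rfl]

theorem rK_h_e (V : FundamentalReps S) (j : Fin r) (t : K) :
    rK V (S.h j) * (t • rK V (S.e j)) - (t • rK V (S.e j)) * rK V (S.h j) =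
      2 • t • rK V (S.e j) := by
  rw [mul_smul_comm, smul_mul_assoc, ← smul_sub, ← rK_lie, S.lie_h_e, S.cartan_diag, map_smul,
    ← Nat.cast_smul_eq_nsmul ℂ, smul_comm]
  norm_num

theorem rK_h_f (V : FundamentalReps S) (j : Fin r) (t : K) :
    rK V (S.h j) * (t • rK V (S.f j)) - (t • rK V (S.f j)) * rK V (S.h j) =
      -(2 • t • rK V (S.f j)) := by
  rw [mul_smul_comm, smul_mul_assoc, ← smul_sub, ← rK_lie, S.lie_h_f, S.cartan_diag, map_smul,
    ← Nat.cast_smul_eq_nsmul ℂ, smul_comm]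
  norm_num

/-- `exp (t e)` in terms of the opposite root subgroup and `w(t)`. -/
theorem xE_eq (V : FundamentalReps S) (j : Fin r) {t : K} (ht : t ≠ 0) :
    xE V j t = xF V j t⁻¹ * weylElt V j t * xF V j t⁻¹ := by
  apply gU_injective
  rw [map_mul, map_mul, gU_weylElt, gU_xE, gU_xF]
  exact expU_eq_weylU _ _ (rK_e_f V j ht) (rK_h_e V j t) (rK_h_f V j t⁻¹)

theorem stable_of_generators (V : FundamentalReps S) (i : Fin r)
    (W : Submodule ℂ (Fin (V.dim i) → ℂ)) (he : ∀ j, ∀ w ∈ W, (V.ρ i (S.e j)).mulVec w ∈ W)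
    (hf : ∀ j, ∀ w ∈ W, (V.ρ i (S.f j)).mulVec w ∈ W) (x : 𝔤) :
    ∀ w ∈ W, (V.ρ i x).mulVec w ∈ W := by
  have hx : x ∈ LieSubalgebra.lieSpan ℂ 𝔤 (Set.range S.e ∪ Set.range S.f) := by
    rw [S.generates]; trivial
  refine LieSubalgebra.lieSpan_induction ℂ (p := fun x _ => ∀ w ∈ W, (V.ρ i x).mulVec w ∈ W)
    ?_ ?_ ?_ ?_ ?_ hx
  · rintro _ (⟨j, rfl⟩ | ⟨j, rfl⟩)
    · exact he j
    · exact hf j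
  · intro w _; simp
  · intro x y _ _ hx hy w hw
    rw [map_add, Matrix.add_mulVec]
    exact add_mem (hx w hw) (hy w hw)
  · intro a x _ hx w hw
    rw [map_smul, Matrix.smul_mulVec]
    exact W.smul_mem _ (hx w hw)
  · intro x y _ _ hx hy w hw
    rw [V.ρ_lie, Matrix.sub_mulVec, ← Matrix.mulVec_mulVec, ← Matrix.mulVec_mulVec]
    exact sub_mem (hx _ (hy w hw)) (hy _ (hx w hw))

/-- A vector of weight `μ`, written in the basis of fundamental weights. -/
def IsWt (V : FundamentalReps S) (i : Fin r) (μ : Fin r → ℤ) (v : Fin (V.dim i) → ℂ) : Prop :=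
  ∀ j, (V.ρ i (S.h j)).mulVec v = (μ j : ℂ) • v

/-- An element of `𝔤` of weight `c`. -/
def HasWt (S : ChevalleySystem r 𝔤) (c : Fin r → ℤ) (x : 𝔤) : Prop :=
  ∀ j, ⁅S.h j, x⁆ = (c j : ℂ) • x

theorem hasWt_e (j : Fin r) : HasWt S (fun k => S.cartan k j) (S.e j) := fun k => S.lie_h_e k j

theorem hasWt_f (j : Fin r) : HasWt S (fun k => -S.cartan k j) (S.f j) := fun k => by
  rw [S.lie_h_f]; push_cast; rfl

theorem HasWt.lie {c d : Fin r → ℤ} {x y : 𝔤} (hx : HasWt S c x) (hy : HasWt S d y) :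
    HasWt S (c + d) ⁅x, y⁆ := fun j => by
  rw [leibniz_lie, hx j, hy j, smul_lie, lie_smul, ← add_smul, Pi.add_apply, Int.cast_add]

theorem IsWt.mulVec {V : FundamentalReps S} {i : Fin r} {μ c : Fin r → ℤ}
    {v : Fin (V.dim i) → ℂ} {x : 𝔤} (hv : IsWt V i μ v) (hx : HasWt S c x) :
    IsWt V i (c + μ) ((V.ρ i x).mulVec v) := fun j => by
  have h := V.ρ_lie i (S.h j) x
  rw [hx j, map_smul, eq_sub_iff_add_eq] at h
  rw [Matrix.mulVec_mulVec, ← h, Matrix.add_mulVec, ← Matrix.mulVec_mulVec, hv j,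
    Matrix.mulVec_smul, Matrix.smul_mulVec, ← add_smul, Pi.add_apply, Int.cast_add]

theorem isWt_ν (V : FundamentalReps S) (i : Fin r) : IsWt V i (Pi.single i 1) (V.ν i) := fun j => by
  rw [V.h_ν]
  by_cases h : i = j
  · subst h; simp
  · rw [if_neg h, Pi.single_eq_of_ne (Ne.symm h)]; simp

/-- The weight vectors span a subspace stable under the Chevalley generators. It contains the
highest weight vector, so irreducibility makes it everything. -/
theorem span_isWt (V : FundamentalReps S) (i : Fin r) :
    Submodule.span ℂ {v | ∃ μ, IsWt V i μ v} = ⊤ := by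
  set W := Submodule.span ℂ {v | ∃ μ, IsWt V i μ v} with hW
  have hst : ∀ (x : 𝔤) (c : Fin r → ℤ), HasWt S c x → ∀ w ∈ W, (V.ρ i x).mulVec w ∈ W := by
    intro x c hx w hw
    induction hw using Submodule.span_induction with
    | mem w hw =>
      obtain ⟨μ, hμ⟩ := hw
      exact Submodule.subset_span ⟨_, hμ.mulVec hx⟩
    | zero => simp
    | add a b _ _ ha hb => rw [Matrix.mulVec_add]; exact add_mem ha hb
    | smul a b _ hb => rw [Matrix.mulVec_smul]; exact W.smul_mem _ hb
  rcases V.irreducible i W (stable_of_generators V i W (fun j => hst _ _ (hasWt_e j))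
    (fun j => hst _ _ (hasWt_f j))) with h | h
  · exfalso
    have : V.ν i ∈ W := Submodule.subset_span ⟨_, isWt_ν V i⟩
    rw [h, Submodule.mem_bot] at this
    exact V.ν_ne_zero i this
  · exact h

/-- Extension of scalars of a vector from `ℂ` to `ℂ(u)`. -/
def vK {n : ℕ} (v : Fin n → ℂ) : Fin n → K := fun a => algebraMap ℂ K (v a)

theorem map_mulVec_vK {n : ℕ} (M : Matrix (Fin n) (Fin n) ℂ) (v : Fin n → ℂ) :
    (M.map (algebraMap ℂ K)).mulVec (vK v) = vK (M.mulVec v) := by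
  funext a
  exact ((algebraMap ℂ K).map_mulVec M v a).symm

theorem vK_smul {n : ℕ} (c : ℂ) (v : Fin n → ℂ) : vK (c • v) = algebraMap ℂ K c • vK v := by
  funext a; simp [vK]

theorem vK_injective {n : ℕ} : Function.Injective (vK (n := n)) := fun v w h => by
  funext a
  exact (algebraMap ℂ K).injective (congrFun h a)

theorem span_vK {n : ℕ} {s : Set (Fin n → ℂ)} (hs : Submodule.span ℂ s = ⊤) :
    Submodule.span K (vK '' s) = ⊤ := by
  have h : ∀ v ∈ Submodule.span ℂ s, vK v ∈ Submodule.span K (vK '' s) := by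
    intro v hv
    induction hv using Submodule.span_induction with
    | mem w hw => exact Submodule.subset_span ⟨w, hw, rfl⟩
    | zero =>
      convert Submodule.zero_mem _
      funext a; simp [vK]
    | add a b _ _ ha hb =>
      convert add_mem ha hb
      funext a; simp [vK]
    | smul a b _ hb => rw [vK_smul]; exact Submodule.smul_mem _ _ hb
  rw [eq_top_iff, ← (Pi.basisFun K (Fin n)).span_eq, Submodule.span_le]
  rintro _ ⟨a, rfl⟩
  have := h (Pi.single a 1) (by rw [hs]; trivial)
  have e : vK (Pi.single a 1) = Pi.basisFun K (Fin n) a := by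
    funext b
    simp only [Pi.basisFun_apply, vK]
    by_cases hb : b = a
    · subst hb; simp
    · simp [Pi.single_eq_of_ne hb]
  rwa [e] at this

theorem IsWt.vK {V : FundamentalReps S} {i : Fin r} {μ : Fin r → ℤ} {v : Fin (V.dim i) → ℂ}
    (hv : IsWt V i μ v) (j : Fin r) :
    (rK V (S.h j) i).mulVec (vK v) = ((μ j : ℤ) : K) • HOper.vK v := by
  rw [rK_apply, map_mulVec_vK, hv j, vK_smul]
  simp

/-- This is how identities involving the torus are checked below: complex weight vectors still span
after extension of scalars to `ℂ(u)`. -/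
theorem alg_ext {V : FundamentalReps S} {P Q : Alg V}
    (h : ∀ i μ v, IsWt V i μ v → (P i).mulVec (vK v) = (Q i).mulVec (vK v)) : P = Q := by
  funext i
  refine matrix_ext_of_span (span_vK (span_isWt V i)) ?_
  rintro _ ⟨v, ⟨μ, hv⟩, rfl⟩
  exact h i μ v hv

/-- `t ^ α̌_j` acts by `t ^ ⟨μ, α̌_j⟩` on vectors of weight `μ`. -/
theorem cochar_mulVec (V : FundamentalReps S) (i j : Fin r) {t : K} (ht : t ≠ 0)
    {v : Fin (V.dim i) → K} {m : ℤ} (hv : (rK V (S.h j) i).mulVec v = (m : K) • v) :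
    (gval V (cochar V j t) i).mulVec v = t ^ m • v := by
  have hspan : Submodule.span K {v : Fin (V.dim i) → K |
      ∃ m : ℤ, (rK V (S.h j) i).mulVec v = (m : K) • v} = ⊤ := by
    rw [eq_top_iff, ← span_vK (span_isWt V i)]
    refine Submodule.span_mono ?_
    rintro _ ⟨v, ⟨μ, hv⟩, rfl⟩
    exact ⟨μ j, hv.vK j⟩
  have hE : IsNilpotent (rK V (S.e j) i) := (isNilpotent_rK_e V j).map (Pi.evalRingHom _ i)
  have hF : IsNilpotent (rK V (S.f j) i) := (isNilpotent_rK_f V j).map (Pi.evalRingHom _ i)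
  have h1 := congrFun (rK_e_f V j one_ne_zero) i
  have h2 := congrFun (rK_h_e V j 1) i
  have h3 := congrFun (rK_h_f V j 1) i
  simp only [inv_one, one_smul] at h1 h2 h3
  have key := cochar_aux hE hF h1 h2 h3 hspan ht hv
  convert key using 2
  have e : ∀ t : K, ∃ w : (Matrix (Fin (V.dim i)) (Fin (V.dim i)) K)ˣ,
    w = weylU (t • rK V (S.e j) i) (t⁻¹ • rK V (S.f j) i) (hE.smul t) (hF.smul _) ∧
      (weylElt V j t).1 i = w := by
    intro t
    refine ⟨_, rfl, ?_⟩
    rw [weylU, expU_congr (neg_smul t⁻¹ (rK V (S.f j) i)).symm _ (hF.smul _)]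
    ext1
    rfl
  obtain ⟨w, hw, hwt⟩ := e t
  obtain ⟨w', hw', hwt'⟩ := e 1
  rw [← hw]
  have : weylU (rK V (S.e j) i) (rK V (S.f j) i) hE hF = w' := by
    rw [hw']; simp only [weylU, expU, inv_one, one_smul]
  rw [this, ← hwt, ← hwt']
  rfl

theorem cochar_mulVec_vK {V : FundamentalReps S} {i : Fin r} {μ : Fin r → ℤ}
    {v : Fin (V.dim i) → ℂ} (hv : IsWt V i μ v) (j : Fin r) {t : K} (ht : t ≠ 0) :
    (gval V (cochar V j t) i).mulVec (vK v) = t ^ μ j • vK v :=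
  cochar_mulVec V i j ht (hv.vK j)

theorem gval_mul_apply (V : FundamentalReps S) (g h : G V) (i : Fin r) (v : Fin (V.dim i) → K) :
    (gval V (g * h) i).mulVec v = (gval V g i).mulVec ((gval V h i).mulVec v) := by
  rw [map_mul, Pi.mul_apply, Matrix.mulVec_mulVec]

theorem cochar_mul (V : FundamentalReps S) (j : Fin r) {s t : K} (hs : s ≠ 0) (ht : t ≠ 0) :
    cochar V j (s * t) = cochar V j s * cochar V j t := by
  apply gval_injective
  refine alg_ext fun i μ v hv => ?_
  rw [gval_mul_apply, cochar_mulVec_vK hv j ht, Matrix.mulVec_smul, cochar_mulVec_vK hv j hs,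
    cochar_mulVec_vK hv j (mul_ne_zero hs ht), smul_smul, mul_zpow, mul_comm]

@[simp] theorem cochar_one (V : FundamentalReps S) (j : Fin r) : cochar V j 1 = 1 := by
  rw [cochar, mul_inv_cancel]

/-- Conjugation by `t ^ α̌_j` on elements of weight `c`. -/
theorem cochar_mul_rK (V : FundamentalReps S) (j : Fin r) {t : K} (ht : t ≠ 0) {c : Fin r → ℤ}
    {x : 𝔤} (hx : HasWt S c x) :
    gval V (cochar V j t) * rK V x = t ^ c j • (rK V x * gval V (cochar V j t)) := by
  refine alg_ext fun i μ v hv => ?_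
  rw [Pi.mul_apply, Pi.smul_apply, Pi.mul_apply, ← Matrix.mulVec_mulVec, rK_apply, map_mulVec_vK,
    cochar_mulVec_vK (hv.mulVec hx) j ht, Matrix.smul_mulVec, ← Matrix.mulVec_mulVec,
    cochar_mulVec_vK hv j ht, Matrix.mulVec_smul, map_mulVec_vK, smul_smul, Pi.add_apply,
    zpow_add₀ ht]

end Rep

/-! ### Ordered products -/

section OrderedProducts

variable {M : Type*} [Monoid M]

theorem oprod_castSucc {n : ℕ} (a : Fin (n + 1) → M) :
    oprod a = oprod (fun i => a i.castSucc) * a (Fin.last n) := by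
  rw [oprod, List.ofFn_succ', List.concat_eq_append, List.prod_append, List.prod_singleton, oprod]

/-- A common induction principle: images under homomorphisms, commutation with a fixed element and
eigenvalues on a vector are all multiplicative relations. -/
theorem oprod_rel {N : Type*} [Monoid N] (R : M → N → Prop) (h1 : R 1 1)
    (hmul : ∀ a b c d, R a c → R b d → R (a * b) (c * d)) {n : ℕ} {a : Fin n → M} {b : Fin n → N}
    (h : ∀ i, R (a i) (b i)) : R (oprod a) (oprod b) := by
  induction n with
  | zero => simpa [oprod] using h1
  | succ n ih =>
    rw [oprod_castSucc, oprod_castSucc]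
    exact hmul _ _ _ _ (ih fun i => h _) (h _)

theorem oprod_eq_prod {N : Type*} [CommMonoid N] {n : ℕ} (a : Fin n → N) : oprod a = ∏ i, a i := by
  rw [oprod, List.prod_ofFn]

theorem map_oprod {N F : Type*} [Monoid N] [FunLike F M N] [MonoidHomClass F M N] (f : F) {n : ℕ}
    (a : Fin n → M) : f (oprod a) = oprod fun i => f (a i) :=
  oprod_rel (fun x y => f x = y) (map_one f) (by rintro a b _ _ rfl rfl; exact map_mul f a b)
    fun _ => rfl

theorem oprod_mem {S : Submonoid M} {n : ℕ} {a : Fin n → M} (h : ∀ i, a i ∈ S) : oprod a ∈ S :=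
  Submonoid.list_prod_mem _ (by simpa [List.mem_ofFn] using h)

theorem oprod_mem' {G : Type*} [Group G] {S : Subgroup G} {n : ℕ} {a : Fin n → G}
    (h : ∀ i, a i ∈ S) : oprod a ∈ S :=
  oprod_mem (S := S.toSubmonoid) h

theorem oprod_mul_of_rel {n : ℕ} {X Y : Fin n → M} {a : M} (h : ∀ i, X i * a = a * Y i) :
    oprod X * a = a * oprod Y := by
  refine oprod_rel (fun x y => x * a = a * y) (by simp) ?_ h
  intro x y z w h1 h2
  rw [mul_assoc, h2, ← mul_assoc, h1, mul_assoc]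

/-- Moving the factors `a i` of an ordered product of terms `a i * X i (t i)` to the left. -/
theorem oprod_mul_eq {F : Type*} [CommMonoid F] {n : ℕ} (a : Fin n → M) (X : Fin n → F → M)
    (c : Fin n → Fin n → F) (h : ∀ j i t, X i t * a j = a j * X i (c j i * t)) (t : Fin n → F) :
    oprod (fun i => a i * X i (t i)) =
      oprod a * oprod fun i => X i ((∏ j with i < j, c j i) * t i) := by
  induction n with
  | zero => simp [oprod]
  | succ n ih =>
    have e1 : ∀ i : Fin n, ∏ j with i.castSucc < j, c j i.castSucc =
        c (Fin.last n) i.castSucc * ∏ j with i < j, c j.castSucc i.castSucc := by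
      intro i
      rw [Finset.prod_filter, Fin.prod_univ_castSucc, if_pos (Fin.castSucc_lt_last i), mul_comm,
        Finset.prod_filter]
      simp
    have e2 : ∏ j with Fin.last n < j, c j (Fin.last n) = 1 := by
      refine Finset.prod_eq_one fun j hj => ?_
      simp only [Finset.mem_filter, Finset.mem_univ, true_and] at hj
      exact absurd (Fin.le_last j) (not_le.mpr hj)
    rw [oprod_castSucc, oprod_castSucc, oprod_castSucc,
      ih (fun i => a i.castSucc) (fun i => X i.castSucc) (fun j i => c j.castSucc i.castSucc)
        (fun j i t => h _ _ t) (fun i => t i.castSucc), e2, one_mul]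
    have := oprod_mul_of_rel (a := a (Fin.last n))
      (X := fun i : Fin n => X i.castSucc ((∏ j with i < j, c j.castSucc i.castSucc) *
        t i.castSucc))
      (Y := fun i : Fin n => X i.castSucc ((∏ j with i.castSucc < j, c j i.castSucc) *
        t i.castSucc)) (fun i => by rw [h, e1, mul_assoc])
    rw [mul_assoc, ← mul_assoc _ (a (Fin.last n)), this]
    simp only [mul_assoc]

end OrderedProducts

/-! ### The torus and its commutation relations -/

section Torus

variable {r : ℕ} {𝔤 : Type*} [LieRing 𝔤] [LieAlgebra ℂ 𝔤] {S : ChevalleySystem r 𝔤}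

theorem gU_mul_expU {V : FundamentalReps S} {g : G V} {z z' : Alg V} (hz : IsNilpotent z)
    (hz' : IsNilpotent z') (h : gval V g * z = z' * gval V g) :
    gU V g * expU z hz = expU z' hz' * gU V g := by
  rw [← mul_inv_eq_iff_eq_mul]
  ext1
  have h1 := IsNilpotent.exp_smul (ConjAct.toConjAct (gU V g)) hz
  rw [ConjAct.units_smul_def, ConjAct.units_smul_def, ConjAct.ofConjAct_toConjAct, gU_val, h,
    mul_assoc, ← gU_val, Units.mul_inv, mul_one] at h1
  exact h1.symm

theorem cochar_mul_xE (V : FundamentalReps S) (j i : Fin r) {t : K} (ht : t ≠ 0) (a : K) :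
    cochar V j t * xE V i a = xE V i (t ^ S.cartan j i * a) * cochar V j t := by
  apply gU_injective
  rw [map_mul, map_mul, gU_xE, gU_xE]
  refine gU_mul_expU _ _ ?_
  rw [mul_smul_comm, cochar_mul_rK V j ht (hasWt_e i), smul_mul_assoc, smul_smul, mul_comm]

theorem cochar_mul_xF (V : FundamentalReps S) (j i : Fin r) {t : K} (ht : t ≠ 0) (a : K) :
    cochar V j t * xF V i a = xF V i (t ^ (-S.cartan j i) * a) * cochar V j t := by
  apply gU_injective
  rw [map_mul, map_mul, gU_xF, gU_xF]
  refine gU_mul_expU _ _ ?_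
  rw [mul_smul_comm, cochar_mul_rK V j ht (hasWt_f i), smul_mul_assoc, smul_smul, mul_comm]

theorem cochar_mul_weylElt (V : FundamentalReps S) (j i : Fin r) {t : K} (ht : t ≠ 0) (a : K) :
    cochar V j t * weylElt V i a = weylElt V i (t ^ S.cartan j i * a) * cochar V j t := by
  have h1 : SemiconjBy (cochar V j t) (xE V i a) (xE V i (t ^ S.cartan j i * a)) :=
    cochar_mul_xE V j i ht a
  have h2 : SemiconjBy (cochar V j t) (xF V i (-a⁻¹)) (xF V i (-(t ^ S.cartan j i * a)⁻¹)) := by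
    have := cochar_mul_xF V j i ht (-a⁻¹)
    rwa [mul_neg, zpow_neg, ← mul_inv] at this
  exact (h1.mul_right h2).mul_right h1

theorem weylElt_eq (V : FundamentalReps S) (i : Fin r) (t : K) :
    weylElt V i t = cochar V i t * simpleLift V i := by
  rw [cochar, simpleLift, inv_mul_cancel_right]

theorem cochar_mul_simpleLift (V : FundamentalReps S) (j i : Fin r) {t : K} (ht : t ≠ 0) :
    cochar V j t * simpleLift V i =
      cochar V i (t ^ S.cartan j i) * simpleLift V i * cochar V j t := by
  rw [simpleLift, cochar_mul_weylElt V j i ht, mul_one, weylElt_eq]; rfl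

theorem simpleLift_mul_cochar (V : FundamentalReps S) (j i : Fin r) {t : K} (ht : t ≠ 0) :
    simpleLift V i * cochar V j t =
      (cochar V i (t ^ S.cartan j i))⁻¹ * cochar V j t * simpleLift V i := by
  rw [mul_assoc, cochar_mul_simpleLift V j i ht, mul_assoc, inv_mul_cancel_left]

theorem cochar_inv (V : FundamentalReps S) (j : Fin r) {t : K} (ht : t ≠ 0) :
    (cochar V j t)⁻¹ = cochar V j t⁻¹ := by
  rw [inv_eq_iff_mul_eq_one, ← cochar_mul V j ht (inv_ne_zero ht), mul_inv_cancel₀ ht, cochar_one]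

/-- The element `∏_j h_j ^ α̌_j` of the torus. -/
def tor (V : FundamentalReps S) (h : Fin r → K) : G V := oprod fun j => cochar V j (h j)

theorem tor_mulVec_vK {V : FundamentalReps S} {i : Fin r} {μ : Fin r → ℤ}
    {v : Fin (V.dim i) → ℂ} (hv : IsWt V i μ v) {h : Fin r → K} (hh : ∀ j, h j ≠ 0) :
    (gval V (tor V h) i).mulVec (vK v) = (∏ j, h j ^ μ j) • vK v := by
  rw [← oprod_eq_prod, tor]
  refine oprod_rel (fun (g : G V) (c : K) => (gval V g i).mulVec (vK v) = c • vK v) ?_ ?_ ?_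
  · simp
  · intro a b c d h1 h2
    rw [gval_mul_apply, h2, Matrix.mulVec_smul, h1, smul_smul, mul_comm]
  · exact fun j => cochar_mulVec_vK hv j (hh j)

theorem tor_mul_rK (V : FundamentalReps S) {h : Fin r → K} (hh : ∀ j, h j ≠ 0) {c : Fin r → ℤ}
    {x : 𝔤} (hx : HasWt S c x) :
    gval V (tor V h) * rK V x = (∏ j, h j ^ c j) • (rK V x * gval V (tor V h)) := by
  refine alg_ext fun i μ v hv => ?_
  rw [Pi.mul_apply, Pi.smul_apply, Pi.mul_apply, ← Matrix.mulVec_mulVec, rK_apply, map_mulVec_vK,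
    tor_mulVec_vK (hv.mulVec hx) hh, Matrix.smul_mulVec, ← Matrix.mulVec_mulVec,
    tor_mulVec_vK hv hh, Matrix.mulVec_smul, map_mulVec_vK, smul_smul, ← Finset.prod_mul_distrib]
  congr 1
  exact Finset.prod_congr rfl fun j _ => by rw [Pi.add_apply, zpow_add₀ (hh j)]

theorem tor_mul_xE (V : FundamentalReps S) {h : Fin r → K} (hh : ∀ j, h j ≠ 0) (i : Fin r)
    (a : K) : tor V h * xE V i a = xE V i ((∏ j, h j ^ S.cartan j i) * a) * tor V h := by
  apply gU_injective
  rw [map_mul, map_mul, gU_xE, gU_xE]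
  refine gU_mul_expU _ _ ?_
  rw [mul_smul_comm, tor_mul_rK V hh (hasWt_e i), smul_mul_assoc, smul_smul, mul_comm]

theorem xE_mul_tor (V : FundamentalReps S) {h : Fin r → K} (hh : ∀ j, h j ≠ 0) (i : Fin r)
    (a : K) : xE V i a * tor V h = tor V h * xE V i ((∏ j, h j ^ (-S.cartan j i)) * a) := by
  rw [tor_mul_xE V hh, ← mul_assoc, ← Finset.prod_mul_distrib]
  have : ∀ j, h j ^ S.cartan j i * h j ^ (-S.cartan j i) = 1 := fun j => by
    rw [← zpow_add₀ (hh j), add_neg_cancel, zpow_zero]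
  rw [Finset.prod_congr rfl fun j _ => this j, Finset.prod_const_one, one_mul]

theorem tor_mul (V : FundamentalReps S) {h k : Fin r → K} (hh : ∀ j, h j ≠ 0)
    (hk : ∀ j, k j ≠ 0) : tor V (fun j => h j * k j) = tor V h * tor V k := by
  apply gval_injective
  refine alg_ext fun i μ v hv => ?_
  rw [gval_mul_apply, tor_mulVec_vK hv hk, Matrix.mulVec_smul, tor_mulVec_vK hv hh,
    tor_mulVec_vK hv fun j => mul_ne_zero (hh j) (hk j), smul_smul, ← Finset.prod_mul_distrib]
  congr 1
  exact Finset.prod_congr rfl fun j _ => by rw [mul_zpow, mul_comm]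

@[simp] theorem tor_one (V : FundamentalReps S) : tor V (fun _ => 1) = 1 := by
  simp [tor, oprod]

theorem tor_inv (V : FundamentalReps S) {h : Fin r → K} (hh : ∀ j, h j ≠ 0) :
    (tor V h)⁻¹ = tor V fun j => (h j)⁻¹ := by
  rw [inv_eq_iff_mul_eq_one, ← tor_mul V hh fun j => inv_ne_zero (hh j)]
  simp [mul_inv_cancel₀ (hh _)]

theorem tor_mem_torus (V : FundamentalReps S) {h : Fin r → K} (hh : ∀ j, h j ≠ 0) :
    tor V h ∈ torus V :=
  oprod_mem' fun j => Subgroup.subset_closure ⟨j, h j, hh j, rfl⟩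

theorem normalForm_eq (V : FundamentalReps S) (Λ : Fin r → ℂ[X]) {g : Fin r → K}
    (hg : ∀ i, g i ≠ 0) : normalForm V Λ g = tor V g *
      oprod fun i => xE V i ((∏ j with i < j, g j ^ (-S.cartan j i)) * (toK (Λ i) / g i)) := by
  refine oprod_mul_eq (fun i => cochar V i (g i)) (fun i => xE V i)
    (fun j i => g j ^ (-S.cartan j i)) (fun j i t => ?_) (fun i => toK (Λ i) / g i)
  rw [cochar_mul_xE V j i (hg j), ← mul_assoc, ← zpow_add₀ (hg j), add_neg_cancel, zpow_zero,
    one_mul]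

@[simp] theorem gShift_xE (ħ : ℂˣ) (V : FundamentalReps S) (j : Fin r) (t : K) :
    gShift ħ V (xE V j t) = xE V j (shift ħ t) :=
  Subtype.ext (funext fun _ => map_shift_expGL ħ _ (isNilpotent_e V _ j) t)

@[simp] theorem gShift_xF (ħ : ℂˣ) (V : FundamentalReps S) (j : Fin r) (t : K) :
    gShift ħ V (xF V j t) = xF V j (shift ħ t) :=
  Subtype.ext (funext fun _ => map_shift_expGL ħ _ (isNilpotent_f V _ j) t)

@[simp] theorem gShift_cochar (ħ : ℂˣ) (V : FundamentalReps S) (j : Fin r) (t : K) :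
    gShift ħ V (cochar V j t) = cochar V j (shift ħ t) := by
  simp [cochar, weylElt]

@[simp] theorem gShift_tor (ħ : ℂˣ) (V : FundamentalReps S) (h : Fin r → K) :
    gShift ħ V (tor V h) = tor V fun j => shift ħ (h j) := by
  rw [tor, map_oprod]; simp [tor]

theorem twist_eq_tor (V : FundamentalReps S) (ζ : Fin r → ℂˣ) :
    twist V ζ = tor V fun i => constK (ζ i) := rfl

end Torus

/-- Scalar multiplication by rational numbers, taken from the `ℚ`-algebra structure. -/
instance ratSMulK : SMul ℚ K := Algebra.toSMul

/-! ### The grading by height and the filtration by length of brackets -/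

section Grading

variable {r : ℕ} {𝔤 : Type*} [LieRing 𝔤] [LieAlgebra ℂ 𝔤] {S : ChevalleySystem r 𝔤}

/-- The algebra `∏_i End(V_i)`. -/
abbrev AlgC (V : FundamentalReps S) : Type := ∀ i, Matrix (Fin (V.dim i)) (Fin (V.dim i)) ℂ

/-- The representation of `𝔤` on all fundamental representations. -/
def rC (V : FundamentalReps S) : 𝔤 →ₗ[ℂ] AlgC V := LinearMap.pi V.ρ

theorem rC_lie (V : FundamentalReps S) (x y : 𝔤) :
    rC V ⁅x, y⁆ = rC V x * rC V y - rC V y * rC V x :=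
  funext fun i => V.ρ_lie i x y

/-- Extension of scalars from `ℂ` to `ℂ(u)`. -/
def extA (V : FundamentalReps S) : AlgC V →+* Alg V :=
  RingHom.pi fun i => (algebraMap ℂ K).mapMatrix.comp (Pi.evalRingHom _ i)

theorem extA_rC (V : FundamentalReps S) (x : 𝔤) : extA V (rC V x) = rK V x := rfl

theorem extA_smul (V : FundamentalReps S) (c : ℂ) (M : AlgC V) :
    extA V (c • M) = algebraMap ℂ K c • extA V M := by
  funext i
  ext a b
  exact map_mul (algebraMap ℂ K) c (M i a b)

/-- The elements of degree at least `l`, homogeneous for the commutator with `d`. -/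
def degSet (V : FundamentalReps S) (d : 𝔤) (l : ℕ) : Set (AlgC V) :=
  {M | ∃ m : ℕ, l ≤ m ∧ rC V d * M - M * rC V d = (m : ℂ) • M}

theorem degSet_anti (V : FundamentalReps S) (d : 𝔤) {a b : ℕ} (h : a ≤ b) :
    degSet V d b ⊆ degSet V d a := fun _ ⟨m, hm, h'⟩ => ⟨m, h.trans hm, h'⟩

theorem degSet_mul (V : FundamentalReps S) (d : 𝔤) {a b : ℕ} {M N : AlgC V}
    (hM : M ∈ degSet V d a) (hN : N ∈ degSet V d b) : M * N ∈ degSet V d (a + b) := by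
  obtain ⟨m, hm, hM⟩ := hM
  obtain ⟨n, hn, hN⟩ := hN
  refine ⟨m + n, by omega, ?_⟩
  have : rC V d * (M * N) - M * N * rC V d =
      (rC V d * M - M * rC V d) * N + M * (rC V d * N - N * rC V d) := by noncomm_ring
  rw [this, hM, hN, smul_mul_assoc, mul_smul_comm, ← add_smul]
  push_cast; rfl

/-- Degrees are eigenvalues of the commutator with `d` on a finite-dimensional space, so only
finitely many occur. -/
theorem exists_degSet_eq_zero (V : FundamentalReps S) (d : 𝔤) :
    ∃ L : ℕ, ∀ M ∈ degSet V d L, M = 0 := by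
  let T : Module.End ℂ (AlgC V) := LinearMap.mulLeft ℂ (rC V d) - LinearMap.mulRight ℂ (rC V d)
  have hfin := Module.End.finite_hasEigenvalue T
  have hfin' : {m : ℕ | T.HasEigenvalue (m : ℂ)}.Finite :=
    hfin.preimage (Nat.cast_injective.injOn)
  obtain ⟨L, hL⟩ := hfin'.bddAbove
  refine ⟨L + 1, ?_⟩
  rintro M ⟨m, hm, hM⟩
  by_contra h0
  have : T.HasEigenvalue (m : ℂ) :=
    Module.End.hasEigenvalue_of_hasEigenvector ⟨Module.End.mem_eigenspace_iff.mpr hM, h0⟩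
  have := hL this
  omega

/-- The elements of degree at least `l` over `ℂ(u)`. -/
def AK (V : FundamentalReps S) (d : 𝔤) (l : ℕ) : Submodule K (Alg V) :=
  Submodule.span K (extA V '' degSet V d l)

theorem AK_anti (V : FundamentalReps S) (d : 𝔤) {a b : ℕ} (h : a ≤ b) : AK V d b ≤ AK V d a :=
  Submodule.span_mono (Set.image_mono (degSet_anti V d h))

theorem AK_mul (V : FundamentalReps S) (d : 𝔤) {a b : ℕ} {M N : Alg V} (hM : M ∈ AK V d a)
    (hN : N ∈ AK V d b) : M * N ∈ AK V d (a + b) := by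
  have h := Submodule.mul_mem_mul hM hN
  rw [AK, AK, Submodule.span_mul_span] at h
  refine Submodule.span_mono ?_ h
  rintro _ ⟨_, ⟨M, hM, rfl⟩, _, ⟨N, hN, rfl⟩, rfl⟩
  exact ⟨M * N, degSet_mul V d hM hN, map_mul _ _ _⟩

theorem exists_AK_eq_bot (V : FundamentalReps S) (d : 𝔤) : ∃ L : ℕ, AK V d L = ⊥ := by
  obtain ⟨L, hL⟩ := exists_degSet_eq_zero V d
  refine ⟨L, ?_⟩
  rw [AK, Submodule.span_eq_bot]
  rintro _ ⟨M, hM, rfl⟩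
  rw [hL M hM, map_zero]

theorem isNilpotent_of_mem_AK {V : FundamentalReps S} {d : 𝔤} {z : Alg V} (hz : z ∈ AK V d 1) :
    IsNilpotent z := by
  have hpow : ∀ n : ℕ, z ^ (n + 1) ∈ AK V d (n + 1) := by
    intro n
    induction n with
    | zero => simpa using hz
    | succ n ih => rw [pow_succ]; exact AK_mul V d ih hz
  obtain ⟨L, hL⟩ := exists_AK_eq_bot V d
  refine ⟨L + 1, ?_⟩
  have := AK_anti V d (Nat.le_succ L) (hpow L)
  rwa [hL, Submodule.mem_bot] at this

theorem rat_smul (V : FundamentalReps S) (c : ℚ) (z : Alg V) :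
    c • z = algebraMap ℚ K c • z := by
  funext i
  ext a b
  exact Algebra.smul_def c (z i a b)

theorem exp_sub_one_sub_mem {V : FundamentalReps S} {d : 𝔤} {l : ℕ} (hl : 1 ≤ l) {z : Alg V}
    (hz : z ∈ AK V d l) : IsNilpotent.exp z - 1 - z ∈ AK V d (l + 1) := by
  obtain ⟨k, hk⟩ := isNilpotent_of_mem_AK (AK_anti V d hl hz)
  have hk2 : z ^ (k + 2) = 0 := by rw [pow_add, hk, zero_mul]
  rw [IsNilpotent.exp_eq_sum hk2, Finset.sum_range_succ', Finset.sum_range_succ']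
  have hpow : ∀ n : ℕ, z ^ (n + 2) ∈ AK V d (l + 1) := by
    intro n
    induction n with
    | zero => rw [zero_add, pow_two]; exact AK_anti V d (by omega) (AK_mul V d hz hz)
    | succ n ih =>
      rw [add_right_comm, pow_succ]
      exact AK_anti V d (by omega) (AK_mul V d ih hz)
  have e : ∀ s : Alg V, s + ((0 + 1).factorial : ℚ)⁻¹ • z ^ (0 + 1) +
      (Nat.factorial 0 : ℚ)⁻¹ • z ^ 0 - 1 - z = s := by
    intro s; simp [rat_smul]
  rw [e]
  refine Submodule.sum_mem _ fun i _ => ?_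
  rw [rat_smul]
  exact Submodule.smul_mem _ _ (hpow i)

/-- Iterated brackets `⁅x i₁, ⁅x i₂, …⁆⁆` of length `n`. -/
def words (x : Fin r → 𝔤) : ℕ → Set 𝔤
  | 0 => ∅
  | 1 => Set.range x
  | n + 2 => {z | ∃ i, ∃ y ∈ words x (n + 1), z = ⁅x i, y⁆}

theorem lie_words_mem {x : Fin r → 𝔤} (i : Fin r) {n : ℕ} {y : 𝔤} (hy : y ∈ words x n) :
    ⁅x i, y⁆ ∈ words x (n + 1) := by
  rcases n with _ | n
  · exact hy.elim
  · exact ⟨i, y, hy, rfl⟩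

/-- The span of the iterated brackets of length `n`. -/
def wordSpan (x : Fin r → 𝔤) (n : ℕ) : Submodule ℂ 𝔤 := Submodule.span ℂ (words x n)

theorem lie_wordSpan_mem {x : Fin r → 𝔤} (i : Fin r) {n : ℕ} {y : 𝔤} (hy : y ∈ wordSpan x n) :
    ⁅x i, y⁆ ∈ wordSpan x (n + 1) := by
  induction hy using Submodule.span_induction with
  | mem y hy => exact Submodule.subset_span (lie_words_mem i hy)
  | zero => simp
  | add a b _ _ ha hb => rw [lie_add]; exact add_mem ha hb
  | smul c a _ ha => rw [lie_smul]; exact Submodule.smul_mem _ _ ha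

/-- The Jacobi identity `⁅⁅x_i, y⁆, z⁆ = ⁅x_i, ⁅y, z⁆⁆ - ⁅y, ⁅x_i, z⁆⁆` allows induction on the
length of the left entry, the right entry being arbitrary. -/
theorem wordSpan_lie_mem {x : Fin r → 𝔤} {a b : ℕ} {y z : 𝔤} (hy : y ∈ wordSpan x a)
    (hz : z ∈ wordSpan x b) : ⁅y, z⁆ ∈ wordSpan x (a + b) := by
  induction hy using Submodule.span_induction with
  | zero => simp
  | add y y' _ _ h h' => rw [add_lie]; exact add_mem h h'
  | smul c y _ h => rw [smul_lie]; exact Submodule.smul_mem _ _ h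
  | mem y hy =>
    induction a using Nat.twoStepInduction generalizing y z b with
    | zero => exact hy.elim
    | one =>
      obtain ⟨i, rfl⟩ := hy
      rw [add_comm]
      exact lie_wordSpan_mem i hz
    | more n _ ih =>
      obtain ⟨i, y, hy, rfl⟩ := hy
      rw [lie_lie]
      refine sub_mem ?_ ?_
      · have := lie_wordSpan_mem i (ih hz y hy)
        convert this using 2
        omega
      · have := ih (lie_wordSpan_mem i hz) y hy
        convert this using 2
        omega

theorem lie_of_mem_words {x : Fin r → 𝔤} {d : 𝔤} (hd : ∀ i, ⁅d, x i⁆ = x i) {n : ℕ} {y : 𝔤}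
    (hy : y ∈ words x n) : ⁅d, y⁆ = (n : ℂ) • y := by
  induction n using Nat.twoStepInduction generalizing y with
  | zero => exact hy.elim
  | one =>
    obtain ⟨i, rfl⟩ := hy
    simpa using hd i
  | more n _ ih =>
    obtain ⟨i, y, hy, rfl⟩ := hy
    rw [leibniz_lie, hd, ih hy, lie_smul]
    push_cast
    module

theorem rC_mem_degSet {V : FundamentalReps S} {x : Fin r → 𝔤} {d : 𝔤} (hd : ∀ i, ⁅d, x i⁆ = x i)
    {n : ℕ} {y : 𝔤} (hy : y ∈ words x n) : rC V y ∈ degSet V d n :=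
  ⟨n, le_rfl, by rw [← rC_lie, lie_of_mem_words hd hy, map_smul]⟩

/-- The `ℂ(u)`-span of the iterated brackets of length at least `l`. -/
def wordsK (V : FundamentalReps S) (x : Fin r → 𝔤) (l : ℕ) : Submodule K (Alg V) :=
  Submodule.span K (rK V '' {y | ∃ m, l ≤ m ∧ y ∈ words x m})

theorem rK_mem_wordsK_of_mem_wordSpan {V : FundamentalReps S} {x : Fin r → 𝔤} {n l : ℕ}
    (hl : l ≤ n) {y : 𝔤} (hy : y ∈ wordSpan x n) : rK V y ∈ wordsK V x l := by
  induction hy using Submodule.span_induction with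
  | mem y hy => exact Submodule.subset_span ⟨y, ⟨n, hl, hy⟩, rfl⟩
  | zero => simp
  | add a b _ _ ha hb => rw [map_add]; exact add_mem ha hb
  | smul c a _ ha =>
    rw [map_smul, ← algebraMap_smul K]
    exact Submodule.smul_mem _ _ ha

theorem wordsK_anti (V : FundamentalReps S) (x : Fin r → 𝔤) {a b : ℕ} (h : a ≤ b) :
    wordsK V x b ≤ wordsK V x a :=
  Submodule.span_mono (Set.image_mono fun _ ⟨m, hm, h'⟩ => ⟨m, h.trans hm, h'⟩)

theorem wordsK_le_AK (V : FundamentalReps S) {x : Fin r → 𝔤} {d : 𝔤} (hd : ∀ i, ⁅d, x i⁆ = x i)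
    (l : ℕ) : wordsK V x l ≤ AK V d l := by
  refine Submodule.span_mono ?_
  rintro _ ⟨y, ⟨m, hm, hy⟩, rfl⟩
  exact ⟨rC V y, degSet_anti V d hm (rC_mem_degSet hd hy), rfl⟩

theorem wordsK_lie (V : FundamentalReps S) (x : Fin r → 𝔤) {a b : ℕ} {y z : Alg V}
    (hy : y ∈ wordsK V x a) (hz : z ∈ wordsK V x b) : y * z - z * y ∈ wordsK V x (a + b) := by
  induction hy using Submodule.span_induction with
  | zero => simp
  | add y y' _ _ h h' =>
    rw [add_mul, mul_add, add_sub_add_comm]; exact add_mem h h'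
  | smul c y _ h => rw [smul_mul_assoc, mul_smul_comm, ← smul_sub]; exact Submodule.smul_mem _ _ h
  | mem y hy =>
    obtain ⟨y, ⟨m, hm, hy⟩, rfl⟩ := hy
    induction hz using Submodule.span_induction with
    | zero => simp
    | add y y' _ _ h h' =>
      rw [add_mul, mul_add, add_sub_add_comm]; exact add_mem h h'
    | smul c y _ h =>
      rw [smul_mul_assoc, mul_smul_comm, ← smul_sub]; exact Submodule.smul_mem _ _ h
    | mem z hz =>
      obtain ⟨z, ⟨n, hn, hz⟩, rfl⟩ := hz
      rw [← rK_lie]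
      exact rK_mem_wordsK_of_mem_wordSpan (by omega)
        (wordSpan_lie_mem (Submodule.subset_span hy) (Submodule.subset_span hz))

/-- The filtration by the length of brackets. -/
def wordFil (V : FundamentalReps S) (x : Fin r → 𝔤) (d : 𝔤) (hd : ∀ i, ⁅d, x i⁆ = x i) :
    LieFiltration (Alg V) where
  F l :=
    { wordsK V x l with
      smul_mem' := fun c z hz => by
        rw [rat_smul]
        exact Submodule.smul_mem _ _ hz }
  anti h := wordsK_anti V x h
  lie := wordsK_lie V x
  nil hz := isNilpotent_of_mem_AK (wordsK_le_AK V hd 1 hz)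
  bot := by
    obtain ⟨L, hL⟩ := exists_AK_eq_bot V d
    refine ⟨L, ?_⟩
    refine eq_bot_iff.mpr fun z hz => ?_
    have := wordsK_le_AK V hd L hz
    rwa [hL] at this

theorem mem_wordFil {V : FundamentalReps S} {x : Fin r → 𝔤} {d : 𝔤} {hd : ∀ i, ⁅d, x i⁆ = x i}
    {l : ℕ} {z : Alg V} : z ∈ (wordFil V x d hd).F l ↔ z ∈ wordsK V x l := Iff.rfl

section Generation

variable (V : FundamentalReps S) (x : Fin r → 𝔤) (d : 𝔤) (hd : ∀ i, ⁅d, x i⁆ = x i)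

/-- The multiples of the generators. -/
def genSet : Set (Alg V) := {z | ∃ i, ∃ t : K, z = t • rK V (x i)}

theorem genSet_subset : genSet V x ⊆ (wordFil V x d hd).F 1 := by
  rintro _ ⟨i, t, rfl⟩
  exact Submodule.smul_mem (wordsK V x 1) _
    (Submodule.subset_span ⟨x i, ⟨1, le_rfl, i, rfl⟩, rfl⟩)

theorem wordFil_one_le : (wordFil V x d hd).F 1 ≤
    Submodule.span ℚ (genSet V x) ⊔ (wordFil V x d hd).F 2 := by
  intro z hz
  rw [mem_wordFil] at hz
  -- The target is only a `ℚ`-subspace, so scalars from `ℂ(u)` are attached to the generators;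
  -- closure under addition is then all that is needed.
  induction hz using Submodule.closure_induction with
  | zero => exact zero_mem _
  | add a b _ _ ha hb => exact add_mem ha hb
  | smul_mem t z hz =>
    obtain ⟨y, ⟨m, hm, hy⟩, rfl⟩ := hz
    rcases hm.eq_or_lt with rfl | hm
    · obtain ⟨i, rfl⟩ := hy
      exact Submodule.mem_sup_left (Submodule.subset_span ⟨i, t, rfl⟩)
    · exact Submodule.mem_sup_right (Submodule.smul_mem (wordsK V x 2) _
        (Submodule.subset_span ⟨y, ⟨m, hm, hy⟩, rfl⟩))

theorem wordFil_succ_le (l : ℕ) (hl : 1 ≤ l) : (wordFil V x d hd).F (l + 1) ≤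
    Submodule.span ℚ {y | ∃ w ∈ genSet V x, ∃ z ∈ (wordFil V x d hd).F l, y = w * z - z * w} ⊔
      (wordFil V x d hd).F (l + 2) := by
  intro z hz
  rw [mem_wordFil] at hz
  induction hz using Submodule.closure_induction with
  | zero => exact zero_mem _
  | add a b _ _ ha hb => exact add_mem ha hb
  | smul_mem t z hz =>
    obtain ⟨y, ⟨m, hm, hy⟩, rfl⟩ := hz
    rcases hm.eq_or_lt with rfl | hm
    · obtain ⟨l, rfl⟩ : ∃ k, l = k + 1 := ⟨l - 1, by omega⟩
      obtain ⟨i, y, hy, rfl⟩ := hy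
      refine Submodule.mem_sup_left (Submodule.subset_span ⟨t • rK V (x i), ⟨i, t, rfl⟩, rK V y,
        Submodule.subset_span ⟨y, ⟨_, le_rfl, hy⟩, rfl⟩, ?_⟩)
      rw [rK_lie, smul_sub, smul_mul_assoc, mul_smul_comm]
    · exact Submodule.mem_sup_right (Submodule.smul_mem (wordsK V x (l + 2)) _
        (Submodule.subset_span ⟨y, ⟨m, hm, hy⟩, rfl⟩))

theorem wordFil_E_one_le (N : Subgroup (Alg V)ˣ)
    (hN : ∀ i (t : K) (hn : IsNilpotent (t • rK V (x i))), expU (t • rK V (x i)) hn ∈ N) :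
    (wordFil V x d hd).E 1 ≤ N := by
  refine (wordFil V x d hd).E_one_le (genSet_subset V x d hd) (wordFil_one_le V x d hd)
    (wordFil_succ_le V x d hd) N ?_
  rintro _ ⟨i, t, rfl⟩ c hn
  have e : c • t • rK V (x i) = (algebraMap ℚ K c * t) • rK V (x i) := by
    rw [mul_smul, rat_smul]
  rw [expU_congr e hn (e ▸ hn)]
  exact hN i _ _

theorem wordFil_E_two_le : (wordFil V x d hd).E 2 ≤
    ⁅(wordFil V x d hd).E 1, (wordFil V x d hd).E 1⁆ :=
  (wordFil V x d hd).E_two_le_commutator (genSet_subset V x d hd) (wordFil_succ_le V x d hd)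

end Generation

end Grading

/-! ### Consequences of simplicity: Cartan matrix, Serre relations, faithfulness -/

section LieTheory

variable {r : ℕ} {𝔤 : Type*} [LieRing 𝔤] [LieAlgebra ℂ 𝔤] [FiniteDimensional ℂ 𝔤]
  [LieAlgebra.IsSimple ℂ 𝔤] (S : ChevalleySystem r 𝔤)

/-- An element commuting with the generators is central, and the center of a simple Lie algebra is
zero. -/
theorem eq_zero_of_lie_eq_zero {x : 𝔤} (he : ∀ i, ⁅S.e i, x⁆ = 0) (hf : ∀ i, ⁅S.f i, x⁆ = 0) :
    x = 0 := by
  have h : ∀ y : 𝔤, ⁅y, x⁆ = 0 := by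
    intro y
    have hy : y ∈ LieSubalgebra.lieSpan ℂ 𝔤 (Set.range S.e ∪ Set.range S.f) := by
      rw [S.generates]; trivial
    refine LieSubalgebra.lieSpan_induction ℂ (p := fun y _ => ⁅y, x⁆ = 0) ?_ ?_ ?_ ?_ ?_ hy
    · rintro _ (⟨j, rfl⟩ | ⟨j, rfl⟩)
      · exact he j
      · exact hf j
    · simp
    · intro a b _ _ ha hb; rw [add_lie, ha, hb, add_zero]
    · intro c a _ ha; rw [smul_lie, ha, smul_zero]
    · intro a b _ _ ha hb; rw [lie_lie, ha, hb, lie_zero, lie_zero, sub_zero]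
  have hc : x ∈ LieAlgebra.center ℂ 𝔤 := (LieModule.mem_maxTrivSubmodule ℂ 𝔤 𝔤 x).mpr h
  rw [LieAlgebra.center_eq_bot] at hc
  simpa using hc

theorem h_ne_zero (i : Fin r) : S.h i ≠ 0 := S.linearIndependent_h.ne_zero i

theorem e_ne_zero (i : Fin r) : S.e i ≠ 0 := fun h => h_ne_zero S i (by
  rw [← if_pos (c := i = i) (t := S.h i) (e := 0) rfl, ← S.lie_e_f, h, zero_lie])

/-- A linear relation between the rows of the Cartan matrix makes `∑ c_j h_j` commute with all `e_i`
and `f_i`, hence vanish. The simple coroots are independent. -/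
theorem cartan_nondegenerate {c : Fin r → ℂ} (hc : ∀ i, ∑ j, c j * S.cartan j i = 0) (j : Fin r) :
    c j = 0 := by
  have hx : ∑ j, c j • S.h j = 0 := by
    refine eq_zero_of_lie_eq_zero S (fun i => ?_) (fun i => ?_)
    · rw [← lie_skew, neg_eq_zero, sum_lie]
      have : ∀ j, ⁅c j • S.h j, S.e i⁆ = (c j * S.cartan j i) • S.e i := fun j => by
        rw [smul_lie, S.lie_h_e, smul_smul]
      rw [Finset.sum_congr rfl fun j _ => this j, ← Finset.sum_smul, hc, zero_smul]
    · rw [← lie_skew, neg_eq_zero, sum_lie]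
      have : ∀ j, ⁅c j • S.h j, S.f i⁆ = -((c j * S.cartan j i) • S.f i) := fun j => by
        rw [smul_lie, S.lie_h_f, smul_smul, mul_neg, neg_smul]
      rw [Finset.sum_congr rfl fun j _ => this j, Finset.sum_neg_distrib, ← Finset.sum_smul, hc,
        zero_smul, neg_zero]
  exact Fintype.linearIndependent_iff.mp S.linearIndependent_h c hx j

theorem exists_coheight_coeff : ∃ c : Fin r → ℂ, ∀ i, ∑ j, c j * S.cartan j i = 1 := by
  let T : (Fin r → ℂ) →ₗ[ℂ] (Fin r → ℂ) :=
    { toFun := fun c i => ∑ j, c j * S.cartan j i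
      map_add' := fun c c' => by
        funext i
        simp [add_mul, Finset.sum_add_distrib]
      map_smul' := fun a c => by
        funext i
        simp [mul_assoc, Finset.mul_sum] }
  have hT : Function.Injective T := by
    refine (injective_iff_map_eq_zero T).mpr fun c hc => ?_
    funext j
    exact cartan_nondegenerate S (fun i => congrFun hc i) j
  obtain ⟨c, hc⟩ := LinearMap.injective_iff_surjective.mp hT (fun _ => 1)
  exact ⟨c, fun i => congrFun hc i⟩

/-- The coefficients of the element of the Cartan subalgebra which is `1` on the simple roots. -/
def coheightCoeff : Fin r → ℂ := (exists_coheight_coeff S).choose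

/-- The element of the Cartan subalgebra which is `1` on the simple roots. -/
def coheight : 𝔤 := ∑ j, coheightCoeff S j • S.h j

theorem coheight_lie {c : Fin r → ℤ} {x : 𝔤} (hx : HasWt S c x) :
    ⁅coheight S, x⁆ = (∑ j, coheightCoeff S j * c j) • x := by
  rw [coheight, sum_lie, Finset.sum_smul]
  exact Finset.sum_congr rfl fun j _ => by rw [smul_lie, hx j, smul_smul]

theorem coheight_lie_e (i : Fin r) : ⁅coheight S, S.e i⁆ = S.e i := by
  have h : ∑ j, coheightCoeff S j * S.cartan j i = 1 := (exists_coheight_coeff S).choose_spec i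
  rw [coheight_lie S (hasWt_e i)]
  exact (congrArg (· • S.e i) h).trans (one_smul _ _)

theorem neg_coheight_lie_f (i : Fin r) : ⁅-coheight S, S.f i⁆ = S.f i := by
  rw [neg_lie, coheight_lie S (hasWt_f i)]
  have : ∑ j, coheightCoeff S j * ((-S.cartan j i : ℤ) : ℂ) = -1 := by
    rw [← (exists_coheight_coeff S).choose_spec i, ← Finset.sum_neg_distrib]
    exact Finset.sum_congr rfl fun j _ => by rw [coheightCoeff]; push_cast; ring
  rw [this, neg_smul, neg_neg, one_smul]

theorem isSl2Triple (i : Fin r) : IsSl2Triple (S.h i) (S.e i) (S.f i) where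
  h_ne_zero := h_ne_zero S i
  lie_e_f := by rw [S.lie_e_f, if_pos rfl]
  lie_h_e_nsmul := by
    rw [S.lie_h_e, S.cartan_diag, ← Nat.cast_smul_eq_nsmul ℂ]; norm_num
  lie_h_f_nsmul := by
    rw [S.lie_h_f, S.cartan_diag, ← Nat.cast_smul_eq_nsmul ℂ]; norm_num

/-- Since `⁅f_i, e_j⁆ = 0`, the vector `e_j` is primitive for the opposite `sl₂`-triple `(-h_i, f_i,
e_i)`, of weight `-a_ij`. Finite dimensionality bounds the length of its string. -/
theorem serre_e {i j : Fin r} (h : i ≠ j) :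
    ((LieAlgebra.ad ℂ 𝔤 (S.e i)) ^ ((-S.cartan i j).toNat + 1)) (S.e j) = 0 := by
  have P : (isSl2Triple S i).symm.HasPrimitiveVectorWith (S.e j) (-(S.cartan i j : ℂ)) :=
    { ne_zero := e_ne_zero S j
      lie_h := by rw [neg_lie, S.lie_h_e, neg_smul]
      lie_e := by rw [← lie_skew, S.lie_e_f, if_neg h.symm, neg_zero] }
  refine P.pow_toEnd_f_eq_zero_of_eq_nat (n := (-S.cartan i j).toNat) ?_
  have := Int.toNat_of_nonneg (neg_nonneg.mpr (S.cartan_offDiag i j h))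
  have h2 : (((-S.cartan i j).toNat : ℤ) : ℂ) = ((-S.cartan i j : ℤ) : ℂ) := by rw [this]
  push_cast at h2 ⊢
  exact h2.symm

theorem lie_e_e_eq_zero {i j : Fin r} (h : i ≠ j) (hij : S.cartan i j = 0) :
    ⁅S.e i, S.e j⁆ = 0 := by
  have := serre_e S h
  rw [hij] at this
  simpa using this

variable {S}

/-- The kernel is an ideal of a simple Lie algebra. It is proper because `h_j` fixes the nonzero
vector `ν_j`. -/
theorem rC_injective (V : FundamentalReps S) : Function.Injective (rC V) := by
  refine (injective_iff_map_eq_zero _).mpr ?_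
  let I : LieIdeal ℂ 𝔤 :=
    { LinearMap.ker (rC V) with
      lie_mem := by
        intro x m hm
        change rC V ⁅x, m⁆ = 0
        have hm' : rC V m = 0 := hm
        rw [rC_lie, hm', mul_zero, zero_mul, sub_zero] }
  rcases LieAlgebra.IsSimple.eq_bot_or_eq_top (R := ℂ) I with h | h
  · intro x hx
    have : x ∈ I := hx
    rw [h] at this
    simpa using this
  · exfalso
    -- In rank zero there are no generators, so the Lie algebra would vanish and be abelian.
    have hr : Nonempty (Fin r) := by
      by_contra hne
      rw [not_nonempty_iff] at hne
      have hg := S.generates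
      rw [Set.range_eq_empty, Set.range_eq_empty, Set.union_empty, LieSubalgebra.span_empty] at hg
      have hall : ∀ x : 𝔤, x = 0 := fun x => by
        have : x ∈ (⊤ : LieSubalgebra ℂ 𝔤) := trivial
        rw [← hg] at this
        simpa using this
      exact LieAlgebra.IsSimple.non_abelian ℂ (L := 𝔤) ⟨fun x y => hall _⟩
    obtain ⟨j⟩ := hr
    have h1 : S.h j ∈ I := by rw [h]; trivial
    have h2 : V.ρ j (S.h j) = 0 := congrFun (show rC V (S.h j) = 0 from h1) j
    have h3 := V.h_ν j j
    rw [h2, if_pos rfl, Matrix.zero_mulVec] at h3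
    exact V.ν_ne_zero j h3.symm

theorem exists_hasWt_of_mem_words {n : ℕ} {y : 𝔤} (hy : y ∈ words S.e n) :
    ∃ c, HasWt S c y := by
  induction n using Nat.twoStepInduction generalizing y with
  | zero => exact hy.elim
  | one =>
    obtain ⟨i, rfl⟩ := hy
    exact ⟨_, hasWt_e i⟩
  | more n _ ih =>
    obtain ⟨i, y, hy, rfl⟩ := hy
    obtain ⟨c, hc⟩ := ih hy
    exact ⟨_, (hasWt_e i).lie hc⟩

/-- The weight is not zero: the coheight element multiplies a bracket of length `n ≥ 1` by `n`,
whereas it kills vectors of weight zero. -/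
theorem isRoot_of_mem_words {n : ℕ} {y : 𝔤} (hy : y ∈ words S.e n) (hy0 : y ≠ 0) {c : Fin r → ℤ}
    (hc : HasWt S c y) : IsRoot S c := by
  refine ⟨?_, y, hy0, hc⟩
  rintro rfl
  have h1 := lie_of_mem_words (coheight_lie_e S) hy
  rw [coheight_lie S hc] at h1
  simp only [Pi.zero_apply, Int.cast_zero, mul_zero, Finset.sum_const_zero, zero_smul] at h1
  rcases smul_eq_zero.mp h1.symm with h | h
  · rw [Nat.cast_eq_zero] at h
    subst h
    exact hy
  · exact hy0 h

/-- A basis of the span of the brackets of length `n`, made of weight vectors. -/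
theorem exists_basis_wordSpan (S : ChevalleySystem r 𝔤) (n : ℕ) : ∃ b : Set 𝔤, b ⊆ words S.e n ∧
    Submodule.span ℂ b = wordSpan S.e n ∧ LinearIndependent ℂ ((↑) : b → 𝔤) ∧ b.Finite := by
  obtain ⟨b, hb, hspan, hli⟩ := exists_linearIndependent ℂ (words S.e n)
  exact ⟨b, hb, hspan, hli, hli.setFinite⟩

/-- The extension to `ℂ(u)` of a linear functional. -/
def funK (V : FundamentalReps S) (φ : AlgC V →ₗ[ℂ] ℂ) : Alg V →ₗ[K] K where
  toFun M := ∑ i, ∑ p, ∑ q, M i p q * algebraMap ℂ K (φ (Pi.single i (Matrix.single p q 1)))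
  map_add' M N := by
    simp only [Pi.add_apply, Matrix.add_apply, add_mul, Finset.sum_add_distrib]
  map_smul' t M := by
    simp only [Pi.smul_apply, Matrix.smul_apply, smul_eq_mul, mul_assoc, Finset.mul_sum,
      RingHom.id_apply]

theorem funK_extA (V : FundamentalReps S) (φ : AlgC V →ₗ[ℂ] ℂ) (M : AlgC V) :
    funK V φ (extA V M) = algebraMap ℂ K (φ M) := by
  have e : M = ∑ i, ∑ p, ∑ q, M i p q • (Pi.single i (Matrix.single p q 1) : AlgC V) := by
    conv_lhs => rw [← Finset.univ_sum_single M]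
    refine Finset.sum_congr rfl fun i _ => ?_
    conv_lhs => rw [Matrix.matrix_eq_sum_single (M i)]
    have := map_sum (LinearMap.single ℂ (fun i => Matrix (Fin (V.dim i)) (Fin (V.dim i)) ℂ) i)
      (fun p => ∑ q, Matrix.single p q (M i p q)) Finset.univ
    refine this.trans ?_
    refine Finset.sum_congr rfl fun p _ => ?_
    rw [map_sum]
    refine Finset.sum_congr rfl fun q _ => ?_
    rw [← mul_one (M i p q), ← smul_eq_mul, ← Matrix.smul_single, map_smul, smul_eq_mul, mul_one]
    rfl
  conv_rhs => rw [e]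
  simp only [map_sum, map_smul, smul_eq_mul, map_mul]
  rfl

/-- For linearly independent elements of length `n`, there are dual functionals which vanish in
degrees greater than `n`. -/
theorem exists_symbol (V : FundamentalReps S) {n : ℕ} {b : Set 𝔤} (hb : b ⊆ words S.e n)
    (hli : LinearIndependent ℂ ((↑) : b → 𝔤)) (x : b) : ∃ φ : AlgC V →ₗ[ℂ] ℂ,
      φ (rC V x) = 1 ∧ (∀ y : b, y ≠ x → φ (rC V y) = 0) ∧
      ∀ M ∈ degSet V (coheight S) (n + 1), φ M = 0 := by
  classical
  set W := Submodule.span ℂ (degSet V (coheight S) (n + 1)) with hW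
  let T : Module.End ℂ (AlgC V) :=
    LinearMap.mulLeft ℂ (rC V (coheight S)) - LinearMap.mulRight ℂ (rC V (coheight S))
  -- Eigenspaces of the commutator with the coheight element are independent. The degree `n` part
  -- thus meets the span of the higher degrees in zero, and linear independence survives in the
  -- quotient by `W`.
  have hdis : Disjoint (T.eigenspace (n : ℂ)) W := by
    have h1 := T.eigenspaces_iSupIndep (n : ℂ)
    refine h1.mono_right ?_
    rw [hW, Submodule.span_le]
    rintro M ⟨m, hm, hM⟩
    have hne : (m : ℂ) ≠ n := by
      rw [Ne, Nat.cast_inj]; omega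
    exact Submodule.mem_iSup_of_mem (m : ℂ) (Submodule.mem_iSup_of_mem hne
      (Module.End.mem_eigenspace_iff.mpr hM))
  have hli2 : LinearIndependent ℂ fun y : b => rC V (y : 𝔤) :=
    hli.map' (rC V) (LinearMap.ker_eq_bot.mpr (rC_injective V))
  have hli3 : LinearIndependent ℂ fun y : b => W.mkQ (rC V (y : 𝔤)) := by
    refine hli2.map ?_
    rw [Submodule.ker_mkQ]
    refine hdis.mono_left ?_
    rw [Submodule.span_le]
    rintro _ ⟨y, rfl⟩
    refine Module.End.mem_eigenspace_iff.mpr ?_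
    change rC V (coheight S) * rC V y - rC V y * rC V (coheight S) = _
    rw [← rC_lie, lie_of_mem_words (coheight_lie_e S) (hb y.2), map_smul]
  obtain ⟨g, hg⟩ := LinearMap.exists_extend ((Finsupp.lapply x).comp hli3.repr)
  have key : ∀ y : b, g (W.mkQ (rC V (y : 𝔤))) = Finsupp.single y 1 x := fun y => by
    have h1 := LinearMap.congr_fun hg ⟨W.mkQ (rC V (y : 𝔤)), Submodule.subset_span ⟨y, rfl⟩⟩
    have h2 := hli3.repr_eq_single y ⟨W.mkQ (rC V (y : 𝔤)), Submodule.subset_span ⟨y, rfl⟩⟩ rfl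
    refine (show g (W.mkQ (rC V (y : 𝔤))) = hli3.repr _ x from h1).trans ?_
    rw [h2]
  refine ⟨g.comp W.mkQ, (key x).trans (Finsupp.single_eq_same), fun y hy =>
    (key y).trans (Finsupp.single_eq_of_ne hy.symm), fun M hM => ?_⟩
  change g (W.mkQ M) = 0
  rw [Submodule.mkQ_apply, (Submodule.Quotient.mk_eq_zero W).mpr (Submodule.subset_span hM),
    map_zero]

end LieTheory

/-! ### Rational functions on orbits and scalar difference equations -/

section Local

theorem toK_injective : Function.Injective toK := RatFunc.algebraMap_injective ℂ

theorem toK_ne_zero {p : ℂ[X]} (hp : p ≠ 0) : toK p ≠ 0 := RatFunc.algebraMap_ne_zero hp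

theorem toK_mul (p q : ℂ[X]) : toK (p * q) = toK p * toK q := map_mul _ _ _

theorem toK_add (p q : ℂ[X]) : toK (p + q) = toK p + toK q := map_add _ _ _

theorem toK_neg (p : ℂ[X]) : toK (-p) = -toK p := map_neg _ _

theorem toK_pow (p : ℂ[X]) (n : ℕ) : toK (p ^ n) = toK p ^ n := map_pow _ _ _

theorem toK_zero : toK 0 = 0 := map_zero _

theorem toK_C (c : ℂ) : toK (C c) = constK c := by
  rw [toK, constK, IsScalarTower.algebraMap_apply ℂ ℂ[X] K]; rfl

theorem shift_toK (ħ : ℂˣ) (p : ℂ[X]) : shift ħ (toK p) = toK (polyShift ħ p) := by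
  rw [shift, RatFunc.coe_mapRingHom_eq_coe_map, RatFunc.map_apply]
  simp

theorem eval_polyShift (ħ : ℂˣ) (p : ℂ[X]) (a : ℂ) :
    (polyShift ħ p).eval a = p.eval ((ħ : ℂ) * a) := by
  simp [polyShift, eval_comp]

theorem constK_ne_zero {c : ℂ} (hc : c ≠ 0) : constK c ≠ 0 :=
  (map_ne_zero_iff _ (algebraMap ℂ K).injective).mpr hc

/-- The rational functions which are regular at `a`. -/
def Reg (a : ℂ) : Subring K where
  carrier := {f | ∃ p q : ℂ[X], q.eval a ≠ 0 ∧ f * toK q = toK p}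
  mul_mem' := by
    rintro f g ⟨p, q, hq, h⟩ ⟨p', q', hq', h'⟩
    refine ⟨p * p', q * q', by rw [eval_mul]; exact mul_ne_zero hq hq', ?_⟩
    rw [toK, map_mul, mul_mul_mul_comm, h, h', ← map_mul]
  one_mem' := ⟨1, 1, by simp, by simp⟩
  add_mem' := by
    rintro f g ⟨p, q, hq, h⟩ ⟨p', q', hq', h'⟩
    refine ⟨p * q' + p' * q, q * q', by rw [eval_mul]; exact mul_ne_zero hq hq', ?_⟩
    simp only [toK, map_mul, map_add] at h h' ⊢
    rw [← h, ← h']; ring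
  zero_mem' := ⟨0, 1, by simp, by simp⟩
  neg_mem' := by
    rintro f ⟨p, q, hq, h⟩
    exact ⟨-p, q, hq, by rw [neg_mul, h, toK_neg]⟩

theorem toK_mem_reg (p : ℂ[X]) (a : ℂ) : toK p ∈ Reg a := ⟨p, 1, by simp, by simp⟩

theorem constK_mem_reg (c a : ℂ) : constK c ∈ Reg a := toK_C c ▸ toK_mem_reg (C c) a

theorem toK_div_mem_reg (p : ℂ[X]) {q : ℂ[X]} {a : ℂ} (h : q.eval a ≠ 0) :
    toK p / toK q ∈ Reg a :=
  ⟨p, q, h, div_mul_cancel₀ _ (toK_ne_zero (by rintro rfl; simp at h))⟩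

theorem toK_inv_mem_reg {q : ℂ[X]} {a : ℂ} (h : q.eval a ≠ 0) : (toK q)⁻¹ ∈ Reg a := by
  have := toK_div_mem_reg 1 h
  rwa [toK, map_one, one_div] at this

theorem mem_reg_iff {f : K} {a : ℂ} : f ∈ Reg a ↔ f.denom.eval a ≠ 0 := by
  constructor
  · rintro ⟨p, q, hq, h⟩ h0
    have hq0 : q ≠ 0 := by rintro rfl; simp at hq
    obtain ⟨t, rfl⟩ := (RatFunc.denom_dvd (x := f) hq0).mpr
      ⟨p, by rw [eq_div_iff (toK_ne_zero hq0)]; exact h⟩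
    rw [eval_mul, h0, zero_mul] at hq
    exact hq rfl
  · intro h
    have := toK_div_mem_reg f.num h
    rwa [toK, toK, RatFunc.num_div_denom] at this

theorem shift_mem_reg {ħ : ℂˣ} {f : K} {a : ℂ} (h : f ∈ Reg ((ħ : ℂ) * a)) :
    shift ħ f ∈ Reg a := by
  obtain ⟨p, q, hq, h⟩ := h
  exact ⟨polyShift ħ p, polyShift ħ q, by rwa [eval_polyShift], by
    rw [← shift_toK, ← map_mul, h, shift_toK]⟩

/-- The point `ħ ^ k a`. -/
def orbitPt (ħ : ℂˣ) (a : ℂ) (k : ℤ) : ℂ := ((ħ ^ k : ℂˣ) : ℂ) * a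

theorem mul_orbitPt (ħ : ℂˣ) (a : ℂ) (k : ℤ) : (ħ : ℂ) * orbitPt ħ a k = orbitPt ħ a (k + 1) := by
  rw [orbitPt, orbitPt, ← mul_assoc, ← Units.val_mul, zpow_add_one, mul_comm ħ]

theorem orbitPt_zero (ħ : ℂˣ) (a : ℂ) : orbitPt ħ a 0 = a := by simp [orbitPt]

theorem zpow_injective_of_pow_ne_one {ħ : ℂˣ} (hħ : ∀ n : ℕ, 0 < n → ħ ^ n ≠ 1) :
    Function.Injective fun k : ℤ => ħ ^ k := by
  refine injective_zpow_iff_not_isOfFinOrder.mpr fun h => ?_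
  obtain ⟨n, hn, h⟩ := isOfFinOrder_iff_pow_eq_one.mp h
  exact hħ n hn h

theorem orbitPt_injective {ħ : ℂˣ} (hħ : ∀ n : ℕ, 0 < n → ħ ^ n ≠ 1) {a : ℂ} (ha : a ≠ 0) :
    Function.Injective (orbitPt ħ a) := fun _ _ h =>
  zpow_injective_of_pow_ne_one hħ (Units.ext (mul_right_cancel₀ ha h))

/-- The rational functions which are regular on the orbit of `a`. -/
def RegOrb (ħ : ℂˣ) (a : ℂ) : Subring K := ⨅ k : ℤ, Reg (orbitPt ħ a k)

theorem mem_regOrb {ħ : ℂˣ} {a : ℂ} {f : K} : f ∈ RegOrb ħ a ↔ ∀ k, f ∈ Reg (orbitPt ħ a k) :=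
  Subring.mem_iInf

theorem shift_mem_regOrb {ħ : ℂˣ} {a : ℂ} {f : K} (h : f ∈ RegOrb ħ a) :
    shift ħ f ∈ RegOrb ħ a :=
  mem_regOrb.mpr fun k => shift_mem_reg (by rw [mul_orbitPt]; exact mem_regOrb.mp h _)

theorem constK_mem_regOrb (ħ : ℂˣ) (c a : ℂ) : constK c ∈ RegOrb ħ a :=
  mem_regOrb.mpr fun _ => constK_mem_reg _ _

theorem toK_mem_regOrb (ħ : ℂˣ) (p : ℂ[X]) (a : ℂ) : toK p ∈ RegOrb ħ a :=
  mem_regOrb.mpr fun _ => toK_mem_reg _ _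

theorem finite_not_mem_reg (f : K) : {a | f ∉ Reg a}.Finite := by
  refine (f.denom.roots.toFinset.finite_toSet).subset fun a ha => ?_
  have ha : f.denom.eval a = 0 := by
    by_contra h
    exact ha (mem_reg_iff.mpr h)
  simpa using ⟨RatFunc.denom_ne_zero f, ha⟩

theorem exists_forall_ge_mem_reg {ħ : ℂˣ} (hħ : ∀ n : ℕ, 0 < n → ħ ^ n ≠ 1) {a : ℂ} (ha : a ≠ 0)
    (f : K) : ∃ N : ℤ, ∀ k, N ≤ k → f ∈ Reg (orbitPt ħ a k) := by
  have h : {k | f ∉ Reg (orbitPt ħ a k)}.Finite :=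
    (finite_not_mem_reg f).preimage (orbitPt_injective hħ ha).injOn
  obtain ⟨N, hN⟩ := h.bddAbove
  refine ⟨N + 1, fun k hk => ?_⟩
  by_contra hc
  have := hN hc
  omega

/-- The points of the orbit are distinct and each function has finitely many poles, so all of them
are regular far along the orbit. Regularity is then carried back one point at a time. -/
theorem orbit_induction {ħ : ℂˣ} (hħ : ∀ n : ℕ, 0 < n → ħ ^ n ≠ 1) {a : ℂ} (ha : a ≠ 0)
    {ι : Type*} [Finite ι] (f : ι → K) (step : ∀ k, (∀ i, f i ∈ Reg (orbitPt ħ a (k + 1))) →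
      ∀ i, f i ∈ Reg (orbitPt ħ a k)) (i : ι) : f i ∈ RegOrb ħ a := by
  choose N hN using fun i => exists_forall_ge_mem_reg hħ ha (f i)
  obtain ⟨M, hM⟩ := (Set.finite_range N).bddAbove
  have key : ∀ n : ℕ, ∀ k, M - n ≤ k → ∀ i, f i ∈ Reg (orbitPt ħ a k) := by
    intro n
    induction n with
    | zero =>
      intro k hk i
      refine hN i k (le_trans (hM ⟨i, rfl⟩) ?_)
      simpa using hk
    | succ n ih =>
      intro k hk
      exact step k (ih (k + 1) (by push_cast at hk; omega))
  refine mem_regOrb.mpr fun k => key (M - k).toNat k ?_ i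
  have := Int.self_le_toNat (M - k)
  omega

/-- The operator `f(u) ↦ c f(ħ u) - f(u)`. -/
def diffOp (ħ : ℂˣ) (c : ℂ) (f : K) : K := constK c * shift ħ f - f

theorem mem_regOrb_of_diffOp {ħ : ℂˣ} (hħ : ∀ n : ℕ, 0 < n → ħ ^ n ≠ 1) {a : ℂ} (ha : a ≠ 0)
    {c : ℂ} {f : K} (h : diffOp ħ c f ∈ RegOrb ħ a) : f ∈ RegOrb ħ a := by
  refine orbit_induction hħ ha (fun _ : Unit => f) (fun k hk _ => ?_) ()
  have e : f = constK c * shift ħ f - diffOp ħ c f := by rw [diffOp]; ring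
  rw [e]
  refine sub_mem (mul_mem (constK_mem_reg _ _) (shift_mem_reg ?_)) (mem_regOrb.mp h k)
  rw [mul_orbitPt]
  exact hk ()

theorem exists_mul_X_pow {f : K} (hf : ∀ a : ℂ, a ≠ 0 → f ∈ Reg a) :
    ∃ (n : ℕ) (p : ℂ[X]), f * toK X ^ n = toK p := by
  have hd : f.denom = X ^ f.denom.roots.card := by
    conv_lhs => rw [(IsAlgClosed.splits f.denom).eq_prod_roots_of_monic (RatFunc.monic_denom f)]
    have : f.denom.roots.map (fun x => X - C x) = f.denom.roots.map (fun _ => X) := by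
      refine Multiset.map_congr rfl fun x hx => ?_
      have hx : x = 0 := by
        by_contra h
        exact mem_reg_iff.mp (hf x h) (isRoot_of_mem_roots hx)
      rw [hx, C_0, sub_zero]
    rw [this, Multiset.map_const', Multiset.prod_replicate]
  refine ⟨f.denom.roots.card, f.num, ?_⟩
  rw [toK, ← map_pow, ← hd]
  conv_lhs => rw [← RatFunc.num_div_denom f, RatFunc.num_div_denom f]
  conv_lhs => arg 1; rw [← RatFunc.num_div_denom f]
  exact div_mul_cancel₀ _ (toK_ne_zero (RatFunc.denom_ne_zero f))

theorem polyShift_monomial (ħ : ℂˣ) (n : ℕ) (c : ℂ) :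
    polyShift ħ (monomial n c) = monomial n ((ħ : ℂ) ^ n * c) := by
  simp [polyShift, ← C_mul_X_pow_eq_monomial, mul_pow]
  ring

theorem coeff_polyShift (ħ : ℂˣ) (p : ℂ[X]) (n : ℕ) :
    (polyShift ħ p).coeff n = (ħ : ℂ) ^ n * p.coeff n := by
  induction p using Polynomial.induction_on' with
  | add p q hp hq => rw [map_add, coeff_add, coeff_add, hp, hq, mul_add]
  | monomial m c =>
    rw [polyShift_monomial, coeff_monomial, coeff_monomial]
    split_ifs with h
    · rw [h]
    · simp

theorem shift_X (ħ : ℂˣ) : shift ħ (toK X) = constK ħ * toK X := by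
  rw [shift_toK, ← toK_C, toK, toK, ← map_mul]
  simp [polyShift]

/-- A pole in `ℂ^×` would propagate along an infinite orbit, so `f` is a Laurent polynomial. The
scaling acts on its monomials by powers of `ħ`. -/
theorem exists_polyShift_eq {ħ : ℂˣ} (hħ : ∀ n : ℕ, 0 < n → ħ ^ n ≠ 1) {c : ℂ} (hc : c ≠ 0) {f : K}
    (h : shift ħ f = constK c * f) : ∃ (n : ℕ) (p : ℂ[X]), f * toK X ^ n = toK p ∧
      ∀ k, p.coeff k ≠ 0 → (ħ : ℂ) ^ k = c * (ħ : ℂ) ^ n := by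
  have hreg : ∀ a : ℂ, a ≠ 0 → f ∈ Reg a := by
    intro a ha
    have : f ∈ RegOrb ħ a := mem_regOrb_of_diffOp hħ ha (c := c⁻¹) (by
      rw [diffOp, h, ← mul_assoc, constK, constK, ← map_mul, inv_mul_cancel₀ hc, map_one, one_mul,
        sub_self]
      exact zero_mem _)
    have := mem_regOrb.mp this 0
    rwa [orbitPt_zero] at this
  obtain ⟨n, p, hp⟩ := exists_mul_X_pow hreg
  refine ⟨n, p, hp, fun k hk => ?_⟩
  have h1 := congrArg (shift ħ) hp
  rw [map_mul, map_pow, shift_X, h, shift_toK, mul_pow, mul_mul_mul_comm, hp, ← toK_C, ← toK_C,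
    toK, toK, toK, toK, ← map_pow, ← map_mul, ← map_mul] at h1
  have h2 := congrArg (fun q => coeff q k) (toK_injective h1)
  simp only [coeff_polyShift] at h2
  rw [← C_pow, ← C_mul, coeff_C_mul] at h2
  exact (mul_right_cancel₀ hk h2).symm

theorem eq_zero_of_shift_eq {ħ : ℂˣ} (hħ : ∀ n : ℕ, 0 < n → ħ ^ n ≠ 1) {c : ℂˣ}
    (hc : ∀ k : ℤ, c ≠ ħ ^ k) {f : K} (h : shift ħ f = constK c * f) : f = 0 := by
  obtain ⟨n, p, hp, hk⟩ := exists_polyShift_eq hħ c.ne_zero h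
  have hp0 : p = 0 := by
    ext k
    rw [coeff_zero]
    by_contra hne
    refine hc (k - n) (Units.ext ?_)
    rw [zpow_sub, zpow_natCast, zpow_natCast]
    push_cast
    rw [hk k hne, mul_assoc, mul_inv_cancel₀ (pow_ne_zero _ ħ.ne_zero), mul_one]
  rw [hp0, toK_zero] at hp
  exact (mul_eq_zero.mp hp).resolve_right (pow_ne_zero _ (toK_ne_zero X_ne_zero))

theorem exists_constK_of_shift_eq {ħ : ℂˣ} (hħ : ∀ n : ℕ, 0 < n → ħ ^ n ≠ 1) {f : K}
    (h : shift ħ f = f) : ∃ c, f = constK c := by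
  obtain ⟨n, p, hp, hk⟩ := exists_polyShift_eq (c := 1) hħ one_ne_zero (f := f)
    (by rw [h, constK, map_one, one_mul])
  refine ⟨p.coeff n, ?_⟩
  have hp1 : p = C (p.coeff n) * X ^ n := by
    ext k
    rw [coeff_C_mul_X_pow]
    split_ifs with hkn
    · rw [hkn]
    · by_contra hne
      have h1 := hk k hne
      rw [one_mul] at h1
      have := zpow_injective_of_pow_ne_one hħ (a₁ := (k : ℤ)) (a₂ := n) (Units.ext (by
        simpa using h1))
      omega
  rw [hp1, toK_mul, toK_pow] at hp
  rw [mul_right_cancel₀ (pow_ne_zero _ (toK_ne_zero X_ne_zero)) hp]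
  exact toK_C _

/-- Partial fractions: the denominator splits into coprime factors with roots inside and outside
`O`, and a Bézout relation separates the two. -/
theorem exists_add_of_set (f : K) (O : Set ℂ) : ∃ g g' : K, f = g + g' ∧ (∀ a ∉ O, g ∈ Reg a) ∧
    ∀ a ∈ O, g' ∈ Reg a := by
  classical
  set s := f.denom.roots with hs
  let q : Multiset ℂ → ℂ[X] := fun m => (m.map fun x => X - C x).prod
  have heval : ∀ (m : Multiset ℂ) (a : ℂ), (q m).eval a ≠ 0 ↔ a ∉ m := by
    intro m a
    rw [eval_multiset_prod, Ne, Multiset.prod_eq_zero_iff]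
    simp [sub_eq_zero]
  have hq : f.denom = q (s.filter (· ∈ O)) * q (s.filter (· ∉ O)) := by
    rw [← Multiset.prod_add, ← Multiset.map_add, Multiset.filter_add_not]
    exact (IsAlgClosed.splits f.denom).eq_prod_roots_of_monic (RatFunc.monic_denom f)
  have hcop : IsCoprime (q (s.filter (· ∈ O))) (q (s.filter (· ∉ O))) := by
    rw [isCoprime_iff_aeval_ne_zero_of_isAlgClosed ℂ ℂ]
    intro a
    rw [coe_aeval_eq_eval, heval, heval]
    by_cases ha : a ∈ O
    · right; simp [ha]
    · left; simp [ha]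
  obtain ⟨x, y, hxy⟩ := hcop
  have h1 : (q (s.filter (· ∈ O))) ≠ 0 := fun h => by
    have := RatFunc.denom_ne_zero f; rw [hq, h, zero_mul] at this; exact this rfl
  have h2 : (q (s.filter (· ∉ O))) ≠ 0 := fun h => by
    have := RatFunc.denom_ne_zero f; rw [hq, h, mul_zero] at this; exact this rfl
  refine ⟨toK (f.num * y) / toK (q (s.filter (· ∈ O))),
    toK (f.num * x) / toK (q (s.filter (· ∉ O))), ?_, fun a ha => toK_div_mem_reg _ ?_,
    fun a ha => toK_div_mem_reg _ ?_⟩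
  · conv_lhs => rw [← RatFunc.num_div_denom f]
    rw [div_add_div _ _ (toK_ne_zero h1) (toK_ne_zero h2), toK, toK, toK, toK, ← map_mul, ← map_mul,
      ← map_mul, ← map_add, ← hq]
    congr 2
    linear_combination (-f.num) * hxy
  · rw [heval]; simp [ha]
  · rw [heval]; simp [ha]

theorem diffOp_add (ħ : ℂˣ) (c : ℂ) (f g : K) :
    diffOp ħ c (f + g) = diffOp ħ c f + diffOp ħ c g := by
  rw [diffOp, diffOp, diffOp, map_add]; ring

theorem diffOp_mem_reg {ħ : ℂˣ} {c : ℂ} {f : K} {a : ℂ} (h : f ∈ Reg a)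
    (h' : f ∈ Reg ((ħ : ℂ) * a)) : diffOp ħ c f ∈ Reg a :=
  sub_mem (mul_mem (constK_mem_reg _ _) (shift_mem_reg h')) h

/-- The monomial `u^(m - n)` is an eigenvector of the operator with eigenvalue `c ħ^(m - n) - 1`,
which is nonzero by genericity of `c`. -/
theorem exists_diffOp_eq_of_laurent {ħ : ℂˣ} {c : ℂˣ} (hc : ∀ k : ℤ, c ≠ ħ ^ k) (n : ℕ) (p : ℂ[X]) :
    ∃ f, diffOp ħ c f = toK p / toK X ^ n := by
  have hX : toK X ^ n ≠ 0 := pow_ne_zero _ (toK_ne_zero X_ne_zero)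
  induction p using Polynomial.induction_on' with
  | add p q hp hq =>
    obtain ⟨f, hf⟩ := hp
    obtain ⟨g, hg⟩ := hq
    exact ⟨f + g, by rw [diffOp_add, hf, hg, toK_add, add_div]⟩
  | monomial m b =>
    set d : ℂ := c * ((ħ : ℂ) ^ m * ((ħ : ℂ) ^ n)⁻¹) - 1 with hd
    have hd0 : d ≠ 0 := by
      intro h
      refine hc (n - m) (Units.ext ?_)
      rw [zpow_sub, zpow_natCast, zpow_natCast]
      push_cast
      have hm : (ħ : ℂ) ^ m ≠ 0 := pow_ne_zero _ ħ.ne_zero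
      have hn : (ħ : ℂ) ^ n ≠ 0 := pow_ne_zero _ ħ.ne_zero
      rw [hd, sub_eq_zero] at h
      field_simp at h ⊢
      exact h
    refine ⟨toK (monomial m (d⁻¹ * b)) / toK X ^ n, ?_⟩
    rw [diffOp, map_div₀, map_pow, shift_X, shift_toK, polyShift_monomial]
    have hmon : ∀ x : ℂ, toK (monomial m x) = constK x * toK X ^ m := fun x => by
      rw [← C_mul_X_pow_eq_monomial, toK, map_mul, map_pow]; exact congrArg (· * _) (toK_C x)
    rw [hmon, hmon, hmon, mul_pow]
    have hħn : constK ħ ^ n ≠ 0 := pow_ne_zero _ (constK_ne_zero ħ.ne_zero)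
    have e : constK b = constK c * constK ((ħ : ℂ) ^ m * (d⁻¹ * b)) * (constK ħ ^ n)⁻¹ -
        constK (d⁻¹ * b) := by
      simp only [constK]
      rw [← map_pow, ← map_inv₀, ← map_mul, ← map_mul, ← map_sub]
      congr 1
      field_simp
      rw [hd]
      field_simp
    rw [e]
    field_simp

/-- An equation `c f(ħ u) - f(u) = s(u)` has a solution in `ℂ(u)` if it has a solution near every
orbit in `ℂ^×`. -/
theorem exists_diffOp_eq {ħ : ℂˣ} {c : ℂˣ} (hc : ∀ k : ℤ, c ≠ ħ ^ k) (s : K)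
    (hs : ∀ a : ℂ, a ≠ 0 → ∃ g, s - diffOp ħ c g ∈ RegOrb ħ a) : ∃ f, diffOp ħ c f = s := by
  have hfin : ∀ s : K, {a | a ≠ 0 ∧ s ∉ Reg a}.Finite := fun s =>
    (finite_not_mem_reg s).subset fun a ha => ha.2
  -- Induction on the number of poles in `ℂ^×`. Without such poles `s` is a Laurent polynomial.
  induction hn : {a | a ≠ 0 ∧ s ∉ Reg a}.ncard using Nat.strong_induction_on generalizing s with
  | _ n ih =>
  by_cases hne : {a | a ≠ 0 ∧ s ∉ Reg a} = ∅
  · obtain ⟨n, p, hp⟩ := exists_mul_X_pow (f := s) (fun a ha => by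
      by_contra h
      have : a ∈ {a | a ≠ 0 ∧ s ∉ Reg a} := ⟨ha, h⟩
      rw [hne] at this
      exact this)
    obtain ⟨f, hf⟩ := exists_diffOp_eq_of_laurent hc n p
    exact ⟨f, by rw [hf, ← hp, mul_div_cancel_right₀ _ (pow_ne_zero _ (toK_ne_zero X_ne_zero))]⟩
  · obtain ⟨w, hw0, hw⟩ := Set.nonempty_iff_ne_empty.mpr hne
    obtain ⟨g, hg⟩ := hs w hw0
    -- Only the part of the local solution with poles on the orbit of `w` is subtracted. It clears
    -- the poles of `s` on that orbit and creates none elsewhere, as the complement of the orbit is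
    -- stable under scaling by `ħ`.
    obtain ⟨g₁, g₂, rfl, h₁, h₂⟩ := exists_add_of_set g (Set.range (orbitPt ħ w))
    have hO : ∀ a, a ∉ Set.range (orbitPt ħ w) → (ħ : ℂ) * a ∉ Set.range (orbitPt ħ w) := by
      rintro a ha ⟨k, hk⟩
      refine ha ⟨k - 1, ?_⟩
      refine mul_left_cancel₀ ħ.ne_zero ?_
      rw [mul_orbitPt, sub_add_cancel, hk]
    have hin : s - diffOp ħ c g₁ ∈ RegOrb ħ w := by
      have h2 : diffOp ħ c g₂ ∈ RegOrb ħ w := mem_regOrb.mpr fun k =>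
        diffOp_mem_reg (h₂ _ ⟨k, rfl⟩) (h₂ _ ⟨k + 1, (mul_orbitPt _ _ _).symm⟩)
      rw [diffOp_add] at hg
      have := add_mem hg h2
      rwa [← sub_sub, sub_add_cancel] at this
    have hout : ∀ a, a ∉ Set.range (orbitPt ħ w) → diffOp ħ c g₁ ∈ Reg a := fun a ha =>
      diffOp_mem_reg (h₁ a ha) (h₁ _ (hO a ha))
    obtain ⟨f, hf⟩ := ih {a | a ≠ 0 ∧ s - diffOp ħ c g₁ ∉ Reg a}.ncard (by
        rw [← hn]
        refine Set.ncard_lt_ncard ⟨fun a ha => ⟨ha.1, fun h => ha.2 (sub_mem h (hout a ?_))⟩,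
          fun h => ?_⟩ (hfin s)
        · rintro ⟨k, rfl⟩
          exact ha.2 (mem_regOrb.mp hin k)
        · refine (h ⟨hw0, hw⟩).2 ?_
          have := mem_regOrb.mp hin 0
          rwa [orbitPt_zero] at this) (s - diffOp ħ c g₁) (fun a ha => by
        obtain ⟨g, hg⟩ := hs a ha
        refine ⟨g - g₁, ?_⟩
        have e : diffOp ħ c (g - g₁) = diffOp ħ c g - diffOp ħ c g₁ := by
          rw [eq_sub_iff_add_eq, ← diffOp_add, sub_add_cancel]
        rw [e, sub_sub_sub_cancel_right]
        exact hg) rfl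
    exact ⟨f + g₁, by rw [diffOp_add, hf, sub_add_cancel]⟩

theorem intDegree_shift (ħ : ℂˣ) (f : K) : (shift ħ f).intDegree = f.intDegree := by
  by_cases hf : f = 0
  · rw [hf, map_zero]
  have hdeg : ∀ p : ℂ[X], (polyShift ħ p).natDegree = p.natDegree := fun p => by
    rw [polyShift, coe_compRingHom_apply, natDegree_comp, natDegree_C_mul ħ.ne_zero, natDegree_X,
      mul_one]
  have hn : toK f.num ≠ 0 := toK_ne_zero (RatFunc.num_ne_zero hf)
  have hd : toK f.denom ≠ 0 := toK_ne_zero (RatFunc.denom_ne_zero f)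
  have e : f = toK f.num / toK f.denom := (RatFunc.num_div_denom f).symm
  rw [e, map_div₀, RatFunc.intDegree_div ((_root_.map_ne_zero _).mpr hn)
    ((_root_.map_ne_zero _).mpr hd),
    RatFunc.intDegree_div hn hd, shift_toK, shift_toK, RatFunc.intDegree_polynomial,
    RatFunc.intDegree_polynomial, RatFunc.intDegree_polynomial, RatFunc.intDegree_polynomial, hdeg,
    hdeg]

/-- A rational function of degree zero without zeros and poles in `ℂ^×` is constant. -/
theorem exists_constK_of_reg {f : K} (hf : f ≠ 0) (h : ∀ a : ℂ, a ≠ 0 → f ∈ Reg a)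
    (h' : ∀ a : ℂ, a ≠ 0 → f⁻¹ ∈ Reg a) (hdeg : f.intDegree = 0) : ∃ c, f = constK c := by
  obtain ⟨n, p, hp⟩ := exists_mul_X_pow h
  obtain ⟨m, q, hq⟩ := exists_mul_X_pow h'
  have hX : toK X ≠ 0 := toK_ne_zero X_ne_zero
  have hpq : p * q = X ^ (n + m) := by
    apply toK_injective
    rw [toK_mul, toK_pow, pow_add, ← hp, ← hq]
    field_simp
  obtain ⟨i, -, hi⟩ := (dvd_prime_pow prime_X _).mp (Dvd.intro _ hpq)
  obtain ⟨u, hu⟩ := hi.symm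
  obtain ⟨c, hc, hcu⟩ := Polynomial.isUnit_iff.mp u.isUnit
  have hp2 : p = X ^ i * C c := by rw [← hu, hcu]
  have hf2 : f = constK c * (toK X ^ i / toK X ^ n) := by
    rw [hp2, toK_mul, toK_pow] at hp
    rw [← mul_div_assoc, eq_div_iff (pow_ne_zero _ hX), hp, mul_comm]
    exact congrArg (· * _) (toK_C c)
  have hin : i = n := by
    have h1 := hdeg
    rw [hf2, RatFunc.intDegree_mul (constK_ne_zero hc.ne_zero)
      (div_ne_zero (pow_ne_zero _ hX) (pow_ne_zero _ hX)),
      RatFunc.intDegree_div (pow_ne_zero _ hX) (pow_ne_zero _ hX), ← toK_C, toK, ← map_pow,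
      ← map_pow, RatFunc.intDegree_polynomial, RatFunc.intDegree_polynomial,
      RatFunc.intDegree_polynomial, natDegree_C, natDegree_X_pow, natDegree_X_pow] at h1
    push_cast at h1
    omega
  exact ⟨c, by rw [hf2, hin, div_self (pow_ne_zero _ hX), mul_one]⟩

end Local

/-! ### Coordinates on the associated graded Lie algebra -/

section Symbols

variable {r : ℕ} {𝔤 : Type*} [LieRing 𝔤] [LieAlgebra ℂ 𝔤] [FiniteDimensional ℂ 𝔤]
  [LieAlgebra.IsSimple ℂ 𝔤] {S : ChevalleySystem r 𝔤}

/-- The filtration of the Lie algebra of `N_+` by height. -/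
abbrev eFil (V : FundamentalReps S) : LieFiltration (Alg V) :=
  wordFil V S.e (coheight S) (coheight_lie_e S)

theorem sub_one_mem_AK {V : FundamentalReps S} {x : Fin r → 𝔤} {d : 𝔤} {hd : ∀ i, ⁅d, x i⁆ = x i}
    {l : ℕ} (hl : 1 ≤ l) {g : (Alg V)ˣ} (hg : g ∈ (wordFil V x d hd).E l) :
    (g : Alg V) - 1 ∈ AK V d l := by
  have hexp : ∀ z ∈ (wordFil V x d hd).F l, IsNilpotent.exp z - 1 ∈ AK V d l := by
    intro z hz
    have hz' := wordsK_le_AK V hd l hz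
    have := add_mem (AK_anti V _ (Nat.le_succ l) (exp_sub_one_sub_mem hl hz')) hz'
    rwa [sub_add_cancel] at this
  induction hg using Subgroup.closure_induction'' with
  | mem u hu =>
    obtain ⟨z, hz, hn, hu⟩ := hu
    rw [hu]
    exact hexp z hz
  | inv_mem u hu =>
    obtain ⟨z, hz, hn, hu⟩ := hu
    have : u⁻¹ = expU (-z) hn.neg := by
      rw [expU_neg hn, show u = expU z hn from Units.ext hu]
    rw [this]
    exact hexp (-z) (neg_mem hz)
  | one => simp
  | mul x y _ _ hx hy =>
    have e : ((x * y : (Alg V)ˣ) : Alg V) - 1 =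
        ((x : Alg V) - 1) * ((y : Alg V) - 1) + (((x : Alg V) - 1) + ((y : Alg V) - 1)) := by
      push_cast; noncomm_ring
    rw [e]
    exact add_mem (AK_anti V _ (by omega) (AK_mul V _ hx hy)) (add_mem hx hy)

section Functional

variable {V : FundamentalReps S} {l : ℕ} {φ : Alg V →ₗ[K] K}

/-- In `gh - 1 = (g - 1)(h - 1) + (g - 1) + (h - 1)` the product has degree at least `2l`, which
exceeds `l`. Functionals vanishing beyond degree `l` thus give additive characters of `E l`. -/
theorem map_mul_sub_one (hl : 1 ≤ l)
    (hφ : ∀ M ∈ AK V (coheight S) (l + 1), φ M = 0) {g h : (Alg V)ˣ} (hg : g ∈ (eFil V).E l)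
      (hh : h ∈ (eFil V).E l) :
    φ (((g * h : (Alg V)ˣ) : Alg V) - 1) = φ ((g : Alg V) - 1) + φ ((h : Alg V) - 1) := by
  have e : ((g * h : (Alg V)ˣ) : Alg V) - 1 =
      ((g : Alg V) - 1) * ((h : Alg V) - 1) + (((g : Alg V) - 1) + ((h : Alg V) - 1)) := by
    push_cast; noncomm_ring
  rw [e, map_add, map_add, hφ _ (AK_anti V _ (by omega)
    (AK_mul V _ (sub_one_mem_AK hl hg) (sub_one_mem_AK hl hh))), zero_add]

theorem map_inv_sub_one (hl : 1 ≤ l)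
    (hφ : ∀ M ∈ AK V (coheight S) (l + 1), φ M = 0) {g : (Alg V)ˣ} (hg : g ∈ (eFil V).E l) :
    φ (((g⁻¹ : (Alg V)ˣ) : Alg V) - 1) = -φ ((g : Alg V) - 1) := by
  have := map_mul_sub_one hl hφ hg (inv_mem hg)
  rw [mul_inv_cancel, Units.val_one, sub_self, map_zero] at this
  exact (neg_eq_of_add_eq_zero_right this.symm).symm

theorem map_expU_sub_one (hl : 1 ≤ l)
    (hφ : ∀ M ∈ AK V (coheight S) (l + 1), φ M = 0) {z : Alg V} (hz : z ∈ wordsK V S.e l) (hn :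
      IsNilpotent z) :
    φ ((expU z hn : Alg V) - 1) = φ z := by
  have h := hφ _ (exp_sub_one_sub_mem hl (wordsK_le_AK V (coheight_lie_e S) l hz))
  rw [map_sub, sub_eq_zero] at h
  exact h

theorem map_sub_one_eq_zero (hφ : ∀ M ∈ AK V (coheight S) (l + 1), φ M = 0) {g : (Alg V)ˣ} (hg :
    g ∈ (eFil V).E (l + 1)) :
    φ ((g : Alg V) - 1) = 0 := hφ _ (sub_one_mem_AK (by omega) hg)

theorem map_oprod_sub_one (hl : 1 ≤ l)
    (hφ : ∀ M ∈ AK V (coheight S) (l + 1), φ M = 0) {n : ℕ} {g : Fin n → (Alg V)ˣ} (hg : ∀ i,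
      g i ∈ (eFil V).E l) :
    φ (((oprod g : (Alg V)ˣ) : Alg V) - 1) = ∑ i, φ ((g i : Alg V) - 1) := by
  induction n with
  | zero => simp [oprod]
  | succ n ih =>
    rw [oprod_castSucc, map_mul_sub_one hl hφ (oprod_mem' fun i => hg _) (hg _),
      ih fun i => hg _, Fin.sum_univ_castSucc]

end Functional

/-- A basis of the span of the brackets of length `l`, made of brackets. -/
def symBasis (S : ChevalleySystem r 𝔤) (l : ℕ) : Set 𝔤 := (exists_basis_wordSpan S l).choose

theorem symBasis_subset (S : ChevalleySystem r 𝔤) (l : ℕ) : symBasis S l ⊆ words S.e l :=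
  (exists_basis_wordSpan S l).choose_spec.1

theorem span_symBasis (S : ChevalleySystem r 𝔤) (l : ℕ) :
    Submodule.span ℂ (symBasis S l) = wordSpan S.e l :=
  (exists_basis_wordSpan S l).choose_spec.2.1

theorem linearIndependent_symBasis (S : ChevalleySystem r 𝔤) (l : ℕ) :
    LinearIndependent ℂ ((↑) : symBasis S l → 𝔤) :=
  (exists_basis_wordSpan S l).choose_spec.2.2.1

instance (S : ChevalleySystem r 𝔤) (l : ℕ) : Fintype (symBasis S l) :=
  (exists_basis_wordSpan S l).choose_spec.2.2.2.fintype

theorem symBasis_ne_zero {l : ℕ} (x : symBasis S l) : (x : 𝔤) ≠ 0 :=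
  (linearIndependent_symBasis S l).ne_zero x

/-- The weight of an element of the basis. -/
def symWt {l : ℕ} (x : symBasis S l) : Fin r → ℤ :=
  (exists_hasWt_of_mem_words (symBasis_subset S l x.2)).choose

theorem hasWt_symWt {l : ℕ} (x : symBasis S l) : HasWt S (symWt x) (x : 𝔤) :=
  (exists_hasWt_of_mem_words (symBasis_subset S l x.2)).choose_spec

theorem isRoot_symWt {l : ℕ} (x : symBasis S l) : IsRoot S (symWt x) :=
  isRoot_of_mem_words (symBasis_subset S l x.2) (symBasis_ne_zero x) (hasWt_symWt x)

variable (V : FundamentalReps S)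

/-- The coordinate in the associated graded Lie algebra. -/
def symK {l : ℕ} (x : symBasis S l) : Alg V →ₗ[K] K :=
  funK V (exists_symbol V (symBasis_subset S l) (linearIndependent_symBasis S l) x).choose

variable {V}

theorem funK_eq_zero {φ : AlgC V →ₗ[ℂ] ℂ} {l : ℕ} (h : ∀ M ∈ degSet V (coheight S) l, φ M = 0)
    {M : Alg V} (hM : M ∈ AK V (coheight S) l) : funK V φ M = 0 := by
  induction hM using Submodule.span_induction with
  | mem M hM =>
    obtain ⟨M, hM, rfl⟩ := hM
    rw [funK_extA, h M hM, map_zero]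
  | zero => exact map_zero _
  | add a b _ _ ha hb => rw [map_add, ha, hb, add_zero]
  | smul t a _ ha => rw [map_smul, ha, smul_zero]

theorem symK_rK_self {l : ℕ} (x : symBasis S l) : symK V x (rK V x) = 1 := by
  rw [symK, ← extA_rC, funK_extA, (exists_symbol V (symBasis_subset S l)
    (linearIndependent_symBasis S l) x).choose_spec.1, map_one]

theorem symK_rK_of_ne {l : ℕ} {x y : symBasis S l} (h : y ≠ x) : symK V x (rK V y) = 0 := by
  rw [symK, ← extA_rC, funK_extA, (exists_symbol V (symBasis_subset S l)
    (linearIndependent_symBasis S l) x).choose_spec.2.1 y h, map_zero]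

theorem symK_of_mem_AK {l : ℕ} (x : symBasis S l) : ∀ M ∈ AK V (coheight S) (l + 1),
    symK V x M = 0 := fun _ hM =>
  funK_eq_zero (exists_symbol V (symBasis_subset S l)
    (linearIndependent_symBasis S l) x).choose_spec.2.2 hM

theorem symK_sum {l : ℕ} (x : symBasis S l) (t : symBasis S l → K) :
    symK V x (∑ y : symBasis S l, t y • rK V (y : 𝔤)) = t x := by
  rw [map_sum, Finset.sum_eq_single x]
  · rw [map_smul, symK_rK_self, smul_eq_mul, mul_one]
  · intro y _ hy
    rw [map_smul, symK_rK_of_ne hy, smul_zero]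
  · intro h
    exact absurd (Finset.mem_univ x) h

theorem sum_smul_mem {l : ℕ} (t : symBasis S l → K) :
    ∑ y : symBasis S l, t y • rK V (y : 𝔤) ∈ wordsK V S.e l :=
  sum_mem fun y _ => Submodule.smul_mem _ _
    (Submodule.subset_span ⟨y, ⟨l, le_rfl, symBasis_subset S l y.2⟩, rfl⟩)

/-- Together with `symK_of_mem_AK`, this makes the coordinates `symK` detect membership in the next
step of the filtration. -/
theorem sub_sum_symK_mem {l : ℕ} {z : Alg V} (hz : z ∈ wordsK V S.e l) :
    z - ∑ x : symBasis S l, symK V x z • rK V (x : 𝔤) ∈ wordsK V S.e (l + 1) := by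
  let T : Alg V →ₗ[K] Alg V :=
    LinearMap.id - ∑ x : symBasis S l, (symK V x).smulRight (rK V (x : 𝔤))
  have hT : ∀ z, T z = z - ∑ x : symBasis S l, symK V x z • rK V (x : 𝔤) := fun z => by
    simp [T]
  rw [← hT]
  suffices h : wordsK V S.e l ≤ (wordsK V S.e (l + 1)).comap T from h hz
  rw [wordsK, Submodule.span_le]
  rintro _ ⟨y, ⟨m, hm, hy⟩, rfl⟩
  rw [SetLike.mem_coe, Submodule.mem_comap]
  rcases hm.eq_or_lt with rfl | hm
  · have hy' : y ∈ Submodule.span ℂ (symBasis S l) := by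
      rw [span_symBasis]; exact Submodule.subset_span hy
    clear hy
    induction hy' using Submodule.span_induction with
    | mem y hy' =>
      have : ∀ x : symBasis S l, x ≠ ⟨y, hy'⟩ → symK V x (rK V y) • rK V (x : 𝔤) = 0 :=
        fun x hx => by
          rw [symK_rK_of_ne (x := x) (y := ⟨y, hy'⟩) hx.symm, zero_smul]
      rw [hT, Finset.sum_eq_single ⟨y, hy'⟩ (fun x _ hx => this x hx)
        (fun h => absurd (Finset.mem_univ _) h), symK_rK_self (V := V) ⟨y, hy'⟩, one_smul, sub_self]
      exact zero_mem _
    | zero => simp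
    | add a b _ _ ha hb => rw [map_add, map_add]; exact add_mem ha hb
    | smul c a _ ha =>
      rw [map_smul, ← algebraMap_smul K, map_smul]
      exact Submodule.smul_mem _ _ ha
  · have hmem : rK V y ∈ wordsK V S.e (l + 1) := Submodule.subset_span ⟨y, ⟨m, hm, hy⟩, rfl⟩
    rw [hT, Finset.sum_eq_zero, sub_zero]
    · exact hmem
    · intro x _
      rw [symK_of_mem_AK x _ (wordsK_le_AK V (coheight_lie_e S) _ hmem), zero_smul]

end Symbols

/-! ### The twisted shift `g(u) ↦ Z⁻¹ g(ħu) Z` -/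

section Twisting

variable {r : ℕ} {𝔤 : Type*} [LieRing 𝔤] [LieAlgebra ℂ 𝔤] {S : ChevalleySystem r 𝔤}

/-- The automorphism `M(u) ↦ M(ħ u)`. -/
def sA (ħ : ℂˣ) (V : FundamentalReps S) : Alg V →+* Alg V :=
  RingHom.pi fun i => (shift ħ).mapMatrix.comp (Pi.evalRingHom _ i)

theorem sA_gval (ħ : ℂˣ) (V : FundamentalReps S) (g : G V) :
    sA ħ V (gval V g) = gval V (gShift ħ V g) := rfl

theorem sA_smul (ħ : ℂˣ) (V : FundamentalReps S) (t : K) (M : Alg V) :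
    sA ħ V (t • M) = shift ħ t • sA ħ V M := by
  funext i
  ext a b
  exact map_mul (shift ħ) t (M i a b)

theorem sA_rK (ħ : ℂˣ) (V : FundamentalReps S) (x : 𝔤) : sA ħ V (rK V x) = rK V x := by
  funext i
  ext a b
  exact shift_algebraMap ħ _

/-- The automorphism `M(u) ↦ Z⁻¹ M(ħ u) Z`. -/
def tau (ħ : ℂˣ) (ζ : Fin r → ℂˣ) (V : FundamentalReps S) : Alg V →+* Alg V where
  toFun M := gval V (twist V ζ)⁻¹ * sA ħ V M * gval V (twist V ζ)
  map_one' := by rw [map_one, mul_one, ← map_mul, inv_mul_cancel, map_one]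
  map_mul' M N := by
    have h : gval V (twist V ζ) * gval V (twist V ζ)⁻¹ = 1 := by
      rw [← map_mul, mul_inv_cancel, map_one]
    rw [map_mul]
    simp only [mul_assoc]
    rw [← mul_assoc (gval V (twist V ζ)), h, one_mul]
  map_zero' := by rw [map_zero, mul_zero, zero_mul]
  map_add' M N := by rw [map_add, mul_add, add_mul]

theorem tau_apply (ħ : ℂˣ) (ζ : Fin r → ℂˣ) (V : FundamentalReps S) (M : Alg V) :
    tau ħ ζ V M = gval V (twist V ζ)⁻¹ * sA ħ V M * gval V (twist V ζ) := rfl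

theorem tau_smul (ħ : ℂˣ) (ζ : Fin r → ℂˣ) (V : FundamentalReps S) (t : K) (M : Alg V) :
    tau ħ ζ V (t • M) = shift ħ t • tau ħ ζ V M := by
  rw [tau_apply, sA_smul, mul_smul_comm, smul_mul_assoc, tau_apply]

/-- The value `∏_i ζ_i ^ c_i` of a weight `c` at `Z`. -/
def chi (ζ : Fin r → ℂˣ) (c : Fin r → ℤ) : ℂˣ := ∏ i, ζ i ^ c i

theorem constK_prod_zpow {ι : Type*} (s : Finset ι) (ζ : ι → ℂˣ) (c : ι → ℤ) :
    ∏ i ∈ s, constK (ζ i) ^ c i = constK ((∏ i ∈ s, ζ i ^ c i : ℂˣ) : ℂ) := by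
  rw [constK, Units.coe_prod, map_prod]
  refine Finset.prod_congr rfl fun i _ => ?_
  rw [Units.val_zpow_eq_zpow_val, map_zpow₀]

theorem tau_rK (ħ : ℂˣ) (ζ : Fin r → ℂˣ) (V : FundamentalReps S) {c : Fin r → ℤ} {x : 𝔤}
    (hx : HasWt S c x) : tau ħ ζ V (rK V x) = constK ((chi ζ c)⁻¹ : ℂˣ) • rK V x := by
  have h := tor_mul_rK V (h := fun i => constK (ζ i)) (fun i => constK_ne_zero (ζ i).ne_zero) hx
  rw [constK_prod_zpow, ← twist_eq_tor] at h
  rw [tau_apply, sA_rK]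
  have h2 : rK V x * gval V (twist V ζ) =
      constK ((chi ζ c)⁻¹ : ℂˣ) • (gval V (twist V ζ) * rK V x) := by
    rw [h, smul_smul, constK, constK, ← map_mul, ← chi, ← Units.val_mul, inv_mul_cancel,
      Units.val_one, map_one, one_smul]
  rw [mul_assoc, h2, mul_smul_comm, ← mul_assoc, ← map_mul, inv_mul_cancel, map_one, one_mul]

/-- The automorphism `g(u) ↦ Z⁻¹ g(ħ u) Z` on units. -/
def tauU (ħ : ℂˣ) (ζ : Fin r → ℂˣ) (V : FundamentalReps S) : (Alg V)ˣ →* (Alg V)ˣ :=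
  Units.map (tau ħ ζ V : Alg V →* Alg V)

theorem tauU_val (ħ : ℂˣ) (ζ : Fin r → ℂˣ) (V : FundamentalReps S) (g : (Alg V)ˣ) :
    (tauU ħ ζ V g : Alg V) = tau ħ ζ V g := rfl

theorem tauU_gU (ħ : ℂˣ) (ζ : Fin r → ℂˣ) (V : FundamentalReps S) (g : G V) :
    tauU ħ ζ V (gU V g) = gU V ((twist V ζ)⁻¹ * gShift ħ V g * twist V ζ) := by
  ext1
  rw [tauU_val, gU_val, gU_val, tau_apply, sA_gval, map_mul, map_mul]

theorem tauU_expU (ħ : ℂˣ) (ζ : Fin r → ℂˣ) (V : FundamentalReps S) {z : Alg V}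
    (hz : IsNilpotent z) (hz' : IsNilpotent (tau ħ ζ V z)) :
    tauU ħ ζ V (expU z hz) = expU (tau ħ ζ V z) hz' := by
  ext1
  exact IsNilpotent.map_exp hz (tau ħ ζ V)

theorem tau_mem_wordsK (ħ : ℂˣ) (ζ : Fin r → ℂˣ) {V : FundamentalReps S} {x : Fin r → 𝔤}
    (hx : ∀ i, ∃ c, HasWt S c (x i)) {l : ℕ} {z : Alg V} (hz : z ∈ wordsK V x l) :
    tau ħ ζ V z ∈ wordsK V x l := by
  have hw : ∀ n, ∀ y ∈ words x n, ∃ c, HasWt S c y := by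
    intro n
    induction n using Nat.twoStepInduction with
    | zero => exact fun y hy => hy.elim
    | one =>
      rintro _ ⟨i, rfl⟩
      exact hx i
    | more n _ ih =>
      rintro _ ⟨i, y, hy, rfl⟩
      obtain ⟨c, hc⟩ := ih y hy
      obtain ⟨d, hd⟩ := hx i
      exact ⟨_, hd.lie hc⟩
  induction hz using Submodule.span_induction with
  | mem z hz =>
    obtain ⟨y, ⟨m, hm, hy⟩, rfl⟩ := hz
    obtain ⟨c, hc⟩ := hw m y hy
    rw [tau_rK ħ ζ V hc]
    exact Submodule.smul_mem _ _ (Submodule.subset_span ⟨y, ⟨m, hm, hy⟩, rfl⟩)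
  | zero => rw [map_zero]; exact zero_mem _
  | add a b _ _ ha hb => rw [map_add]; exact add_mem ha hb
  | smul t a _ ha => rw [tau_smul]; exact Submodule.smul_mem _ _ ha

end Twisting

/-! ### The twisted shift on graded coordinates -/

section Symbols

variable {r : ℕ} {𝔤 : Type*} [LieRing 𝔤] [LieAlgebra ℂ 𝔤] [FiniteDimensional ℂ 𝔤]
  [LieAlgebra.IsSimple ℂ 𝔤] {S : ChevalleySystem r 𝔤} {V : FundamentalReps S}

theorem tau_mem_eFil (ħ : ℂˣ) (ζ : Fin r → ℂˣ) {l : ℕ} {z : Alg V} (hz : z ∈ wordsK V S.e l) :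
    tau ħ ζ V z ∈ wordsK V S.e l := tau_mem_wordsK ħ ζ (fun i => ⟨_, hasWt_e i⟩) hz

theorem tauU_mem_E (ħ : ℂˣ) (ζ : Fin r → ℂˣ) {l : ℕ} {g : (Alg V)ˣ} (hg : g ∈ (eFil V).E l) :
    tauU ħ ζ V g ∈ (eFil V).E l := by
  have h : (eFil V).E l ≤ ((eFil V).E l).comap (tauU ħ ζ V) := by
    refine (Subgroup.closure_le _).mpr ?_
    rintro u ⟨z, hz, hn, hu⟩
    rw [show u = expU z hn from Units.ext hu]
    change tauU ħ ζ V (expU z hn) ∈ (eFil V).E l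
    rw [tauU_expU ħ ζ V hn (hn.map (tau ħ ζ V))]
    exact (eFil V).expU_mem (tau_mem_eFil ħ ζ hz) _
  exact h hg

/-- The basis consists of weight vectors, on which `τ` acts diagonally, so on the graded pieces the
equation for a gauge transformation decouples into scalar equations. The version for group elements
is `symU_tauU`. -/
theorem symK_tau (ħ : ℂˣ) (ζ : Fin r → ℂˣ) {l : ℕ} (x : symBasis S l) {z : Alg V}
    (hz : z ∈ wordsK V S.e l) : symK V x (tau ħ ζ V z) =
      constK ((chi ζ (symWt x))⁻¹ : ℂˣ) * shift ħ (symK V x z) := by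
  have h0 := symK_of_mem_AK x _ (wordsK_le_AK V (coheight_lie_e S) _
    (tau_mem_eFil ħ ζ (sub_sum_symK_mem hz)))
  rw [map_sub, map_sub, sub_eq_zero] at h0
  rw [h0, map_sum]
  have : ∀ y : symBasis S l, tau ħ ζ V (symK V y z • rK V (y : 𝔤)) =
      (constK ((chi ζ (symWt y))⁻¹ : ℂˣ) * shift ħ (symK V y z)) • rK V (y : 𝔤) := fun y => by
    rw [tau_smul, tau_rK ħ ζ V (hasWt_symWt y), smul_smul, mul_comm]
  rw [Finset.sum_congr rfl fun y _ => this y, symK_sum]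

/-- The coordinate of an element of the group in the associated graded Lie algebra. -/
def symU {l : ℕ} (x : symBasis S l) (g : (Alg V)ˣ) : K := symK V x ((g : Alg V) - 1)

theorem symU_mul {l : ℕ} (hl : 1 ≤ l) (x : symBasis S l) {g h : (Alg V)ˣ}
    (hg : g ∈ (eFil V).E l) (hh : h ∈ (eFil V).E l) : symU x (g * h) = symU x g + symU x h :=
  map_mul_sub_one hl (symK_of_mem_AK x) hg hh

theorem symU_inv {l : ℕ} (hl : 1 ≤ l) (x : symBasis S l) {g : (Alg V)ˣ}
    (hg : g ∈ (eFil V).E l) : symU x g⁻¹ = -symU x g :=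
  map_inv_sub_one hl (symK_of_mem_AK x) hg

theorem symU_eq_zero {l : ℕ} (x : symBasis S l) {g : (Alg V)ˣ} (hg : g ∈ (eFil V).E (l + 1)) :
    symU x g = 0 := map_sub_one_eq_zero (symK_of_mem_AK x) hg

theorem symU_expU {l : ℕ} (hl : 1 ≤ l) (x : symBasis S l) {z : Alg V} (hz : z ∈ wordsK V S.e l)
    (hn : IsNilpotent z) : symU x (expU z hn) = symK V x z :=
  map_expU_sub_one hl (symK_of_mem_AK x) hz hn

theorem exists_symU_eq {l : ℕ} (hl : 1 ≤ l) {g : (Alg V)ˣ} (hg : g ∈ (eFil V).E l) :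
    ∃ z ∈ wordsK V S.e l, ∃ hn : IsNilpotent z, ∃ e ∈ (eFil V).E (l + 1), g = e * expU z hn ∧
      ∀ x : symBasis S l, symU x g = symK V x z := by
  obtain ⟨z, hz, e, he, h⟩ := (eFil V).exists_expU_mul hl hg
  refine ⟨z, hz, _, e, he, h, fun x => ?_⟩
  rw [h, symU_mul hl x ((eFil V).E_anti (Nat.le_succ l) he) ((eFil V).expU_mem hz _),
    symU_eq_zero x he, symU_expU hl x hz, zero_add]

theorem symU_tauU (ħ : ℂˣ) (ζ : Fin r → ℂˣ) {l : ℕ} (hl : 1 ≤ l) (x : symBasis S l)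
    {g : (Alg V)ˣ} (hg : g ∈ (eFil V).E l) : symU x (tauU ħ ζ V g) =
      constK ((chi ζ (symWt x))⁻¹ : ℂˣ) * shift ħ (symU x g) := by
  obtain ⟨z, hz, hn, e, he, h, hs⟩ := exists_symU_eq hl hg
  have he' := tauU_mem_E ħ ζ he
  rw [hs, ← symK_tau ħ ζ x hz, h, map_mul, tauU_expU ħ ζ V hn (hn.map (tau ħ ζ V)),
    symU_mul hl x ((eFil V).E_anti (Nat.le_succ l) he')
      ((eFil V).expU_mem (tau_mem_eFil ħ ζ hz) _), symU_eq_zero x he',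
    symU_expU hl x (tau_mem_eFil ħ ζ hz), zero_add]

/-- Modulo `E (l + 1)` the element is the exponential of some `z`, and vanishing coordinates put `z`
one step deeper. -/
theorem mem_E_succ {l : ℕ} (hl : 1 ≤ l) {g : (Alg V)ˣ} (hg : g ∈ (eFil V).E l)
    (h0 : ∀ x : symBasis S l, symU x g = 0) : g ∈ (eFil V).E (l + 1) := by
  obtain ⟨z, hz, hn, e, he, h, hs⟩ := exists_symU_eq hl hg
  have h1 := sub_sum_symK_mem hz
  rw [Finset.sum_eq_zero (fun x _ => by rw [← hs, h0, zero_smul]), sub_zero] at h1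
  rw [h]
  exact mul_mem he ((eFil V).expU_mem h1 _)

end Symbols

/-! ### Matrices with entries in a ring of regular functions -/

section Regular

variable {r : ℕ} {𝔤 : Type*} [LieRing 𝔤] [LieAlgebra ℂ 𝔤] {S : ChevalleySystem r 𝔤}

/-- The matrices with entries in `R`. -/
def regAlg (V : FundamentalReps S) (R : Subring K) : Subring (Alg V) where
  carrier := {M | ∀ i a b, M i a b ∈ R}
  mul_mem' hM hN i a b := by
    rw [Pi.mul_apply, Matrix.mul_apply]
    exact sum_mem fun c _ => mul_mem (hM i a c) (hN i c b)
  one_mem' i a b := by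
    rw [Pi.one_apply, Matrix.one_apply]
    split_ifs
    · exact one_mem _
    · exact zero_mem _
  add_mem' hM hN i a b := add_mem (hM i a b) (hN i a b)
  zero_mem' _ _ _ := zero_mem _
  neg_mem' hM i a b := neg_mem (hM i a b)

/-- The invertible matrices over `R`. -/
def regU (V : FundamentalReps S) (R : Subring K) : Subgroup (Alg V)ˣ :=
  (regAlg V R).toSubmonoid.units

variable {V : FundamentalReps S} {R : Subring K}

theorem mem_regU {g : (Alg V)ˣ} :
    g ∈ regU V R ↔ (g : Alg V) ∈ regAlg V R ∧ ((g⁻¹ : (Alg V)ˣ) : Alg V) ∈ regAlg V R :=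
  Submonoid.mem_units_iff _ _

theorem smul_mem_regAlg {t : K} {M : Alg V} (ht : t ∈ R) (hM : M ∈ regAlg V R) :
    t • M ∈ regAlg V R := fun i a b => mul_mem ht (hM i a b)

theorem rK_mem_regAlg (hR : ∀ c, constK c ∈ R) (x : 𝔤) : rK V x ∈ regAlg V R :=
  fun _ _ _ => hR _

theorem rat_smul_mem_regAlg (hR : ∀ c, constK c ∈ R) (c : ℚ) {M : Alg V} (hM : M ∈ regAlg V R) :
    c • M ∈ regAlg V R := by
  rw [rat_smul]
  refine smul_mem_regAlg ?_ hM
  have := hR (algebraMap ℚ ℂ c)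
  rwa [constK, ← RingHom.comp_apply,
    RingHom.congr_fun (RingHom.ext_rat ((algebraMap ℂ K).comp (algebraMap ℚ ℂ)) (algebraMap ℚ K))]
    at this

theorem exp_mem_regAlg (hR : ∀ c, constK c ∈ R) {z : Alg V} (hn : IsNilpotent z)
    (hz : z ∈ regAlg V R) : IsNilpotent.exp z ∈ regAlg V R := by
  obtain ⟨k, hk⟩ := hn
  rw [IsNilpotent.exp_eq_sum hk]
  exact sum_mem fun i _ => rat_smul_mem_regAlg hR _ (pow_mem hz i)

theorem expU_mem_regU (hR : ∀ c, constK c ∈ R) {z : Alg V} (hn : IsNilpotent z)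
    (hz : z ∈ regAlg V R) : expU z hn ∈ regU V R :=
  mem_regU.mpr ⟨exp_mem_regAlg hR hn hz, exp_mem_regAlg hR hn.neg (neg_mem hz)⟩

theorem funK_mem (hR : ∀ c, constK c ∈ R) (φ : AlgC V →ₗ[ℂ] ℂ) {M : Alg V}
    (hM : M ∈ regAlg V R) : funK V φ M ∈ R :=
  show ∑ i, ∑ p, ∑ q, M i p q * algebraMap ℂ K (φ (Pi.single i (Matrix.single p q 1))) ∈ R from
    sum_mem fun i _ => sum_mem fun p _ => sum_mem fun q _ => mul_mem (hM i p q) (hR _)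

/-- By construction `Z` is a product of exponentials of constant matrices. -/
theorem gval_tor_const_mem (hR : ∀ c, constK c ∈ R) {ζ : Fin r → ℂˣ} :
    gval V (twist V ζ) ∈ regAlg V R := by
  have hE : ∀ j (c : ℂ), gval V (xE V j (constK c)) ∈ regAlg V R := fun j c => by
    rw [← gU_val, gU_xE]
    exact exp_mem_regAlg hR ((isNilpotent_rK_e V j).smul _)
      (smul_mem_regAlg (hR c) (rK_mem_regAlg hR _))
  have hF : ∀ j (c : ℂ), gval V (xF V j (constK c)) ∈ regAlg V R := fun j c => by
    rw [← gU_val, gU_xF]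
    exact exp_mem_regAlg hR ((isNilpotent_rK_f V j).smul _)
      (smul_mem_regAlg (hR c) (rK_mem_regAlg hR _))
  have hW : ∀ j (c : ℂ), gval V (weylElt V j (constK c)) ∈ regAlg V R := fun j c => by
    rw [weylElt, map_mul, map_mul]
    refine mul_mem (mul_mem (hE j c) ?_) (hE j c)
    have := hF j (-c⁻¹)
    rwa [constK, map_neg, map_inv₀] at this
  have hW' : ∀ j, gval V (weylElt V j 1)⁻¹ ∈ regAlg V R := fun j => by
    rw [weylElt, mul_inv_rev, mul_inv_rev, ← xE_neg, ← xF_neg, map_mul, map_mul, neg_neg, inv_one]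
    have h1 := hE j (-1)
    have h2 := hF j 1
    rw [constK, map_neg, map_one] at h1
    rw [constK, map_one] at h2
    exact mul_mem h1 (mul_mem h2 h1)
  rw [twist, map_oprod]
  refine oprod_mem (S := (regAlg V R).toSubmonoid) fun i => ?_
  rw [cochar, map_mul]
  exact mul_mem (hW _ _) (hW' i)

theorem twist_inv (ζ : Fin r → ℂˣ) : (twist V ζ)⁻¹ = twist V fun i => (ζ i)⁻¹ := by
  rw [twist_eq_tor, twist_eq_tor, tor_inv V fun i => constK_ne_zero (ζ i).ne_zero]
  congr 1
  funext i
  rw [Units.val_inv_eq_inv_val, constK, constK, map_inv₀]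

theorem tau_mem_regAlg (hR : ∀ c, constK c ∈ R) {ħ : ℂˣ} (hs : ∀ f ∈ R, shift ħ f ∈ R)
    {ζ : Fin r → ℂˣ} {M : Alg V} (hM : M ∈ regAlg V R) : tau ħ ζ V M ∈ regAlg V R := by
  rw [tau_apply, twist_inv]
  exact mul_mem (mul_mem (gval_tor_const_mem hR) fun i a b => hs _ (hM i a b))
    (gval_tor_const_mem hR)

theorem tauU_mem_regU (hR : ∀ c, constK c ∈ R) {ħ : ℂˣ} (hs : ∀ f ∈ R, shift ħ f ∈ R)
    {ζ : Fin r → ℂˣ} {g : (Alg V)ˣ} (hg : g ∈ regU V R) : tauU ħ ζ V g ∈ regU V R := by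
  rw [mem_regU] at hg ⊢
  exact ⟨tau_mem_regAlg hR hs hg.1, by
    rw [← map_inv]; exact tau_mem_regAlg hR hs hg.2⟩

end Regular

/-! ### Solving the nonabelian difference equation -/

section Existence

variable {r : ℕ} {𝔤 : Type*} [LieRing 𝔤] [LieAlgebra ℂ 𝔤] [FiniteDimensional ℂ 𝔤]
  [LieAlgebra.IsSimple ℂ 𝔤] {S : ChevalleySystem r 𝔤} {V : FundamentalReps S}

theorem symU_mem {R : Subring K} (hR : ∀ c, constK c ∈ R) {l : ℕ} (x : symBasis S l)
    {g : (Alg V)ˣ} (hg : g ∈ regU V R) : symU x g ∈ R :=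
  funK_mem hR _ (sub_mem (mem_regU.mp hg).1 (one_mem _))

theorem chi_inv_ne {ħ : ℂˣ} {ζ : Fin r → ℂˣ} (hζ : GenericTwist S ħ ζ) {c : Fin r → ℤ}
    (hc : IsRoot S c) (k : ℤ) : (chi ζ c)⁻¹ ≠ ħ ^ k := fun h =>
  hζ c hc (-k) (by rw [zpow_neg, ← h, inv_inv, chi])

theorem mul_mul_inv_eq_of_mul_eq {G : Type*} [Group G] {P T b R p g : G}
    (h : P * T * b = R * (p * g)) : T * b * g⁻¹ = P⁻¹ * R * p := by
  rw [mul_inv_eq_iff_eq_mul, mul_assoc, mul_assoc, ← h, mul_assoc, inv_mul_cancel_left]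

/-- If two gauge transformations take `a` to a regular element and to an element of `E k`, then
their quotient is the product of a regular element and an element of `E l`, `l ≤ k`. -/
theorem exists_regU_mul {ħ : ℂˣ} (hħ : ∀ n : ℕ, 0 < n → ħ ^ n ≠ 1) (ζ : Fin r → ℂˣ) {w : ℂ}
    (hw : w ≠ 0) {k : ℕ} {a R' h : (Alg V)ˣ} (ha : a ∈ (eFil V).E k)
    (hR' : R' ∈ regU V (RegOrb ħ w)) (hh : h ∈ (eFil V).E 1)
    (heq : tauU ħ ζ V h * a = R' * h) {l : ℕ} (hl1 : 1 ≤ l) (hl : l ≤ k) :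
    ∃ p ∈ regU V (RegOrb ħ w), ∃ g ∈ (eFil V).E l, h = p * g := by
  have hR : ∀ c, constK c ∈ RegOrb ħ w := fun c => constK_mem_regOrb ħ c w
  have hs : ∀ f ∈ RegOrb ħ w, shift ħ f ∈ RegOrb ħ w := fun f => shift_mem_regOrb
  induction l, hl1 using Nat.le_induction with
  | base => exact ⟨1, one_mem _, h, hh, (one_mul h).symm⟩
  | succ l hl1 ih =>
    obtain ⟨p, hp, g, hg, rfl⟩ := ih (by omega)
    have ha' := (eFil V).E_anti hl ha
    have ha'' := (eFil V).E_anti (Nat.le_succ l) ha'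
    -- Since `a` lies in `E (l + 1)`, it is invisible in degree `l`. The coordinates of `g`
    -- therefore satisfy a scalar equation with regular right-hand side, which makes them regular on
    -- the whole orbit.
    have hreg : ∀ x : symBasis S l, symU x g ∈ RegOrb ħ w := by
      intro x
      refine mem_regOrb_of_diffOp hħ hw (c := ((chi ζ (symWt x))⁻¹ : ℂˣ)) ?_
      have e : tauU ħ ζ V g * a * g⁻¹ = (tauU ħ ζ V p)⁻¹ * R' * p := by
        rw [map_mul] at heq
        exact mul_mul_inv_eq_of_mul_eq heq
      have h1 := symU_mem hR x (mul_mem (mul_mem (inv_mem (tauU_mem_regU hR hs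
        (ζ := ζ) hp)) hR') hp)
      rw [← e, symU_mul hl1 x (mul_mem (tauU_mem_E ħ ζ hg) ha'') (inv_mem hg),
        symU_mul hl1 x (tauU_mem_E ħ ζ hg) ha'', symU_eq_zero x ha', symU_inv hl1 x hg,
        symU_tauU ħ ζ hl1 x hg, add_zero, ← sub_eq_add_neg] at h1
      exact h1
    -- The exponential of the leading term of `g` is regular, so it can be moved from `g` to `p`.
    set z := ∑ x : symBasis S l, symU x g • rK V (x : 𝔤) with hz
    have hzm : z ∈ wordsK V S.e l := sum_smul_mem _
    have hn : IsNilpotent z := (eFil V).nil' hl1 hzm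
    have hzr : z ∈ regAlg V (RegOrb ħ w) :=
      sum_mem fun x _ => smul_mem_regAlg (hreg x) (rK_mem_regAlg hR _)
    have hzE := (eFil V).expU_mem hzm hn
    refine ⟨p * expU z hn, mul_mem hp (expU_mem_regU hR hn hzr), (expU z hn)⁻¹ * g,
      mem_E_succ hl1 (mul_mem (inv_mem hzE) hg) fun x => ?_, by group⟩
    rw [symU_mul hl1 x (inv_mem hzE) hg, symU_inv hl1 x hzE, symU_expU hl1 x hzm, hz, symK_sum,
      neg_add_cancel]

/-- A `τ`-connection in the unipotent group which is gauge equivalent to `1` modulo `E 2`, and can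
be made regular near every orbit, is gauge equivalent to `1`. -/
theorem exists_gauge {ħ : ℂˣ} (hħ : ∀ n : ℕ, 0 < n → ħ ^ n ≠ 1) {ζ : Fin r → ℂˣ}
    (hζ : GenericTwist S ħ ζ) {a n₀ : (Alg V)ˣ} (hn₀ : n₀ ∈ (eFil V).E 1)
    (h₀ : (tauU ħ ζ V n₀)⁻¹ * a * n₀ ∈ (eFil V).E 2)
    (hloc : ∀ w : ℂ, w ≠ 0 → ∃ n ∈ (eFil V).E 1, (tauU ħ ζ V n)⁻¹ * a * n ∈ regU V (RegOrb ħ w)) :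
    ∃ m ∈ (eFil V).E 2, (tauU ħ ζ V (n₀ * m))⁻¹ * a * (n₀ * m) = 1 := by
  obtain ⟨L, hL⟩ := (eFil V).E_eq_bot
  suffices key : ∀ d : ℕ, ∃ m ∈ (eFil V).E 2,
      (tauU ħ ζ V (n₀ * m))⁻¹ * a * (n₀ * m) ∈ (eFil V).E (2 + d) by
    obtain ⟨m, hm, h⟩ := key L
    refine ⟨m, hm, ?_⟩
    have := (eFil V).E_anti (Nat.le_add_left L 2) h
    rwa [hL, Subgroup.mem_bot] at this
  intro d
  induction d with
  | zero => exact ⟨1, one_mem _, by simpa using h₀⟩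
  | succ d ih =>
    obtain ⟨m, hm, hk⟩ := ih
    set k := 2 + d with hkd
    have hk1 : 1 ≤ k := by omega
    set n := n₀ * m with hn
    have hnE : n ∈ (eFil V).E 1 := mul_mem hn₀ ((eFil V).E_anti one_le_two hm)
    set b := (tauU ħ ζ V n)⁻¹ * a * n with hb
    -- The obstruction in degree `k` splits into scalar equations, which need only be solved near
    -- each orbit. There the local gauge `nw` is compared with the gauge `n` found so far; the
    -- degree `k` coordinate of the non-regular factor, with the opposite sign, is a local solution.
    have hsol : ∀ x : symBasis S k, ∃ f,
        diffOp ħ ((chi ζ (symWt x))⁻¹ : ℂˣ) f = symU x b := by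
      intro x
      refine exists_diffOp_eq (chi_inv_ne hζ (isRoot_symWt x)) _ fun w hw => ?_
      obtain ⟨nw, hnw, hreg⟩ := hloc w hw
      have hR : ∀ c, constK c ∈ RegOrb ħ w := fun c => constK_mem_regOrb ħ c w
      have hs : ∀ f ∈ RegOrb ħ w, shift ħ f ∈ RegOrb ħ w := fun f => shift_mem_regOrb
      have heq : tauU ħ ζ V (nw⁻¹ * n) * b = ((tauU ħ ζ V nw)⁻¹ * a * nw) * (nw⁻¹ * n) := by
        rw [hb, map_mul, map_inv]; group
      obtain ⟨p, hp, g, hg, hpg⟩ := exists_regU_mul hħ ζ hw hk hreg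
        (mul_mem (inv_mem hnw) hnE) heq hk1 le_rfl
      have e : tauU ħ ζ V g * b * g⁻¹ =
          (tauU ħ ζ V p)⁻¹ * ((tauU ħ ζ V nw)⁻¹ * a * nw) * p := by
        rw [hpg, map_mul] at heq
        exact mul_mul_inv_eq_of_mul_eq heq
      have h1 := symU_mem hR x (mul_mem (mul_mem (inv_mem (tauU_mem_regU hR hs
        (ζ := ζ) hp)) hreg) hp)
      rw [← e, symU_mul hk1 x (mul_mem (tauU_mem_E ħ ζ hg) hk) (inv_mem hg),
        symU_mul hk1 x (tauU_mem_E ħ ζ hg) hk, symU_inv hk1 x hg, symU_tauU ħ ζ hk1 x hg] at h1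
      refine ⟨-symU x g, ?_⟩
      rw [diffOp, map_neg]
      convert h1 using 1
      ring
    choose f hf using hsol
    set z := ∑ x : symBasis S k, f x • rK V (x : 𝔤) with hz
    have hzm : z ∈ wordsK V S.e k := sum_smul_mem _
    have hzn : IsNilpotent z := (eFil V).nil' hk1 hzm
    have hzE := (eFil V).expU_mem hzm hzn
    have hτ := tauU_mem_E ħ ζ hzE
    refine ⟨m * expU z hzn, mul_mem hm ((eFil V).E_anti (by omega) hzE), ?_⟩
    have e : (tauU ħ ζ V (n₀ * (m * expU z hzn)))⁻¹ * a * (n₀ * (m * expU z hzn)) =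
        (tauU ħ ζ V (expU z hzn))⁻¹ * b * expU z hzn := by
      rw [← mul_assoc n₀, ← hn, map_mul, hb]; group
    rw [e]
    refine mem_E_succ hk1 (mul_mem (mul_mem (inv_mem hτ) hk) hzE) fun x => ?_
    rw [symU_mul hk1 x (mul_mem (inv_mem hτ) hk) hzE, symU_mul hk1 x (inv_mem hτ) hk,
      symU_inv hk1 x hτ, symU_tauU ħ ζ hk1 x hzE, symU_expU hk1 x hzm, hz, symK_sum, ← hf x, diffOp]
    ring

end Existence

/-! ### An identity for ordered products with commuting insertions -/

section GroupIdentity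

variable {N : Type*} [Group N]

theorem oprod_inv_of_commute {n : ℕ} {x : Fin n → N} (h : ∀ i j, Commute (x i) (x j)) :
    oprod (fun i => (x i)⁻¹) = (oprod x)⁻¹ := by
  induction n with
  | zero => simp [oprod]
  | succ n ih =>
    rw [oprod_castSucc, oprod_castSucc, ih fun i j => h _ _, ← mul_inv_rev]
    congr 1
    exact (oprod_mul_of_rel (X := fun i => x i.castSucc) (Y := fun i => x i.castSucc)
      fun i => h _ _).symm

theorem oprod_conj {n : ℕ} (a : N) (g : Fin n → N) :
    oprod (fun i => a * g i * a⁻¹) = a * oprod g * a⁻¹ := by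
  have := map_oprod (MulAut.conj a) g
  simpa using this.symm

/-- Moving commuting factors `y i * (x i)⁻¹` of an ordered product to the ends. -/
theorem oprod_mul_commuting {n : ℕ} (g x y : Fin n → N) (hx : ∀ i j, Commute (x i) (x j))
    (hy : ∀ i j, Commute (y i) (y j)) (hxy : ∀ i j, Commute (x i) (y j)) :
    (oprod y)⁻¹ * oprod (fun i => g i * (y i * (x i)⁻¹)) * oprod x =
      oprod fun i => (oprod fun j => if j < i then (x j)⁻¹ else (y j)⁻¹) * g i *
        (oprod fun j => if j < i then (x j)⁻¹ else (y j)⁻¹)⁻¹ := by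
  induction n with
  | zero => simp [oprod]
  | succ n ih =>
    have IH := ih (fun i => g i.castSucc) (fun i => x i.castSucc) (fun i => y i.castSucc)
      (fun i j => hx _ _) (fun i j => hy _ _) (fun i j => hxy _ _)
    set X := oprod fun i : Fin n => x i.castSucc with hX
    set Y := oprod fun i : Fin n => y i.castSucc with hY
    set P := oprod fun i : Fin n => g i.castSucc * (y i.castSucc * (x i.castSucc)⁻¹) with hP
    set yl := y (Fin.last n) with hyl
    set xl := x (Fin.last n) with hxl
    have hlast : oprod (fun j : Fin (n + 1) => if j < Fin.last n then (x j)⁻¹ else (y j)⁻¹) =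
        X⁻¹ * yl⁻¹ := by
      rw [oprod_castSucc, if_neg (lt_irrefl _), hX, ← oprod_inv_of_commute fun i j => hx _ _]
      congr 2
      funext j
      rw [if_pos (Fin.castSucc_lt_last j)]
    have hi : ∀ i : Fin n, oprod (fun j : Fin (n + 1) => if j < i.castSucc then (x j)⁻¹ else
        (y j)⁻¹) = yl⁻¹ * oprod (fun j : Fin n => if j < i then (x j.castSucc)⁻¹ else
          (y j.castSucc)⁻¹) := by
      intro i
      rw [oprod_castSucc, if_neg (Fin.castSucc_lt_last i).not_gt]
      refine oprod_mul_of_rel fun j => ?_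
      simp only [Fin.castSucc_lt_castSucc_iff]
      split_ifs
      · exact ((hxy _ _).inv_inv)
      · exact ((hy _ _).inv_inv)
    rw [oprod_castSucc, oprod_castSucc, oprod_castSucc, oprod_castSucc, hlast]
    simp only [hi]
    have e : ∀ i : Fin n, yl⁻¹ * oprod (fun j : Fin n => if j < i then (x j.castSucc)⁻¹ else
          (y j.castSucc)⁻¹) * g i.castSucc * (yl⁻¹ * oprod (fun j : Fin n => if j < i then
          (x j.castSucc)⁻¹ else (y j.castSucc)⁻¹))⁻¹ =
        yl⁻¹ * (oprod (fun j : Fin n => if j < i then (x j.castSucc)⁻¹ else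
          (y j.castSucc)⁻¹) * g i.castSucc * (oprod (fun j : Fin n => if j < i then
          (x j.castSucc)⁻¹ else (y j.castSucc)⁻¹))⁻¹) * (yl⁻¹)⁻¹ := fun i => by group
    simp only [e]
    rw [oprod_conj, ← IH]
    have hc : X * xl = xl * X := oprod_mul_of_rel (X := fun i : Fin n => x i.castSucc)
      (Y := fun i : Fin n => x i.castSucc) fun i => hx _ _
    change (Y * yl)⁻¹ * (P * (g (Fin.last n) * (yl * xl⁻¹))) * (X * xl) = _
    have hc2 : X * yl = yl * X := oprod_mul_of_rel (X := fun i : Fin n => x i.castSucc)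
      (Y := fun i : Fin n => x i.castSucc) fun i => hxy _ _
    have hc3 : X⁻¹ * yl⁻¹ = yl⁻¹ * X⁻¹ := by rw [← mul_inv_rev, ← mul_inv_rev, hc2]
    rw [hc, hc3]
    group
    rw [mul_assoc _ yl X, mul_assoc _ X yl, hc2]

end GroupIdentity

/-! ### Regularity of the connection on one orbit -/

section LocalRegular

variable {r : ℕ} {𝔤 : Type*} [LieRing 𝔤] [LieAlgebra ℂ 𝔤] [FiniteDimensional ℂ 𝔤]
  [LieAlgebra.IsSimple ℂ 𝔤] {S : ChevalleySystem r 𝔤} {V : FundamentalReps S}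

theorem adQ_smul_pow (t : K) (z M : Alg V) (k : ℕ) :
    ((adQ (t • z)) ^ k) M = t ^ k • ((adQ z) ^ k) M := by
  induction k with
  | zero => simp
  | succ k ih =>
    rw [pow_succ', Module.End.mul_apply, ih, pow_succ' (adQ z), Module.End.mul_apply, adQ_apply,
      adQ_apply, smul_mul_smul_comm, smul_mul_smul_comm, ← pow_succ', ← pow_succ, ← smul_sub]

theorem adQ_pow_smul (t : K) (z M : Alg V) (k : ℕ) :
    ((adQ z) ^ k) (t • M) = t • ((adQ z) ^ k) M := by
  induction k with
  | zero => simp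
  | succ k ih =>
    rw [pow_succ', Module.End.mul_apply, ih, Module.End.mul_apply, adQ_apply,
      adQ_apply, mul_smul_comm, smul_mul_assoc, ← smul_sub]

theorem adQ_pow_mem_regAlg {R : Subring K} {z M : Alg V} (hz : z ∈ regAlg V R)
    (hM : M ∈ regAlg V R) (k : ℕ) : ((adQ z) ^ k) M ∈ regAlg V R := by
  induction k with
  | zero => simpa using hM
  | succ k ih =>
    rw [pow_succ', Module.End.mul_apply, adQ_apply]
    exact sub_mem (mul_mem hz ih) (mul_mem ih hz)

theorem adQ_pow_conj (z M : Alg V) (g : (Alg V)ˣ) (hg : (g : Alg V) * z = z * g) (k : ℕ) :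
    ((adQ z) ^ k) (g * M * ((g⁻¹ : (Alg V)ˣ) : Alg V)) =
      g * ((adQ z) ^ k) M * ((g⁻¹ : (Alg V)ˣ) : Alg V) := by
  have hg' : ((g⁻¹ : (Alg V)ˣ) : Alg V) * z = z * ((g⁻¹ : (Alg V)ˣ) : Alg V) := by
    rw [Units.inv_mul_eq_iff_eq_mul, ← mul_assoc, hg, mul_assoc, Units.mul_inv, mul_one]
  induction k with
  | zero => simp
  | succ k ih =>
    rw [pow_succ', Module.End.mul_apply, ih, Module.End.mul_apply, adQ_apply, adQ_apply, mul_sub,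
      sub_mul]
    congr 1
    · rw [← mul_assoc, ← mul_assoc, ← hg, ← mul_assoc]
    · rw [mul_assoc, hg', ← mul_assoc, mul_assoc (g : Alg V)]

theorem adQ_rK_pow (x y : 𝔤) (k : ℕ) :
    ((adQ (rK V x)) ^ k) (rK V y) = rK V (((LieAlgebra.ad ℂ 𝔤 x) ^ k) y) := by
  induction k with
  | zero => simp
  | succ k ih =>
    rw [pow_succ', Module.End.mul_apply, ih, adQ_apply, ← rK_lie, pow_succ',
      Module.End.mul_apply, LieAlgebra.ad_apply]

theorem gU_xE_mul_rK {i j : Fin r} (h : ⁅S.e i, S.e j⁆ = 0) (t : K) :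
    (gU V (xE V i t) : Alg V) * rK V (S.e j) = rK V (S.e j) * (gU V (xE V i t) : Alg V) := by
  have hc : Commute (t • rK V (S.e i)) (rK V (S.e j)) := by
    refine Commute.smul_left ?_ t
    rw [commute_iff_eq, ← sub_eq_zero, ← rK_lie, h, map_zero]
  rw [gU_xE]
  obtain ⟨k, hk⟩ := (isNilpotent_rK_e V i).smul t
  change IsNilpotent.exp (t • rK V (S.e i)) * _ = _ * IsNilpotent.exp (t • rK V (S.e i))
  rw [IsNilpotent.exp_eq_sum hk, Finset.sum_mul, Finset.mul_sum]
  refine Finset.sum_congr rfl fun m _ => ?_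
  rw [rat_smul, smul_mul_assoc, mul_smul_comm, (hc.pow_left m).eq]

theorem xE_comm {i j : Fin r} (h : ⁅S.e i, S.e j⁆ = 0) (s t : K) :
    Commute (xE V i s) (xE V j t) := by
  rw [commute_iff_eq]
  apply gU_injective
  rw [map_mul, map_mul, gU_xE V j]
  refine gU_mul_expU _ _ ?_
  rw [mul_smul_comm, smul_mul_assoc]
  exact congrArg (t • ·) (gU_xE_mul_rK h s)

/-- The conjugate of `exp (s e_i)` by a product of `exp (t_j e_j)`, for commuting `e_j`, is regular
if `s` vanishes sufficiently at the poles of the `t_j`. -/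
theorem conj_xE_mem_regU {R : Subring K} (hR : ∀ c, constK c ∈ R) (I : Fin r → Prop)
    [DecidablePred I] (hI : ∀ i j, I i → I j → ⁅S.e i, S.e j⁆ = 0) {i : Fin r} (hi : ¬I i)
    {t κ : Fin r → K} (ht : ∀ j, ¬I j → t j = 0) (hκ : ∀ j, I j → κ j ∈ R ∧ κ j * t j ∈ R)
    {s ρ : K} (hρ : ρ ∈ R) (hs : s = ρ * ∏ j, if I j then κ j ^ (-S.cartan j i).toNat else 1) :
    gU V (oprod (fun j => xE V j (t j)) * xE V i s * (oprod fun j => xE V j (t j))⁻¹) ∈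
      regU V R := by
  -- The second half of the induction keeps the Serre relations for the conjugated element. They
  -- persist because the conjugating exponentials commute with every `e_j`, `j ∈ I`.
  have key : ∀ L : List (Fin r),
      (L.map fun j => if I j then κ j ^ (-S.cartan j i).toNat else 1).prod •
        (gval V (L.map fun j => xE V j (t j)).prod * rK V (S.e i) *
          gval V ((L.map fun j => xE V j (t j)).prod)⁻¹) ∈ regAlg V R ∧
      ∀ j, I j → ((adQ (rK V (S.e j))) ^ ((-S.cartan j i).toNat + 1))
        (gval V (L.map fun j => xE V j (t j)).prod * rK V (S.e i) *
          gval V ((L.map fun j => xE V j (t j)).prod)⁻¹) = 0 := by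
    intro L
    induction L with
    | nil =>
      simp only [List.map_nil, List.prod_nil, one_smul, inv_one, map_one, one_mul, mul_one]
      refine ⟨rK_mem_regAlg hR _, fun j hj => ?_⟩
      rw [adQ_rK_pow, serre_e S (by rintro rfl; exact hi hj), map_zero]
    | cons j L ih =>
      set D := (L.map fun j => xE V j (t j)).prod with hD
      set c := (L.map fun j => if I j then κ j ^ (-S.cartan j i).toNat else 1).prod with hc
      set M := gval V D * rK V (S.e i) * gval V D⁻¹ with hM
      simp only [List.map_cons, List.prod_cons]
      by_cases hj : I j
      · rw [if_pos hj]
        set n := (-S.cartan j i).toNat with hn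
        have e : gval V (xE V j (t j) * D) * rK V (S.e i) * gval V (xE V j (t j) * D)⁻¹ =
            (gU V (xE V j (t j)) : Alg V) * M * (((gU V (xE V j (t j)))⁻¹ : (Alg V)ˣ) : Alg V) := by
          rw [mul_inv_rev, map_mul, map_mul, ← map_inv, gU_val, gU_val, hM]
          simp only [mul_assoc]
        rw [← hD, e]
        constructor
        · have hnil : IsNilpotent (t j • rK V (S.e j)) := (isNilpotent_rK_e V j).smul _
          have h0 : ((adQ (t j • rK V (S.e j))) ^ (n + 1)) M = 0 := by
            rw [adQ_smul_pow, ih.2 j hj, smul_zero]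
          rw [gU_xE]
          change _ • (IsNilpotent.exp (t j • rK V (S.e j)) * M *
            IsNilpotent.exp (-(t j • rK V (S.e j)))) ∈ _
          rw [exp_conj_eq_sum hnil h0, Finset.smul_sum]
          refine sum_mem fun k hk => ?_
          -- The term with `k` brackets carries `t_j ^ k`. Of the `n` available factors `κ_j`,
          -- exactly `k` are spent on these poles and the remaining `n - k` are harmless.
          have hk' : n = (n - k) + k := by
            have := Finset.mem_range.mp hk; omega
          rw [smul_comm]
          refine rat_smul_mem_regAlg hR _ ?_
          rw [adQ_smul_pow, smul_smul, hk', pow_add]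
          have e2 : κ j ^ (n - k) * κ j ^ k * c * t j ^ k =
              (κ j ^ (n - k) * (κ j * t j) ^ k) * c := by rw [mul_pow]; ring
          rw [e2, mul_smul, ← adQ_pow_smul]
          exact smul_mem_regAlg (mul_mem (pow_mem (hκ j hj).1 _) (pow_mem (hκ j hj).2 _))
            (adQ_pow_mem_regAlg (rK_mem_regAlg hR _) ih.1 _)
        · intro j' hj'
          rw [adQ_pow_conj _ _ _ (gU_xE_mul_rK (hI j j' hj hj') _), ih.2 j' hj', mul_zero,
            zero_mul]
      · rw [if_neg hj, ht j hj, xE_zero, one_mul, one_mul]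
        exact ih
  have h := (key (List.finRange r)).1
  rw [← List.ofFn_eq_map, ← List.ofFn_eq_map] at h
  change oprod _ • (gval V (oprod _) * rK V (S.e i) * gval V (oprod _)⁻¹) ∈ _ at h
  rw [oprod_eq_prod] at h
  set D := oprod (fun j => xE V j (t j)) with hD
  have hn : IsNilpotent (s • (gval V D * rK V (S.e i) * gval V D⁻¹)) := by
    refine IsNilpotent.smul ?_ s
    obtain ⟨k, hk⟩ := isNilpotent_rK_e V i
    refine ⟨k, ?_⟩
    have hu := Units.conj_pow (gU V D) (rK V (S.e i)) k
    rw [hk, mul_zero, zero_mul, ← map_inv] at hu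
    exact hu
  have e : gU V (D * xE V i s * D⁻¹) =
      expU (s • (gval V D * rK V (S.e i) * gval V D⁻¹)) hn := by
    rw [map_mul, map_mul, map_inv, mul_inv_eq_iff_eq_mul, gU_xE]
    refine gU_mul_expU _ _ ?_
    rw [mul_smul_comm, smul_mul_assoc, mul_assoc, mul_assoc, ← map_mul, inv_mul_cancel, map_one,
      mul_one]
  rw [e]
  refine expU_mem_regU hR hn ?_
  rw [hs, mul_smul]
  exact smul_mem_regAlg hρ h

/-- The factors `exp (s_i e_i)` with `i ∈ I` are absorbed by the two gauge factors, by
`oprod_mul_commuting`. Every other factor ends up conjugated by exponentials with coefficients `f j`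
for `j < i` and `f' j` for `j > i`. This is why the denominators `q j` and `q' j` appear in the
condition on `s i` according to the order of the nodes, as `Q₊^j(u)` and `Q₊^j(ħu)` do in the
`QQ`-system. -/
theorem local_regular {R : Subring K} (hR : ∀ c, constK c ∈ R) (I : Fin r → Prop)
    [DecidablePred I] (hI : ∀ i j, I i → I j → ⁅S.e i, S.e j⁆ = 0) {f f' s q q' ρ : Fin r → K}
    (hs : ∀ i, I i → s i = f i - f' i) (hq : ∀ i, I i → q i ∈ R ∧ q i * f i ∈ R)
    (hq' : ∀ i, I i → q' i ∈ R ∧ q' i * f' i ∈ R) (hρ : ∀ i, ¬I i → ρ i ∈ R ∧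
      s i = ρ i * ∏ j, if I j then (if j < i then q j else q' j) ^ (-S.cartan j i).toNat else 1) :
    gU V ((oprod fun i => xE V i (if I i then -f' i else 0))⁻¹ *
      oprod (fun i => xE V i (s i)) * oprod fun i => xE V i (if I i then -f i else 0)) ∈
      regU V R := by
  have hcomm : ∀ (u u' : Fin r → K) i j,
      Commute (xE V i (if I i then u i else 0)) (xE V j (if I j then u' j else 0)) := by
    intro u u' i j
    by_cases hi : I i
    · by_cases hj : I j
      · exact xE_comm (hI i j hi hj) _ _
      · rw [if_neg hj, xE_zero]; exact Commute.one_right _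
    · rw [if_neg hi, xE_zero]; exact Commute.one_left _
  -- For `i ∈ I` the factor is written as `exp (-f' e_i)` times the inverse of `exp (-f e_i)`, the
  -- shape to which `oprod_mul_commuting` applies.
  have e1 : (fun i => xE V i (s i)) = fun i => (if I i then 1 else xE V i (s i)) *
      (xE V i (if I i then -f' i else 0) * (xE V i (if I i then -f i else 0))⁻¹) := by
    funext i
    by_cases hi : I i
    · rw [if_pos hi, if_pos hi, if_pos hi, hs i hi, ← xE_neg, ← xE_add, one_mul]
      congr 1; ring
    · rw [if_neg hi, if_neg hi, if_neg hi, xE_zero, inv_one, mul_one, mul_one]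
  rw [e1, oprod_mul_commuting _ _ _ (hcomm _ _) (hcomm _ _) (hcomm _ _), map_oprod]
  refine oprod_mem' fun i => ?_
  by_cases hi : I i
  · rw [if_pos hi, mul_one, mul_inv_cancel, map_one]
    exact one_mem _
  · rw [if_neg hi]
    have e2 : (fun j => if j < i then (xE V j (if I j then -f j else 0))⁻¹ else
        (xE V j (if I j then -f' j else 0))⁻¹) =
        fun j => xE V j (if I j then (if j < i then f j else f' j) else 0) := by
      funext j
      by_cases hj : I j <;> by_cases hji : j < i <;> simp [hj, hji, ← xE_neg, xE_zero]
    rw [e2]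
    refine conj_xE_mem_regU hR I hI hi (κ := fun j => if j < i then q j else q' j)
      (fun j hj => if_neg hj) (fun j hj => ?_) (hρ i hi).1 (hρ i hi).2
    simp only [if_pos hj]
    split_ifs
    · exact hq j hj
    · exact hq' j hj

end LocalRegular

/-! ### The `QQ`-system as a scalar difference equation -/

section QQTerm

variable {r : ℕ} {𝔤 : Type*} [LieRing 𝔤] [LieAlgebra ℂ 𝔤] {S : ChevalleySystem r 𝔤}

theorem prod_erase_eq {n : ℕ} {M : Type*} [CommMonoid M] (i : Fin n) (F : Fin n → M) :
    ∏ j ∈ Finset.univ.erase i, F j = (∏ j with i < j, F j) * ∏ j with j < i, F j := by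
  rw [← Finset.prod_union]
  · refine Finset.prod_congr ?_ fun _ _ => rfl
    ext j
    simp only [Finset.mem_erase, Finset.mem_univ, and_true, Finset.mem_union, Finset.mem_filter,
      true_and]
    exact ⟨fun h => (lt_or_gt_of_ne h).symm, fun h => h.elim ne_of_gt ne_of_lt⟩
  · rw [Finset.disjoint_left]
    intro j h1 h2
    simp only [Finset.mem_filter, Finset.mem_univ, true_and] at h1 h2
    exact absurd h1 h2.not_gt

/-- The right-hand side of the `QQ`-system, after division by `ξ̃_i P_i(u) P_i(ħ u)`. -/
def qqTerm (S : ChevalleySystem r 𝔤) (ħ : ℂˣ) (ζ : Fin r → ℂˣ) (Λ P : Fin r → ℂ[X])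
    (i : Fin r) : K :=
  constK ((xiTilde S ζ i)⁻¹ : ℂˣ) * (toK (Λ i) / (toK (P i) * shift ħ (toK (P i)))) *
    ∏ j ∈ Finset.univ.erase i,
      (if j < i then toK (P j) else shift ħ (toK (P j))) ^ (-S.cartan j i).toNat

/-- The value of the simple root `α_i` at `Z`. -/
abbrev chiRoot (S : ChevalleySystem r 𝔤) (ζ : Fin r → ℂˣ) (i : Fin r) : ℂˣ :=
  chi ζ fun k => S.cartan k i

theorem xi_eq (S : ChevalleySystem r 𝔤) (ζ : Fin r → ℂˣ) (i : Fin r) :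
    xi S ζ i = xiTilde S ζ i * (chiRoot S ζ i)⁻¹ := by
  rw [chiRoot, chi, ← Finset.mul_prod_erase Finset.univ _ (Finset.mem_univ i), prod_erase_eq,
    xi, xiTilde]
  have h : ∏ j with j < i, ζ j ^ (-S.cartan j i) = (∏ j with j < i, ζ j ^ S.cartan j i)⁻¹ := by
    rw [← Finset.prod_inv_distrib]
    exact Finset.prod_congr rfl fun j _ => zpow_neg _ _
  have h2 : ζ i ^ S.cartan i i = ζ i * ζ i := by
    have := S.cartan_diag i
    exact (congrArg (ζ i ^ ·) this).trans (zpow_two _)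
  rw [h]
  simp only [h2, mul_inv]
  set A := ∏ j with j < i, ζ j ^ S.cartan j i
  set B := ∏ j with i < j, ζ j ^ S.cartan j i
  calc (ζ i)⁻¹ * A⁻¹ = (ζ i * (ζ i)⁻¹) * (B * B⁻¹) * ((ζ i)⁻¹ * A⁻¹) := by simp
    _ = _ := by
      simp only [mul_left_comm, mul_assoc]

theorem zpow_neg_cartan (S : ChevalleySystem r 𝔤) {i j : Fin r} (h : j ≠ i) (x : K) :
    x ^ (-S.cartan j i) = x ^ (-S.cartan j i).toNat := by
  have := Int.toNat_of_nonneg (neg_nonneg.mpr (S.cartan_offDiag j i h))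
  rw [← zpow_natCast, this]

/-- Divide by `ξ̃_i Q₊^i(u) Q₊^i(ħu)` and use `ξ_i / ξ̃_i = α_i(Z)⁻¹` from `xi_eq`. The system
becomes the equation of the unipotent gauge problem modulo `[N_+, N_+]`. -/
theorem qq_iff {ħ : ℂˣ} {ζ : Fin r → ℂˣ} {Λ Qp Qm : Fin r → ℂ[X]} (h : ∀ i, Qp i ≠ 0) :
    IsQQSolution S ħ Λ ζ Qp Qm ↔ ∀ i, toK (Qm i) / toK (Qp i) - constK ((chiRoot S ζ i)⁻¹ : ℂˣ) *
      shift ħ (toK (Qm i) / toK (Qp i)) = qqTerm S ħ ζ Λ Qp i := by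
  refine forall_congr' fun i => ?_
  rw [← toK_injective.eq_iff, sub_eq_add_neg, toK_add, toK_neg, toK_mul, toK_mul, toK_mul, toK_mul,
    toK_mul, toK_mul, toK_C, toK_C, ← sub_eq_add_neg, ← shift_toK, ← shift_toK, map_div₀, qqTerm,
    prod_erase_eq, xi_eq]
  have hp : ∀ s : Finset (Fin r), ∀ F : Fin r → ℂ[X], toK (∏ j ∈ s, F j) = ∏ j ∈ s, toK (F j) :=
    fun s F => map_prod (algebraMap ℂ[X] K) F s
  have e1 : ∏ j with i < j, (if j < i then toK (Qp j) else shift ħ (toK (Qp j))) ^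
      (-S.cartan j i).toNat = toK (∏ j with i < j, polyShift ħ (Qp j) ^ (-S.cartan j i).toNat) := by
    rw [hp]
    refine Finset.prod_congr rfl fun j hj => ?_
    rw [if_neg (Finset.mem_filter.mp hj).2.not_gt, shift_toK, toK_pow]
  have e2 : ∏ j with j < i, (if j < i then toK (Qp j) else shift ħ (toK (Qp j))) ^
      (-S.cartan j i).toNat = toK (∏ j with j < i, Qp j ^ (-S.cartan j i).toNat) := by
    rw [hp]
    refine Finset.prod_congr rfl fun j hj => ?_
    rw [if_pos (Finset.mem_filter.mp hj).2, toK_pow]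
  rw [e1, e2, Units.val_mul, Units.val_inv_eq_inv_val, Units.val_inv_eq_inv_val, constK, constK,
    constK, constK, map_mul, map_inv₀, map_inv₀]
  have h1 : toK (Qp i) ≠ 0 := toK_ne_zero (h i)
  have h2 : shift ħ (toK (Qp i)) ≠ 0 := (_root_.map_ne_zero _).mpr h1
  have h3 : algebraMap ℂ K (xiTilde S ζ i) ≠ 0 := constK_ne_zero (Units.ne_zero _)
  have h4 : algebraMap ℂ K (chiRoot S ζ i) ≠ 0 := constK_ne_zero (Units.ne_zero _)
  set A := toK (∏ j with i < j, polyShift ħ (Qp j) ^ (-S.cartan j i).toNat)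
  set B := toK (∏ j with j < i, Qp j ^ (-S.cartan j i).toNat)
  set x := algebraMap ℂ K (xiTilde S ζ i)
  set y := algebraMap ℂ K (chiRoot S ζ i)
  field_simp

/-- The connection `∏_i g_i^α̌_i exp ((Λ_i / g_i) e_i)` with `g_i = ζ_i P_i(ħ u) / P_i(u)`, after the
gauge transformation by `∏_i P_i^(-α̌_i)`. -/
theorem normalForm_eq_qqTerm (V : FundamentalReps S) (ħ : ℂˣ) (ζ : Fin r → ℂˣ) (Λ : Fin r → ℂ[X])
    {P : Fin r → ℂ[X]} (hP : ∀ i, P i ≠ 0) :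
    normalForm V Λ (fun i => constK (ζ i) * shift ħ (toK (P i)) / toK (P i)) =
      gShift ħ V (tor V fun i => toK (P i)) * twist V ζ *
        oprod (fun i => xE V i (qqTerm S ħ ζ Λ P i)) * (tor V fun i => toK (P i))⁻¹ := by
  have h1 : ∀ i, toK (P i) ≠ 0 := fun i => toK_ne_zero (hP i)
  have h2 : ∀ i, shift ħ (toK (P i)) ≠ 0 := fun i => (_root_.map_ne_zero _).mpr (h1 i)
  have h3 : ∀ i, constK (ζ i) ≠ 0 := fun i => constK_ne_zero (Units.ne_zero _)
  have hg : ∀ i, constK (ζ i) * shift ħ (toK (P i)) / toK (P i) ≠ 0 := fun i =>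
    div_ne_zero (mul_ne_zero (h3 i) (h2 i)) (h1 i)
  rw [normalForm_eq V Λ hg, eq_mul_inv_iff_mul_eq, gShift_tor, twist_eq_tor, ← tor_mul V h2 h3]
  rw [mul_assoc, oprod_mul_of_rel fun i => xE_mul_tor V h1 i _, ← mul_assoc, ← tor_mul V hg h1]
  congr 1
  · congr 1
    funext i
    rw [div_mul_cancel₀ _ (h1 i), mul_comm]
  · congr 1
    funext i
    congr 1
    rw [← Finset.mul_prod_erase Finset.univ _ (Finset.mem_univ i), prod_erase_eq]
    rw [qqTerm, prod_erase_eq, xiTilde]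
    have e0 : toK (P i) ^ (-S.cartan i i) = (toK (P i) * toK (P i))⁻¹ := by
      have := S.cartan_diag i
      refine (congrArg (fun n : ℤ => toK (P i) ^ (-n)) this).trans ?_
      rw [zpow_neg, zpow_two]
    have e1 : ∏ j with i < j, (constK (ζ j) * shift ħ (toK (P j)) / toK (P j)) ^ (-S.cartan j i) =
        (constK ((∏ j with i < j, ζ j ^ S.cartan j i : ℂˣ) : ℂ))⁻¹ *
        (∏ j with i < j, (if j < i then toK (P j) else shift ħ (toK (P j))) ^
          (-S.cartan j i).toNat) * (∏ j with i < j, toK (P j) ^ (-S.cartan j i))⁻¹ := by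
      rw [← constK_prod_zpow, ← Finset.prod_inv_distrib, ← Finset.prod_inv_distrib,
        ← Finset.prod_mul_distrib, ← Finset.prod_mul_distrib]
      refine Finset.prod_congr rfl fun j hj => ?_
      have hij := (Finset.mem_filter.mp hj).2
      rw [if_neg hij.not_gt, ← zpow_neg_cartan S hij.ne', div_zpow, mul_zpow, zpow_neg (constK _),
        div_eq_mul_inv]
    have e2 : ∏ j with j < i, toK (P j) ^ (-S.cartan j i) = ∏ j with j < i,
        (if j < i then toK (P j) else shift ħ (toK (P j))) ^ (-S.cartan j i).toNat := by
      refine Finset.prod_congr rfl fun j hj => ?_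
      have hij := (Finset.mem_filter.mp hj).2
      rw [if_pos hij, ← zpow_neg_cartan S hij.ne]
    have h4 : ∏ j with i < j, toK (P j) ^ (-S.cartan j i) ≠ 0 :=
      Finset.prod_ne_zero_iff.mpr fun j _ => zpow_ne_zero _ (h1 j)
    have h5 : constK ((∏ j with i < j, ζ j ^ S.cartan j i : ℂˣ) : ℂ) ≠ 0 :=
      constK_ne_zero (Units.ne_zero _)
    have e3 : constK (((ζ i * ∏ j with i < j, ζ j ^ S.cartan j i)⁻¹ : ℂˣ) : ℂ) =
        (constK (ζ i))⁻¹ * (constK ((∏ j with i < j, ζ j ^ S.cartan j i : ℂˣ) : ℂ))⁻¹ := by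
      rw [Units.val_inv_eq_inv_val, Units.val_mul, constK, map_inv₀, map_mul, mul_inv]
    have h1i := h1 i
    have h2i := h2 i
    have h3i := h3 i
    rw [e0, e1, e2, e3]
    set x := constK ((∏ j with i < j, ζ j ^ S.cartan j i : ℂˣ) : ℂ)
    set y := constK (ζ i)
    set A := ∏ j with i < j, toK (P j) ^ (-S.cartan j i)
    field_simp

end QQTerm

/-! ### From solutions to twisted connections and back -/

section Unipotent

variable {r : ℕ} {𝔤 : Type*} [LieRing 𝔤] [LieAlgebra ℂ 𝔤] [FiniteDimensional ℂ 𝔤]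
  [LieAlgebra.IsSimple ℂ 𝔤] {S : ChevalleySystem r 𝔤} {V : FundamentalReps S}

theorem smul_rK_e_mem (i : Fin r) (t : K) : t • rK V (S.e i) ∈ wordsK V S.e 1 :=
  Submodule.smul_mem _ _ (Submodule.subset_span ⟨S.e i, ⟨1, le_rfl, i, rfl⟩, rfl⟩)

theorem gU_xE_mem (i : Fin r) (t : K) : gU V (xE V i t) ∈ (eFil V).E 1 := by
  rw [gU_xE]
  exact (eFil V).expU_mem (smul_rK_e_mem i t) _

theorem map_gU_Nplus : (Nplus V).map (gU V) = (eFil V).E 1 := by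
  refine le_antisymm ?_ ?_
  · rw [Subgroup.map_le_iff_le_comap, Nplus, Subgroup.closure_le]
    rintro _ ⟨i, t, rfl⟩
    exact gU_xE_mem i t
  · refine wordFil_E_one_le V S.e _ _ _ fun i t hn => ?_
    refine ⟨xE V i t, Subgroup.subset_closure ⟨i, t, rfl⟩, ?_⟩
    rw [gU_xE]

/-- One inclusion says that commutators go down the central filtration; the other that, from height
two on, the Lie algebra is spanned by brackets. The factor in `[N_+, N_+]` thereby becomes
accessible degree by degree. -/
theorem map_gU_commutator : ⁅Nplus V, Nplus V⁆.map (gU V) = (eFil V).E 2 := by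
  rw [Subgroup.map_commutator, map_gU_Nplus]
  refine le_antisymm ?_ (wordFil_E_two_le V S.e _ _)
  rw [Subgroup.commutator_le]
  intro g hg h hh
  rw [commutatorElement_def]
  exact (eFil V).commutator_E_mem le_rfl hg hh

theorem commutator_le_Nplus : ⁅Nplus V, Nplus V⁆ ≤ Nplus V :=
  Subgroup.commutator_le.mpr fun _ hg _ hh =>
    mul_mem (mul_mem (mul_mem hg hh) (inv_mem hg)) (inv_mem hh)

theorem tauU_xE (ħ : ℂˣ) (ζ : Fin r → ℂˣ) (i : Fin r) (t : K) : tauU ħ ζ V (gU V (xE V i t)) =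
    gU V (xE V i (constK ((chiRoot S ζ i)⁻¹ : ℂˣ) * shift ħ t)) := by
  have hn : IsNilpotent (t • rK V (S.e i)) := (isNilpotent_rK_e V i).smul t
  rw [gU_xE, gU_xE, tauU_expU ħ ζ V hn (hn.map (tau ħ ζ V))]
  exact expU_congr (A := Alg V) (by
    rw [tau_smul, tau_rK ħ ζ V (hasWt_e i), smul_smul, mul_comm]) _ _

theorem map_gU_xE_sub_one {φ : Alg V →ₗ[K] K} (hφ : ∀ M ∈ AK V (coheight S) (1 + 1), φ M = 0)
    (t : Fin r → K) : φ ((gU V (oprod fun i => xE V i (t i)) : Alg V) - 1) =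
      ∑ i, t i * φ (rK V (S.e i)) := by
  rw [map_oprod, map_oprod_sub_one le_rfl hφ fun i => gU_xE_mem i _]
  refine Finset.sum_congr rfl fun i _ => ?_
  rw [gU_xE, map_expU_sub_one le_rfl hφ (smul_rK_e_mem i (t i)), map_smul, smul_eq_mul]

theorem linearIndependent_e (S : ChevalleySystem r 𝔤) : LinearIndependent ℂ S.e := by
  rw [Fintype.linearIndependent_iff]
  intro c hc i
  have h : ⁅∑ j, c j • S.e j, S.f i⁆ = c i • S.h i := by
    rw [sum_lie, Finset.sum_eq_single i]
    · rw [smul_lie, S.lie_e_f, if_pos rfl]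
    · intro j _ hj
      rw [smul_lie, S.lie_e_f, if_neg hj, smul_zero]
    · intro h
      exact absurd (Finset.mem_univ i) h
  rw [hc, zero_lie] at h
  exact (smul_eq_zero.mp h.symm).resolve_right (h_ne_zero S i)

theorem exists_coordinate (V : FundamentalReps S) (i : Fin r) : ∃ φ : Alg V →ₗ[K] K,
    (∀ M ∈ AK V (coheight S) (1 + 1), φ M = 0) ∧ φ (rK V (S.e i)) = 1 ∧
      ∀ j, j ≠ i → φ (rK V (S.e j)) = 0 := by
  have hli := linearIndependent_e S
  obtain ⟨φ, h1, h2, h3⟩ := exists_symbol V (b := Set.range S.e) (n := 1) subset_rfl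
    hli.linearIndepOn_id ⟨S.e i, i, rfl⟩
  refine ⟨funK V φ, fun M hM => funK_eq_zero h3 hM, ?_, fun j hj => ?_⟩
  · rw [← extA_rC, funK_extA, h1, map_one]
  · have := h2 ⟨S.e j, j, rfl⟩ fun h => hj (hli.injective (congrArg Subtype.val h))
    rw [← extA_rC, funK_extA, this, map_zero]

/-- The analytic core: a nondegenerate solution fixes the gauge modulo `[N_+, N_+]`, and
`exists_gauge` supplies the remaining factor once the connection is shown to be regularizable on
each orbit. -/
theorem exists_twisted_form {ħ : ℂˣ} (hħ : ∀ n : ℕ, 0 < n → ħ ^ n ≠ 1) {ζ : Fin r → ℂˣ}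
    (hζ : GenericTwist S ħ ζ) {Λ Qp Qm : Fin r → ℂ[X]}
    (hQQ : IsQQSolution S ħ Λ ζ Qp Qm) (h0 : ∀ i, Qp i ≠ 0) (hN : NeighborsDistinct S ħ Qp) :
    ∃ m ∈ ⁅Nplus V, Nplus V⁆, ∃ v : G V,
      v = (tor V fun i => toK (Qp i)) * oprod (fun i => xE V i (-(toK (Qm i) / toK (Qp i)))) * m ∧
      normalForm V Λ (fun i => constK (ζ i) * shift ħ (toK (Qp i)) / toK (Qp i)) =
        gShift ħ V v * twist V ζ * v⁻¹ := by
  classical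
  rw [qq_iff h0] at hQQ
  set f : Fin r → K := fun i => toK (Qm i) / toK (Qp i) with hf
  set f' : Fin r → K := fun i => constK ((chiRoot S ζ i)⁻¹ : ℂˣ) * shift ħ (f i) with hf'
  have hs : ∀ i, qqTerm S ħ ζ Λ Qp i = f i - f' i := fun i => (hQQ i).symm
  have hτ : ∀ t : Fin r → K, tauU ħ ζ V (gU V (oprod fun i => xE V i (t i))) =
      gU V (oprod fun i => xE V i (constK ((chiRoot S ζ i)⁻¹ : ℂˣ) * shift ħ (t i))) := by
    intro t
    rw [map_oprod, map_oprod, map_oprod]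
    congr 1
    funext i
    exact tauU_xE ħ ζ i (t i)
  have hE : ∀ t : Fin r → K, gU V (oprod fun i => xE V i (t i)) ∈ (eFil V).E 1 := fun t => by
    rw [map_oprod]; exact oprod_mem' fun i => gU_xE_mem i (t i)
  obtain ⟨m₀, hm₀, h⟩ := exists_gauge (V := V) hħ hζ
    (a := gU V (oprod fun i => xE V i (qqTerm S ħ ζ Λ Qp i)))
    (n₀ := gU V (oprod fun i => xE V i (-f i))) (hE _) (by
      -- In degree one the coordinates add up to `f' - f + qqTerm`, which vanishes by the
      -- `QQ`-system.
      have h1 := hE fun i => constK ((chiRoot S ζ i)⁻¹ : ℂˣ) * shift ħ (-f i)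
      rw [hτ]
      refine mem_E_succ le_rfl (mul_mem (mul_mem (inv_mem h1) (hE _)) (hE _)) fun x => ?_
      rw [symU_mul le_rfl x (mul_mem (inv_mem h1) (hE _)) (hE _),
        symU_mul le_rfl x (inv_mem h1) (hE _), symU_inv le_rfl x h1, symU, symU, symU,
        map_gU_xE_sub_one (symK_of_mem_AK x), map_gU_xE_sub_one (symK_of_mem_AK x),
        map_gU_xE_sub_one (symK_of_mem_AK x), ← Finset.sum_neg_distrib, ← Finset.sum_add_distrib,
        ← Finset.sum_add_distrib]
      refine Finset.sum_eq_zero fun i _ => ?_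
      rw [hs, hf', map_neg]
      ring) (by
      intro w hw
      let I : Fin r → Prop := fun i => ∃ k, (Qp i).IsRoot (orbitPt ħ w k)
      -- `I` collects the nodes responsible for poles on this orbit; for the others, `1 / Q₊^i` is
      -- regular along it.
      have hnr : ∀ i, ¬I i → (toK (Qp i))⁻¹ ∈ RegOrb ħ w := fun i hi =>
        mem_regOrb.mpr fun k => toK_inv_mem_reg fun h => hi ⟨k, h⟩
      have hR : ∀ c, constK c ∈ RegOrb ħ w := fun c => constK_mem_regOrb ħ c w
      refine ⟨_, hE fun i => if I i then -f i else 0, ?_⟩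
      have hfun : (fun i => constK ((chiRoot S ζ i)⁻¹ : ℂˣ) * shift ħ (if I i then -f i else 0)) =
          fun i => if I i then -f' i else 0 := by
        funext i
        split_ifs
        · rw [hf', map_neg, mul_neg]
        · rw [map_zero, mul_zero]
      have hτI := (hτ fun i => if I i then -f i else 0).trans
        (congrArg (gU V) (congrArg oprod (funext fun i => congrArg (xE V i) (congrFun hfun i))))
      rw [hτI, ← map_inv, ← map_mul, ← map_mul]
      refine local_regular hR I ?_ (q := fun i => toK (Qp i)) (q' := fun i => shift ħ (toK (Qp i)))
        (fun i _ => hs i) (fun i _ => ⟨toK_mem_regOrb _ _ _, ?_⟩)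
        (fun i _ => ⟨shift_mem_regOrb (toK_mem_regOrb _ _ _), ?_⟩)
        -- What remains of `qqTerm` after removing the powers of `Q₊^j`, `j ∈ I`. For `i ∉ I` its
        -- denominators do not vanish on the orbit.
        (ρ := fun i => constK ((xiTilde S ζ i)⁻¹ : ℂˣ) *
          (toK (Λ i) * ((toK (Qp i))⁻¹ * shift ħ (toK (Qp i))⁻¹)) *
          ∏ j ∈ Finset.univ.erase i, if I j then 1 else
            (if j < i then toK (Qp j) else shift ħ (toK (Qp j))) ^ (-S.cartan j i).toNat)
        (fun i hi => ⟨mul_mem (mul_mem (hR _) (mul_mem (toK_mem_regOrb _ _ _)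
          (mul_mem (hnr i hi) (shift_mem_regOrb (hnr i hi))))) (prod_mem fun j _ => ?_), ?_⟩)
      · rintro i j ⟨k, hk⟩ ⟨k', hk'⟩
        by_cases hij : i = j
        · rw [hij, lie_self]
        · refine lie_e_e_eq_zero S hij ?_
          by_contra hc
          -- Two adjacent nodes with roots on the same orbit would violate nondegeneracy, so `e_i`
          -- and `e_j` commute.
          refine hN i j hij hc _ _ hk hk' (k' - k) ?_
          rw [orbitPt, orbitPt, ← mul_assoc, ← Units.val_mul, ← zpow_add, sub_add_cancel]
      · rw [hf, mul_div_cancel₀ _ (toK_ne_zero (h0 i))]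
        exact toK_mem_regOrb _ _ _
      · change shift ħ (toK (Qp i)) * (constK ((chiRoot S ζ i)⁻¹ : ℂˣ) *
          shift ħ (toK (Qm i) / toK (Qp i))) ∈ _
        rw [map_div₀, mul_left_comm,
          mul_div_cancel₀ _ ((_root_.map_ne_zero _).mpr (toK_ne_zero (h0 i)))]
        exact mul_mem (hR _) (shift_mem_regOrb (toK_mem_regOrb _ _ _))
      · split_ifs
        · exact one_mem _
        · exact pow_mem (toK_mem_regOrb _ _ _) _
        · exact pow_mem (shift_mem_regOrb (toK_mem_regOrb _ _ _)) _
      · have e : ∀ j, (if I j then (if j < i then toK (Qp j) else shift ħ (toK (Qp j))) ^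
            (-S.cartan j i).toNat else 1) * (if I j then 1 else
            (if j < i then toK (Qp j) else shift ħ (toK (Qp j))) ^ (-S.cartan j i).toNat) =
            (if j < i then toK (Qp j) else shift ħ (toK (Qp j))) ^ (-S.cartan j i).toNat := by
          intro j
          split_ifs <;> simp
        rw [← Finset.mul_prod_erase Finset.univ _ (Finset.mem_univ i), if_neg hi, one_mul, qqTerm,
          ← Finset.prod_congr rfl fun j _ => e j, Finset.prod_mul_distrib, map_inv₀, ← mul_inv,
          ← div_eq_mul_inv (toK (Λ i))]
        ring)
  rw [← map_gU_commutator] at hm₀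
  obtain ⟨m, hm, rfl⟩ := hm₀
  refine ⟨m, hm, _, rfl, ?_⟩
  rw [normalForm_eq_qqTerm V ħ ζ Λ h0]
  rw [← map_mul, tauU_gU, ← map_inv, ← map_mul, ← map_mul] at h
  have h' := gU_injective V (h.trans (map_one _).symm)
  set n := oprod (fun i => xE V i (-f i)) * m with hn
  set q := tor V fun i => toK (Qp i) with hq
  have h2 : oprod (fun i => xE V i (qqTerm S ħ ζ Λ Qp i)) =
      (twist V ζ)⁻¹ * gShift ħ V n * twist V ζ * n⁻¹ := by
    rw [eq_mul_inv_iff_mul_eq, ← inv_mul_eq_one, inv_mul_eq_one, eq_comm, ← inv_mul_eq_one,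
      ← mul_assoc]
    exact h'
  rw [h2, mul_assoc q, ← hn, (gShift ħ V).map_mul q n]
  group

theorem Nplus_mulVec {n : G V} (hn : n ∈ Nplus V) (i : Fin r) :
    (gval V n i).mulVec (vK (V.ν i)) = vK (V.ν i) := by
  have h : Nplus V ≤ { carrier := {n | (gval V n i).mulVec (vK (V.ν i)) = vK (V.ν i)}
                       mul_mem' := fun {a b} ha hb => by
                        change (gval V (a * b) i).mulVec (vK (V.ν i)) = vK (V.ν i)
                        rw [gval_mul_apply, hb, ha]
                       one_mem' := by
                        change (gval V 1 i).mulVec (vK (V.ν i)) = vK (V.ν i)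
                        rw [map_one, Pi.one_apply, Matrix.one_mulVec]
                       inv_mem' := fun {a} ha => by
                        change (gval V a⁻¹ i).mulVec (vK (V.ν i)) = vK (V.ν i)
                        conv_lhs => rw [← (show (gval V a i).mulVec (vK (V.ν i)) = _ from ha)]
                        rw [← gval_mul_apply, inv_mul_cancel, map_one, Pi.one_apply,
                          Matrix.one_mulVec] : Subgroup (G V) } := by
    rw [Nplus, Subgroup.closure_le]
    rintro _ ⟨j, t, rfl⟩
    change (gval V (xE V j t) i).mulVec (vK (V.ν i)) = vK (V.ν i)
    have hn : IsNilpotent (t • rK V (S.e j)) := (isNilpotent_rK_e V j).smul t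
    obtain ⟨k, hk⟩ := hn
    have hk2 : (t • rK V (S.e j)) ^ (k + 1) = 0 := by rw [pow_succ, hk, zero_mul]
    have h0 : (rK V (S.e j) i).mulVec (vK (V.ν i)) = 0 := by
      rw [rK_apply, map_mulVec_vK, V.e_ν]
      funext a
      exact map_zero _
    have e : gval V (xE V j t) = IsNilpotent.exp (t • rK V (S.e j)) := by
      rw [← gU_val, gU_xE]; rfl
    have hpow : ∀ m : ℕ, (((t • rK V (S.e j)) ^ (m + 1)) i).mulVec (vK (V.ν i)) = 0 := by
      intro m
      rw [pow_succ, Pi.mul_apply, ← Matrix.mulVec_mulVec, Pi.smul_apply, Matrix.smul_mulVec, h0,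
        smul_zero, Matrix.mulVec_zero]
    rw [e, IsNilpotent.exp_eq_sum hk2, Finset.sum_range_succ', Pi.add_apply, Matrix.add_mulVec,
      Finset.sum_apply, Matrix.sum_mulVec, Finset.sum_eq_zero, zero_add]
    · rw [rat_smul]
      simp
    · intro m _
      rw [rat_smul, Pi.smul_apply, Matrix.smul_mulVec, hpow, smul_zero]
  exact h hn

theorem gShift_mem_Nplus (ħ : ℂˣ) {n : G V} (hn : n ∈ Nplus V) : gShift ħ V n ∈ Nplus V := by
  have h : Nplus V ≤ (Nplus V).comap (gShift ħ V) := by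
    rw [Nplus, Subgroup.closure_le]
    rintro _ ⟨j, t, rfl⟩
    exact Subgroup.subset_closure ⟨j, shift ħ t, gShift_xE ħ V j t⟩
  exact h hn

theorem xE_mem_Nplus (i : Fin r) (t : K) : xE V i t ∈ Nplus V :=
  Subgroup.subset_closure ⟨i, t, rfl⟩

theorem tor_mul_Nplus_mulVec {h : Fin r → K} (hh : ∀ i, h i ≠ 0) {n : G V} (hn : n ∈ Nplus V)
    (i : Fin r) : (gval V (tor V h * n) i).mulVec (vK (V.ν i)) = h i • vK (V.ν i) := by
  rw [gval_mul_apply, Nplus_mulVec hn, tor_mulVec_vK (isWt_ν V i) hh]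
  congr 1
  rw [Finset.prod_eq_single i]
  · rw [Pi.single_eq_same, zpow_one]
  · intro j _ hj
    rw [Pi.single_eq_of_ne hj, zpow_zero]
  · intro h
    exact absurd (Finset.mem_univ i) h

theorem vK_ν_ne_zero (i : Fin r) : vK (V.ν i) ≠ 0 := fun h =>
  V.ν_ne_zero i (vK_injective (h.trans (funext fun _ => (map_zero _).symm)))

/-- Highest weight vectors are fixed by `N_+`, so they see only the torus part and give `g`. The
coordinates of `N_+ / [N_+, N_+]` ignore the unknown factor `m` and give the scalar equations. -/
theorem eq_of_normalForm_eq {ħ : ℂˣ} {ζ : Fin r → ℂˣ} {Λ P Qp Qm : Fin r → ℂ[X]} {g : Fin r → K}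
    (hg : ∀ i, g i ≠ 0) (hP : ∀ i, P i ≠ 0) {m v : G V} (hm : m ∈ ⁅Nplus V, Nplus V⁆)
    (hv : v = (tor V fun i => toK (P i)) *
      oprod (fun i => xE V i (-(toK (Qm i) / toK (Qp i)))) * m)
    (h : normalForm V Λ g = gShift ħ V v * twist V ζ * v⁻¹) :
    (∀ i, g i = constK (ζ i) * shift ħ (toK (P i)) / toK (P i)) ∧
    ∀ i, toK (Qm i) / toK (Qp i) - constK ((chiRoot S ζ i)⁻¹ : ℂˣ) *
      shift ħ (toK (Qm i) / toK (Qp i)) = qqTerm S ħ ζ Λ P i := by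
  have h1 : ∀ i, toK (P i) ≠ 0 := fun i => toK_ne_zero (hP i)
  have h2 : ∀ i, shift ħ (toK (P i)) ≠ 0 := fun i => (_root_.map_ne_zero _).mpr (h1 i)
  have h3 : ∀ i, constK (ζ i) ≠ 0 := fun i => constK_ne_zero (Units.ne_zero _)
  set n := oprod (fun i => xE V i (-(toK (Qm i) / toK (Qp i)))) * m with hn
  have hnN : n ∈ Nplus V :=
    mul_mem (oprod_mem' fun i => xE_mem_Nplus _ _) (commutator_le_Nplus hm)
  rw [mul_assoc, ← hn] at hv
  have hgi : ∀ i, g i = constK (ζ i) * shift ħ (toK (P i)) / toK (P i) := by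
    intro i
    have e1 := congrArg (fun a => (gval V a i).mulVec (vK (V.ν i))) (eq_mul_inv_iff_mul_eq.mp h)
    have eL : (gval V (normalForm V Λ g * v) i).mulVec (vK (V.ν i)) =
        (toK (P i) * g i) • vK (V.ν i) := by
      rw [hv, gval_mul_apply, tor_mul_Nplus_mulVec h1 hnN, Matrix.mulVec_smul, normalForm_eq V Λ hg,
        tor_mul_Nplus_mulVec hg (oprod_mem' fun i => xE_mem_Nplus _ _), smul_smul]
    have eZ : (gval V (twist V ζ) i).mulVec (vK (V.ν i)) = constK (ζ i) • vK (V.ν i) := by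
      have := tor_mul_Nplus_mulVec (V := V) h3 (one_mem _) i
      rwa [mul_one, ← twist_eq_tor] at this
    have eR : (gval V (gShift ħ V v * twist V ζ) i).mulVec (vK (V.ν i)) =
        (constK (ζ i) * shift ħ (toK (P i))) • vK (V.ν i) := by
      rw [gval_mul_apply, eZ, hv, (gShift ħ V).map_mul (tor V fun i => toK (P i)) n, gShift_tor,
        Matrix.mulVec_smul, tor_mul_Nplus_mulVec h2 (gShift_mem_Nplus ħ hnN), smul_smul]
    have e2 := smul_left_injective K (vK_ν_ne_zero i) (eL.symm.trans (e1.trans eR))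
    rw [eq_div_iff (h1 i), mul_comm]
    exact e2
  refine ⟨hgi, fun i => ?_⟩
  rw [funext hgi, normalForm_eq_qqTerm V ħ ζ Λ hP] at h
  set q := tor V fun i => toK (P i) with hq
  have e : oprod (fun i => xE V i (qqTerm S ħ ζ Λ P i)) =
      (twist V ζ)⁻¹ * gShift ħ V n * twist V ζ * n⁻¹ := by
    rw [hv, (gShift ħ V).map_mul q n, mul_inv_rev, ← mul_assoc _ n⁻¹, mul_left_inj,
      mul_assoc (gShift ħ V q), mul_assoc (gShift ħ V q), mul_assoc (gShift ħ V q),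
      mul_right_inj] at h
    rw [mul_assoc (twist V ζ)⁻¹, mul_assoc (twist V ζ)⁻¹, ← h, inv_mul_cancel_left]
  obtain ⟨φ, hφ, hφ1, hφ0⟩ := exists_coordinate V i
  have hsum : ∀ t : Fin r → K, ∑ j, t j * φ (rK V (S.e j)) = t i := fun t => by
    rw [Finset.sum_eq_single i (fun j _ hj => by rw [hφ0 j hj, mul_zero])
      (fun h => absurd (Finset.mem_univ i) h), hφ1, mul_one]
  have hE : ∀ t : Fin r → K, gU V (oprod fun i => xE V i (t i)) ∈ (eFil V).E 1 := fun t => by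
    rw [map_oprod]; exact oprod_mem' fun i => gU_xE_mem i (t i)
  have hm2 : gU V m ∈ (eFil V).E (1 + 1) := by
    rw [← map_gU_commutator]; exact ⟨m, hm, rfl⟩
  have hm1 := (eFil V).E_anti one_le_two hm2
  have e2 : gU V (oprod fun i => xE V i (qqTerm S ħ ζ Λ P i)) =
      gU V (oprod fun i => xE V i (constK ((chiRoot S ζ i)⁻¹ : ℂˣ) *
        shift ħ (-(toK (Qm i) / toK (Qp i))))) * tauU ħ ζ V (gU V m) * (gU V n)⁻¹ := by
    rw [e, map_mul, ← tauU_gU, map_inv, hn, map_mul, map_mul, map_oprod, map_oprod, map_oprod]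
    congr 3
    funext i
    exact tauU_xE ħ ζ i _
  have e3 := congrArg (fun u : (Alg V)ˣ => φ ((u : Alg V) - 1)) e2
  have hnE : gU V n ∈ (eFil V).E 1 := by
    rw [← map_gU_Nplus]; exact ⟨n, hnN, rfl⟩
  rw [map_mul_sub_one le_rfl hφ (mul_mem (hE _) (tauU_mem_E ħ ζ hm1)) (inv_mem hnE),
    map_mul_sub_one le_rfl hφ (hE _) (tauU_mem_E ħ ζ hm1), map_inv_sub_one le_rfl hφ hnE,
    map_sub_one_eq_zero hφ (tauU_mem_E ħ ζ hm2), hn, map_mul,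
    map_mul_sub_one le_rfl hφ (hE _) hm1, map_sub_one_eq_zero hφ hm2,
    map_gU_xE_sub_one hφ, map_gU_xE_sub_one hφ, map_gU_xE_sub_one hφ, hsum, hsum, hsum,
    map_neg] at e3
  rw [e3]
  ring

end Unipotent

/-! ### The normal form lies in the Coxeter cell -/

section Levi

variable {r : ℕ} {𝔤 : Type*} [LieRing 𝔤] [LieAlgebra ℂ 𝔤] [FiniteDimensional ℂ 𝔤]
  [LieAlgebra.IsSimple ℂ 𝔤] {S : ChevalleySystem r 𝔤}

/-- The group generated by the root subgroups of `±α_i`, `i ∈ J`. -/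
def levi (V : FundamentalReps S) (J : Set (Fin r)) : Subgroup (G V) :=
  Subgroup.closure {g | ∃ i ∈ J, ∃ t, g = xE V i t ∨ g = xF V i t}

/-- The largest subgroup of `N_-` which is stable under conjugation by `levi V J`. -/
def leviCore (V : FundamentalReps S) (J : Set (Fin r)) : Subgroup (G V) where
  carrier := {g | ∀ l ∈ levi V J, l * g * l⁻¹ ∈ Nminus V}
  mul_mem' ha hb l hl := by
    have := mul_mem (ha l hl) (hb l hl)
    simpa [mul_assoc] using this
  one_mem' l _ := by simp
  inv_mem' ha l hl := by
    have := inv_mem (ha l hl)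
    simpa [mul_assoc] using this

variable {V : FundamentalReps S}

theorem leviCore_le (J : Set (Fin r)) : leviCore V J ≤ Nminus V := fun g hg => by
  simpa using hg 1 (one_mem _)

theorem leviCore_anti {J J' : Set (Fin r)} (h : J ⊆ J') : leviCore V J' ≤ leviCore V J :=
  fun _ hg l hl => hg l (Subgroup.closure_mono (by
    rintro _ ⟨i, hi, t, ht⟩
    exact ⟨i, h hi, t, ht⟩) hl)

theorem conj_mem_leviCore {J : Set (Fin r)} {l g : G V} (hl : l ∈ levi V J)
    (hg : g ∈ leviCore V J) : l * g * l⁻¹ ∈ leviCore V J := fun l' hl' => by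
  have := hg (l' * l) (mul_mem hl' hl)
  simpa [mul_assoc] using this

theorem xF_mem_levi {J : Set (Fin r)} {i : Fin r} (hi : i ∈ J) (t : K) : xF V i t ∈ levi V J :=
  Subgroup.subset_closure ⟨i, hi, t, Or.inr rfl⟩

theorem weylElt_mem_levi {J : Set (Fin r)} {i : Fin r} (hi : i ∈ J) (t : K) :
    weylElt V i t ∈ levi V J :=
  mul_mem (mul_mem (Subgroup.subset_closure ⟨i, hi, t, Or.inl rfl⟩) (xF_mem_levi hi _))
    (Subgroup.subset_closure ⟨i, hi, t, Or.inl rfl⟩)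

/-- The brackets `⁅f_{i₁}, ⁅…, ⁅f_{iₙ}, f_j⁆⁆⁆` with all `i_k` in `J`. -/
inductive LeviWord (S : ChevalleySystem r 𝔤) (J : Set (Fin r)) (j : Fin r) : ℕ → 𝔤 → Prop
  | base : LeviWord S J j 1 (S.f j)
  | step {n : ℕ} {y : 𝔤} (i : Fin r) (hi : i ∈ J) (hy : LeviWord S J j n y) :
      LeviWord S J j (n + 1) ⁅S.f i, y⁆

/-- The span of these brackets. -/
def leviSpan (S : ChevalleySystem r 𝔤) (J : Set (Fin r)) (j : Fin r) : Submodule ℂ 𝔤 :=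
  Submodule.span ℂ {y | ∃ n, LeviWord S J j n y}

theorem LeviWord.exists_hasWt {J : Set (Fin r)} {j : Fin r} {n : ℕ} {y : 𝔤}
    (h : LeviWord S J j n y) : ∃ c, HasWt S c y := by
  induction h with
  | base => exact ⟨_, hasWt_f j⟩
  | step i _ _ ih =>
    obtain ⟨c, hc⟩ := ih
    exact ⟨_, (hasWt_f i).lie hc⟩

theorem LeviWord.mem_words {J : Set (Fin r)} {j : Fin r} {n : ℕ} {y : 𝔤}
    (h : LeviWord S J j n y) : 1 ≤ n ∧ y ∈ words S.f n := by
  induction h with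
  | base => exact ⟨le_rfl, j, rfl⟩
  | step i _ _ ih => exact ⟨by omega, lie_words_mem i ih.2⟩

theorem lie_f_leviSpan {J : Set (Fin r)} {i j : Fin r} (hi : i ∈ J) {y : 𝔤}
    (hy : y ∈ leviSpan S J j) : ⁅S.f i, y⁆ ∈ leviSpan S J j := by
  induction hy using Submodule.span_induction with
  | mem y hy =>
    obtain ⟨n, hy⟩ := hy
    exact Submodule.subset_span ⟨n + 1, hy.step i hi⟩
  | zero => rw [lie_zero]; exact zero_mem _
  | add a b _ _ ha hb => rw [lie_add]; exact add_mem ha hb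
  | smul c a _ ha => rw [lie_smul]; exact Submodule.smul_mem _ _ ha

/-- Move `e_i` inward through the bracket: crossing `f_i` produces `h_i`, which acts on the
remaining weight vector by a scalar. At the end `⁅e_i, f_j⁆ = 0` because `j ≠ i`. -/
theorem lie_e_leviSpan {J : Set (Fin r)} {i j : Fin r} (hi : i ∈ J) (hj : j ∉ J) {y : 𝔤}
    (hy : y ∈ leviSpan S J j) : ⁅S.e i, y⁆ ∈ leviSpan S J j := by
  induction hy using Submodule.span_induction with
  | mem y hy =>
    obtain ⟨n, hy⟩ := hy
    induction hy with
    | base =>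
      rw [S.lie_e_f, if_neg (by rintro rfl; exact hj hi)]
      exact zero_mem _
    | @step n y k hk hy ih =>
      rw [leibniz_lie, S.lie_e_f]
      refine add_mem ?_ (lie_f_leviSpan hk ih)
      split_ifs with h
      · obtain ⟨c, hc⟩ := hy.exists_hasWt
        rw [hc i]
        exact Submodule.smul_mem _ _ (Submodule.subset_span ⟨n, hy⟩)
      · rw [zero_lie]; exact zero_mem _
  | zero => rw [lie_zero]; exact zero_mem _
  | add a b _ _ ha hb => rw [lie_add]; exact add_mem ha hb
  | smul c a _ ha => rw [lie_smul]; exact Submodule.smul_mem _ _ ha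

/-- The span of these brackets over `ℂ(u)`. -/
def leviSpanK (V : FundamentalReps S) (J : Set (Fin r)) (j : Fin r) : Submodule K (Alg V) :=
  Submodule.span K (rK V '' (leviSpan S J j : Set 𝔤))

theorem commutator_leviSpanK {J : Set (Fin r)} {j : Fin r} {x : 𝔤}
    (hx : ∀ y ∈ leviSpan S J j, ⁅x, y⁆ ∈ leviSpan S J j) (t : K) {m : Alg V}
    (hm : m ∈ leviSpanK V J j) : (t • rK V x) * m - m * (t • rK V x) ∈ leviSpanK V J j := by
  induction hm using Submodule.span_induction with
  | mem m hm =>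
    obtain ⟨y, hy, rfl⟩ := hm
    rw [smul_mul_assoc, mul_smul_comm, ← smul_sub, ← rK_lie]
    exact Submodule.smul_mem _ _ (Submodule.subset_span ⟨_, hx y hy, rfl⟩)
  | zero => simp
  | add a b _ _ ha hb => rw [mul_add, add_mul, add_sub_add_comm]; exact add_mem ha hb
  | smul c a _ ha =>
    rw [mul_smul_comm c (t • rK V x) a, smul_mul_assoc c a, ← smul_sub]
    exact Submodule.smul_mem _ _ ha

theorem conj_mem_leviSpanK {J : Set (Fin r)} {j : Fin r} (hj : j ∉ J) {l : G V}
    (hl : l ∈ levi V J) : ∀ m ∈ leviSpanK V J j,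
      gval V l * m * gval V l⁻¹ ∈ leviSpanK V J j := by
  have hexp : ∀ x : 𝔤, (∀ y ∈ leviSpan S J j, ⁅x, y⁆ ∈ leviSpan S J j) → ∀ (t : K)
      (hn : IsNilpotent (t • rK V x)), ∀ m ∈ leviSpanK V J j,
      IsNilpotent.exp (t • rK V x) * m * IsNilpotent.exp (-(t • rK V x)) ∈ leviSpanK V J j := by
    intro x hx t hn m hm
    have h := exp_conj_sub_mem (A := Alg V) hn
      { leviSpanK V J j with
        smul_mem' := fun c z hz => by
          rw [rat_smul]
          exact Submodule.smul_mem _ _ hz } (fun m hm => commutator_leviSpanK hx t hm)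
      (w := m) (commutator_leviSpanK hx t hm)
    have := add_mem (show _ ∈ leviSpanK V J j from h) hm
    rwa [sub_add_cancel] at this
  have hgen : ∀ i ∈ J, ∀ t : K, (∀ m ∈ leviSpanK V J j,
      gval V (xE V i t) * m * gval V (xE V i t)⁻¹ ∈ leviSpanK V J j) ∧ ∀ m ∈ leviSpanK V J j,
      gval V (xF V i t) * m * gval V (xF V i t)⁻¹ ∈ leviSpanK V J j := by
    intro i hi t
    constructor
    · intro m hm
      have := hexp (S.e i) (fun y hy => lie_e_leviSpan hi hj hy) t
        ((isNilpotent_rK_e V i).smul t) m hm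
      have e1 : gval V (xE V i t) = IsNilpotent.exp (t • rK V (S.e i)) := by
        rw [← gU_val, gU_xE]; rfl
      have e2 : gval V (xE V i t)⁻¹ = IsNilpotent.exp (-(t • rK V (S.e i))) := by
        rw [← gU_val, map_inv, gU_xE]; rfl
      rw [e1, e2]
      exact this
    · intro m hm
      have := hexp (S.f i) (fun y hy => lie_f_leviSpan hi hy) t
        ((isNilpotent_rK_f V i).smul t) m hm
      have e1 : gval V (xF V i t) = IsNilpotent.exp (t • rK V (S.f i)) := by
        rw [← gU_val, gU_xF]; rfl
      have e2 : gval V (xF V i t)⁻¹ = IsNilpotent.exp (-(t • rK V (S.f i))) := by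
        rw [← gU_val, map_inv, gU_xF]; rfl
      rw [e1, e2]
      exact this
  induction hl using Subgroup.closure_induction'' with
  | mem x hx =>
    obtain ⟨i, hi, t, rfl | rfl⟩ := hx
    · exact (hgen i hi t).1
    · exact (hgen i hi t).2
  | inv_mem x hx =>
    obtain ⟨i, hi, t, rfl | rfl⟩ := hx
    · rw [← xE_neg]; exact (hgen i hi _).1
    · rw [← xF_neg]; exact (hgen i hi _).2
  | one => intro m hm; simpa using hm
  | mul x y _ _ hx hy =>
    intro m hm
    have := hx _ (hy m hm)
    rw [mul_inv_rev, map_mul, map_mul]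
    simpa [mul_assoc] using this

theorem xF_mem_Nminus (i : Fin r) (t : K) : xF V i t ∈ Nminus V :=
  Subgroup.subset_closure ⟨i, t, rfl⟩

/-- Under the Levi group of `J`, the element `f_j` stays within brackets of the `f`'s containing
`f_j`. Its conjugates therefore remain in the span of brackets generating `N_-`, and their
exponentials lie in `N_-`. -/
theorem xF_mem_leviCore {J : Set (Fin r)} {j : Fin r} (hj : j ∉ J) (t : K) :
    xF V j t ∈ leviCore V J := by
  intro l hl
  set z := t • (gval V l * rK V (S.f j) * gval V l⁻¹) with hz
  have hz1 : z ∈ wordsK V S.f 1 := by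
    refine Submodule.smul_mem _ _ ?_
    have h1 := conj_mem_leviSpanK hj hl (rK V (S.f j))
      (Submodule.subset_span ⟨_, Submodule.subset_span ⟨1, .base⟩, rfl⟩)
    refine (Submodule.span_le.mpr ?_ : leviSpanK V J j ≤ wordsK V S.f 1) h1
    rintro _ ⟨y, hy, rfl⟩
    induction (hy : y ∈ leviSpan S J j) using Submodule.span_induction with
    | mem y hy =>
      obtain ⟨n, hy⟩ := hy
      exact Submodule.subset_span ⟨y, ⟨n, hy.mem_words.1, hy.mem_words.2⟩, rfl⟩
    | zero => rw [map_zero]; exact zero_mem _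
    | add a b ha hb ha' hb' => rw [map_add]; exact add_mem ha' hb'
    | smul c a ha ha' =>
      rw [map_smul, ← algebraMap_smul K]
      exact Submodule.smul_mem _ _ ha'
  let F := wordFil V S.f (-coheight S) (neg_coheight_lie_f S)
  have hn : IsNilpotent z := F.nil hz1
  have h1 : gU V (l * xF V j t * l⁻¹) = expU z hn := by
    rw [map_mul, map_mul, map_inv, mul_inv_eq_iff_eq_mul, gU_xF]
    refine gU_mul_expU _ _ ?_
    rw [hz, mul_smul_comm, smul_mul_assoc, mul_assoc, mul_assoc, ← map_mul, inv_mul_cancel,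
      map_one, mul_one]
  have h2 : F.E 1 ≤ (Nminus V).map (gU V) := by
    refine wordFil_E_one_le V S.f _ _ _ fun i t hn => ?_
    refine ⟨xF V i t, xF_mem_Nminus i t, ?_⟩
    rw [gU_xF]
  obtain ⟨g, hg, hgz⟩ := h2 (F.expU_mem hz1 hn)
  rw [← h1] at hgz
  rw [← gU_injective V hgz]
  exact hg

/-- A product of elements of `N_- s_i N_-` for different `i` can be rearranged. -/
theorem exists_Nminus_mul {L : List (Fin r)} (hL : L.Nodup) (a b c : Fin r → K) :
    ∃ n ∈ leviCore V {i | i ∉ L}, ∃ n' ∈ Nminus V,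
      (L.map fun i => xF V i (a i) * weylElt V i (c i) * xF V i (b i)).prod =
        n * (L.map fun i => weylElt V i (c i)).prod * n' := by
  induction L with
  | nil => exact ⟨1, one_mem _, 1, one_mem _, by simp⟩
  | cons i L ih =>
    obtain ⟨hi, hL⟩ := List.nodup_cons.mp hL
    obtain ⟨n, hn, n', hn', h⟩ := ih hL
    have hiJ : i ∈ {j | j ∉ L} := hi
    have hW : (L.map fun i => weylElt V i (c i)).prod ∈ levi V {j | j ∈ L} := by
      refine Subgroup.list_prod_mem _ ?_
      intro x hx
      obtain ⟨k, hk, rfl⟩ := List.mem_map.mp hx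
      exact weylElt_mem_levi hk _
    set W := (L.map fun i => weylElt V i (c i)).prod with hWdef
    -- The right factor `exp (b_i f_i)` moves to the far right past `W`, which involves only nodes
    -- different from `i`.
    have hn4 : W⁻¹ * xF V i (b i) * W⁻¹⁻¹ ∈ Nminus V :=
      xF_mem_leviCore (J := {j | j ∈ L}) hi (b i) _ (inv_mem hW)
    -- The left factor `n` moves to the far left past the terms of the node `i`. The condition `n ∈
    -- leviCore` in the induction is there to keep it in `N_-`.
    have hn2 := conj_mem_leviCore (weylElt_mem_levi hiJ (c i))
      (conj_mem_leviCore (xF_mem_levi hiJ (b i)) hn)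
    have hsub : {j | j ∉ i :: L} ⊆ {j | j ∉ L} := fun j hj hjL => hj (List.mem_cons_of_mem _ hjL)
    refine ⟨_, mul_mem (xF_mem_leviCore (J := {j | j ∉ i :: L}) (fun h => h List.mem_cons_self)
      (a i))
      (leviCore_anti hsub hn2), _, mul_mem hn4 hn', ?_⟩
    rw [List.map_cons, List.prod_cons, List.map_cons, List.prod_cons, h, ← hWdef]
    group

theorem cochar_mul_xE_eq (V : FundamentalReps S) (i : Fin r) {g Λ : K} (hg : g ≠ 0) (hΛ : Λ ≠ 0) :
    cochar V i g * xE V i (Λ / g) =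
      xF V i (g ^ (-S.cartan i i) * (Λ / g)⁻¹) * weylElt V i Λ * xF V i (Λ / g)⁻¹ := by
  have ht : Λ / g ≠ 0 := div_ne_zero hΛ hg
  rw [xE_eq V i ht, ← mul_assoc, ← mul_assoc, cochar_mul_xF V i i hg, mul_assoc (xF V i _),
    weylElt_eq V i (Λ / g), weylElt_eq V i Λ, ← mul_assoc (cochar V i g), ← cochar_mul V i hg ht,
    mul_div_cancel₀ _ hg]

theorem exists_normalForm_eq (V : FundamentalReps S) {Λ : Fin r → ℂ[X]} (hΛ : ∀ i, Λ i ≠ 0)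
    {g : Fin r → K} (hg : ∀ i, g i ≠ 0) : ∃ n' ∈ Nminus V, ∃ n ∈ Nminus V,
      normalForm V Λ g = n' * oprod (fun i => cochar V i (toK (Λ i)) * simpleLift V i) * n := by
  obtain ⟨n, hn, n', hn', h⟩ := exists_Nminus_mul (V := V) (List.nodup_finRange r)
    (fun i => g i ^ (-S.cartan i i) * (toK (Λ i) / g i)⁻¹) (fun i => (toK (Λ i) / g i)⁻¹)
    (fun i => toK (Λ i))
  refine ⟨n, leviCore_le _ hn, n', hn', ?_⟩
  rw [← List.ofFn_eq_map, ← List.ofFn_eq_map] at h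
  have e1 : normalForm V Λ g = oprod fun i => xF V i (g i ^ (-S.cartan i i) *
      (toK (Λ i) / g i)⁻¹) * weylElt V i (toK (Λ i)) * xF V i (toK (Λ i) / g i)⁻¹ :=
    congrArg oprod (funext fun i => cochar_mul_xE_eq V i (hg i) (toK_ne_zero (hΛ i)))
  have e2 : (fun i => cochar V i (toK (Λ i)) * simpleLift V i) =
      fun i => weylElt V i (toK (Λ i)) := funext fun i => (weylElt_eq V i _).symm
  rw [e1, e2]
  exact h

theorem simpleLift_conj_mem_torus (j : Fin r) {h : G V} (hh : h ∈ torus V) :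
    simpleLift V j * h * (simpleLift V j)⁻¹ ∈ torus V := by
  induction hh using Subgroup.closure_induction with
  | mem x hx =>
    obtain ⟨i, t, ht, rfl⟩ := hx
    rw [simpleLift_mul_cochar V i j ht, mul_inv_cancel_right]
    exact mul_mem (inv_mem (Subgroup.subset_closure ⟨j, _, zpow_ne_zero _ ht, rfl⟩))
      (Subgroup.subset_closure ⟨i, t, ht, rfl⟩)
  | one => rw [mul_one, mul_inv_cancel]; exact one_mem _
  | mul x y _ _ hx hy =>
    have e : simpleLift V j * (x * y) * (simpleLift V j)⁻¹ =
        simpleLift V j * x * (simpleLift V j)⁻¹ * (simpleLift V j * y * (simpleLift V j)⁻¹) := by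
      group
    rw [e]
    exact mul_mem hx hy
  | inv x _ hx =>
    have e : simpleLift V j * x⁻¹ * (simpleLift V j)⁻¹ =
        (simpleLift V j * x * (simpleLift V j)⁻¹)⁻¹ := by group
    rw [e]
    exact inv_mem hx

theorem exists_torus_mul {n : ℕ} (c s : Fin n → G V) (hc : ∀ i, c i ∈ torus V)
    (hs : ∀ i, ∀ h ∈ torus V, s i * h * (s i)⁻¹ ∈ torus V) :
    ∃ h ∈ torus V, oprod (fun i => c i * s i) = h * oprod s := by
  have key : ∃ h ∈ torus V, oprod (fun i => c i * s i) = h * oprod s ∧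
      ∀ h ∈ torus V, oprod s * h * (oprod s)⁻¹ ∈ torus V := by
    induction n with
    | zero => exact ⟨1, one_mem _, by simp [oprod], by simp [oprod]⟩
    | succ n ih =>
      obtain ⟨h, hh, e, hconj⟩ := ih (fun i => c i.castSucc) (fun i => s i.castSucc)
        (fun i => hc _) (fun i => hs _)
      refine ⟨_, mul_mem hh (hconj _ (hc (Fin.last n))), ?_, fun h' hh' => ?_⟩
      · rw [oprod_castSucc, oprod_castSucc, e]; group
      · have := hconj _ (hs (Fin.last n) h' hh')
        rw [oprod_castSucc]
        convert this using 1
        group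
  obtain ⟨h, hh, e, -⟩ := key
  exact ⟨h, hh, e⟩

theorem cochar_mem_torus (i : Fin r) {t : K} (ht : t ≠ 0) : cochar V i t ∈ torus V :=
  Subgroup.subset_closure ⟨i, t, ht, rfl⟩

theorem normalForm_mem_Bplus (Λ : Fin r → ℂ[X]) {g : Fin r → K} (hg : ∀ i, g i ≠ 0) :
    normalForm V Λ g ∈ Bplus V :=
  oprod_mem' fun i => mul_mem (Subgroup.mem_sup_left (cochar_mem_torus i (hg i)))
    (Subgroup.mem_sup_right (xE_mem_Nplus i _))

/-- The Miura oper with the connection `∏_i g_i^α̌_i exp ((Λ_i / g_i) e_i)`. -/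
def normalFormOper (ħ : ℂˣ) (V : FundamentalReps S) {Λ : Fin r → ℂ[X]} (hΛ : ∀ i, Λ i ≠ 0)
    {g : Fin r → K} (hg : ∀ i, g i ≠ 0) : MiuraOper ħ V where
  conn := normalForm V Λ g
  redMinus := ((1 : G V) : G V ⧸ Bminus V)
  redPlus := ((1 : G V) : G V ⧸ Bplus V)
  oper := by
    obtain ⟨n', hn', n, hn, h⟩ := exists_normalForm_eq V hΛ hg
    obtain ⟨t, ht, h2⟩ := exists_torus_mul (fun i => cochar V i (toK (Λ i))) (simpleLift V)
      (fun i => cochar_mem_torus i (toK_ne_zero (hΛ i)))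
      (fun i h hh => simpleLift_conj_mem_torus i hh)
    refine ⟨1, rfl, n' * t, mul_mem (Subgroup.mem_sup_right hn') (Subgroup.mem_sup_left ht), n,
      Subgroup.mem_sup_right hn, ?_⟩
    rw [map_one, inv_one, one_mul, mul_one, h, h2]
    group
  preserved := ⟨1, rfl, by
    rw [map_one, inv_one, one_mul, mul_one]
    exact normalForm_mem_Bplus Λ hg⟩

theorem hasRegularSingularities_normalFormOper (ħ : ℂˣ) (V : FundamentalReps S)
    {Λ : Fin r → ℂ[X]} (hΛ : ∀ i, Λ i ≠ 0) {g : Fin r → K} (hg : ∀ i, g i ≠ 0) :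
    HasRegularSingularities Λ (normalFormOper ħ V hΛ hg) := by
  obtain ⟨n', hn', n, hn, h⟩ := exists_normalForm_eq V hΛ hg
  refine ⟨1, rfl, n', hn', n, hn, ?_⟩
  rw [map_one, inv_one, one_mul, mul_one]
  exact h

end Levi

/-! ### The intersection of opposite Borel subgroups -/

section Intersection

variable {r : ℕ} {𝔤 : Type*} [LieRing 𝔤] [LieAlgebra ℂ 𝔤] [FiniteDimensional ℂ 𝔤]
  [LieAlgebra.IsSimple ℂ 𝔤] {S : ChevalleySystem r 𝔤} {V : FundamentalReps S}

theorem exists_tor_of_mem_torus {g : G V} (hg : g ∈ torus V) :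
    ∃ h : Fin r → K, (∀ i, h i ≠ 0) ∧ g = tor V h := by
  induction hg using Subgroup.closure_induction with
  | mem x hx =>
    obtain ⟨j, t, ht, rfl⟩ := hx
    have hne : ∀ i, Function.update (fun _ => (1 : K)) j t i ≠ 0 := fun i => by
      rcases eq_or_ne i j with rfl | h
      · rwa [Function.update_self]
      · rw [Function.update_of_ne h]; exact one_ne_zero
    refine ⟨Function.update (fun _ => 1) j t, hne, gval_injective V ?_⟩
    refine alg_ext fun i μ v hv => ?_
    rw [tor_mulVec_vK hv hne, cochar_mulVec_vK hv j ht, Finset.prod_eq_single j]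
    · rw [Function.update_self]
    · intro k _ hk
      rw [Function.update_of_ne hk, one_zpow]
    · exact fun h => absurd (Finset.mem_univ j) h
  | one => exact ⟨fun _ => 1, fun _ => one_ne_zero, (tor_one V).symm⟩
  | mul x y _ _ hx hy =>
    obtain ⟨h, hh, rfl⟩ := hx
    obtain ⟨k, hk, rfl⟩ := hy
    exact ⟨_, fun i => mul_ne_zero (hh i) (hk i), (tor_mul V hh hk).symm⟩
  | inv x _ hx =>
    obtain ⟨h, hh, rfl⟩ := hx
    exact ⟨_, fun i => inv_ne_zero (hh i), tor_inv V hh⟩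

/-- A subgroup generated by one-parameter groups which are rescaled by the torus is normalized by
the torus. -/
theorem torus_le_normalizer_closure (x : Fin r → K → G V) (c : Fin r → Fin r → ℤ)
    (hx : ∀ j i (t : K), t ≠ 0 → ∀ a,
      cochar V j t * x i a = x i (t ^ c j i * a) * cochar V j t) :
    torus V ≤ Subgroup.normalizer (Subgroup.closure {g | ∃ j t, g = x j t} : Set (G V)) := by
  rw [torus, Subgroup.closure_le]
  rintro _ ⟨j, t, ht, rfl⟩
  have key : ∀ t : K, t ≠ 0 → ∀ n ∈ Subgroup.closure {g | ∃ j t, g = x j t},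
      cochar V j t * n * (cochar V j t)⁻¹ ∈ Subgroup.closure {g | ∃ j t, g = x j t} := by
    intro t ht n hn
    induction hn using Subgroup.closure_induction with
    | mem y hy =>
      obtain ⟨i, a, rfl⟩ := hy
      rw [hx j i t ht, mul_inv_cancel_right]
      exact Subgroup.subset_closure ⟨i, _, rfl⟩
    | one => rw [mul_one, mul_inv_cancel]; exact one_mem _
    | mul y z _ _ hy hz =>
      have := mul_mem hy hz
      rwa [show cochar V j t * y * (cochar V j t)⁻¹ * (cochar V j t * z * (cochar V j t)⁻¹) =
        cochar V j t * (y * z) * (cochar V j t)⁻¹ by group] at this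
    | inv y _ hy =>
      have := inv_mem hy
      rwa [mul_inv_rev, mul_inv_rev, inv_inv, ← mul_assoc] at this
  refine Subgroup.mem_normalizer_iff.mpr fun n => ⟨key t ht n, fun h => ?_⟩
  have := key t⁻¹ (inv_ne_zero ht) _ h
  rw [← cochar_inv V j ht] at this
  have e : (cochar V j t)⁻¹ * (cochar V j t * n * (cochar V j t)⁻¹) * (cochar V j t)⁻¹⁻¹ = n := by
    group
  rwa [e] at this

theorem exists_of_mem_Bplus {g : G V} (hg : g ∈ Bplus V) :
    ∃ h : Fin r → K, (∀ i, h i ≠ 0) ∧ ∃ n ∈ Nplus V, g = tor V h * n := by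
  have h := Subgroup.coe_mul_of_left_le_normalizer_right (torus V) (Nplus V)
    (torus_le_normalizer_closure (xE V) _ fun j i t ht a => cochar_mul_xE V j i ht a)
  have hg' : g ∈ (↑(torus V ⊔ Nplus V) : Set (G V)) := hg
  rw [h] at hg'
  obtain ⟨t, ht, n, hn, rfl⟩ := hg'
  obtain ⟨h, hh, rfl⟩ := exists_tor_of_mem_torus ht
  exact ⟨h, hh, n, hn, rfl⟩

theorem exists_of_mem_Bminus {g : G V} (hg : g ∈ Bminus V) :
    ∃ h : Fin r → K, (∀ i, h i ≠ 0) ∧ ∃ n ∈ Nminus V, g = tor V h * n := by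
  have h := Subgroup.coe_mul_of_left_le_normalizer_right (torus V) (Nminus V)
    (torus_le_normalizer_closure (xF V) _ fun j i t ht a => cochar_mul_xF V j i ht a)
  have hg' : g ∈ (↑(torus V ⊔ Nminus V) : Set (G V)) := hg
  rw [h] at hg'
  obtain ⟨t, ht, n, hn, rfl⟩ := hg'
  obtain ⟨h, hh, rfl⟩ := exists_tor_of_mem_torus ht
  exact ⟨h, hh, n, hn, rfl⟩

theorem Nplus_sub_one_mem {n : G V} (hn : n ∈ Nplus V) : gval V n - 1 ∈ AK V (coheight S) 1 :=
  sub_one_mem_AK le_rfl (g := gU V n) (by rw [← map_gU_Nplus]; exact ⟨n, hn, rfl⟩)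

theorem Nminus_sub_one_mem {n : G V} (hn : n ∈ Nminus V) :
    gval V n - 1 ∈ AK V (-coheight S) 1 := by
  have h : Nminus V ≤ ((wordFil V S.f (-coheight S) (neg_coheight_lie_f S)).E 1).comap (gU V) := by
    rw [Nminus, Subgroup.closure_le]
    rintro _ ⟨i, t, rfl⟩
    change gU V (xF V i t) ∈ (wordFil V S.f (-coheight S) (neg_coheight_lie_f S)).E 1
    rw [gU_xF]
    refine LieFiltration.expU_mem (wordFil V S.f (-coheight S) (neg_coheight_lie_f S)) ?_ _
    exact Submodule.smul_mem (wordsK V S.f 1) _ (Submodule.subset_span ⟨S.f i, ⟨1, le_rfl, i,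
      rfl⟩, rfl⟩)
  exact sub_one_mem_AK (hd := neg_coheight_lie_f S) le_rfl (h hn)

/-- The commutator with the image of `d`. -/
def adK (V : FundamentalReps S) (d : 𝔤) : Module.End K (Alg V) :=
  LinearMap.mulLeft K (rK V d) - LinearMap.mulRight K (rK V d)

theorem adK_apply (d : 𝔤) (M : Alg V) : adK V d M = rK V d * M - M * rK V d := rfl

theorem adK_neg (d : 𝔤) (M : Alg V) : adK V (-d) M = -adK V d M := by
  rw [adK_apply, adK_apply, map_neg]; noncomm_ring

theorem mul_mem_iSup_eigenspace {d : 𝔤} {t : Alg V} (ht : t * rK V d = rK V d * t) {s : Set K}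
    {M : Alg V} (hM : M ∈ ⨆ μ ∈ s, (adK V d).eigenspace μ) :
    t * M ∈ ⨆ μ ∈ s, (adK V d).eigenspace μ := by
  have h : (⨆ μ ∈ s, (adK V d).eigenspace μ) ≤
      (⨆ μ ∈ s, (adK V d).eigenspace μ).comap (LinearMap.mulLeft K t) := by
    refine iSup₂_le fun μ hμ M hM => ?_
    refine Submodule.mem_iSup_of_mem μ (Submodule.mem_iSup_of_mem hμ ?_)
    rw [Module.End.mem_eigenspace_iff, adK_apply] at hM ⊢
    rw [LinearMap.mulLeft_apply, ← mul_assoc, ← ht, mul_assoc, mul_assoc, ← mul_sub, hM,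
      mul_smul_comm]
  exact h hM

theorem AK_le_iSup_eigenspace (d : 𝔤) :
    AK V d 1 ≤ ⨆ μ ∈ {μ : K | ∃ m : ℕ, 1 ≤ m ∧ μ = m}, (adK V d).eigenspace μ := by
  rw [AK, Submodule.span_le]
  rintro _ ⟨M, ⟨m, hm, hM⟩, rfl⟩
  refine Submodule.mem_iSup_of_mem (m : K) (Submodule.mem_iSup_of_mem ⟨m, hm, rfl⟩ ?_)
  rw [Module.End.mem_eigenspace_iff, adK_apply, ← extA_rC, ← map_mul, ← map_mul, ← map_sub, hM,
    extA_smul, map_natCast]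

theorem AK_neg_le_iSup_eigenspace (d : 𝔤) :
    AK V (-d) 1 ≤ ⨆ μ ∈ {μ : K | ∃ m : ℕ, μ = -(m : K)}, (adK V d).eigenspace μ := by
  rw [AK, Submodule.span_le]
  rintro _ ⟨M, ⟨m, hm, hM⟩, rfl⟩
  refine Submodule.mem_iSup_of_mem (-(m : K)) (Submodule.mem_iSup_of_mem ⟨m, rfl⟩ ?_)
  rw [Module.End.mem_eigenspace_iff, ← neg_neg (adK V d _), ← adK_neg, adK_apply, ← extA_rC,
    ← map_mul, ← map_mul, ← map_sub, hM, extA_smul, map_natCast, neg_smul]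

theorem tor_mul_rK_coheight {h : Fin r → K} (hh : ∀ i, h i ≠ 0) :
    gval V (tor V h) * rK V (coheight S) = rK V (coheight S) * gval V (tor V h) := by
  have hw : HasWt S (fun _ => 0) (coheight S) := fun i => by
    rw [coheight, lie_sum, Int.cast_zero, zero_smul]
    exact Finset.sum_eq_zero fun j _ => by rw [lie_smul, S.lie_h_h, smul_zero]
  rw [tor_mul_rK V hh hw]
  simp

/-- Comparing the two factorizations gives `t n = m` with `t` in the torus, `n ∈ N_+` and `m ∈ N_-`.
In `t (n - 1) = (m - 1) + (1 - t)` the left side has only positive degrees and the right side only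
nonpositive ones, so both vanish and `n = 1`. -/
theorem eq_tor_of_mem_inf {g : G V} (h1 : g ∈ Bplus V) (h2 : g ∈ Bminus V) :
    ∃ h : Fin r → K, (∀ i, h i ≠ 0) ∧ g = tor V h := by
  obtain ⟨h, hh, n, hn, rfl⟩ := exists_of_mem_Bplus h1
  obtain ⟨k, hk, m, hm, e⟩ := exists_of_mem_Bminus h2
  refine ⟨h, hh, ?_⟩
  have e2 : (tor V k)⁻¹ * tor V h * n = m := by rw [mul_assoc, e, inv_mul_cancel_left]
  rw [tor_inv V hk, ← tor_mul V (fun i => inv_ne_zero (hk i)) hh] at e2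
  set l : Fin r → K := fun i => (k i)⁻¹ * h i
  have hl : ∀ i, l i ≠ 0 := fun i => mul_ne_zero (inv_ne_zero (hk i)) (hh i)
  set t := gval V (tor V l)
  have ht := tor_mul_rK_coheight (V := V) hl
  have e3 := congrArg (gval V) e2
  rw [map_mul] at e3
  have hp := mul_mem_iSup_eigenspace ht
    (AK_le_iSup_eigenspace _ (Nplus_sub_one_mem hn))
  have hq : t * (gval V n - 1) ∈
      ⨆ μ ∈ {μ : K | ∃ m : ℕ, μ = -(m : K)}, (adK V (coheight S)).eigenspace μ := by
    have e4 : t * (gval V n - 1) = (gval V m - 1) + (1 - t) := by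
      rw [← e3]; noncomm_ring
    rw [e4]
    refine add_mem (AK_neg_le_iSup_eigenspace _ (Nminus_sub_one_mem hm)) ?_
    refine Submodule.mem_iSup_of_mem 0 (Submodule.mem_iSup_of_mem ⟨0, by simp⟩ ?_)
    rw [Module.End.mem_eigenspace_iff, adK_apply, zero_smul, mul_sub, sub_mul, mul_one,
      one_mul, sub_sub_sub_cancel_left]
    exact sub_eq_zero.mpr ht
  have hdisj : Disjoint {μ : K | ∃ m : ℕ, 1 ≤ m ∧ μ = m} {μ : K | ∃ m : ℕ, μ = -(m : K)} := by
    rw [Set.disjoint_left]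
    rintro _ ⟨a, ha, rfl⟩ ⟨b, hb⟩
    have : ((a + b : ℕ) : K) = 0 := by push_cast; rw [hb]; ring
    rw [Nat.cast_eq_zero] at this
    omega
  have h0 := Submodule.disjoint_def.mp
    ((adK V (coheight S)).eigenspaces_iSupIndep.disjoint_biSup_biSup hdisj) _ hp hq
  have hn1 : gval V n - 1 = 0 := by
    have := congrArg (gval V (tor V l)⁻¹ * ·) h0
    simp only [mul_zero, ← mul_assoc] at this
    rwa [← map_mul, inv_mul_cancel, map_one, one_mul] at this
  have hn2 : n = 1 := gval_injective V (by rw [map_one, ← sub_eq_zero, hn1])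
  rw [hn2, mul_one]

end Intersection

/-! ### Units of local rings of rational functions, and degrees -/

section Rational

/-- `f` and its inverse are regular at `a`. -/
def RegUnit (a : ℂ) (f : K) : Prop := f ∈ Reg a ∧ f⁻¹ ∈ Reg a

theorem RegUnit.mul {a : ℂ} {f g : K} (hf : RegUnit a f) (hg : RegUnit a g) : RegUnit a (f * g) :=
  ⟨mul_mem hf.1 hg.1, by rw [mul_inv]; exact mul_mem hf.2 hg.2⟩

theorem RegUnit.inv {a : ℂ} {f : K} (hf : RegUnit a f) : RegUnit a f⁻¹ :=
  ⟨hf.2, by rw [inv_inv]; exact hf.1⟩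

theorem RegUnit.zpow {a : ℂ} {f : K} (hf : RegUnit a f) (n : ℤ) : RegUnit a (f ^ n) := by
  obtain ⟨n, rfl | rfl⟩ := n.eq_nat_or_neg
  · rw [zpow_natCast]
    exact ⟨pow_mem hf.1 n, by rw [← inv_pow]; exact pow_mem hf.2 n⟩
  · rw [zpow_neg, zpow_natCast]
    exact ⟨by rw [← inv_pow]; exact pow_mem hf.2 n, by rw [inv_inv]; exact pow_mem hf.1 n⟩

theorem RegUnit.prod {a : ℂ} {ι : Type*} (s : Finset ι) {f : ι → K}
    (hf : ∀ i ∈ s, RegUnit a (f i)) : RegUnit a (∏ i ∈ s, f i) :=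
  ⟨prod_mem fun i hi => (hf i hi).1, by
    rw [← Finset.prod_inv_distrib]; exact prod_mem fun i hi => (hf i hi).2⟩

theorem RegUnit.shift {ħ : ℂˣ} {a : ℂ} {f : K} (hf : RegUnit ((ħ : ℂ) * a) f) :
    RegUnit a (shift ħ f) :=
  ⟨shift_mem_reg hf.1, by rw [← map_inv₀]; exact shift_mem_reg hf.2⟩

theorem intDegree_zpow {f : K} (hf : f ≠ 0) (n : ℤ) : (f ^ n).intDegree = n * f.intDegree := by
  have hpow : ∀ m : ℕ, (f ^ m).intDegree = m * f.intDegree := fun m => by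
    induction m with
    | zero => simp
    | succ m ih =>
      rw [pow_succ, RatFunc.intDegree_mul (pow_ne_zero _ hf) hf, ih]; push_cast; ring
  obtain ⟨n, rfl | rfl⟩ := n.eq_nat_or_neg
  · rw [zpow_natCast, hpow]
  · rw [zpow_neg, zpow_natCast, RatFunc.intDegree_inv, hpow]; ring

theorem intDegree_prod {ι : Type*} (s : Finset ι) {f : ι → K} (hf : ∀ i ∈ s, f i ≠ 0) :
    (∏ i ∈ s, f i).intDegree = ∑ i ∈ s, (f i).intDegree := by
  classical
  induction s using Finset.induction_on with
  | empty => simp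
  | insert i s hi ih =>
    rw [Finset.prod_insert hi, Finset.sum_insert hi, RatFunc.intDegree_mul
      (hf i (Finset.mem_insert_self i s))
      (Finset.prod_ne_zero_iff.mpr fun j hj => hf j (Finset.mem_insert_of_mem hj)),
      ih fun j hj => hf j (Finset.mem_insert_of_mem hj)]

end Rational

/-! ### Rigidity of the normal form under torus gauge transformations -/

section Injective

variable {r : ℕ} {𝔤 : Type*} [LieRing 𝔤] [LieAlgebra ℂ 𝔤] [FiniteDimensional ℂ 𝔤]
  [LieAlgebra.IsSimple ℂ 𝔤] {S : ChevalleySystem r 𝔤} {V : FundamentalReps S}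

/-- The relation expresses `h_i(u)` through values at `ħu` and through `h_j(u)` with `j < i`.
Absence of zeros and poles then propagates backwards along the orbit, with an inner induction on the
node. -/
theorem regUnit_of_prod_eq_one {ħ : ℂˣ} (hħ : ∀ n : ℕ, 0 < n → ħ ^ n ≠ 1) {h : Fin r → K}
    (heq : ∀ i, h i * shift ħ (h i) * ((∏ j with i < j, shift ħ (h j) ^ S.cartan j i) *
      ∏ j with j < i, h j ^ S.cartan j i) = 1) {a : ℂ} (ha : a ≠ 0) (i : Fin r) :
    RegUnit a (h i) := by
  have key := orbit_induction hħ ha (Sum.elim h fun i => (h i)⁻¹) (fun k hk => ?_)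
  · have h1 := mem_regOrb.mp (key (Sum.inl i)) 0
    have h2 := mem_regOrb.mp (key (Sum.inr i)) 0
    rw [orbitPt_zero] at h1 h2
    exact ⟨h1, h2⟩
  · have hu : ∀ i, RegUnit (orbitPt ħ a k) (shift ħ (h i)) := fun i => RegUnit.shift (by
      rw [mul_orbitPt]
      exact ⟨hk (Sum.inl i), hk (Sum.inr i)⟩)
    have main : ∀ i, RegUnit (orbitPt ħ a k) (h i) := by
      intro i
      induction i using WellFoundedLT.induction with
      | _ i ih =>
        have e : h i = (shift ħ (h i) * ((∏ j with i < j, shift ħ (h j) ^ S.cartan j i) *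
            ∏ j with j < i, h j ^ S.cartan j i))⁻¹ := by
          have := heq i
          rw [mul_assoc] at this
          exact eq_inv_of_mul_eq_one_left this
        rw [e]
        exact ((hu i).mul ((RegUnit.prod _ fun j _ => (hu j).zpow _).mul
          (RegUnit.prod _ fun j hj => (ih j (Finset.mem_filter.mp hj).2).zpow _))).inv
    rintro (i | i)
    · exact (main i).1
    · exact (main i).2

/-- The degree is invariant under `u ↦ ħu`, so the relation puts the vector of degrees in the kernel
of the Cartan matrix, which is zero. A function of degree zero without zeros or poles in `ℂ^×` is
constant. -/
theorem exists_constK_of_prod_eq_one {ħ : ℂˣ} (hħ : ∀ n : ℕ, 0 < n → ħ ^ n ≠ 1) {h : Fin r → K}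
    (hh : ∀ i, h i ≠ 0)
    (heq : ∀ i, h i * shift ħ (h i) * ((∏ j with i < j, shift ħ (h j) ^ S.cartan j i) *
      ∏ j with j < i, h j ^ S.cartan j i) = 1) (i : Fin r) : ∃ c, h i = constK c := by
  have hs : ∀ i, shift ħ (h i) ≠ 0 := fun i => (_root_.map_ne_zero _).mpr (hh i)
  refine exists_constK_of_reg (hh i) (fun a ha => (regUnit_of_prod_eq_one hħ heq ha i).1)
    (fun a ha => (regUnit_of_prod_eq_one hħ heq ha i).2) ?_
  have hdeg : ∀ i, ∑ j, (h j).intDegree * S.cartan j i = 0 := by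
    intro i
    have e := congrArg RatFunc.intDegree (heq i)
    have n1 : (∏ j with i < j, shift ħ (h j) ^ S.cartan j i) ≠ 0 :=
      Finset.prod_ne_zero_iff.mpr fun j _ => zpow_ne_zero _ (hs j)
    have n2 : (∏ j with j < i, h j ^ S.cartan j i) ≠ 0 :=
      Finset.prod_ne_zero_iff.mpr fun j _ => zpow_ne_zero _ (hh j)
    rw [RatFunc.intDegree_mul (mul_ne_zero (hh i) (hs i)) (mul_ne_zero n1 n2),
      RatFunc.intDegree_mul (hh i) (hs i), RatFunc.intDegree_mul n1 n2,
      intDegree_prod _ fun j _ => zpow_ne_zero _ (hs j),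
      intDegree_prod _ fun j _ => zpow_ne_zero _ (hh j), RatFunc.intDegree_one, intDegree_shift,
      Finset.sum_congr rfl fun j _ => intDegree_zpow (hs j) _,
      Finset.sum_congr rfl fun j _ => intDegree_zpow (hh j) _] at e
    simp only [intDegree_shift] at e
    have e2 := prod_erase_eq i fun j => Multiplicative.ofAdd ((h j).intDegree * S.cartan j i)
    rw [← ofAdd_sum, ← ofAdd_sum, ← ofAdd_sum, ← ofAdd_add] at e2
    rw [← Finset.add_sum_erase _ _ (Finset.mem_univ i), Multiplicative.ofAdd.injective e2,
      S.cartan_diag]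
    simp only [mul_comm (RatFunc.intDegree _)]
    linarith
  have := cartan_nondegenerate (S := S) (c := fun j => ((h j).intDegree : ℂ))
    (fun i => by exact_mod_cast congrArg (Int.cast (R := ℂ)) (hdeg i)) i
  exact_mod_cast this

theorem eq_of_tor_mul_oprod_eq {g g' s s' : Fin r → K} (hg : ∀ i, g i ≠ 0) (hg' : ∀ i, g' i ≠ 0)
    (h : (tor V g * oprod fun i => xE V i (s i)) = tor V g' * oprod fun i => xE V i (s' i)) :
    g = g' ∧ s = s' := by
  have hN : ∀ s : Fin r → K, (oprod fun i => xE V i (s i)) ∈ Nplus V := fun s =>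
    oprod_mem' fun i => xE_mem_Nplus _ _
  have e1 : g = g' := funext fun i => by
    have := congrArg (fun a => (gval V a i).mulVec (vK (V.ν i))) h
    have h1 := tor_mul_Nplus_mulVec hg (hN s) i
    have h2 := tor_mul_Nplus_mulVec hg' (hN s') i
    exact smul_left_injective K (vK_ν_ne_zero i) (h1.symm.trans (this.trans h2))
  subst e1
  refine ⟨rfl, funext fun i => ?_⟩
  rw [mul_right_inj] at h
  obtain ⟨φ, hφ, hφ1, hφ0⟩ := exists_coordinate V i
  have hsum : ∀ t : Fin r → K, ∑ j, t j * φ (rK V (S.e j)) = t i := fun t => by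
    rw [Finset.sum_eq_single i (fun j _ hj => by rw [hφ0 j hj, mul_zero])
      (fun h => absurd (Finset.mem_univ i) h), hφ1, mul_one]
  have e := congrArg (fun u : G V => φ ((gU V u : Alg V) - 1)) h
  have e1 := (map_gU_xE_sub_one hφ s).trans (hsum s)
  have e2 := (map_gU_xE_sub_one hφ s').trans (hsum s')
  exact e1.symm.trans (e.trans e2)

/-- With all torus factors moved to the left, the torus parts and the coefficients of the `e_i` can
be compared separately. The second relation expresses that the nonzero `Λ_i` are unchanged. -/
theorem prod_eq_one_of_gauge {ħ : ℂˣ} {Λ : Fin r → ℂ[X]} (hΛ : ∀ i, Λ i ≠ 0) {g g' h : Fin r → K}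
    (hg : ∀ i, g i ≠ 0) (hg' : ∀ i, g' i ≠ 0) (hh : ∀ i, h i ≠ 0)
    (heq : normalForm V Λ g' = gShift ħ V (tor V h) * normalForm V Λ g * (tor V h)⁻¹) :
    (∀ i, g' i = shift ħ (h i) * g i / h i) ∧
    ∀ i, h i * shift ħ (h i) * ((∏ j with i < j, shift ħ (h j) ^ S.cartan j i) *
      ∏ j with j < i, h j ^ S.cartan j i) = 1 := by
  have hs : ∀ i, shift ħ (h i) ≠ 0 := fun i => (_root_.map_ne_zero _).mpr (hh i)
  have hi : ∀ i, (h i)⁻¹ ≠ 0 := fun i => inv_ne_zero (hh i)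
  rw [normalForm_eq V Λ hg, normalForm_eq V Λ hg', gShift_tor, tor_inv V hh, ← mul_assoc,
    mul_assoc _ (oprod _), oprod_mul_of_rel fun i => xE_mul_tor V hi i _, ← mul_assoc,
    ← tor_mul V hs hg, ← tor_mul V (fun i => mul_ne_zero (hs i) (hg i)) hi] at heq
  obtain ⟨e1, e2⟩ := eq_of_tor_mul_oprod_eq hg'
    (fun i => mul_ne_zero (mul_ne_zero (hs i) (hg i)) (hi i)) heq
  refine ⟨fun i => by rw [e1, div_eq_mul_inv], fun i => ?_⟩
  have e3 := congrFun e2 i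
  rw [e1] at e3
  simp only [inv_zpow', neg_neg] at e3
  have hΛi := toK_ne_zero (hΛ i)
  have hmul : ∏ j with i < j, (shift ħ (h j) * g j * (h j)⁻¹) ^ (-S.cartan j i) =
      (∏ j with i < j, shift ħ (h j) ^ S.cartan j i)⁻¹ *
      (∏ j with i < j, g j ^ (-S.cartan j i)) * ∏ j with i < j, h j ^ S.cartan j i := by
    rw [← Finset.prod_inv_distrib, ← Finset.prod_mul_distrib, ← Finset.prod_mul_distrib]
    exact Finset.prod_congr rfl fun j _ => by
      rw [mul_zpow, mul_zpow, inv_zpow', neg_neg, zpow_neg]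
  have hsplit : ∏ j, h j ^ S.cartan j i = h i * h i *
      ((∏ j with i < j, h j ^ S.cartan j i) * ∏ j with j < i, h j ^ S.cartan j i) := by
    rw [← Finset.mul_prod_erase _ _ (Finset.mem_univ i),
      prod_erase_eq i fun j => h j ^ S.cartan j i]
    congr 1
    rw [← zpow_two]
    exact congrArg (h i ^ ·) (S.cartan_diag i)
  have n1 : (∏ j with i < j, shift ħ (h j) ^ S.cartan j i) ≠ 0 :=
    Finset.prod_ne_zero_iff.mpr fun j _ => zpow_ne_zero _ (hs j)
  have n2 : (∏ j with i < j, g j ^ (-S.cartan j i)) ≠ 0 :=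
    Finset.prod_ne_zero_iff.mpr fun j _ => zpow_ne_zero _ (hg j)
  have n3 : (∏ j with i < j, h j ^ S.cartan j i) ≠ 0 :=
    Finset.prod_ne_zero_iff.mpr fun j _ => zpow_ne_zero _ (hh j)
  rw [hmul] at e3
  have e5 := e3.trans (congrArg (· * _) hsplit)
  set A := ∏ j with i < j, shift ħ (h j) ^ S.cartan j i
  set B := ∏ j with i < j, g j ^ (-S.cartan j i)
  set C' := ∏ j with i < j, h j ^ S.cartan j i
  set D := ∏ j with j < i, h j ^ S.cartan j i
  have hgi := hg i
  have hhi := hh i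
  have hsi := hs i
  field_simp at e5
  linear_combination -e5

end Injective

/-! ### Poles of solutions of the scalar equation -/

section Poles

theorem eq_toK_of_reg {f : K} (h : ∀ a, f ∈ Reg a) : ∃ p, f = toK p := by
  have hd : f.denom = 1 := by
    have hdeg : f.denom.degree = 0 := by
      by_contra hne
      obtain ⟨a, ha⟩ := IsAlgClosed.exists_root f.denom hne
      exact mem_reg_iff.mp (h a) ha
    rw [eq_C_of_degree_eq_zero hdeg, ← C_1]
    congr 1
    have := RatFunc.monic_denom f
    rw [eq_C_of_degree_eq_zero hdeg] at this
    simpa using this.leadingCoeff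
  refine ⟨f.num, ?_⟩
  have := RatFunc.num_div_denom f
  rw [hd, map_one, div_one] at this
  exact this.symm

/-- Regularity far ahead on the orbit is carried back to `a`, and only the values of `R` on the
forward half of the orbit matter. -/
theorem mem_reg_of_eq_add {ħ : ℂˣ} (hħ : ∀ n : ℕ, 0 < n → ħ ^ n ≠ 1) {c a : ℂ} (ha : a ≠ 0)
    {f R : K} (h : f = constK c * shift ħ f + R)
    (hR : ∀ k : ℤ, 0 ≤ k → R ∈ Reg (orbitPt ħ a k)) : f ∈ Reg a := by
  obtain ⟨N, hN⟩ := exists_forall_ge_mem_reg hħ ha f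
  have key : ∀ n : ℕ, ∀ k : ℤ, 0 ≤ k → N - n ≤ k → f ∈ Reg (orbitPt ħ a k) := by
    intro n
    induction n with
    | zero => exact fun k _ hk => hN k (by simpa using hk)
    | succ n ih =>
      intro k hk0 hk
      rw [h]
      refine add_mem (mul_mem (constK_mem_reg _ _) (shift_mem_reg ?_)) (hR k hk0)
      rw [mul_orbitPt]
      exact ih (k + 1) (by omega) (by push_cast at hk; omega)
  have := key N.toNat 0 le_rfl (by have := Int.self_le_toNat N; omega)
  rwa [orbitPt_zero] at this

theorem shift_inv_shift (ħ : ℂˣ) (f : K) : shift ħ⁻¹ (shift ħ f) = f := by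
  have hp : ∀ p : ℂ[X], polyShift ħ⁻¹ (polyShift ħ p) = p := fun p => by
    ext n
    rw [coeff_polyShift, coeff_polyShift, ← mul_assoc, ← mul_pow, Units.inv_mul, one_pow, one_mul]
  rw [← RatFunc.num_div_denom f, map_div₀, map_div₀, shift_toK, shift_toK, shift_toK, shift_toK,
    hp, hp]

theorem shift_constK (ħ : ℂˣ) (c : ℂ) : shift ħ (constK c) = constK c := shift_algebraMap ħ c

theorem constK_mul (a b : ℂ) : constK (a * b) = constK a * constK b := map_mul _ _ _

/-- Solve for `f(ħu)` and replace `ħ` by `ħ⁻¹`: the backward half of the orbit serves equally well.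
-/
theorem mem_reg_of_eq_add' {ħ : ℂˣ} (hħ : ∀ n : ℕ, 0 < n → ħ ^ n ≠ 1) {c a : ℂ} (hc : c ≠ 0)
    (ha : a ≠ 0) {f R : K} (h : f = constK c * shift ħ f + R)
    (hR : ∀ k : ℤ, k < 0 → R ∈ Reg (orbitPt ħ a k)) : f ∈ Reg a := by
  have hħ' : ∀ n : ℕ, 0 < n → ħ⁻¹ ^ n ≠ 1 := fun n hn h => hħ n hn (by simpa using h)
  refine mem_reg_of_eq_add (c := c⁻¹) (R := -constK c⁻¹ * shift ħ⁻¹ R) hħ' ha ?_ fun k hk => ?_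
  · have e := congrArg (shift ħ⁻¹) h
    rw [map_add, map_mul, shift_constK, shift_inv_shift] at e
    rw [e, mul_add, ← mul_assoc, ← constK_mul, inv_mul_cancel₀ hc, constK, map_one]
    ring
  · refine mul_mem (neg_mem (constK_mem_reg _ _)) (shift_mem_reg ?_)
    rw [mul_orbitPt]
    have := hR (-(k + 1)) (by omega)
    rwa [orbitPt, zpow_neg, ← inv_zpow, ← orbitPt] at this

/-- A solution of the scalar difference equation is regular at `0`. -/
theorem mem_reg_zero {ħ : ℂˣ} {c : ℂˣ} (hc : ∀ k : ℤ, c ≠ ħ ^ k) {f R : K}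
    (h : f = constK c * shift ħ f + R) (hR : R ∈ Reg 0) : f ∈ Reg 0 := by
  by_contra hf
  rw [mem_reg_iff, not_not] at hf
  have hd0 := RatFunc.denom_ne_zero f
  obtain ⟨d, hd, hroot⟩ := exists_eq_pow_rootMultiplicity_mul_and_not_dvd f.denom hd0 0
  set m := f.denom.rootMultiplicity 0
  rw [C_0, sub_zero] at hd hroot
  have hd1 : d.eval 0 ≠ 0 := by
    rw [← coeff_zero_eq_eval_zero]
    exact fun h => hroot (X_dvd_iff.mpr h)
  have hn : f.num.eval 0 ≠ 0 := by
    intro hn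
    obtain ⟨a, b, hab⟩ := RatFunc.isCoprime_num_denom f
    have := congrArg (eval 0) hab
    rw [eval_add, eval_mul, eval_mul, hn, hf] at this
    simp at this
  obtain ⟨p, q, hq, hpq⟩ := hR
  have hq0 : toK q ≠ 0 := toK_ne_zero (by rintro rfl; simp at hq)
  have hdK : toK d ≠ 0 := toK_ne_zero (by rintro rfl; simp at hd1)
  have hX : toK X ≠ 0 := toK_ne_zero X_ne_zero
  have hσd : shift ħ (toK d) ≠ 0 := (_root_.map_ne_zero _).mpr hdK
  have hσX : constK (ħ : ℂ) ≠ 0 := constK_ne_zero ħ.ne_zero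
  have hf2 : f = toK f.num / (toK X ^ m * toK d) := by
    conv_lhs => rw [← RatFunc.num_div_denom f, hd]
    rw [← toK_pow, ← toK_mul]
  have hR2 : R = toK p / toK q := by rw [eq_div_iff hq0, hpq]
  rw [hf2, hR2, map_div₀, map_mul, map_pow, shift_X] at h
  have key : constK (ħ : ℂ) ^ m * toK f.num * shift ħ (toK d) * toK q =
      constK c * shift ħ (toK f.num) * toK d * toK q +
        constK (ħ : ℂ) ^ m * toK X ^ m * toK p * toK d * shift ħ (toK d) := by
    field_simp at h
    refine mul_left_cancel₀ (pow_ne_zero m hX) ?_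
    linear_combination h
  have hpoly : C ((ħ : ℂ) ^ m) * f.num * polyShift ħ d * q =
      C (c : ℂ) * polyShift ħ f.num * d * q + C ((ħ : ℂ) ^ m) * X ^ m * p * d * polyShift ħ d := by
    apply toK_injective
    rw [toK_add]
    simp only [toK_mul, toK_C, toK_pow, ← shift_toK]
    rw [show constK ((ħ : ℂ) ^ m) = constK (ħ : ℂ) ^ m from map_pow _ _ _]
    exact key
  have hm : m ≠ 0 := by
    intro hm
    rw [hd, hm, pow_zero, one_mul] at hf
    exact hd1 hf
  -- If the pole had order `m > 0`, the term from `R` would vanish at `0`, and comparison of leading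
  -- coefficients would give `c = ħ ^ m`.
  have hev := congrArg (eval 0) hpoly
  simp only [eval_mul, eval_add, eval_C, eval_polyShift, mul_zero, eval_pow, eval_X,
    zero_pow hm, zero_mul, add_zero] at hev
  refine hc m (Units.ext ?_)
  rw [zpow_natCast, Units.val_pow_eq_pow_val]
  have hne : f.num.eval 0 * d.eval 0 * q.eval 0 ≠ 0 := mul_ne_zero (mul_ne_zero hn hd1) hq
  refine mul_right_cancel₀ hne ?_
  linear_combination -hev

/-- The poles of a solution of the scalar difference equation whose right hand side is
`N / (P P(ħ u))`. -/
theorem denom_eq_of_generic {ħ : ℂˣ} (hħ : ∀ n : ℕ, 0 < n → ħ ^ n ≠ 1) {c : ℂˣ}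
    (hc : ∀ k : ℤ, c ≠ ħ ^ k) {f : K} {P N : ℂ[X]} (hP0 : P.eval 0 ≠ 0) (hnd : P.roots.Nodup)
    (horb : ∀ a b, P.IsRoot a → P.IsRoot b → a ≠ b → ∀ k : ℤ, b ≠ ((ħ ^ k : ℂˣ) : ℂ) * a)
    (hN : ∀ a, P.IsRoot a → N.eval a ≠ 0)
    (h : f = constK c * shift ħ f + toK N / (toK P * shift ħ (toK P))) :
    P = C P.leadingCoeff * f.denom := by
  have hPne : P ≠ 0 := by rintro rfl; simp at hP0
  have hPK := toK_ne_zero hPne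
  have hσP : shift ħ (toK P) ≠ 0 := (_root_.map_ne_zero _).mpr hPK
  set R := toK N / (toK P * shift ħ (toK P)) with hRdef
  have hR : ∀ a, P.eval a ≠ 0 → P.eval ((ħ : ℂ) * a) ≠ 0 → R ∈ Reg a := by
    intro a h1 h2
    rw [hRdef, shift_toK, ← toK_mul]
    refine toK_div_mem_reg N ?_
    rw [eval_mul, eval_polyShift]
    exact mul_ne_zero h1 h2
  have hroot0 : ∀ a, P.IsRoot a → a ≠ 0 := by
    rintro _ ha rfl
    exact hP0 ha
  have huniq : ∀ a, a ≠ 0 → ∀ k l : ℤ, P.IsRoot (orbitPt ħ a k) → P.IsRoot (orbitPt ħ a l) →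
      k = l := by
    intro a ha k l hk hl
    by_contra hkl
    refine horb _ _ hk hl (fun e => hkl (orbitPt_injective hħ ha e)) (l - k) ?_
    rw [orbitPt, orbitPt, ← mul_assoc, ← Units.val_mul, ← zpow_add, sub_add_cancel]
  -- An orbit contains at most one root of `P`, and `R` can have poles only at that root and one
  -- step before it. Regularity at `a` is reached from the half of the orbit that avoids both: from
  -- behind if the root lies ahead, from ahead otherwise.
  have hreg : ∀ a, P.eval a ≠ 0 → f ∈ Reg a := by
    intro a ha
    by_cases ha0 : a = 0
    · subst ha0
      exact mem_reg_zero hc h (hR 0 ha (by simpa using ha))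
    by_cases hex : ∃ k : ℤ, 0 ≤ k ∧ P.IsRoot (orbitPt ħ a k)
    · obtain ⟨k, hk, hroot⟩ := hex
      have hk0 : k ≠ 0 := by
        rintro rfl
        rw [orbitPt_zero] at hroot
        exact ha hroot
      refine mem_reg_of_eq_add' hħ c.ne_zero ha0 h fun l hl => hR _ (fun h0 => ?_) fun h0 => ?_
      · have := huniq a ha0 l k h0 hroot; omega
      · rw [mul_orbitPt] at h0
        have := huniq a ha0 (l + 1) k h0 hroot; omega
    · have hex : ∀ k : ℤ, 0 ≤ k → P.eval (orbitPt ħ a k) ≠ 0 := fun k hk h0 => hex ⟨k, hk, h0⟩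
      refine mem_reg_of_eq_add hħ ha0 h fun k hk => hR _ (hex k hk) ?_
      rw [mul_orbitPt]
      exact hex _ (by omega)
  have hnext : ∀ a, P.IsRoot a → P.eval ((ħ : ℂ) * a) ≠ 0 := by
    intro a ha h0
    have := huniq a (hroot0 a ha) 0 1 (by rwa [orbitPt_zero]) (by
      rw [← zero_add (1 : ℤ), ← mul_orbitPt, orbitPt_zero]; exact h0)
    omega
  have hall : ∀ a, f * toK P ∈ Reg a := by
    intro a
    by_cases ha : P.eval a = 0
    · rw [h, add_mul]
      refine add_mem (mul_mem (mul_mem (constK_mem_reg _ _) (shift_mem_reg (hreg _ (hnext a ha))))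
        (toK_mem_reg _ _)) ?_
      have e : R * toK P = toK N / toK (polyShift ħ P) := by
        rw [hRdef, ← shift_toK]; field_simp
      rw [e]
      refine toK_div_mem_reg N ?_
      rw [eval_polyShift]
      exact hnext a ha
    · exact mul_mem (hreg a ha) (toK_mem_reg _ _)
  obtain ⟨p, hp⟩ := eq_toK_of_reg hall
  have hdvd : f.denom ∣ P := (RatFunc.denom_dvd hPne).mpr ⟨p, by rw [eq_div_iff hPK]; exact hp⟩
  -- At a root `a` of `P`, the function `f(ħu)` is regular because `ħa` is not a root. If `f` were
  -- regular too, so would be `R`, although its numerator does not vanish at `a`.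
  have hpole : ∀ a, P.IsRoot a → f.denom.IsRoot a := by
    intro a ha
    by_contra hna
    have h1 : f ∈ Reg a := mem_reg_iff.mpr hna
    have h2 : R ∈ Reg a := by
      have e : R = f - constK c * shift ħ f := (sub_eq_of_eq_add' h).symm
      rw [e]
      exact sub_mem h1 (mul_mem (constK_mem_reg _ _) (shift_mem_reg (hreg _ (hnext a ha))))
    obtain ⟨s, q, hq, hsq⟩ := h2
    have hpoly : N * q = s * P * polyShift ħ P := by
      apply toK_injective
      rw [toK_mul, toK_mul, toK_mul, ← hsq, ← shift_toK, hRdef]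
      field_simp
    have := congrArg (eval a) hpoly
    rw [eval_mul, eval_mul, eval_mul, show P.eval a = 0 from ha, mul_zero, zero_mul] at this
    exact mul_ne_zero (hN a ha) hq this
  have hdvd2 : P ∣ f.denom := by
    have h1 : (P.roots.map fun a => X - C a).prod ∣ f.denom := by
      rw [Multiset.prod_X_sub_C_dvd_iff_le_roots (RatFunc.denom_ne_zero f),
        Multiset.le_iff_subset hnd]
      intro a ha
      rw [mem_roots (RatFunc.denom_ne_zero f)]
      exact hpole a (mem_roots hPne |>.mp ha)
    have h2 := (IsAlgClosed.splits P).eq_prod_roots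
    rw [h2]
    exact (isUnit_C.mpr (isUnit_iff_ne_zero.mpr
      (leadingCoeff_ne_zero.mpr hPne))).mul_left_dvd.mpr h1
  obtain ⟨q, hq⟩ := hdvd
  have hu : IsUnit q := by
    have hass := associated_of_dvd_dvd hdvd2 (Dvd.intro q hq.symm)
    obtain ⟨u, hu⟩ := hass
    have : f.denom * (q * u) = f.denom * 1 := by rw [← mul_assoc, ← hq, hu, mul_one]
    exact IsUnit.of_mul_eq_one _ (mul_left_cancel₀ (RatFunc.denom_ne_zero f) this)
  obtain ⟨k, hk, rfl⟩ := isUnit_iff.mp hu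
  have hl : P.leadingCoeff = k := by
    rw [hq, leadingCoeff_mul, (RatFunc.monic_denom f).leadingCoeff, one_mul, leadingCoeff_C]
  rw [hl, mul_comm]
  exact hq

end Poles

/-! ### The bijection and the generic case -/

section Main

variable {r : ℕ} {𝔤 : Type*} [LieRing 𝔤] [LieAlgebra ℂ 𝔤] [FiniteDimensional ℂ 𝔤]
  [LieAlgebra.IsSimple ℂ 𝔤] {S : ChevalleySystem r 𝔤} {V : FundamentalReps S}

theorem isRoot_simple (S : ChevalleySystem r 𝔤) (i : Fin r) : IsRoot S fun k => S.cartan k i :=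
  isRoot_of_mem_words (n := 1) ⟨i, rfl⟩ ((linearIndependent_e S).ne_zero i) (hasWt_e i)

theorem chiRoot_ne {ħ : ℂˣ} {ζ : Fin r → ℂˣ} (hζ : GenericTwist S ħ ζ) (i : Fin r) (k : ℤ) :
    chiRoot S ζ i ≠ ħ ^ k := hζ _ (isRoot_simple S i) k

theorem chiRoot_inv_ne {ħ : ℂˣ} {ζ : Fin r → ℂˣ} (hζ : GenericTwist S ħ ζ) (i : Fin r) (k : ℤ) :
    (chiRoot S ζ i)⁻¹ ≠ ħ ^ k := fun h => chiRoot_ne hζ i (-k) (by rw [zpow_neg, ← h, inv_inv])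

theorem twistedFactor_ne_zero (ħ : ℂˣ) (ζ : Fin r → ℂˣ) {P : Fin r → ℂ[X]} (hP : ∀ i, P i ≠ 0)
    (i : Fin r) : constK (ζ i) * shift ħ (toK (P i)) / toK (P i) ≠ 0 :=
  div_ne_zero (mul_ne_zero (constK_ne_zero (Units.ne_zero _))
    ((_root_.map_ne_zero _).mpr (toK_ne_zero (hP i)))) (toK_ne_zero (hP i))

/-- The quotient `q / p` is invariant under `u ↦ ħu`, hence constant, and monicity makes the
constant `1`. -/
theorem eq_of_shift_div_eq {ħ : ℂˣ} (hħ : ∀ n : ℕ, 0 < n → ħ ^ n ≠ 1) {p q : ℂ[X]} (hp : p.Monic)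
    (hq : q.Monic) (h : shift ħ (toK p) / toK p = shift ħ (toK q) / toK q) : p = q := by
  have hp0 := toK_ne_zero hp.ne_zero
  have hq0 := toK_ne_zero hq.ne_zero
  have hs : shift ħ (toK p) ≠ 0 := (_root_.map_ne_zero _).mpr hp0
  obtain ⟨c, hc⟩ := exists_constK_of_shift_eq (f := toK q / toK p) hħ (by
    rw [map_div₀, div_eq_div_iff hs hp0]
    rw [div_eq_div_iff hp0 hq0] at h
    rw [← h]; ring)
  rw [div_eq_iff hp0, ← toK_C, ← toK_mul] at hc
  have hc := toK_injective hc
  have hl := congrArg leadingCoeff hc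
  rw [hq.leadingCoeff, leadingCoeff_mul, leadingCoeff_C, hp.leadingCoeff, mul_one] at hl
  rw [hc, ← hl, C_1, one_mul]

/-- The isomorphism preserves both standard reductions, so it lies in the torus and is constant.
Equality of the `g_i` then gives equality of the `Q₊^i`, and the difference of the fractions `Q₋^i /
Q₊^i` solves `f(ħu) = α_i(Z) f(u)`, which has no nonzero solution. -/
theorem eq_of_gaugeEquiv {ħ : ℂˣ} (hħ : ∀ n : ℕ, 0 < n → ħ ^ n ≠ 1) {ζ : Fin r → ℂˣ}
    (hζ : GenericTwist S ħ ζ) {Λ : Fin r → ℂ[X]} (hΛ : ∀ i, Λ i ≠ 0)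
    {Q Q' : (Fin r → ℂ[X]) × (Fin r → ℂ[X])} (hQ : Q ∈ nondegenerateSolutions S ħ Λ ζ)
    (hQ' : Q' ∈ nondegenerateSolutions S ħ Λ ζ)
    (h : GaugeEquiv
      (normalFormOper ħ V hΛ (twistedFactor_ne_zero ħ ζ fun i => (hQ.2.1 i).ne_zero))
      (normalFormOper ħ V hΛ (twistedFactor_ne_zero ħ ζ fun i => (hQ'.2.1 i).ne_zero))) :
    Q = Q' := by
  have n1 : ∀ i, Q.1 i ≠ 0 := fun i => (hQ.2.1 i).ne_zero
  have n2 : ∀ i, Q'.1 i ≠ 0 := fun i => (hQ'.2.1 i).ne_zero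
  obtain ⟨γ, h1, h2, h3⟩ := h
  have hm : γ ∈ Bminus V := by
    have h2 : ((1 : G V) : G V ⧸ Bminus V) = ((γ * 1 : G V) : G V ⧸ Bminus V) := h2
    rw [QuotientGroup.eq] at h2
    simpa using h2
  have hp : γ ∈ Bplus V := by
    have h3 : ((1 : G V) : G V ⧸ Bplus V) = ((γ * 1 : G V) : G V ⧸ Bplus V) := h3
    rw [QuotientGroup.eq] at h3
    simpa using h3
  obtain ⟨t, ht, rfl⟩ := eq_tor_of_mem_inf hp hm
  obtain ⟨e1, e2⟩ := prod_eq_one_of_gauge hΛ (twistedFactor_ne_zero ħ ζ n1)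
    (twistedFactor_ne_zero ħ ζ n2) ht h1
  have hQp : Q.1 = Q'.1 := funext fun i => by
    refine eq_of_shift_div_eq hħ (hQ.2.1 i) (hQ'.2.1 i) ?_
    obtain ⟨c, hc⟩ := exists_constK_of_prod_eq_one hħ ht e2 i
    have e := e1 i
    have ht' := ht i
    rw [hc] at ht'
    rw [hc, shift_constK, mul_div_cancel_left₀ _ ht', mul_div_assoc, mul_div_assoc] at e
    exact (mul_left_cancel₀ (constK_ne_zero (Units.ne_zero _)) e).symm
  refine Prod.ext hQp (funext fun i => ?_)
  have q1 := (qq_iff n1).mp hQ.1 i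
  have q2 := (qq_iff n2).mp hQ'.1 i
  rw [← hQp] at q2
  have n3 := toK_ne_zero (n1 i)
  have h0 := eq_zero_of_shift_eq hħ (chiRoot_ne hζ i)
    (f := toK (Q.2 i) / toK (Q.1 i) - toK (Q'.2 i) / toK (Q.1 i)) (by
      have e := q1.trans q2.symm
      have hcc : constK (chiRoot S ζ i) * constK ((chiRoot S ζ i)⁻¹ : ℂˣ) = 1 := by
        rw [← constK_mul, Units.mul_inv, constK, map_one]
      rw [map_sub]
      set x := toK (Q.2 i) / toK (Q.1 i)
      set y := toK (Q'.2 i) / toK (Q.1 i)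
      linear_combination (-constK (chiRoot S ζ i)) * e - (shift ħ x - shift ħ y) * hcc)
  rw [sub_eq_zero, div_left_inj' n3] at h0
  exact toK_injective h0

theorem hasTwistedForm_normalFormOper {ħ : ℂˣ} (hħ : ∀ n : ℕ, 0 < n → ħ ^ n ≠ 1) {ζ : Fin r → ℂˣ}
    (hζ : GenericTwist S ħ ζ) {Λ Qp Qm : Fin r → ℂ[X]} (hΛ : ∀ i, Λ i ≠ 0)
    (hQQ : IsQQSolution S ħ Λ ζ Qp Qm) (h0 : ∀ i, Qp i ≠ 0) (hN : NeighborsDistinct S ħ Qp) :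
    HasTwistedForm Λ ζ (normalFormOper ħ V hΛ (twistedFactor_ne_zero ħ ζ h0)) Qp Qp Qm := by
  obtain ⟨m, hm, v, hv, h⟩ := exists_twisted_form (V := V) hħ hζ hQQ h0 hN
  exact ⟨h0, h0, _, (gaugeSetoid ħ V).refl _, rfl, rfl, ⟨_, twistedFactor_ne_zero ħ ζ h0, rfl⟩,
    m, hm, v, hv, h⟩

theorem isTwisted_normalFormOper {ħ : ℂˣ} (hħ : ∀ n : ℕ, 0 < n → ħ ^ n ≠ 1) {ζ : Fin r → ℂˣ}
    (hζ : GenericTwist S ħ ζ) {Λ Qp Qm : Fin r → ℂ[X]} (hΛ : ∀ i, Λ i ≠ 0)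
    (hQQ : IsQQSolution S ħ Λ ζ Qp Qm) (h0 : ∀ i, Qp i ≠ 0) (hN : NeighborsDistinct S ħ Qp) :
    IsTwisted ζ (normalFormOper ħ V hΛ (twistedFactor_ne_zero ħ ζ h0)) := by
  obtain ⟨m, hm, v, hv, h⟩ := exists_twisted_form (V := V) hħ hζ hQQ h0 hN
  refine ⟨v, ?_, h⟩
  change (v : G V ⧸ Bplus V) = ((1 : G V) : G V ⧸ Bplus V)
  rw [eq_comm, QuotientGroup.eq, inv_one, one_mul, hv]
  exact mul_mem (mul_mem
    (Subgroup.mem_sup_left (tor_mem_torus V fun i => toK_ne_zero (h0 i)))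
    (Subgroup.mem_sup_right (oprod_mem' fun i => xE_mem_Nplus _ _)))
    (Subgroup.mem_sup_right (commutator_le_Nplus hm))

theorem gaugeEquiv_normalFormOper {ħ : ℂˣ} {Λ : Fin r → ℂ[X]} (hΛ : ∀ i, Λ i ≠ 0)
    {g : Fin r → K} (hg : ∀ i, g i ≠ 0) {y : MiuraOper ħ V}
    (h1 : y.redMinus = ((1 : G V) : G V ⧸ Bminus V)) (h2 : y.redPlus = ((1 : G V) : G V ⧸ Bplus V))
    (h3 : y.conn = normalForm V Λ g) : GaugeEquiv (normalFormOper ħ V hΛ hg) y :=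
  ⟨1, by rw [h3, map_one, one_mul, inv_one, mul_one]; rfl, by rw [h1, one_smul]; rfl,
    by rw [h2, one_smul]; rfl⟩

theorem toK_prod {ι : Type*} (s : Finset ι) (F : ι → ℂ[X]) :
    toK (∏ j ∈ s, F j) = ∏ j ∈ s, toK (F j) := map_prod _ _ _

theorem qqTerm_eq_div (S : ChevalleySystem r 𝔤) (ħ : ℂˣ) (ζ : Fin r → ℂˣ) (Λ P : Fin r → ℂ[X])
    (i : Fin r) : qqTerm S ħ ζ Λ P i =
      toK (C (((xiTilde S ζ i)⁻¹ : ℂˣ) : ℂ) * Λ i * ∏ j ∈ Finset.univ.erase i,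
        (if j < i then P j else polyShift ħ (P j)) ^ (-S.cartan j i).toNat) /
        (toK (P i) * shift ħ (toK (P i))) := by
  rw [qqTerm, toK_mul, toK_mul, toK_C, toK_prod]
  have e : ∀ j, toK ((if j < i then P j else polyShift ħ (P j)) ^ (-S.cartan j i).toNat) =
      (if j < i then toK (P j) else shift ħ (toK (P j))) ^ (-S.cartan j i).toNat := fun j => by
    rw [toK_pow, shift_toK]
    split_ifs <;> rfl
  rw [Finset.prod_congr rfl fun j _ => e j]
  ring

theorem eval_numerator_ne_zero {ħ : ℂˣ} {Λ P : Fin r → ℂ[X]} {i : Fin r} {c a : ℂ} (hc : c ≠ 0)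
    (hN : NeighborsDistinct S ħ P) (hG : HbarDistinct ħ (P i) (Λ i)) (ha : (P i).IsRoot a) :
    (C c * Λ i * ∏ j ∈ Finset.univ.erase i,
        (if j < i then P j else polyShift ħ (P j)) ^ (-S.cartan j i).toNat).eval a ≠ 0 := by
  rw [eval_mul, eval_mul, eval_C, eval_prod]
  refine mul_ne_zero (mul_ne_zero hc fun h => hG a a ha h 0 (by simp)) ?_
  refine Finset.prod_ne_zero_iff.mpr fun j hj => ?_
  have hji : j ≠ i := (Finset.mem_erase.mp hj).1
  rw [eval_pow]
  by_cases h0 : S.cartan j i = 0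
  · have : (-S.cartan j i).toNat = 0 := by
      have := neg_eq_zero.mpr h0
      exact congrArg Int.toNat this
    rw [this, pow_zero]
    exact one_ne_zero
  · refine pow_ne_zero _ ?_
    split_ifs
    · exact fun h => hN j i hji h0 a a h ha 0 (by simp)
    · rw [eval_polyShift]
      -- Here the root of `P_j` is `ħ a`, so the exponent `-1` leads back to the root `a` of `P_i`.
      refine fun h => hN j i hji h0 _ a h ha (-1) ?_
      simp

/-- The polynomials `P_i` need not be monic. Normalizing them changes the right-hand side of the
linear equation by a constant, which can be absorbed into `Q₋^i`. -/
theorem qqTerm_C_mul (S : ChevalleySystem r 𝔤) (ħ : ℂˣ) (ζ : Fin r → ℂˣ) (Λ D : Fin r → ℂ[X])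
    {κ : Fin r → ℂ} (hκ : ∀ i, κ i ≠ 0) (i : Fin r) :
    qqTerm S ħ ζ Λ D i = constK (κ i * κ i * (∏ j ∈ Finset.univ.erase i,
      κ j ^ (-S.cartan j i).toNat)⁻¹) * qqTerm S ħ ζ Λ (fun i => C (κ i) * D i) i := by
  have hk := constK_ne_zero (hκ i)
  have hne : constK (∏ j ∈ Finset.univ.erase i, κ j ^ (-S.cartan j i).toNat) ≠ 0 :=
    constK_ne_zero (Finset.prod_ne_zero_iff.mpr fun j _ => pow_ne_zero _ (hκ j))
  have e : ∏ j ∈ Finset.univ.erase i, (if j < i then toK (C (κ j) * D j) else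
      shift ħ (toK (C (κ j) * D j))) ^ (-S.cartan j i).toNat =
      constK (∏ j ∈ Finset.univ.erase i, κ j ^ (-S.cartan j i).toNat) *
      ∏ j ∈ Finset.univ.erase i,
        (if j < i then toK (D j) else shift ħ (toK (D j))) ^ (-S.cartan j i).toNat := by
    rw [constK, map_prod, ← Finset.prod_mul_distrib]
    refine Finset.prod_congr rfl fun j _ => ?_
    rw [map_pow, ← mul_pow]
    congr 1
    rw [toK_mul, toK_C, map_mul, shift_constK]
    split_ifs <;> rfl
  rw [qqTerm, qqTerm, e, toK_mul, toK_C, map_mul, shift_constK, constK_mul, constK_mul,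
    show ∀ x : ℂ, constK x⁻¹ = (constK x)⁻¹ from fun x => map_inv₀ _ _]
  generalize constK (∏ j ∈ Finset.univ.erase i, κ j ^ (-S.cartan j i).toNat) = A at hne ⊢
  generalize (∏ j ∈ Finset.univ.erase i,
        (if j < i then toK (D j) else shift ħ (toK (D j))) ^ (-S.cartan j i).toNat) = B
  field_simp

/-- By `denom_eq_of_generic`, each `P_i` is a multiple of the reduced denominator of `Q₋^i / Q₊^i`.
The normalized data solve the `QQ`-system and give the same `g_i`, so the existence theorem provides
another `v`, now with `P_i = Q₊^i`, for the same connection. -/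
theorem isNondegenerate_of_generic {ħ : ℂˣ} (hħ : ∀ n : ℕ, 0 < n → ħ ^ n ≠ 1) {ζ : Fin r → ℂˣ}
    (hζ : GenericTwist S ħ ζ) {Λ P Qp Qm : Fin r → ℂ[X]} (hΛ : ∀ i, Λ i ≠ 0) {x : MiuraOper ħ V}
    (hx : HasTwistedForm Λ ζ x P Qp Qm) (hN : NeighborsDistinct S ħ P)
    (hG : GenericRoots ħ Λ P) : IsNondegenerate Λ ζ x := by
  obtain ⟨hP, -, y, hxy, hy1, hy2, ⟨g, hg, hgy⟩, m, hm, v, hv, hy⟩ := hx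
  obtain ⟨e1, e2⟩ := eq_of_normalForm_eq hg hP hm hv (hgy.symm.trans hy)
  have hden : ∀ i, P i = C (P i).leadingCoeff * (toK (Qm i) / toK (Qp i)).denom := fun i =>
    denom_eq_of_generic hħ (chiRoot_inv_ne hζ i) (hG i).1 (hG i).2.1 (hG i).2.2.2
      (fun a ha => eval_numerator_ne_zero (Units.ne_zero _) hN (hG i).2.2.1 ha)
      (by rw [← qqTerm_eq_div, ← e2 i]; ring)
  set κ : Fin r → ℂ := fun i => (P i).leadingCoeff with hκdef
  set D : Fin r → ℂ[X] := fun i => (toK (Qm i) / toK (Qp i)).denom with hD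
  have hκ : ∀ i, κ i ≠ 0 := fun i => leadingCoeff_ne_zero.mpr (hP i)
  have hPD : P = fun i => C (κ i) * D i := funext hden
  have hD0 : ∀ i, D i ≠ 0 := fun i => RatFunc.denom_ne_zero _
  set k : Fin r → ℂ := fun i => κ i * κ i * (∏ j ∈ Finset.univ.erase i,
      κ j ^ (-S.cartan j i).toNat)⁻¹ with hk
  have hk0 : ∀ i, k i ≠ 0 := fun i => mul_ne_zero (mul_ne_zero (hκ i) (hκ i))
    (inv_ne_zero (Finset.prod_ne_zero_iff.mpr fun j _ => pow_ne_zero _ (hκ j)))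
  set M : Fin r → ℂ[X] := fun i => C (k i) * (toK (Qm i) / toK (Qp i)).num with hM
  have hMD : ∀ i, toK (M i) / toK (D i) = constK (k i) * (toK (Qm i) / toK (Qp i)) := fun i => by
    rw [hM, toK_mul, toK_C, mul_div_assoc]
    exact congrArg (constK (k i) * ·) (RatFunc.num_div_denom _)
  have hQQ : IsQQSolution S ħ Λ ζ D M := (qq_iff hD0).mpr fun i => by
    rw [hMD, qqTerm_C_mul S ħ ζ Λ D hκ i, ← hPD, ← e2 i, map_mul, shift_constK]
    ring
  have hroot : ∀ i a, (D i).IsRoot a → (P i).IsRoot a := fun i a ha => by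
    rw [hden i, Polynomial.IsRoot.def, eval_mul]
    exact mul_eq_zero_of_right _ ha
  have hND : NeighborsDistinct S ħ D := fun i j hij hc a b ha hb =>
    hN i j hij hc a b (hroot i a ha) (hroot j b hb)
  have hform := hasTwistedForm_normalFormOper (V := V) hħ hζ hΛ hQQ hD0 hND
  have hgD : g = fun i => constK (ζ i) * shift ħ (toK (D i)) / toK (D i) := funext fun i => by
    have := constK_ne_zero (hκ i)
    have := toK_ne_zero (hD0 i)
    rw [e1 i, hPD, toK_mul, toK_C, map_mul, shift_constK]
    field_simp
  rw [hgD] at hgy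
  have hxz : GaugeEquiv x (normalFormOper ħ V hΛ (twistedFactor_ne_zero ħ ζ hD0)) :=
    (gaugeSetoid ħ V).trans hxy
      ((gaugeSetoid ħ V).symm (gaugeEquiv_normalFormOper hΛ _ hy1 hy2 hgy))
  obtain ⟨a1, a2, z, hz, a3⟩ := hform
  refine ⟨D, D, M, ⟨a1, a2, z, (gaugeSetoid ħ V).trans hxz hz, a3⟩,
    fun i => RatFunc.monic_denom _, fun i => ?_, hND, fun _ => rfl⟩
  refine (isCoprime_mul_unit_left_right (isUnit_C.mpr (hk0 i).isUnit) _ _).mpr ?_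
  exact (RatFunc.isCoprime_num_denom _).symm

theorem mk_mem_nondegenerateOpers {ħ : ℂˣ} (hħ : ∀ n : ℕ, 0 < n → ħ ^ n ≠ 1) {ζ : Fin r → ℂˣ}
    (hζ : GenericTwist S ħ ζ) {Λ : Fin r → ℂ[X]} (hΛ : ∀ i, Λ i ≠ 0)
    {Q : (Fin r → ℂ[X]) × (Fin r → ℂ[X])} (hQ : Q ∈ nondegenerateSolutions S ħ Λ ζ) :
    (Quotient.mk _ (normalFormOper ħ V hΛ
      (twistedFactor_ne_zero ħ ζ fun i => (hQ.2.1 i).ne_zero)) : MiuraOperClass ħ V) ∈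
      nondegenerateOpers ħ V Λ ζ :=
  ⟨_, rfl, hasRegularSingularities_normalFormOper ħ V hΛ _,
    isTwisted_normalFormOper hħ hζ hΛ hQ.1 (fun i => (hQ.2.1 i).ne_zero) hQ.2.2.2, Q.1, Q.1, Q.2,
    hasTwistedForm_normalFormOper hħ hζ hΛ hQ.1 (fun i => (hQ.2.1 i).ne_zero) hQ.2.2.2, hQ.2.1,
      hQ.2.2.1, hQ.2.2.2,
    fun _ => rfl⟩

/-- With `P = Q₊`, the scalar equations extracted from the twisted form are the `QQ`-system, and the
formula for `g_i` identifies the oper with the one attached to this solution. -/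
theorem exists_solution_of_mem {ħ : ℂˣ} {ζ : Fin r → ℂˣ} {Λ : Fin r → ℂ[X]} (hΛ : ∀ i, Λ i ≠ 0)
    {c : MiuraOperClass ħ V} (hc : c ∈ nondegenerateOpers ħ V Λ ζ) :
    ∃ (Q : (Fin r → ℂ[X]) × (Fin r → ℂ[X])) (hQ : Q ∈ nondegenerateSolutions S ħ Λ ζ),
      Quotient.mk _ (normalFormOper ħ V hΛ
        (twistedFactor_ne_zero ħ ζ fun i => (hQ.2.1 i).ne_zero)) = c := by
  obtain ⟨x, rfl, -, -, P, Qp, Qm, ⟨hP, -, y, hxy, hy1, hy2, ⟨g, hg, hgy⟩, m, hm, v, hv, hy⟩,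
    hmonic, hcop, hN, hPQ⟩ := hc
  obtain rfl : P = Qp := funext hPQ
  obtain ⟨e1, e2⟩ := eq_of_normalForm_eq hg hP hm hv (hgy.symm.trans hy)
  refine ⟨(P, Qm), ⟨(qq_iff hP).mpr e2, hmonic, hcop, hN⟩, ?_⟩
  rw [funext e1] at hgy
  exact Quotient.sound ((gaugeSetoid ħ V).trans (gaugeEquiv_normalFormOper hΛ _ hy1 hy2 hgy)
    ((gaugeSetoid ħ V).symm hxy))

/-- The bijection between solutions of the `QQ`-system and Miura opers. -/
def solutionsEquivOpers {ħ : ℂˣ} (hħ : ∀ n : ℕ, 0 < n → ħ ^ n ≠ 1) {ζ : Fin r → ℂˣ}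
    (hζ : GenericTwist S ħ ζ) {Λ : Fin r → ℂ[X]} (hΛ : ∀ i, Λ i ≠ 0) (V : FundamentalReps S) :
    nondegenerateSolutions S ħ Λ ζ ≃ nondegenerateOpers ħ V Λ ζ :=
  Equiv.ofBijective (fun Q => ⟨_, mk_mem_nondegenerateOpers hħ hζ hΛ Q.2⟩)
    ⟨fun Q Q' h => Subtype.ext (eq_of_gaugeEquiv hħ hζ hΛ Q.2 Q'.2
        (Quotient.exact (congrArg Subtype.val h))),
      fun c => by
        obtain ⟨Q, hQ, h⟩ := exists_solution_of_mem hΛ c.2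
        exact ⟨⟨Q, hQ⟩, Subtype.ext h⟩⟩

end Main

end HOper

end

theorem mainTheorem4 {r : ℕ} {𝔤 : Type*} [LieRing 𝔤] [LieAlgebra ℂ 𝔤] [FiniteDimensional ℂ 𝔤]
    [LieAlgebra.IsSimple ℂ 𝔤] (S : HOper.ChevalleySystem r 𝔤) (V : HOper.FundamentalReps S)
    (ħ : ℂˣ) (hħ : ∀ n : ℕ, 0 < n → ħ ^ n ≠ 1)
    (ζ : Fin r → ℂˣ) (hζ : HOper.GenericTwist S ħ ζ)
    (Λ : Fin r → Polynomial ℂ) (hΛ : ∀ i, Λ i ≠ 0) :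
    (∃ Φ : HOper.nondegenerateSolutions S ħ Λ ζ ≃ HOper.nondegenerateOpers ħ V Λ ζ,
      ∀ Q : HOper.nondegenerateSolutions S ħ Λ ζ, ∃ x : HOper.MiuraOper ħ V,
        Quotient.mk _ x = (Φ Q).1 ∧
        x.redMinus = ((1 : HOper.G V) : HOper.G V ⧸ HOper.Bminus V) ∧
        x.redPlus = ((1 : HOper.G V) : HOper.G V ⧸ HOper.Bplus V) ∧
        x.conn = HOper.normalForm V Λ (fun i =>
          HOper.constK (ζ i) * HOper.shift ħ (HOper.toK (Q.1.1 i)) / HOper.toK (Q.1.1 i)) ∧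
        HOper.HasTwistedForm Λ ζ x Q.1.1 Q.1.1 Q.1.2) ∧
    (∀ x : HOper.MiuraOper ħ V, HOper.HasRegularSingularities Λ x → HOper.IsTwisted ζ x →
      ∀ P Qp Qm : Fin r → Polynomial ℂ, HOper.HasTwistedForm Λ ζ x P Qp Qm →
        HOper.NeighborsDistinct S ħ P → HOper.GenericRoots ħ Λ P →
        HOper.IsNondegenerate Λ ζ x) := by
  refine ⟨⟨HOper.solutionsEquivOpers hħ hζ hΛ V, fun Q => ?_⟩,
    fun x _ _ P Qp Qm hx hN hG => HOper.isNondegenerate_of_generic hħ hζ hΛ hx hN hG⟩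
  exact ⟨HOper.normalFormOper ħ V hΛ
    (HOper.twistedFactor_ne_zero ħ ζ fun i => (Q.2.2.1 i).ne_zero), rfl, rfl, rfl, rfl,
    HOper.hasTwistedForm_normalFormOper hħ hζ hΛ Q.2.1
      (fun i => (Q.2.2.1 i).ne_zero) Q.2.2.2.2⟩
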